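/- Fix an integer $q\ge 2$ and let $D=\{-q+1,\dots,q-1\}$. **Definitions.** A *labelled dag* $\Pi=(\Gamma,\delta)$ is a finite set $\Gamma$ with a map $\delta:\Gamma\times\Gamma\to D$ such that the directed graph with edges $\{(u,v):\delta(u,v)\ne 0\}$ is acyclic. A *marking* is a map $M:\Gamma\to D$; the *successor marking* of $u$ is $\Lambda_u(v)=\delta(u,v)$. Values are defined recursively by $\varepsilon(M)=\sum_{u}M(u)\varepsilon(u)$ and $\varepsilon(u)=q^{\varepsilon(\Lambda_u)}$. $\Pi$ is a *power circuit* if $\varepsilon(u)\in\{q^k:k\in\mathbb N\}$ for all $u\in\Gamma$. A *chain* is a list of nodes $u_1,\dots,u_k$ with $q\,\varepsilon(u_i)=\varepsilon(u_{i+1})$ for $1\le i<k$; it is *maximal* if it is non-empty and is not part of a longer chain starting at $u_1$, and $u_k$ is then its *top node*. A *power sum* is a formal sum $\sum_{i\ge 0}\alpha_iq^i$ with $\alpha_i\in D$, almost all zero. It is *compact* if none of the following value-preserving rewriting rules, nor any of the rules obtained from them by reversing all signs, applies to it: $\alpha q^i+\beta q^{i+1}\to(\alpha-q)q^i+(\beta+1)q^{i+1}$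 for $\alpha>0>\beta$; and, for $i<j$, $\alpha q^i+(q-1)(q^{i+1}+\dots+q^j)+\beta q^{j+1}\to(\alpha-q)q^i+(\beta+1)q^{j+1}$ for $\alpha>0$, $\beta<q-1$. A *treed circuit* is a power circuit $\Pi=(\Gamma,\delta)$, possibly carrying a collection of markings, such that: 1. (*reduced*) different nodes have different values, and $\Pi$ is equipped with the list $u_1,\dots,u_n$ of its nodes sorted by increasing value and with bits $b_1,\dots,b_{n-1}$ such that $b_i=1$ iff $q\,\varepsilon(u_i)=\varepsilon(u_{i+1})$; 2. $\Pi$ is equipped with a rooted directed tree in which the edges leaving a node carry distinct labels from $D$ and are ordered by these labels, and all leaves have depth $n$. A leaf represents the marking $u_i\mapsto\alpha_i$, where $\alpha_1,\dots,\alpha_n$ are the labels read from the leaf to the root. The power sum $\sum_i\alpha_i\,\varepsilon(u_i)$ (each $\varepsilon(u_i)$ being a power of $q$) is compact for each leaf. The markings represented by leaves are called *compact markings*; 3. all successor markings $\Lambda_u$ are compact markings; 4. no node in the support of a carried marking, of a successor marking or of a marking represented in the tree is the top node of a maximal chain; 5. for each level of the tree there is a list of the nodes of this level. **Theorem.** For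 every $q\ge 2$ there are a procedure MakeTree and constants $C,d$, depending only on $q$, such that the following holds. Given a power circuit $\Pi=(\Gamma,\delta)$ and markings $M_1,\dots,M_m$ in $\Pi$ (the edge labels and the markings being stored as arrays), MakeTree returns a treed circuit $\Pi'=(\Gamma',\delta')$, including its additional data, and markings $M_1',\dots,M_m'$ carried by it, which are compact markings in $\Pi'$, such that $\varepsilon(M_i')=\varepsilon(M_i)$ for $1\le i\le m$ and $|\Gamma'|\le 4|\Gamma|$. MakeTree is a program for a random access machine with integer cells, indirect addressing, addition, subtraction and sign tests; it makes at most $C\,(|\Gamma|^2+|\Gamma|\cdot m+1)$ steps, and all integers it computes have absolute value at most $C\,(|\Gamma|+m+1)^d$. In particular it runs in $O(|\Gamma|^2+|\Gamma|\cdot m)$ time, without logarithmic factors. -/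

import Mathlib

open scoped BigOperators

namespace PowerCircuits

/-! ## Digits, labelled graphs, markings and evaluation -/

/-- The digit set `D = {-q+1, …, q-1}`. -/
abbrev Digit (q : ℕ) : Type := ↥(Finset.Icc (1 - (q : ℤ)) ((q : ℤ) - 1))

/-- A marking of the node set `Γ` is a map `Γ → D`. -/
abbrev Marking (q : ℕ) (Γ : Type) : Type := Γ → Digit q

/-- A directed acyclic graph on `Γ` with edges labelled by non-zero digits;
`δ u v = 0` means that there is no edge from `u` to `v`. -/
structure LabelledDag (q : ℕ) (Γ : Type) where
  δ : Γ → Γ → Digit q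
  acyclic : ∀ u, ¬ Relation.TransGen (fun x y => (δ x y : ℤ) ≠ 0) u u

namespace LabelledDag

variable {q : ℕ} {Γ : Type}

def Edge (G : LabelledDag q Γ) (u v : Γ) : Prop := (G.δ u v : ℤ) ≠ 0

/-- The successor marking `Λ_u`. -/
def succ (G : LabelledDag q Γ) (u : Γ) : Marking q Γ := fun v => G.δ u v

theorem wellFounded_edge [Finite Γ] (G : LabelledDag q Γ) :
    WellFounded (fun v u => G.Edge u v) := by
  have : IsTrans Γ (fun v u => Relation.TransGen G.Edge u v) := ⟨fun _ _ _ h₁ h₂ => h₂.trans h₁⟩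
  have : Std.Irrefl (fun v u => Relation.TransGen G.Edge u v) := ⟨G.acyclic⟩
  exact Subrelation.wf (fun hvu => Relation.TransGen.single hvu)
    (Finite.wellFounded_of_trans_of_irrefl (fun v u => Relation.TransGen G.Edge u v))

variable [Fintype Γ]

open Classical in
/-- The value `ε(u) = q ^ ε(Λ_u)` of a node (a real power), by recursion along the edges. -/
noncomputable def nodeVal (G : LabelledDag q Γ) : Γ → ℝ :=
  G.wellFounded_edge.fix fun u ev =>
    (q : ℝ) ^ (∑ v, if h : G.Edge u v then ((G.δ u v : ℤ) : ℝ) * ev v h else 0)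

/-- The value `ε(M) = ∑ M(u) ε(u)` of a marking. -/
noncomputable def markVal (G : LabelledDag q Γ) (M : Marking q Γ) : ℝ :=
  ∑ u, ((M u : ℤ) : ℝ) * G.nodeVal u

theorem nodeVal_eq (G : LabelledDag q Γ) (u : Γ) :
    G.nodeVal u = (q : ℝ) ^ G.markVal (G.succ u) := by
  unfold nodeVal
  rw [WellFounded.fix_eq]
  congr 1
  refine Finset.sum_congr rfl fun v _ => ?_
  by_cases h : G.Edge u v
  · rw [dif_pos h]; rfl
  · have h0 : (G.δ u v : ℤ) = 0 := not_not.mp h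
    rw [dif_neg h]
    simp [succ, h0]

/-- A chain: a list of nodes in which each value is `q` times the preceding one. -/
def IsNodeChain (G : LabelledDag q Γ) (l : List Γ) : Prop :=
  l.IsChain (fun u v => (q : ℝ) * G.nodeVal u = G.nodeVal v)

/-- A maximal chain: a chain which is not part of a longer chain with the same starting node. -/
def IsMaximalChain (G : LabelledDag q Γ) (l : List Γ) : Prop :=
  l ≠ [] ∧ G.IsNodeChain l ∧ ∀ l', G.IsNodeChain l' → l <+: l' → l' = l

/-- `v` is the top (that is, last) node of a maximal chain. -/
def IsTop (G : LabelledDag q Γ) (v : Γ) : Prop :=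
  ∃ l, G.IsMaximalChain l ∧ l.getLast? = some v

open Classical in
/-- The power sum belonging to a marking: the coefficient of `q ^ k` is the digit at the node of
value `q ^ k`. (In a reduced circuit there is at most one such node.) -/
noncomputable def powerSum (G : LabelledDag q Γ) (M : Marking q Γ) : ℕ → ℤ :=
  fun k => ∑ u, if G.nodeVal u = (q : ℝ) ^ k then (M u : ℤ) else 0

end LabelledDag

/-- A power circuit: all nodes evaluate to powers `q ^ k` with `k` a natural number. -/
structure PowerCircuit (q : ℕ) (Γ : Type) [Fintype Γ] extends LabelledDag q Γ where
  proper : ∀ u, ∃ k : ℕ, toLabelledDag.nodeVal u = (q : ℝ) ^ k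

/-! ## Compact power sums -/

/-- Coefficient sequences of power sums `∑ αᵢ qⁱ`. -/
def IsPowerSum (q : ℕ) (S : ℕ → ℤ) : Prop :=
  (Function.support S).Finite ∧ ∀ i, S i ∈ Finset.Icc (1 - (q : ℤ)) ((q : ℤ) - 1)

/-- The rewriting system on power sums. -/
inductive Rewrites (q : ℕ) : (ℕ → ℤ) → (ℕ → ℤ) → Prop
  | rule1 (S : ℕ → ℤ) (i : ℕ) : 0 < S i → S (i + 1) < 0 →
      Rewrites q S (fun k =>
        if k = i then S k - q else if k = i + 1 then S k + 1 else S k)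
  | rule2 (S : ℕ → ℤ) (i : ℕ) : S i < 0 → 0 < S (i + 1) →
      Rewrites q S (fun k =>
        if k = i then S k + q else if k = i + 1 then S k - 1 else S k)
  | rule3 (S : ℕ → ℤ) (i j : ℕ) : i < j → 0 < S i →
      (∀ k, i < k → k ≤ j → S k = (q : ℤ) - 1) → S (j + 1) < (q : ℤ) - 1 →
      Rewrites q S (fun k =>
        if k = i then S k - q else if i < k ∧ k ≤ j then 0
        else if k = j + 1 then S k + 1 else S k)
  | rule4 (S : ℕ → ℤ) (i j : ℕ) : i < j → S i < 0 →
      (∀ k, i < k → k ≤ j → S k = -(q : ℤ) + 1) → -(q : ℤ) + 1 < S (j + 1) →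
      Rewrites q S (fun k =>
        if k = i then S k + q else if i < k ∧ k ≤ j then 0
        else if k = j + 1 then S k - 1 else S k)

/-- A compact power sum is one to which no rewriting rule applies. -/
def IsCompactPowerSum (q : ℕ) (S : ℕ → ℤ) : Prop :=
  IsPowerSum q S ∧ ¬ ∃ T, Rewrites q S T

/-! ## Reduced and treed circuits -/

/-- A reduced power circuit: different nodes have different values, and the circuit is equipped
with the sorted list of its nodes and with the bit vector that tells which neighbours in this
list differ exactly by the factor `q`. -/
structure ReducedCircuit (q : ℕ) (Γ : Type) [Fintype Γ] extends PowerCircuit q Γ where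
  nodes : List Γ
  bits : List Bool
  nodeVal_ne : ∀ u v, u ≠ v → toLabelledDag.nodeVal u ≠ toLabelledDag.nodeVal v
  mem_nodes : ∀ u, u ∈ nodes
  sorted : nodes.Pairwise (fun u v => toLabelledDag.nodeVal u < toLabelledDag.nodeVal v)
  bits_length : bits.length = nodes.length - 1
  bits_iff : ∀ (i : ℕ) (h : i + 1 < nodes.length),
    bits[i]? = some true ↔
      (q : ℝ) * toLabelledDag.nodeVal nodes[i] = toLabelledDag.nodeVal nodes[i + 1]

/-- The data of a tree with node set `{0, …, size-1}`, whose edges are labelled by digits: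
`child t a` is the target of the edge with label `a` starting at `t`, if there is such an edge. -/
structure TreeData (q : ℕ) where
  size : ℕ
  root : Fin size
  child : Fin size → Digit q → Option (Fin size)

/-- `T.Path w t`: the path from the root to `t` has the labels `w`, read from `t` to the root. -/
inductive TreeData.Path {q : ℕ} (T : TreeData q) : List (Digit q) → Fin T.size → Prop
  | root : T.Path [] T.root
  | step (w : List (Digit q)) (t : Fin T.size) (a : Digit q) (c : Fin T.size) :
      T.Path w t → T.child t a = some c → T.Path (a :: w) c

def TreeData.IsLeaf {q : ℕ} (T : TreeData q) (t : Fin T.size) : Prop :=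
  ∀ a, T.child t a = none

/-- A directed tree with edges labelled by digits, together with a list of the nodes of each
level. Edges starting at the same node have different labels, since `child` is a function of
the label, and they are ordered by their labels. -/
structure DigitTree (q : ℕ) extends TreeData q where
  root_ne_child : ∀ t a, child t a ≠ some root
  parent_unique : ∀ t a t' a' c, child t a = some c → child t' a' = some c → t = t' ∧ a = a'
  reachable : ∀ t, ∃ w, toTreeData.Path w t
  level : ℕ → List (Fin size)
  level_nodup : ∀ k, (level k).Nodup
  mem_level : ∀ k t, t ∈ level k ↔ ∃ w, toTreeData.Path w t ∧ w.length = k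

/-- The marking `M` is represented by a leaf of `T`: the labels on the path from the leaf to the
root are the digits of `M` at the nodes `u₁, …, uₙ` of the sorted list. -/
def IsLeafMarking {q : ℕ} {Γ : Type} (nodes : List Γ) (T : TreeData q) (M : Marking q Γ) : Prop :=
  ∃ t, T.IsLeaf t ∧ T.Path (nodes.map M) t

/-- A treed power circuit carrying the markings in `𝓜` (in addition to the successor markings
and to the markings represented in the tree). -/
structure TreedCircuit (q : ℕ) (Γ : Type) [Fintype Γ] (𝓜 : Set (Marking q Γ))
    extends ReducedCircuit q Γ where
  tree : DigitTree q
  leaf_depth : ∀ t w, tree.IsLeaf t → tree.Path w t → w.length = Fintype.card Γ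
  leaf_compact : ∀ M, IsLeafMarking nodes tree.toTreeData M →
    IsCompactPowerSum q (toLabelledDag.powerSum M)
  succ_compact : ∀ u, IsLeafMarking nodes tree.toTreeData (toLabelledDag.succ u)
  unmarked_top : ∀ M,
    (M ∈ 𝓜 ∨ IsLeafMarking nodes tree.toTreeData M ∨ ∃ u, M = toLabelledDag.succ u) →
    ∀ v, (M v : ℤ) ≠ 0 → ¬ toLabelledDag.IsTop v

/-- A marking is compact in a treed circuit if it is represented as a leaf of the tree. -/
def TreedCircuit.IsCompact {q : ℕ} {Γ : Type} [Fintype Γ] {𝓜 : Set (Marking q Γ)}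
    (P : TreedCircuit q Γ 𝓜) (M : Marking q Γ) : Prop :=
  IsLeafMarking P.nodes P.tree.toTreeData M

/-! ## Random access machines -/

/-- The storage: integer registers, and a memory of integer cells. The memory is divided into
segments; a program accesses only the finitely many segments whose numbers occur in it, so that
interleaving them gives an ordinary linear memory. -/
structure Store where
  reg : ℕ → ℤ
  mem : ℕ → ℤ → ℤ

def Store.setReg (σ : Store) (x : ℕ) (a : ℤ) : Store :=
  { σ with reg := Function.update σ.reg x a }

def Store.setMem (σ : Store) (s : ℕ) (p a : ℤ) : Store :=
  { σ with mem := Function.update σ.mem s (Function.update (σ.mem s) p a) }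

/-- Programs of the random access machine, in structured form. -/
inductive Program
  | skip
  | const (x : ℕ) (c : ℤ)
  | move (x y : ℕ)
  | add (x y z : ℕ)
  | sub (x y z : ℕ)
  | load (x s y : ℕ)
  | store (s y x : ℕ)
  | seq (p₁ p₂ : Program)
  | ifPos (x : ℕ) (p₁ p₂ : Program)
  | whilePos (x : ℕ) (p : Program)

/-- `Exec w p σ t σ'`: started on `σ`, the program `p` stops after exactly `t` steps with the
storage `σ'`, and all integers computed on the way have absolute value at most `w`. Each
instruction and each test `x > 0` is one step. -/
inductive Exec (w : ℤ) : Program → Store → ℕ → Store → Prop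
  | skip (σ : Store) : Exec w .skip σ 1 σ
  | const (σ : Store) (x : ℕ) (c : ℤ) : |c| ≤ w →
      Exec w (.const x c) σ 1 (σ.setReg x c)
  | move (σ : Store) (x y : ℕ) : Exec w (.move x y) σ 1 (σ.setReg x (σ.reg y))
  | add (σ : Store) (x y z : ℕ) : |σ.reg y + σ.reg z| ≤ w →
      Exec w (.add x y z) σ 1 (σ.setReg x (σ.reg y + σ.reg z))
  | sub (σ : Store) (x y z : ℕ) : |σ.reg y - σ.reg z| ≤ w →
      Exec w (.sub x y z) σ 1 (σ.setReg x (σ.reg y - σ.reg z))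
  | load (σ : Store) (x s y : ℕ) :
      Exec w (.load x s y) σ 1 (σ.setReg x (σ.mem s (σ.reg y)))
  | store (σ : Store) (s y x : ℕ) :
      Exec w (.store s y x) σ 1 (σ.setMem s (σ.reg y) (σ.reg x))
  | seq (p₁ p₂ : Program) (σ σ₁ σ₂ : Store) (t₁ t₂ : ℕ) :
      Exec w p₁ σ t₁ σ₁ → Exec w p₂ σ₁ t₂ σ₂ → Exec w (.seq p₁ p₂) σ (t₁ + t₂) σ₂
  | ifPos_true (x : ℕ) (p₁ p₂ : Program) (σ σ' : Store) (t : ℕ) : 0 < σ.reg x →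
      Exec w p₁ σ t σ' → Exec w (.ifPos x p₁ p₂) σ (t + 1) σ'
  | ifPos_false (x : ℕ) (p₁ p₂ : Program) (σ σ' : Store) (t : ℕ) : ¬ 0 < σ.reg x →
      Exec w p₂ σ t σ' → Exec w (.ifPos x p₁ p₂) σ (t + 1) σ'
  | whilePos_true (x : ℕ) (p : Program) (σ σ₁ σ₂ : Store) (t₁ t₂ : ℕ) : 0 < σ.reg x →
      Exec w p σ t₁ σ₁ → Exec w (.whilePos x p) σ₁ t₂ σ₂ →
      Exec w (.whilePos x p) σ (t₁ + t₂ + 1) σ₂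
  | whilePos_false (x : ℕ) (p : Program) (σ : Store) : ¬ 0 < σ.reg x →
      Exec w (.whilePos x p) σ 1 σ

/-! ## Input and output -/

/-- The initial storage for a labelled graph on `{0, …, n-1}` and `m` markings: `n` and `m` are
in registers `0` and `1`, the matrix `δ` is stored row by row in segment `0`, the markings are
stored one after the other in segment `1`, and everything else is `0`. -/
def inputStore {q n m : ℕ} (G : LabelledDag q (Fin n)) (M : Fin m → Marking q (Fin n)) :
    Store where
  reg := fun x => if x = 0 then n else if x = 1 then m else 0
  mem := fun s p =>
    if s = 0 then
      ∑ i : Fin n, ∑ j : Fin n, if p = (i : ℤ) * n + j then (G.δ i j : ℤ) else 0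
    else if s = 1 then
      ∑ k : Fin m, ∑ i : Fin n, if p = (k : ℤ) * n + i then (M k i : ℤ) else 0
    else 0

/-- The storage `σ` holds the treed circuit `P` (with all of its additional data) and the
markings `M`. Register `0` holds the number of nodes, registers `1` and `2` hold the number of
nodes of the tree and its root. -/
structure HoldsOutput {q n m : ℕ} {𝓜 : Set (Marking q (Fin n))} (σ : Store)
    (P : TreedCircuit q (Fin n) 𝓜) (M : Fin m → Marking q (Fin n)) : Prop where
  size : σ.reg 0 = n
  /-- the edge labels, row by row -/
  edges : ∀ i j : Fin n, σ.mem 0 ((i : ℤ) * n + j) = (P.δ i j : ℤ)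
  /-- the markings, one after the other -/
  markings : ∀ (k : Fin m) (i : Fin n), σ.mem 1 ((k : ℤ) * n + i) = (M k i : ℤ)
  /-- the sorted list of nodes -/
  nodes : ∀ (i : ℕ) (h : i < P.nodes.length), σ.mem 2 i = ((P.nodes[i] : ℕ) : ℤ)
  /-- the bit vector -/
  bits : ∀ (i : ℕ) (h : i < P.bits.length), σ.mem 3 i = if P.bits[i] = true then 1 else 0
  treeSize : σ.reg 1 = P.tree.size
  treeRoot : σ.reg 2 = ((P.tree.root : ℕ) : ℤ)
  /-- the table of children of the tree, with `-1` for a missing edge -/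
  children : ∀ (t : Fin P.tree.size) (a : Digit q),
    σ.mem 4 ((t : ℤ) * (2 * q - 1) + ((a : ℤ) + q - 1)) =
      (P.tree.child t a).elim (-1) (fun c => ((c : ℕ) : ℤ))
  /-- the list of level `k` starts at the position in segment `6` given by cell `k` of
  segment `5`, and the list of the next level follows directly -/
  levelStart : ∀ k ≤ n, σ.mem 5 ((k : ℤ) + 1) = σ.mem 5 k + (P.tree.level k).length
  levels : ∀ k ≤ n, ∀ (i : ℕ) (h : i < (P.tree.level k).length),
    σ.mem 6 (σ.mem 5 k + i) = (((P.tree.level k)[i] : ℕ) : ℤ)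

end PowerCircuits

/-! Compact digits. A sequence of digits is compact as soon as a positive digit is followed by one
in `0, …, q - 2`, and symmetrically for negative digits (`Compact`). The terms below `q ^ i` of a
compact sum then add up to less than `q ^ (i + 1) / (q + 1)` in absolute value (`Compact.psum_lt`,
`Compact.lt_psum`). Hence values are ordered lexicographically from the highest digit
(`Compact.lt_of_lex`), a compact sum is determined by its value (`Compact.eq_of_hasVal`), and one
may speak of the digits `cd q x` of a number `x`.

Normalisation. Let integer coefficients be attached to nodes with known exponents. One pass upwards
divides by `q` with remainder, one pass downwards decides for each residue between its non-negative
and its negative representative, and one pass upwards produces the digits; this is linear in the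
number of nodes. Carries move only along chains. The carry that is left at the top of a chain
vanishes if, for every exponent `p` without node, the terms below `q ^ p` have a sum of absolute
value at most `q ^ (p - 1)` (`normalise_spec`).

Room in the chains. The nodes of the given circuit are processed in topological order. The exponent
of a node `u` is a sum, with coefficients in `D`, of the values of processed nodes; it is normalised
over the new nodes, and a node with this exponent is found or created. Then the chain of this node
is extended twice at its top, and the chain of exponent `0` once. So at most four nodes are spent on
each given node, which gives the bound on the size. Call `j` a slot if `j`, `j + 1` and `j + 2` are
all exponents of nodes. The first two extensions turn the former top of the chain, whose value is at
least that of `u`, into a slot; the third extension creates another slot, which pays for an additive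
slack. By `Capacity.step` this preserves the invariant `Capacity`: below any exponent `p` without
node, the slots outweigh the processed nodes. Since slots below `p` are even below `p - 2`, every
marking of processed nodes contributes at most `q ^ (p - 2) - 1` below `p`. The exponents of the
nodes that were added by extensions are values of such markings up to a small remainder (`Spans`),
so that the same bound holds for them (`Spans.tame`).

This one bound has two uses. It is strong enough for the normalisation, even after a few increments
by `1` (`gap_bound`). And with `p - 1` the exponent of the top node of a chain, it forces the
compact digit at the top node to be `0` (`Compact.eq_zero_of_small`), which is the condition on
unmarked top nodes.

Running time. Each node costs linear time: the normalisation is linear, and the search in the sorted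
list is linear because it narrows an interval of candidates digit by digit (`runs_findNode`).
Division by `q` and multiplication are replaced by tables. The tree is the digital tree of the rows
of digits, built level by level with constant time for each string and level (`Trie`,
`runs_buildTrie`), hence within the number of nodes times the number of markings. Finally the nodes
are renumbered by increasing exponent. The resulting graph is acyclic since a compact sum of value
`e` uses only powers `q ^ j` with `j < e` (`Compact.lt_of_ne_zero`). -/

open scoped BigOperators
namespace PowerCircuits

/-! ## Compact digit sequences -/

/-- The local form of compactness of a sequence of digits. -/
structure Compact (q : ℕ) (α : ℕ → ℤ) : Prop where
  lo : ∀ i, -(q : ℤ) < α i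
  hi : ∀ i, α i < q
  pos : ∀ i, 0 < α i → 0 ≤ α (i + 1) ∧ α (i + 1) < q - 1
  neg : ∀ i, α i < 0 → α (i + 1) ≤ 0 ∧ -((q : ℤ) - 1) < α (i + 1)

theorem Compact.opp {q : ℕ} {α : ℕ → ℤ} (h : Compact q α) : Compact q (fun i => -α i) where
  lo i := by have := h.hi i; linarith
  hi i := by have := h.lo i; linarith
  pos i hi := by have := h.neg i (by linarith); constructor <;> linarith
  neg i hi := by have := h.pos i (by linarith); constructor <;> linarith

theorem Compact.isCompactPowerSum {q : ℕ} {α : ℕ → ℤ} (hq : 2 ≤ q) (h : Compact q α)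
    (hf : (Function.support α).Finite) : IsCompactPowerSum q α := by
  have hq' : (2 : ℤ) ≤ q := by exact_mod_cast hq
  refine ⟨⟨hf, fun i => ?_⟩, ?_⟩
  · have := h.lo i; have := h.hi i
    rw [Finset.mem_Icc]; constructor <;> linarith
  · rintro ⟨T, hT⟩
    cases hT with
    | rule1 i h1 h2 => have := (h.pos i h1).1; linarith
    | rule2 i h1 h2 => have := (h.neg i h1).1; linarith
    | rule3 i j hij h1 h2 h3 =>
      have := (h.pos i h1).2; have := h2 (i + 1) (by omega) (by omega); linarith
    | rule4 i j hij h1 h2 h3 =>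
      have := (h.neg i h1).2; have := h2 (i + 1) (by omega) (by omega); linarith

/-- Partial sums of a power sum. -/
def psum (q : ℕ) (α : ℕ → ℤ) (p : ℕ) : ℤ := ∑ i ∈ Finset.range p, α i * (q : ℤ) ^ i

theorem psum_succ (q : ℕ) (α : ℕ → ℤ) (p : ℕ) :
    psum q α (p + 1) = psum q α p + α p * (q : ℤ) ^ p := Finset.sum_range_succ _ _

theorem psum_zero (q : ℕ) (α : ℕ → ℤ) : psum q α 0 = 0 := rfl

theorem psum_opp (q : ℕ) (α : ℕ → ℤ) (p : ℕ) : psum q (fun i => -α i) p = -psum q α p := by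
  simp [psum, Finset.sum_neg_distrib]

/-- The bound `q ^ (i + 1) / (q + 1)` is the supremum, approached by the alternating digits `q - 1,
0, q - 1, 0, …`. The second half is what makes the induction work: if `α i` is not in `0, …, q - 2`,
then the digit before it is not positive, and a factor `q` is gained. -/
theorem Compact.psum_lt {q : ℕ} {α : ℕ → ℤ} (hq : 2 ≤ q) (h : Compact q α) (i : ℕ) :
    ((q : ℤ) + 1) * psum q α i < (q : ℤ) ^ (i + 1) ∧
      (¬ (0 ≤ α i ∧ α i < q - 1) → ((q : ℤ) + 1) * psum q α i < (q : ℤ) ^ i) := by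
  have hq' : (2 : ℤ) ≤ q := by exact_mod_cast hq
  induction i with
  | zero => simp [psum_zero]; linarith
  | succ i ih =>
    obtain ⟨ih1, ih2⟩ := ih
    have hQ : (0 : ℤ) < (q : ℤ) ^ i := by positivity
    have e1 : (q : ℤ) ^ (i + 1) = q ^ i * q := pow_succ _ _
    have e2 : (q : ℤ) ^ (i + 1 + 1) = q ^ i * q * q := by rw [pow_succ, pow_succ]
    rw [psum_succ]
    rw [e1] at ih1
    rw [e1, e2]
    set Q := (q : ℤ) ^ i
    set S := psum q α i
    have hle : α i ≤ 0 → ((q : ℤ) + 1) * (S + α i * Q) < Q * q := fun h0 => by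
      have : α i * Q ≤ 0 := mul_nonpos_of_nonpos_of_nonneg h0 hQ.le
      nlinarith
    refine ⟨?_, fun h0 => ?_⟩
    · by_cases hc : 0 ≤ α i ∧ α i < q - 1
      · have : α i * Q ≤ (q - 2) * Q := by
          apply mul_le_mul_of_nonneg_right _ hQ.le; omega
        nlinarith
      · by_cases h0 : α i ≤ 0
        · have := hle h0; have : 0 ≤ Q * q * (q - 1) := mul_nonneg (by positivity)
              (by linarith); linarith
        · have h1 : α i = q - 1 := by have := h.hi i; omega
          have := ih2 hc
          rw [h1]; nlinarith
    · apply hle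
      by_contra hc
      exact h0 (h.pos i (by omega))

theorem Compact.lt_psum {q : ℕ} {α : ℕ → ℤ} (hq : 2 ≤ q) (h : Compact q α) (i : ℕ) :
    -(q : ℤ) ^ (i + 1) < ((q : ℤ) + 1) * psum q α i ∧
      (¬ (α i ≤ 0 ∧ -((q : ℤ) - 1) < α i) → -(q : ℤ) ^ i < ((q : ℤ) + 1) * psum q α i) := by
  have := h.opp.psum_lt hq i
  rw [psum_opp] at this
  refine ⟨by linarith [this.1], fun h0 => ?_⟩
  have := this.2 (fun hc => h0 ⟨by linarith [hc.1], by linarith [hc.2]⟩)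
  linarith

theorem Compact.abs_psum_lt {q : ℕ} {α : ℕ → ℤ} (hq : 2 ≤ q) (h : Compact q α) (i : ℕ) :
    |psum q α i| < (q : ℤ) ^ i := by
  have h1 := (h.psum_lt hq i).1
  have h2 := (h.lt_psum hq i).1
  have hQ : (0 : ℤ) < (q : ℤ) ^ i := by positivity
  rw [pow_succ] at h1 h2
  rw [abs_lt]
  constructor <;> nlinarith

/-- The two bounds `q ^ (i + 1) / (q + 1)` and `q ^ i / (q + 1)` add up to exactly `q ^ i`. Because
of `α i < β i`, at least one of the two digits is of the kind that yields the smaller bound for the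
terms below it, so these terms cannot outweigh the difference of the digits at `i`. -/
theorem Compact.psum_lt_psum {q : ℕ} {α β : ℕ → ℤ} (hq : 2 ≤ q) (hα : Compact q α)
    (hβ : Compact q β) {i : ℕ} (h : α i < β i) : psum q α (i + 1) < psum q β (i + 1) := by
  have hQ : (0 : ℤ) < (q : ℤ) ^ i := by positivity
  have h1 := hα.psum_lt hq i
  have h2 := hβ.lt_psum hq i
  rw [psum_succ, psum_succ]
  have e1 : (q : ℤ) ^ (i + 1) = q ^ i * q := pow_succ _ _
  rw [e1] at h1 h2
  set Q := (q : ℤ) ^ i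
  have key : ((q : ℤ) + 1) * (psum q α i - psum q β i) < Q * (q + 1) := by
    by_cases hc : 0 ≤ α i ∧ α i < q - 1
    · have := h2.2 (fun hc' => by omega)
      nlinarith [h1.1]
    · have := h1.2 hc
      nlinarith [h2.1]
  have : (1 : ℤ) * Q ≤ (β i - α i) * Q := mul_le_mul_of_nonneg_right (by omega) hQ.le
  have h3 : psum q α i - psum q β i < Q := by
    by_contra hc
    have : ((q : ℤ) + 1) * Q ≤ ((q : ℤ) + 1) * (psum q α i - psum q β i) :=
      mul_le_mul_of_nonneg_left (by omega) (by positivity)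
    nlinarith
  linarith

theorem Compact.eq_of_psum_eq {q : ℕ} {α β : ℕ → ℤ} (hq : 2 ≤ q) (hα : Compact q α)
    (hβ : Compact q β) (B : ℕ) (hB : ∀ i, B ≤ i → α i = β i)
    (h : psum q α B = psum q β B) : α = β := by
  induction B with
  | zero => exact funext fun i => hB i (Nat.zero_le _)
  | succ B ih =>
    have hBB : α B = β B := by
      rcases lt_trichotomy (α B) (β B) with h1 | h1 | h1
      · exact absurd h (hα.psum_lt_psum hq hβ h1).ne
      · exact h1
      · exact absurd h (hβ.psum_lt_psum hq hα h1).ne'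
    refine ih (fun i hi => ?_) ?_
    · rcases hi.eq_or_lt with rfl | hi
      · exact hBB
      · exact hB i hi
    · rw [psum_succ, psum_succ, hBB] at h
      linarith

/-- The power sum `α` has finitely many non-zero terms, and its value is `x`. -/
def HasVal (q : ℕ) (α : ℕ → ℤ) (x : ℤ) : Prop := ∃ B, (∀ i, B ≤ i → α i = 0) ∧ psum q α B = x

theorem psum_eq_of_zero {q : ℕ} {α : ℕ → ℤ} {B p : ℕ} (h : ∀ i, B ≤ i → α i = 0) (hp : B ≤ p) :
    psum q α p = psum q α B := by
  induction p, hp using Nat.le_induction with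
  | base => rfl
  | succ p hp ih => rw [psum_succ, ih, h p hp, zero_mul, add_zero]

theorem HasVal.exists_psum {q : ℕ} {α : ℕ → ℤ} {x : ℤ} (h : HasVal q α x) (m : ℕ) :
    ∃ B, m ≤ B ∧ (∀ i, B ≤ i → α i = 0) ∧ psum q α B = x := by
  obtain ⟨B, h1, h2⟩ := h
  exact ⟨max m B, le_max_left _ _, fun i hi => h1 i (le_trans (le_max_right _ _) hi),
    by rw [psum_eq_of_zero h1 (le_max_right _ _), h2]⟩

theorem HasVal.finite {q : ℕ} {α : ℕ → ℤ} {x : ℤ} (h : HasVal q α x) :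
    (Function.support α).Finite := by
  obtain ⟨B, h1, -⟩ := h
  refine (Set.finite_lt_nat B).subset fun i hi => ?_
  by_contra hc
  exact hi (h1 i (by simpa using hc))

theorem psum_sub_psum_of_agree {q : ℕ} {α β : ℕ → ℤ} {i p : ℕ} (h : ∀ j, i ≤ j → α j = β j)
    (hp : i ≤ p) : psum q α p - psum q β p = psum q α i - psum q β i := by
  induction p, hp using Nat.le_induction with
  | base => rfl
  | succ p hp ih => rw [psum_succ, psum_succ, h p hp]; linarith

/-- This makes it possible to compare exponents, which may be astronomically large, by comparing
rows of digits. -/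
theorem Compact.lt_of_lex {q : ℕ} {α β : ℕ → ℤ} {x y : ℤ} (hq : 2 ≤ q) (hα : Compact q α)
    (hβ : Compact q β) (hx : HasVal q α x) (hy : HasVal q β y) {i : ℕ}
    (hag : ∀ j, i < j → α j = β j) (h : α i < β i) : x < y := by
  obtain ⟨B₁, hB₁, hB₁'⟩ := hx
  obtain ⟨B₂, hB₂, hB₂'⟩ := hy
  let B := max (max B₁ B₂) (i + 1)
  have e1 : psum q α B = x := by
    rw [psum_eq_of_zero hB₁ (le_trans (le_max_left _ _) (le_max_left _ _)), hB₁']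
  have e2 : psum q β B = y := by
    rw [psum_eq_of_zero hB₂ (le_trans (le_max_right _ _) (le_max_left _ _)), hB₂']
  have e3 := psum_sub_psum_of_agree (q := q) (α := α) (β := β) (i := i + 1) (p := B)
    (fun j hj => hag j hj) (le_max_right _ _)
  have := hα.psum_lt_psum hq hβ h
  linarith

theorem Compact.eq_of_hasVal {q : ℕ} {α β : ℕ → ℤ} {x : ℤ} (hq : 2 ≤ q) (hα : Compact q α)
    (hβ : Compact q β) (hx : HasVal q α x) (hy : HasVal q β x) : α = β := by
  obtain ⟨B₁, hB₁, hB₁'⟩ := hx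
  obtain ⟨B₂, hm, hB₂, hB₂'⟩ := hy.exists_psum B₁
  refine hα.eq_of_psum_eq hq hβ B₂ (fun i hi => ?_) ?_
  · rw [hB₁ i (hm.trans hi), hB₂ i hi]
  · rw [psum_eq_of_zero hB₁ hm, hB₁', hB₂']

open Classical in
/-- The digits of the compact power sum of value `x`. -/
noncomputable def cd (q : ℕ) (x : ℤ) : ℕ → ℤ :=
  -- The default value is never used. Existence is not proved for all integers; it results from
  -- `normalise_spec` for each value that is computed, and `HasCd` records it.
  if h : ∃ α, Compact q α ∧ HasVal q α x then h.choose else 0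

/-- There is a compact power sum of value `x`. -/
def HasCd (q : ℕ) (x : ℤ) : Prop := Compact q (cd q x) ∧ HasVal q (cd q x) x

theorem Compact.cd_eq {q : ℕ} {α : ℕ → ℤ} {x : ℤ} (hq : 2 ≤ q) (hα : Compact q α)
    (hx : HasVal q α x) : cd q x = α := by
  have h : ∃ α, Compact q α ∧ HasVal q α x := ⟨α, hα, hx⟩
  rw [cd, dif_pos h]
  exact h.choose_spec.1.eq_of_hasVal hq hα h.choose_spec.2 hx

theorem Compact.hasCd {q : ℕ} {α : ℕ → ℤ} {x : ℤ} (hq : 2 ≤ q) (hα : Compact q α)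
    (hx : HasVal q α x) : HasCd q x := by
  rw [HasCd, hα.cd_eq hq hx]; exact ⟨hα, hx⟩

theorem compact_zero {q : ℕ} (hq : 2 ≤ q) : Compact q 0 := by
  have hq' : (2 : ℤ) ≤ q := by exact_mod_cast hq
  constructor <;> intro i <;> simp <;> linarith

theorem hasVal_zero (q : ℕ) : HasVal q 0 0 := ⟨0, fun _ _ => rfl, rfl⟩

theorem HasVal.eq {q : ℕ} {α : ℕ → ℤ} {x y : ℤ} (hx : HasVal q α x) (hy : HasVal q α y) :
    x = y := by
  obtain ⟨B₁, hB₁, hB₁'⟩ := hx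
  obtain ⟨B₂, hm, hB₂, hB₂'⟩ := hy.exists_psum B₁
  rw [← hB₁', ← hB₂', psum_eq_of_zero hB₁ hm]

theorem HasVal.exists_eq_psum_add {q : ℕ} {α : ℕ → ℤ} {x : ℤ} (h : HasVal q α x) (p : ℕ) :
    ∃ Y : ℤ, x = psum q α p + (q : ℤ) ^ p * Y := by
  obtain ⟨B, hm, -, h2⟩ := h.exists_psum p
  rw [← h2]; clear h2
  induction B, hm using Nat.le_induction with
  | base => exact ⟨0, by ring⟩
  | succ B hB ih =>
    obtain ⟨Y, hY⟩ := ih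
    obtain ⟨k, rfl⟩ := Nat.exists_eq_add_of_le hB
    exact ⟨Y + α (p + k) * (q : ℤ) ^ k, by rw [psum_succ, hY, pow_add]; ring⟩

/-- Below a gap, the compact power sum has the same partial sum as any other power sum of the
same value whose partial sum is small. -/
theorem Compact.psum_eq_of_gap {q : ℕ} {α β : ℕ → ℤ} {x : ℤ} (hq : 2 ≤ q) (hα : Compact q α)
    (hx : HasVal q α x) (hy : HasVal q β x) {p : ℕ} (hαp : α p = 0) (hβp : β p = 0)
    (hb : q * |psum q β p| ≤ (q : ℤ) ^ p) : psum q α p = psum q β p := by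
  have hq' : (2 : ℤ) ≤ q := by exact_mod_cast hq
  obtain ⟨Y, hY⟩ := hx.exists_eq_psum_add (p + 1)
  obtain ⟨Z, hZ⟩ := hy.exists_eq_psum_add (p + 1)
  rw [psum_succ, hαp, zero_mul, add_zero] at hY
  rw [psum_succ, hβp, zero_mul, add_zero] at hZ
  have h1 := hα.abs_psum_lt hq p
  have hQ : (0 : ℤ) < (q : ℤ) ^ p := by positivity
  have h2 : |psum q β p| ≤ (q : ℤ) ^ p := by
    have := abs_nonneg (psum q β p)
    nlinarith
  -- As the digit at `p` is `0` in both sums, the two partial sums are congruent modulo `q ^ (p +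
  -- 1)` and not only modulo `q ^ p`. They differ by less than `2 * q ^ p`.
  have hdvd : (q : ℤ) ^ (p + 1) ∣ psum q α p - psum q β p := ⟨Z - Y, by linarith⟩
  have h3 : |psum q α p - psum q β p| < (q : ℤ) ^ (p + 1) := by
    calc |psum q α p - psum q β p| ≤ |psum q α p| + |psum q β p| := abs_sub _ _
      _ < (q : ℤ) ^ p * 2 := by linarith
      _ ≤ (q : ℤ) ^ (p + 1) := by rw [pow_succ]; exact mul_le_mul_of_nonneg_left hq' hQ.le
  have := Int.eq_zero_of_abs_lt_dvd hdvd h3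
  linarith

/-- A positive digit at `b` excludes a negative digit before it, so the lower terms exceed `-q ^ b /
(q + 1)`; adding `q ^ b` gives `q ^ (b + 1) / (q + 1)`. -/
theorem Compact.lt_of_pos {q : ℕ} {α : ℕ → ℤ} (hq : 2 ≤ q) (hα : Compact q α) {b : ℕ}
    (h : 0 < α b) : (q : ℤ) ^ (b + 1) < (q + 1) * psum q α (b + 1) := by
  have hQ : (0 : ℤ) < (q : ℤ) ^ b := by positivity
  have h1 := (hα.lt_psum hq b).2 (fun hc => by omega)
  have : (1 : ℤ) * (q : ℤ) ^ b ≤ α b * (q : ℤ) ^ b := mul_le_mul_of_nonneg_right (by omega) hQ.le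
  rw [psum_succ, pow_succ]
  nlinarith

/-- A non-zero digit would make the partial sum larger than `q ^ (b + 1) / (q + 1)`, which is more
than `q ^ (b - 1)`. Applied to the top of a chain, this shows that top nodes are unmarked. -/
theorem Compact.eq_zero_of_small {q : ℕ} {α : ℕ → ℤ} (hq : 2 ≤ q) (hα : Compact q α) {b : ℕ}
    (h : q * |psum q α (b + 1)| < (q : ℤ) ^ b) : α b = 0 := by
  have hq' : (2 : ℤ) ≤ q := by exact_mod_cast hq
  have hQ : (0 : ℤ) < (q : ℤ) ^ b := by positivity
  have key : ∀ β : ℕ → ℤ, Compact q β → q * |psum q β (b + 1)| < (q : ℤ) ^ b → ¬ 0 < β b := by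
    intro β hβ h hpos
    have h1 := hβ.lt_of_pos hq hpos
    have h2 := le_abs_self (psum q β (b + 1))
    have h3 := abs_nonneg (psum q β (b + 1))
    rw [pow_succ] at h1
    nlinarith
  have h1 := key α hα h
  have h2 := key _ hα.opp (by rwa [psum_opp, abs_neg])
  omega

/-- The leading digit is positive since the value is not negative, so the value exceeds `q ^ (L + 1)
/ (q + 1)` for the leading position `L`, and this is at least `L`. The lemma provides the acyclicity
of the new graph. -/
theorem Compact.lt_of_ne_zero {q : ℕ} {α : ℕ → ℤ} (hq : 2 ≤ q) (hα : Compact q α) {e : ℕ}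
    (he : HasVal q α e) {j : ℕ} (hj : α j ≠ 0) : j < e := by
  have hq' : (2 : ℤ) ≤ q := by exact_mod_cast hq
  obtain ⟨B, hB, hB'⟩ := he
  obtain ⟨L, hL, hmax⟩ : ∃ L, α L ≠ 0 ∧ ∀ i, L < i → α i = 0 := by
    have hf : (Function.support α).Finite := HasVal.finite ⟨B, hB, hB'⟩
    obtain ⟨L, hL, hm⟩ := Set.exists_max_image _ id hf ⟨j, hj⟩
    refine ⟨L, hL, fun i hi => ?_⟩
    by_contra hc
    exact absurd (hm i hc) (not_le.mpr hi)
  have hjL : j ≤ L := by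
    by_contra hc
    exact hj (hmax j (by omega))
  have hpos : 0 < α L := by
    rcases lt_trichotomy (α L) 0 with h | h | h
    · have := hα.lt_of_lex hq (compact_zero hq) ⟨B, hB, hB'⟩ (hasVal_zero q)
        (fun i hi => by rw [hmax i hi]; rfl) h
      omega
    · exact absurd h hL
    · exact h
  have h1 := hα.lt_of_pos hq hpos
  have h2 : psum q α (L + 1) = e :=
    HasVal.eq ⟨L + 1, fun i hi => hmax i hi, rfl⟩ ⟨B, hB, hB'⟩
  rw [h2] at h1
  have h3 : q ^ (L + 1) < (q + 1) * e := by exact_mod_cast h1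
  refine lt_of_le_of_lt hjL ?_
  by_contra hc
  have hc : e ≤ L := not_lt.mp hc
  cases L with
  | zero =>
    have : e = 0 := by omega
    subst this; simp at h3
  | succ L =>
    have h4 : L + 1 ≤ q ^ L := Nat.lt_pow_self (by omega)
    have h5 : (q + 1) * e ≤ (q + 1) * (L + 1) := Nat.mul_le_mul_left _ hc
    have h6 : q ^ (L + 1 + 1) = q ^ L * (q * q) := by rw [pow_succ, pow_succ, mul_assoc]
    have h7 : (L + 1) * (q + 1) ≤ q ^ L * (q * q) := Nat.mul_le_mul h4 (by nlinarith)
    nlinarith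

/-! ## Sums of multiples of powers -/

/-- The power sum with coefficients `A a` at the exponents `e a`. -/
def spread {ι : Type*} (s : Finset ι) (e : ι → ℕ) (A : ι → ℤ) : ℕ → ℤ :=
  fun m => ∑ a ∈ s, if e a = m then A a else 0

theorem psum_spread {ι : Type*} (q : ℕ) (s : Finset ι) (e : ι → ℕ) (A : ι → ℤ) (p : ℕ) :
    psum q (spread s e A) p = ∑ a ∈ s, if e a < p then A a * (q : ℤ) ^ e a else 0 := by
  unfold psum spread
  simp_rw [Finset.sum_mul]
  rw [Finset.sum_comm]
  refine Finset.sum_congr rfl fun a _ => ?_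
  simp [ite_mul, Finset.sum_ite_eq]

theorem hasVal_spread {ι : Type*} (q : ℕ) (s : Finset ι) (e : ι → ℕ) (A : ι → ℤ) :
    HasVal q (spread s e A) (∑ a ∈ s, A a * (q : ℤ) ^ e a) := by
  have hlt : ∀ a ∈ s, e a < s.sup e + 1 := fun a ha => Nat.lt_succ_of_le (Finset.le_sup ha)
  refine ⟨s.sup e + 1, fun i hi => ?_, ?_⟩
  · refine Finset.sum_eq_zero fun a ha => if_neg fun h => ?_
    have := hlt a ha
    omega
  · rw [psum_spread]
    exact Finset.sum_congr rfl fun a ha => if_pos (hlt a ha)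

theorem spread_apply {ι : Type*} {s : Finset ι} {e : ι → ℕ} (A : ι → ℤ) {a : ι} (ha : a ∈ s)
    (he : ∀ b ∈ s, e b = e a → b = a) : spread s e A (e a) = A a := by
  unfold spread
  rw [Finset.sum_eq_single a]
  · simp
  · intro b hb hne
    exact if_neg fun h => hne (he b hb h)
  · exact fun h => absurd ha h

theorem spread_eq_zero {ι : Type*} {s : Finset ι} {e : ι → ℕ} (A : ι → ℤ) {m : ℕ}
    (h : ∀ b ∈ s, e b ≠ m) : spread s e A m = 0 :=
  Finset.sum_eq_zero fun b hb => if_neg (h b hb)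

theorem spread_reindex {e ord : ℕ → ℕ} (A : ℕ → ℤ) {N : ℕ} (hlt : ∀ i < N, ord i < N)
    (hinj : ∀ i < N, ∀ j < N, ord i = ord j → i = j) (hsurj : ∀ a < N, ∃ i < N, ord i = a) :
    spread (Finset.range N) (fun i => e (ord i)) (fun i => A (ord i)) =
      spread (Finset.range N) e A := by
  funext m
  refine Finset.sum_bij (fun i _ => ord i) ?_ ?_ ?_ ?_
  · intro i hi; simpa using hlt i (by simpa using hi)
  · intro i hi j hj h; exact hinj i (by simpa using hi) j (by simpa using hj) h
  · intro a ha
    obtain ⟨i, hi, rfl⟩ := hsurj a (by simpa using ha)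
    exact ⟨i, by simpa using hi, rfl⟩
  · intros; rfl

/-! ## The normalisation algorithm -/

open Classical in
/-- The carry of the first pass: division with remainder, from the lowest exponent upwards. -/
noncomputable def carryLo (q : ℕ) (A : ℕ → ℤ) (bit : ℕ → Prop) : ℕ → ℤ
  | 0 => 0
  | i + 1 => if bit i then (A i + carryLo q A bit i) / q else 0

/-- The final digit, if the digit of the first pass plus the incoming carry is `z`. -/
noncomputable def outDigit (q : ℕ) (z : ℤ) (pn : Prop) [Decidable pn] : ℤ :=
  -- This happens only for the residue `q - 1` with an incoming carry; the digit is then `0` for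
  -- either choice of the sign.
  if z = q then 0 else if z ≤ 0 then 0 else if pn then z else z - q

/-- The outgoing carry, if the digit of the first pass plus the incoming carry is `z`. -/
noncomputable def outCarry (q : ℕ) (z : ℤ) (pn : Prop) [Decidable pn] : ℤ :=
  if z = q then 1 else if z ≤ 0 then 0 else if pn then 0 else 1

open Classical in
/-- The carry of the last pass. -/
noncomputable def carryHi (q : ℕ) (x : ℕ → ℤ) (pn bit : ℕ → Prop) : ℕ → ℤ
  | 0 => 0
  | i + 1 => if bit i then outCarry q (x i + carryHi q x pn bit i) (pn i) else 0

/-- Only the size of the digits is used here, so the bound is that of the geometric series with all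
digits equal to `q - 1`. -/
theorem abs_sum_digits_lt {q : ℕ} (hq : 2 ≤ q) {e : ℕ → ℕ} {α : ℕ → ℤ} (j m : ℕ)
    (he : ∀ i k, i < k → k < j → e i < e k) (hm : ∀ i < j, e i < m)
    (hα : ∀ i < j, |α i| ≤ q - 1) :
    |∑ i ∈ Finset.range j, α i * (q : ℤ) ^ e i| < (q : ℤ) ^ m := by
  induction j generalizing m with
  | zero => simp; positivity
  | succ j ih =>
    have h1 := ih (e j) (fun i k hik hk => he i k hik (by omega)) (fun i hi => he i j hi (by omega))
      (fun i hi => hα i (by omega))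
    have h2 := hα j (by omega)
    have hQ : (0 : ℤ) < (q : ℤ) ^ e j := by positivity
    rw [Finset.sum_range_succ]
    calc _ ≤ |∑ i ∈ Finset.range j, α i * (q : ℤ) ^ e i| + |α j * (q : ℤ) ^ e j| := abs_add_le _ _
      _ < (q : ℤ) ^ (e j) + (q - 1) * (q : ℤ) ^ (e j) := by
          rw [abs_mul, abs_of_pos hQ]
          have := mul_le_mul_of_nonneg_right h2 hQ.le
          linarith
      _ = (q : ℤ) ^ (e j + 1) := by rw [pow_succ]; ring
      _ ≤ (q : ℤ) ^ m := by
          have := hm j (by omega)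
          exact pow_le_pow_right₀ (by exact_mod_cast (by omega : 1 ≤ q)) this

section Normalise
open Classical

variable {q N : ℕ} {A x : ℕ → ℤ} {e : ℕ → ℕ} {bit pn : ℕ → Prop}

theorem outDigit_add (q : ℕ) (z : ℤ) (pn : Prop) (h0 : 0 ≤ z) :
    outDigit q z pn + q * outCarry q z pn = z := by
  unfold outDigit outCarry
  split_ifs <;> omega

theorem outDigit_bounds {q : ℕ} (hq : 2 ≤ q) {z : ℤ} (pn : Prop) (h1 : z ≤ q) :
    -(q : ℤ) < outDigit q z pn ∧ outDigit q z pn < q := by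
  unfold outDigit
  split_ifs <;> constructor <;> omega

theorem outCarry_mem (q : ℕ) (z : ℤ) (pn : Prop) : outCarry q z pn = 0 ∨ outCarry q z pn = 1 := by
  unfold outCarry
  split_ifs <;> simp

theorem carryHi_mem (q : ℕ) (x : ℕ → ℤ) (pn bit : ℕ → Prop) (i : ℕ) :
    carryHi q x pn bit i = 0 ∨ carryHi q x pn bit i = 1 := by
  cases i with
  | zero => exact Or.inl rfl
  | succ i =>
    rw [carryHi]
    split_ifs
    · exact outCarry_mem _ _ _
    · exact Or.inl rfl

/-- The digits computed by the normalisation algorithm are the compact digits. -/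
theorem normalise_spec (hq : 2 ≤ q) (he : ∀ i k, i < k → k < N → e i < e k)
    (hbit : ∀ i < N, bit i ↔ i + 1 < N ∧ e (i + 1) = e i + 1)
    (hx : ∀ i < N, x i = (A i + carryLo q A bit i) % q)
    -- `pn i` means that the non-negative representative is taken at `i`. A positive digit needs a
    -- successor in `0, …, q - 2`: residue `0` is always fine, residue `q - 1` never, and otherwise
    -- the successor has to be non-negative as well. In the remaining cases the negative
    -- representative works: the carry into the successor makes its digit `0` or at least `2 - q`.
    -- At the top of a chain the sign is that of the quotient that is left over.
    (hpn : ∀ i < N, pn i ↔ if bit i then x (i + 1) = 0 ∨ x (i + 1) ≠ q - 1 ∧ pn (i + 1)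
      else 0 ≤ (A i + carryLo q A bit i) / q)
    (hb : ∀ i < N, ¬ bit i →
      q * |∑ k ∈ Finset.range (i + 1), A k * (q : ℤ) ^ e k| ≤ (q : ℤ) ^ (e i + 1)) :
    HasCd q (∑ k ∈ Finset.range N, A k * (q : ℤ) ^ e k) ∧
    (∀ i < N, cd q (∑ k ∈ Finset.range N, A k * (q : ℤ) ^ e k) (e i) =
      outDigit q (x i + carryHi q x pn bit i) (pn i)) ∧
    (∀ m, cd q (∑ k ∈ Finset.range N, A k * (q : ℤ) ^ e k) m ≠ 0 → ∃ i < N, e i = m) := by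
  have hq' : (2 : ℤ) ≤ q := by exact_mod_cast hq
  have hq0 : (q : ℤ) ≠ 0 := by omega
  set c := carryLo q A bit with hc
  set d := carryHi q x pn bit with hd
  set α : ℕ → ℤ := fun i => outDigit q (x i + d i) (pn i) with hα
  set γ : ℕ → ℤ := fun i => outCarry q (x i + d i) (pn i) with hγ
  have hd01 : ∀ i, d i = 0 ∨ d i = 1 := carryHi_mem q x pn bit
  have hx0 : ∀ i < N, 0 ≤ x i := fun i hi => by rw [hx i hi]; exact Int.emod_nonneg _ hq0
  have hxq : ∀ i < N, x i < q := fun i hi => by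
    rw [hx i hi]; exact Int.emod_lt_of_pos _ (by omega)
  have hα1 : ∀ i < N, α i + q * γ i = x i + d i := fun i hi =>
    outDigit_add q _ _ (by have := hx0 i hi; have := hd01 i; omega)
  have hα2 : ∀ i < N, -(q : ℤ) < α i ∧ α i < q := fun i hi =>
    outDigit_bounds hq _ (by have := hxq i hi; have := hd01 i; omega)
  have hstep : ∀ i < N, A i + (c i + d i) = α i + q * ((A i + c i) / q + γ i) := fun i hi => by
    have h1 := hα1 i hi
    have h2 := Int.emod_add_mul_ediv (A i + c i) q
    rw [← hx i hi] at h2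
    linarith
  -- At the top of a chain the digit and the leftover carry never have opposite signs, so they
  -- cannot cancel each other.
  have hsign : ∀ i < N, ¬ bit i → 0 ≤ α i * ((A i + c i) / q + γ i) := by
    intro i hi hbi
    have h1 := hpn i hi
    rw [if_neg hbi] at h1
    by_cases hp : pn i
    · have hk := h1.mp hp
      have ha : 0 ≤ α i := by
        simp only [hα, outDigit]; split_ifs <;> omega
      have hg : 0 ≤ γ i := by rcases outCarry_mem q (x i + d i) (pn i) with h | h <;> simp [hγ, h]
      positivity
    · have hk := mt h1.mpr hp
      have ha : α i ≤ 0 := by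
        have := hxq i hi; have := hd01 i
        simp only [hα, outDigit]; split_ifs <;> first | contradiction | omega
      have hg : γ i ≤ 1 := by rcases outCarry_mem q (x i + d i) (pn i) with h | h <;> simp [hγ, h]
      exact mul_nonneg_of_nonpos_of_nonpos ha (by omega)
  -- The terms below position `j` have the same sum as their final digits together with both pending
  -- carries, which count with the value of the node `j`. At the end of a chain this requires that
  -- nothing is left over.
  have hmain : ∀ j ≤ N, ∑ k ∈ Finset.range j, A k * (q : ℤ) ^ e k =
      ∑ k ∈ Finset.range j, α k * (q : ℤ) ^ e k + (c j + d j) * (q : ℤ) ^ e j := by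
    intro j
    induction j with
    | zero => intro _; simp [hc, hd, carryLo, carryHi]
    | succ j ih =>
      intro hj
      have ih := ih (by omega)
      have h1 := hstep j (by omega)
      have e1 : ∑ k ∈ Finset.range (j + 1), A k * (q : ℤ) ^ e k =
          ∑ k ∈ Finset.range j, α k * (q : ℤ) ^ e k + α j * (q : ℤ) ^ e j +
            ((A j + c j) / q + γ j) * (q : ℤ) ^ (e j + 1) := by
        rw [Finset.sum_range_succ, ih, pow_succ]
        linear_combination (q : ℤ) ^ e j * h1
      by_cases hbj : bit j
      · have h2 := ((hbit j (by omega)).mp hbj).2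
        have h3 : c (j + 1) = (A j + c j) / q := by simp [hc, carryLo, hbj]
        have h4 : d (j + 1) = γ j := by simp [hd, hγ, carryHi, hbj]
        rw [e1, h2, h3, h4, Finset.sum_range_succ]
      · have h3 : c (j + 1) = 0 := by simp [hc, carryLo, hbj]
        have h4 : d (j + 1) = 0 := by simp [hd, carryHi, hbj]
        have h5 := hb j (by omega) hbj
        have h6 := abs_sum_digits_lt hq (e := e) (α := α) j (e j)
          (fun i k hik hk => he i k hik (by omega)) (fun i hi => he i j hi (by omega))
          (fun i hi => by have := hα2 i (by omega); rw [abs_le]; constructor <;> omega)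
        have h7 := hsign j (by omega) hbj
        have hQ : (0 : ℤ) < (q : ℤ) ^ e j := by positivity
        -- If the leftover carry were not `0`, then, having the same sign as the digit, it would
        -- contribute at least `q ^ (e j + 1)`. The lower digits take away less than `q ^ e j`, so
        -- the sum would exceed `q ^ e j`, contrary to the hypothesis on the gap above `e j`.
        have hz : (A j + c j) / q + γ j = 0 := by
          rw [e1] at h5
          rw [pow_succ] at h5
          set h := (A j + c j) / q + γ j
          set S := ∑ k ∈ Finset.range j, α k * (q : ℤ) ^ e k
          set Q := (q : ℤ) ^ e j
          have h6' := abs_lt.mp h6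
          have h8 := le_abs_self (S + α j * Q + h * (Q * q))
          have h9 := neg_abs_le (S + α j * Q + h * (Q * q))
          by_contra hne
          rcases lt_or_gt_of_ne hne with hlt | hgt
          · have ha : α j ≤ 0 := by
              by_contra hc; have := mul_neg_of_pos_of_neg (not_le.mp hc) hlt; omega
            have g1 : h * (Q * q) ≤ (-1) * (Q * q) :=
              mul_le_mul_of_nonneg_right (by omega) (by positivity)
            have g2 : α j * Q ≤ 0 := mul_nonpos_of_nonpos_of_nonneg ha hQ.le
            have g3 : |S + α j * Q + h * (Q * q)| ≤ Q := by nlinarith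
            nlinarith
          · have ha : 0 ≤ α j := by
              by_contra hc; have := mul_neg_of_neg_of_pos (not_le.mp hc) hgt; omega
            have g1 : 1 * (Q * q) ≤ h * (Q * q) :=
              mul_le_mul_of_nonneg_right (by omega) (by positivity)
            have g2 : 0 ≤ α j * Q := mul_nonneg ha hQ.le
            have g3 : |S + α j * Q + h * (Q * q)| ≤ Q := by nlinarith
            nlinarith
        rw [e1, hz, h3, h4, Finset.sum_range_succ]
        ring
  have hcN : c N + d N = 0 := by
    cases N with
    | zero => simp [hc, hd, carryLo, carryHi]
    | succ N =>
      have hbN : ¬ bit N := by rw [hbit N (by omega)]; omega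
      simp [hc, hd, carryLo, carryHi, hbN]
  have hval : ∑ k ∈ Finset.range N, A k * (q : ℤ) ^ e k =
      ∑ k ∈ Finset.range N, α k * (q : ℤ) ^ e k := by
    rw [hmain N le_rfl, hcN]; ring
  have hinj : ∀ i < N, ∀ k ∈ Finset.range N, e k = e i → k = i := by
    intro i hi k hk h
    rw [Finset.mem_range] at hk
    rcases lt_trichotomy i k with h1 | h1 | h1
    · have := he i k h1 hk; omega
    · exact h1.symm
    · have := he k i h1 hi; omega
  set β := spread (Finset.range N) e α with hβ
  have hβe : ∀ i < N, β (e i) = α i := fun i hi =>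
    spread_apply α (Finset.mem_range.mpr hi) (hinj i hi)
  have hβ0 : ∀ m, β m ≠ 0 → ∃ i < N, e i = m := by
    intro m hm
    by_contra hne
    push Not at hne
    exact hm (spread_eq_zero α fun b hb => hne b (Finset.mem_range.mp hb))
  -- Compactness at neighbouring exponents. If there is no node with exponent `e i + 1`, the next
  -- digit is `0`; otherwise that node is the next one in the list, and the rule for `pn` gives a
  -- finite case distinction.
  have hnext : ∀ i < N, (0 < α i → 0 ≤ β (e i + 1) ∧ β (e i + 1) < q - 1) ∧
      (α i < 0 → β (e i + 1) ≤ 0 ∧ -((q : ℤ) - 1) < β (e i + 1)) := by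
    intro i hi
    by_cases h0 : β (e i + 1) = 0
    · rw [h0]; constructor <;> intro _ <;> constructor <;> omega
    obtain ⟨k, hk, hke⟩ := hβ0 _ h0
    have hki : k = i + 1 := by
      rcases lt_trichotomy k (i + 1) with h1 | h1 | h1
      · rcases Nat.lt_succ_iff_lt_or_eq.mp h1 with h2 | h2
        · have := he k i h2 hi; omega
        · subst h2; omega
      · exact h1
      · have := he (i + 1) k h1 hk; have := he i (i + 1) (by omega) (by omega); omega
    subst hki
    have hbi : bit i := (hbit i hi).mpr ⟨hk, hke⟩
    have hp := hpn i hi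
    rw [if_pos hbi] at hp
    rw [← hke, hβe _ hk]
    have hd' : d (i + 1) = γ i := by simp [hd, hγ, carryHi, hbi]
    have b1 := hx0 _ hk; have b2 := hxq _ hk; have b3 := hx0 _ hi; have b4 := hxq _ hi
    have b5 := hd01 i
    simp only [hα]
    rw [hd']
    simp only [hγ, outDigit, outCarry]
    by_cases hpi : pn i
    · have h1 := hp.mp hpi
      simp only [hpi, if_true]
      by_cases hpk : pn (i + 1) <;> simp only [hpk, if_true, if_false, and_true, and_false,
          or_false] at h1 ⊢ <;>
      · constructor <;> intro hh <;> split_ifs at hh ⊢ <;> constructor <;> omega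
    · have h1 := mt hp.mpr hpi
      simp only [hpi, if_false]
      by_cases hpk : pn (i + 1) <;> simp only [hpk, if_true, if_false, and_true, and_false,
          or_false] at h1 ⊢ <;>
      · constructor <;> intro hh <;> split_ifs at hh ⊢ <;> constructor <;> omega
  have hβc : Compact q β := by
    refine ⟨fun i => ?_, fun i => ?_, fun i hi => ?_, fun i hi => ?_⟩
    · by_cases h0 : β i = 0
      · rw [h0]; omega
      · obtain ⟨k, hk, rfl⟩ := hβ0 _ h0
        rw [hβe k hk]; exact (hα2 k hk).1
    · by_cases h0 : β i = 0
      · rw [h0]; omega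
      · obtain ⟨k, hk, rfl⟩ := hβ0 _ h0
        rw [hβe k hk]; exact (hα2 k hk).2
    · obtain ⟨k, hk, rfl⟩ := hβ0 _ hi.ne'
      rw [hβe k hk] at hi
      exact (hnext k hk).1 hi
    · obtain ⟨k, hk, rfl⟩ := hβ0 _ hi.ne
      rw [hβe k hk] at hi
      exact (hnext k hk).2 hi
  have hβv : HasVal q β (∑ k ∈ Finset.range N, A k * (q : ℤ) ^ e k) := by
    rw [hval]; exact hasVal_spread q _ e α
  have hcd := hβc.cd_eq hq hβv
  exact ⟨hβc.hasCd hq hβv, fun i hi => by rw [hcd, hβe i hi],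
      fun m hm => hβ0 m (by rwa [hcd] at hm)⟩

end Normalise

end PowerCircuits

open scoped BigOperators
namespace PowerCircuits

/-! ## Reasoning about programs -/

/-- Started on `σ`, the program `p` stops after at most `T` steps in a storage with property `Q`,
and all integers computed are bounded by `w`. -/
def Runs (w : ℤ) (p : Program) (σ : Store) (T : ℕ) (Q : Store → Prop) : Prop :=
  ∃ t σ', Exec w p σ t σ' ∧ t ≤ T ∧ Q σ'

theorem Runs.mono {w : ℤ} {p : Program} {σ : Store} {T T' : ℕ} {Q Q' : Store → Prop}
    (h : Runs w p σ T Q) (hT : T ≤ T') (hQ : ∀ σ', Q σ' → Q' σ') : Runs w p σ T' Q' := by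
  obtain ⟨t, σ', h1, h2, h3⟩ := h
  exact ⟨t, σ', h1, h2.trans hT, hQ _ h3⟩

theorem Runs.seq {w : ℤ} {p₁ p₂ : Program} {σ : Store} {T₁ T₂ : ℕ} {R Q : Store → Prop}
    (h₁ : Runs w p₁ σ T₁ R) (h₂ : ∀ σ', R σ' → Runs w p₂ σ' T₂ Q) :
    Runs w (.seq p₁ p₂) σ (T₁ + T₂) Q := by
  obtain ⟨t₁, σ₁, h1, h2, h3⟩ := h₁
  obtain ⟨t₂, σ₂, h4, h5, h6⟩ := h₂ _ h3
  exact ⟨t₁ + t₂, σ₂, .seq _ _ _ _ _ _ _ h1 h4, by omega, h6⟩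

theorem Runs.ifPos {w : ℤ} {p₁ p₂ : Program} {x : ℕ} {σ : Store} {T : ℕ} {Q : Store → Prop}
    (h₁ : 0 < σ.reg x → Runs w p₁ σ T Q) (h₂ : ¬ 0 < σ.reg x → Runs w p₂ σ T Q) :
    Runs w (.ifPos x p₁ p₂) σ (T + 1) Q := by
  by_cases h : 0 < σ.reg x
  · obtain ⟨t, σ', h1, h2, h3⟩ := h₁ h
    exact ⟨t + 1, σ', .ifPos_true _ _ _ _ _ _ h h1, by omega, h3⟩
  · obtain ⟨t, σ', h1, h2, h3⟩ := h₂ h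
    exact ⟨t + 1, σ', .ifPos_false _ _ _ _ _ _ h h1, by omega, h3⟩

/-- Each iteration costs `c` steps for the body and one for the test, and lowers the potential `μ`.
A potential instead of an iteration count is needed for the loops whose progress is amortised. -/
theorem Runs.whilePos {w : ℤ} {p : Program} {x : ℕ} {σ : Store} (c : ℕ) (Inv : Store → Prop)
    (μ : Store → ℕ) (h0 : Inv σ)
    (hstep : ∀ σ, Inv σ → 0 < σ.reg x → Runs w p σ c (fun σ' => Inv σ' ∧ μ σ' < μ σ)) :
    Runs w (.whilePos x p) σ ((c + 1) * μ σ + 1) (fun σ' => Inv σ' ∧ ¬ 0 < σ'.reg x) := by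
  induction hn : μ σ using Nat.strong_induction_on generalizing σ with
  | _ n ih =>
    subst hn
    by_cases h : 0 < σ.reg x
    · obtain ⟨t, σ', h1, h2, h3, h4⟩ := hstep σ h0 h
      obtain ⟨t', σ'', h5, h6, h7⟩ := ih _ h4 h3 rfl
      refine ⟨t + t' + 1, σ'', .whilePos_true _ _ _ _ _ _ _ h h1 h5, ?_, h7⟩
      have : (c + 1) * (μ σ' + 1) ≤ (c + 1) * μ σ := Nat.mul_le_mul_left _ h4
      linarith
    · exact ⟨1, σ, .whilePos_false _ _ _ h, by omega, h0, h⟩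

/-- Weakest preconditions of programs without loops. -/
def wp (w : ℤ) : Program → (Store → Prop) → Store → Prop
  | .skip, Q, σ => Q σ
  | .const x c, Q, σ => |c| ≤ w ∧ Q (σ.setReg x c)
  | .move x y, Q, σ => Q (σ.setReg x (σ.reg y))
  | .add x y z, Q, σ => |σ.reg y + σ.reg z| ≤ w ∧ Q (σ.setReg x (σ.reg y + σ.reg z))
  | .sub x y z, Q, σ => |σ.reg y - σ.reg z| ≤ w ∧ Q (σ.setReg x (σ.reg y - σ.reg z))
  | .load x s y, Q, σ => Q (σ.setReg x (σ.mem s (σ.reg y)))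
  | .store s y x, Q, σ => Q (σ.setMem s (σ.reg y) (σ.reg x))
  | .seq p₁ p₂, Q, σ => wp w p₁ (wp w p₂ Q) σ
  | .ifPos x p₁ p₂, Q, σ => (0 < σ.reg x → wp w p₁ Q σ) ∧ (¬ 0 < σ.reg x → wp w p₂ Q σ)
  | .whilePos _ _, _, _ => False

/-- The running time of programs without loops. -/
def cost : Program → ℕ
  | .seq p₁ p₂ => cost p₁ + cost p₂
  | .ifPos _ p₁ p₂ => max (cost p₁) (cost p₂) + 1
  | _ => 1

theorem Runs.of_wp' {w : ℤ} {p : Program} {σ : Store} {Q : Store → Prop} (h : wp w p Q σ) :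
    Runs w p σ (cost p) Q := by
  induction p generalizing σ Q with
  | skip => exact ⟨1, _, .skip _, le_rfl, h⟩
  | const x c => exact ⟨1, _, .const _ _ _ h.1, le_rfl, h.2⟩
  | move x y => exact ⟨1, _, .move _ _ _, le_rfl, h⟩
  | add x y z => exact ⟨1, _, .add _ _ _ _ h.1, le_rfl, h.2⟩
  | sub x y z => exact ⟨1, _, .sub _ _ _ _ h.1, le_rfl, h.2⟩
  | load x s y => exact ⟨1, _, .load _ _ _ _, le_rfl, h⟩
  | store s y x => exact ⟨1, _, .store _ _ _ _, le_rfl, h⟩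
  | seq p₁ p₂ ih₁ ih₂ => exact (ih₁ h).seq fun σ' h' => ih₂ h'
  | ifPos x p₁ p₂ ih₁ ih₂ =>
    exact Runs.ifPos (fun hx => (ih₁ (h.1 hx)).mono (le_max_left _ _) fun _ => id)
      (fun hx => (ih₂ (h.2 hx)).mono (le_max_right _ _) fun _ => id)
  | whilePos x p ih => exact h.elim

theorem Runs.of_wp {w : ℤ} {p : Program} {σ : Store} {Q : Store → Prop} {T : ℕ}
    (hT : cost p ≤ T) (h : wp w p Q σ) : Runs w p σ T Q :=
  (Runs.of_wp' h).mono hT fun _ => id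

@[simp] theorem Store.reg_setReg (σ : Store) (x : ℕ) (a : ℤ) (y : ℕ) :
    (σ.setReg x a).reg y = if y = x then a else σ.reg y := by
  simp [Store.setReg, Function.update_apply]

@[simp] theorem Store.mem_setReg (σ : Store) (x : ℕ) (a : ℤ) : (σ.setReg x a).mem = σ.mem := rfl

@[simp] theorem Store.reg_setMem (σ : Store) (s : ℕ) (p a : ℤ) : (σ.setMem s p a).reg = σ.reg := rfl

@[simp] theorem Store.mem_setMem (σ : Store) (s : ℕ) (p a : ℤ) (s' : ℕ) (p' : ℤ) :
    (σ.setMem s p a).mem s' p' = if s' = s ∧ p' = p then a else σ.mem s' p' := by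
  by_cases h : s' = s
  · subst h; simp [Store.setMem, Function.update_apply]
  · simp [Store.setMem, h]

@[simp] theorem Store.mem_setMem_of_ne (σ : Store) (s : ℕ) (p a : ℤ) {s' : ℕ} (h : s' ≠ s) :
    (σ.setMem s p a).mem s' = σ.mem s' := by simp [Store.setMem, h]

/-- The storages `σ` and `σ'` agree except for registers from `b` on and segments in `S`. -/
structure Frame (b : ℕ) (S : List ℕ) (σ σ' : Store) : Prop where
  reg : ∀ r < b, σ'.reg r = σ.reg r
  mem : ∀ s, s ∉ S → σ'.mem s = σ.mem s

@[simp] theorem Frame.refl (b : ℕ) (S : List ℕ) (σ : Store) : Frame b S σ σ :=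
  ⟨fun _ _ => rfl, fun _ _ => rfl⟩

theorem Frame.trans {b b' : ℕ} {S S' : List ℕ} {σ σ' σ'' : Store} (h : Frame b S σ σ')
    (h' : Frame b' S' σ' σ'') (hb : b ≤ b') (hS : S' ⊆ S) : Frame b S σ σ'' :=
  ⟨fun r hr => (h'.reg r (by omega)).trans (h.reg r hr),
    fun s hs => (h'.mem s fun hc => hs (hS hc)).trans (h.mem s hs)⟩

theorem Frame.weaken {b b' : ℕ} {S S' : List ℕ} {σ σ' : Store} (h : Frame b' S' σ σ')
    (hb : b ≤ b') (hS : S' ⊆ S) : Frame b S σ σ' := (Frame.refl b S σ).trans h hb hS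

@[simp] theorem frame_setReg_iff {b : ℕ} {S : List ℕ} {σ σ' : Store} {x : ℕ} {a : ℤ}
    (hx : b ≤ x) : Frame b S σ (σ'.setReg x a) ↔ Frame b S σ σ' := by
  refine ⟨fun h => ⟨fun r hr => ?_, h.mem⟩, fun h => ⟨fun r hr => ?_, h.mem⟩⟩
  · have := h.reg r hr
    rwa [Store.reg_setReg, if_neg (by omega)] at this
  · rw [Store.reg_setReg, if_neg (by omega), h.reg r hr]

@[simp] theorem frame_setMem_iff {b : ℕ} {S : List ℕ} {σ σ' : Store} {s : ℕ} {p a : ℤ}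
    (hs : s ∈ S) : Frame b S σ (σ'.setMem s p a) ↔ Frame b S σ σ' := by
  have hne : ∀ s', s' ∉ S → s' ≠ s := fun s' hs' hc => hs' (by rw [hc]; exact hs)
  refine ⟨fun h => ⟨h.reg, fun s' hs' => ?_⟩, fun h => ⟨h.reg, fun s' hs' => ?_⟩⟩
  · rw [← h.mem s' hs', Store.mem_setMem_of_ne _ _ _ _ (hne s' hs')]
  · rw [Store.mem_setMem_of_ne _ _ _ _ (hne s' hs'), h.mem s' hs']

/-- The loop `for i = 0, …, b - 1`, with auxiliary register `t`; register `3` holds `1`. -/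
def forUp (i b t : ℕ) (p : Program) : Program :=
  .seq (.const i 0) (.seq (.sub t b i)
    (.whilePos t (.seq p (.seq (.add i i 3) (.sub t b i)))))

/-- The hypothesis `hcl` says that the invariant does not look at the counter and at the auxiliary
register, which the loop itself overwrites. The overhead of three steps per round consists of the
test, the increment and the new difference. -/
theorem Runs.forUp {w : ℤ} {p : Program} {σ₀ σ : Store} {i b t r : ℕ} {S : List ℕ} {n : ℕ}
    (c : ℕ) (Inv : ℕ → Store → Prop) (hr : 3 < r) (hi : r ≤ i) (ht : r ≤ t) (hit : i ≠ t)
    (hb : b < r) (hbn : σ₀.reg b = n) (h3 : σ₀.reg 3 = 1) (hnw : (n : ℤ) ≤ w)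
    (hF : Frame r S σ₀ σ) (h0 : Inv 0 σ)
    (hcl : ∀ k σ v v', Inv k σ → Inv k ((σ.setReg i v).setReg t v'))
    (hbody : ∀ k < n, ∀ σ, Frame r S σ₀ σ → Inv k σ → σ.reg i = k →
      Runs w p σ c (fun σ' => Frame r S σ₀ σ' ∧ Inv (k + 1) σ' ∧ σ'.reg i = k)) :
    Runs w (forUp i b t p) σ ((c + 3) * n + 3) (fun σ' => Frame r S σ₀ σ' ∧ Inv n σ') := by
  have hib : b ≠ i := by omega
  have hbt : b ≠ t := by omega
  have hi3 : 3 ≠ i := by omega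
  have ht3 : 3 ≠ t := by omega
  have hw0 : (0 : ℤ) ≤ w := by omega
  have hinit : Runs w (.seq (.const i 0) (.sub t b i)) σ 2
      (fun σ' => Frame r S σ₀ σ' ∧ Inv 0 σ' ∧ σ'.reg i = 0 ∧ σ'.reg t = n) := by
    refine Runs.of_wp (by simp [cost]) ?_
    have hb' : σ.reg b = n := by rw [hF.reg b hb, hbn]
    simp only [wp, Store.reg_setReg, if_true, hib, hit, if_false, hb', sub_zero, abs_zero,
      Nat.abs_cast]
    exact ⟨hw0, hnw, (frame_setReg_iff ht).mpr ((frame_setReg_iff hi).mpr hF), hcl _ _ _ _ h0,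
        trivial, trivial⟩
  have hloop : ∀ σ', (Frame r S σ₀ σ' ∧ Inv 0 σ' ∧ σ'.reg i = 0 ∧ σ'.reg t = n) →
      Runs w (.whilePos t (.seq p (.seq (.add i i 3) (.sub t b i)))) σ' ((c + 2 + 1) * n + 1)
        (fun σ' => Frame r S σ₀ σ' ∧ Inv n σ') := by
    intro σ' ⟨g1, g2, g3, g4⟩
    have := Runs.whilePos (w := w) (p := .seq p (.seq (.add i i 3) (.sub t b i))) (x := t)
      (σ := σ') (c + 2)
      (fun σ => ∃ k, k ≤ n ∧ Frame r S σ₀ σ ∧ Inv k σ ∧ σ.reg i = k ∧ σ.reg t = (n : ℤ) - k)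
      (fun σ => (σ.reg t).toNat) ⟨0, by omega, g1, g2, by simpa using g3, by simpa using g4⟩ ?_
    · rw [g4, Int.toNat_natCast] at this
      refine this.mono le_rfl ?_
      rintro σ'' ⟨⟨k, hk, f1, f2, f3, f4⟩, f5⟩
      have : k = n := by omega
      exact ⟨f1, this ▸ f2⟩
    · rintro σ₁ ⟨k, hk, f1, f2, f3, f4⟩ f5
      refine (hbody k (by omega) σ₁ f1 f2 f3).seq (T₂ := 2) ?_
      rintro σ₂ ⟨e1, e2, e3⟩
      refine Runs.of_wp (by simp [cost]) ?_
      have hb' : σ₂.reg b = n := by rw [e1.reg b hb, hbn]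
      have h3' : σ₂.reg 3 = 1 := by rw [e1.reg 3 hr, h3]
      simp only [wp, Store.reg_setReg, if_true, hib, hit, if_false, hb', h3', e3, f4]
      refine ⟨by rw [abs_le]; omega, by rw [abs_le]; omega, ⟨k + 1, by omega,
        (frame_setReg_iff ht).mpr ((frame_setReg_iff hi).mpr e1), hcl _ _ _ _ e2,
            by push_cast; rfl, by push_cast; rfl⟩, by omega⟩
  -- The program brackets its three parts in the other way, so the execution is taken apart and put
  -- together again.
  have hkey := hinit.seq hloop
  obtain ⟨t', σ', h1, h2, h3'⟩ := hkey
  cases h1 with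
  | seq _ _ _ σ₁ _ t₁ t₂ h1 h4 =>
    cases h1 with
    | seq _ _ _ σ₂ _ t₃ t₄ h5 h6 =>
      exact ⟨t₃ + (t₄ + t₂), σ', .seq _ _ _ _ _ _ _ h5 (.seq _ _ _ _ _ _ _ h6 h4),
        by linarith, h3'⟩

/-- Sequential composition of a list of programs. -/
def block : List Program → Program
  | [] => .skip
  | [p] => p
  | p :: l => .seq p (block l)

/-! ## The accumulator -/

/-- Clear the accumulator. -/
def clearAcc : Program := forUp 30 4 31 (.seq (.const 32 0) (.store 14 30 32))

theorem runs_clearAcc {w : ℤ} {σ : Store} {N : ℕ} (h4 : σ.reg 4 = N) (h3 : σ.reg 3 = 1)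
    (hN : (N : ℤ) ≤ w) :
    Runs w clearAcc σ (5 * N + 3)
      (fun σ' => Frame 30 [14] σ σ' ∧ ∀ j < N, σ'.mem 14 (j : ℤ) = 0) := by
  refine Runs.forUp (σ₀ := σ) (r := 30) 2 (fun k σ' => ∀ j < k, σ'.mem 14 (j : ℤ) = 0)
    (by decide) (by decide) (by decide) (by decide) (by decide) h4 h3 hN (Frame.refl _ _ _)
    (by simp) (fun k σ v v' h => h) ?_
  intro k hk σ' hF hI hi
  refine Runs.of_wp (by decide) ?_
  simp [wp, hi, hF]
  exact ⟨by omega, fun j hj h => hI j (by omega)⟩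

/-- Add the terms of a marking in segment `s`, starting at the position in register `12`. -/
def addMarking (s : ℕ) : Program :=
  .seq (.move 33 12) (forUp 30 0 31 (block [.load 34 19 30, .load 35 s 33, .load 36 14 34,
    .add 36 36 35, .store 14 34 36, .add 33 33 3]))

/-- The map `π` need not be injective: nodes of the given circuit with equal values share a new
node, and their digits are added in its cell. After `k` terms a cell is bounded by `k * K`. -/
theorem runs_addMarking {w : ℤ} {σ : Store} {N n s K : ℕ} {base : ℕ} {π : ℕ → ℕ} {f : ℕ → ℤ}
    (hs : s ≠ 14) (h0 : σ.reg 0 = n) (h3 : σ.reg 3 = 1) (h12 : σ.reg 12 = base)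
    (hπ : ∀ v < n, σ.mem 19 (v : ℤ) = π v) (hf : ∀ v < n, σ.mem s ((base : ℤ) + v) = f v)
    (hfK : ∀ v < n, |f v| ≤ K) (hπN : ∀ v < n, π v < N)
    (hacc : ∀ a < N, σ.mem 14 (a : ℤ) = 0)
    (hw : (n : ℤ) * K + n + base ≤ w) :
    Runs w (addMarking s) σ (9 * n + 4) (fun σ' => Frame 30 [14] σ σ' ∧
      ∀ a < N, σ'.mem 14 (a : ℤ) = ∑ v ∈ Finset.range n, if π v = a then f v else 0) := by
  have hK : (0 : ℤ) ≤ (n : ℤ) * K := by positivity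
  have hT : 9 * n + 4 = 1 + (9 * n + 3) := by omega
  rw [hT]
  refine Runs.seq (R := fun σ' => Frame 30 [14] σ σ' ∧ σ'.reg 33 = base ∧ σ'.mem = σ.mem)
    (Runs.of_wp (by decide) ?_) ?_
  · simp [wp, Store.reg_setReg, Store.mem_setReg, h12]
  rintro σ₁ ⟨g1, g2, g3⟩
  refine (Runs.forUp (σ₀ := σ) (r := 30) (S := [14]) (n := n) 6 (fun k σ' => σ'.reg 33 =
      (base : ℤ) + k ∧
    ∀ a < N, σ'.mem 14 (a : ℤ) = ∑ v ∈ Finset.range k, if π v = a then f v else 0)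
    (by decide) (by decide) (by decide) (by decide) (by decide) h0 h3 (by omega) g1
    (by simp [g2, g3]; exact hacc) (fun k σ v v' h => by simpa using h) ?_).mono
    (by omega) (fun σ' h => ⟨h.1, h.2.2⟩)
  rintro k hk σ' hF ⟨hI1, hI2⟩ hi
  refine Runs.of_wp (by simp [block, cost]) ?_
  have m19 : σ'.mem 19 (k : ℤ) = π k := by rw [hF.mem 19 (by decide), hπ k hk]
  have ms : σ'.mem s ((base : ℤ) + k) = f k := by rw [hF.mem s (by simpa using hs), hf k hk]
  have h3' : σ'.reg 3 = 1 := by rw [hF.reg 3 (by decide), h3]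
  have hsum : |(∑ v ∈ Finset.range k, if π v = π k then f v else 0)| ≤ (k : ℤ) * K := by
    refine (Finset.abs_sum_le_sum_abs _ _).trans ?_
    refine (Finset.sum_le_card_nsmul _ _ (K : ℤ) fun v hv => ?_).trans (by simp)
    have := hfK v (by have := Finset.mem_range.mp hv; omega)
    split_ifs
    · exact this
    · simp
  have hkK : ((k : ℤ) + 1) * K ≤ n * K := mul_le_mul_of_nonneg_right (by omega) (by positivity)
  have hfk := hfK k hk
  simp [block, wp, hi, hF,
    m19, hI1, ms, h3', hI2 _ (hπN k hk), Finset.sum_range_succ]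
  refine ⟨?_, ?_, by ring, ?_⟩
  · rw [abs_le] at *; constructor <;> linarith
  · rw [abs_le]; constructor <;> linarith
  · intro a ha
    by_cases h : a = π k
    · subst h; simp
    · rw [if_neg h, hI2 a ha, if_neg (fun hc => h hc.symm), add_zero]

/-- Load the row of the node in register `26`, and add register `27` at the node `0`. -/
def loadAcc : Program :=
  .seq (.load 33 13 26) (.seq (forUp 30 4 31 (block [.add 34 33 30, .load 35 12 34,
    .store 14 30 35])) (block [.const 34 0, .load 35 14 34, .add 35 35 27, .store 14 34 35]))

theorem runs_loadAcc {w : ℤ} {σ : Store} {N L id : ℕ} {row : ℕ → ℤ} (h4 : σ.reg 4 = N)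
    (h3 : σ.reg 3 = 1) (hN : 0 < N) (h26 : σ.reg 26 = id) (hid : σ.mem 13 (id : ℤ) = (id : ℤ) * L)
    (hrow : ∀ a < N, σ.mem 12 ((id : ℤ) * L + a) = row a)
    (hw : (id : ℤ) * L + N ≤ w) (hw0 : |row 0 + σ.reg 27| ≤ w) :
    Runs w loadAcc σ (6 * N + 8) (fun σ' => Frame 30 [14] σ σ' ∧
      ∀ a < N, σ'.mem 14 (a : ℤ) = row a + if a = 0 then σ.reg 27 else 0) := by
  have hp : (0 : ℤ) ≤ (id : ℤ) * L := by positivity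
  have hT : 6 * N + 8 = 1 + ((6 * N + 3) + 4) := by omega
  rw [hT]
  refine Runs.seq (R := fun σ' => Frame 30 [14] σ σ' ∧ σ'.reg 33 = (id : ℤ) * L)
    (Runs.of_wp (by decide) ?_) ?_
  · simp [wp, Store.reg_setReg, h26, hid]
  rintro σ₁ ⟨g1, g2⟩
  refine Runs.seq (R := fun σ' => Frame 30 [14] σ σ' ∧ ∀ a < N, σ'.mem 14 (a : ℤ) = row a) ?_ ?_
  · refine (Runs.forUp (σ₀ := σ) (r := 30) (S := [14]) (n := N) 3 (fun k σ' => σ'.reg 33 =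
        (id : ℤ) * L ∧
      ∀ a < k, σ'.mem 14 (a : ℤ) = row a)
      (by decide) (by decide) (by decide) (by decide) (by decide) h4 h3 (by omega) g1
      (by simp [g2]) (fun k σ v v' h => by simpa using h) ?_).mono
      (by omega) (fun σ' h => ⟨h.1, h.2.2⟩)
    rintro k hk σ' hF ⟨hI1, hI2⟩ hi
    refine Runs.of_wp (by simp [block, cost]) ?_
    have ms : σ'.mem 12 ((id : ℤ) * L + k) = row k := by rw [hF.mem 12 (by decide), hrow k hk]
    simp [block, wp, hi, hF, hI1, ms]
    refine ⟨?_, ?_⟩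
    · rw [abs_le]; constructor <;> linarith
    · intro a ha
      split_ifs with h
      · rw [h]
      · exact hI2 a (by omega)
  · rintro σ' ⟨hF, hI⟩
    refine Runs.of_wp (by simp [block, cost]) ?_
    have h27 : σ'.reg 27 = σ.reg 27 := hF.reg 27 (by decide)
    have m0 := hI 0 hN
    simp only [Nat.cast_zero] at m0
    simp [block, wp, m0, h27, hF]
    refine ⟨by omega, hw0, ?_⟩
    intro a ha
    split_ifs with h
    · rw [h]
    · rw [hI a ha, add_zero]

end PowerCircuits

open scoped BigOperators
namespace PowerCircuits

/-! ## The representation of the nodes -/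

/-- The storage represents the nodes `0, …, N - 1` with exponents `e`, where `ord` lists the nodes
by increasing exponent. -/
structure Repr (q L N : ℕ) (e ord : ℕ → ℕ) (σ : Store) : Prop where
  pos : 0 < N
  ord_lt : ∀ i < N, ord i < N
  mono : ∀ i k, i < k → k < N → e (ord i) < e (ord k)
  surj : ∀ a < N, ∃ i < N, ord i = a
  zero : e 0 = 0
  hasCd : ∀ a < N, HasCd q (e a)
  supp : ∀ a < N, ∀ m, cd q (e a) m ≠ 0 → ∃ b < N, e b = m
  one : σ.reg 3 = 1
  num : σ.reg 4 = N
  ordm : ∀ i < N, σ.mem 10 (i : ℤ) = ord i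
  next : ∀ a < N, ∀ b < N, e b = e a + 1 → σ.mem 11 (a : ℤ) = b
  -- The number `0` can stand for a missing successor, because the node `0` has exponent `0` and is
  -- never one above another node.
  no_next : ∀ a < N, (∀ b < N, e b ≠ e a + 1) → σ.mem 11 (a : ℤ) = 0
  rows : ∀ a < N, ∀ b < N, σ.mem 12 ((a : ℤ) * L + b) = cd q (e a) (e b)
  -- Columns of future nodes are kept at `0`. When a node is created, its column is then already
  -- correct, since no older exponent has a non-zero digit there.
  rows_zero : ∀ a < L, ∀ b < L, N ≤ b → σ.mem 12 ((a : ℤ) * L + b) = 0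
  -- The rows have the fixed length `L`, whatever the current number of nodes. Their positions are
  -- tabulated because the machine cannot multiply.
  mul : ∀ a < L, σ.mem 13 (a : ℤ) = (a : ℤ) * L

variable {q L N : ℕ} {e ord : ℕ → ℕ} {σ : Store}

theorem Repr.frame {σ' : Store} (R : Repr q L N e ord σ) {b : ℕ} {S : List ℕ}
    (hF : Frame b S σ σ') (hb : 5 ≤ b) (hS : 10 ∉ S ∧ 11 ∉ S ∧ 12 ∉ S ∧ 13 ∉ S) :
    Repr q L N e ord σ' where
  pos := R.pos
  ord_lt := R.ord_lt
  mono := R.mono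
  surj := R.surj
  zero := R.zero
  hasCd := R.hasCd
  supp := R.supp
  one := by rw [hF.reg 3 (by omega), R.one]
  num := by rw [hF.reg 4 (by omega), R.num]
  ordm := by rw [hF.mem 10 hS.1]; exact R.ordm
  next := by rw [hF.mem 11 hS.2.1]; exact R.next
  no_next := by rw [hF.mem 11 hS.2.1]; exact R.no_next
  rows := by rw [hF.mem 12 hS.2.2.1]; exact R.rows
  rows_zero := by rw [hF.mem 12 hS.2.2.1]; exact R.rows_zero
  mul := by rw [hF.mem 13 hS.2.2.2]; exact R.mul

theorem Repr.ord_inj (R : Repr q L N e ord σ) {i k : ℕ} (hi : i < N) (hk : k < N)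
    (h : ord i = ord k) : i = k := by
  rcases lt_trichotomy i k with h1 | h1 | h1
  · have := R.mono i k h1 hk; rw [h] at this; omega
  · exact h1
  · have := R.mono k i h1 hi; rw [h] at this; omega

theorem Repr.e_inj (R : Repr q L N e ord σ) {a b : ℕ} (ha : a < N) (hb : b < N)
    (h : e a = e b) : a = b := by
  obtain ⟨i, hi, rfl⟩ := R.surj a ha
  obtain ⟨k, hk, rfl⟩ := R.surj b hb
  rcases lt_trichotomy i k with h1 | h1 | h1
  · have := R.mono i k h1 hk; omega
  · rw [h1]
  · have := R.mono k i h1 hi; omega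

theorem Repr.lt_of_e_lt (R : Repr q L N e ord σ) {i k : ℕ} (hi : i < N)
    (h : e (ord i) < e (ord k)) : i < k := by
  rcases lt_trichotomy i k with h1 | h1 | h1
  · exact h1
  · subst h1; omega
  · have := R.mono k i h1 hi; omega

theorem Repr.next_pos_iff (R : Repr q L N e ord σ) {a : ℕ} (ha : a < N) :
    0 < σ.mem 11 (a : ℤ) ↔ ∃ b < N, e b = e a + 1 := by
  constructor
  · intro h
    by_contra hc
    push Not at hc
    rw [R.no_next a ha hc] at h
    omega
  · rintro ⟨b, hb, hbe⟩
    rw [R.next a ha b hb hbe]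
    have : b ≠ 0 := by rintro rfl; rw [R.zero] at hbe; omega
    omega

theorem Repr.next_ord_iff (R : Repr q L N e ord σ) {i : ℕ} (hi : i < N) :
    0 < σ.mem 11 (ord i : ℤ) ↔ i + 1 < N ∧ e (ord (i + 1)) = e (ord i) + 1 := by
  rw [R.next_pos_iff (R.ord_lt i hi)]
  constructor
  · rintro ⟨b, hb, hbe⟩
    obtain ⟨k, hk, rfl⟩ := R.surj b hb
    have h1 : i < k := R.lt_of_e_lt hi (by omega)
    have h2 : k = i + 1 := by
      by_contra hc
      have h3 : i + 1 < k := by omega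
      have := R.mono i (i + 1) (by omega) (by omega)
      have := R.mono (i + 1) k h3 hk
      omega
    subst h2
    exact ⟨hk, hbe⟩
  · rintro ⟨h1, h2⟩
    exact ⟨_, R.ord_lt _ h1, h2⟩

/-- The tables for the division by `q`. -/
def DivTable (q B : ℕ) (σ : Store) : Prop :=
  ∀ a : ℤ, |a| ≤ B → σ.mem 17 a = a / q ∧ σ.mem 18 a = a % q

theorem DivTable.frame {B : ℕ} {σ' : Store} (D : DivTable q B σ) {b : ℕ} {S : List ℕ}
    (hF : Frame b S σ σ') (hS : 17 ∉ S ∧ 18 ∉ S) : DivTable q B σ' := by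
  unfold DivTable
  rw [hF.mem 17 hS.1, hF.mem 18 hS.2]
  exact D

/-- A coefficient plus a carry is at most `2 * B`, and division by `q ≥ 2` brings it back to `B`.
Therefore a division table for arguments up to `2 * B` suffices. -/
theorem abs_carryLo_le (hq : 2 ≤ q) {A : ℕ → ℤ} {bit : ℕ → Prop} {B : ℕ}
    (i : ℕ) (hA : ∀ k < i, |A k| ≤ B) : |carryLo q A bit i| ≤ B := by
  induction i with
  | zero => simp [carryLo]
  | succ i ih =>
    have ih := ih fun k hk => hA k (by omega)
    have h1 := hA i (by omega)
    rw [carryLo]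
    split_ifs
    · rw [abs_le] at *
      have hq' : (2 : ℤ) ≤ q := by exact_mod_cast hq
      constructor
      · rw [Int.le_ediv_iff_mul_le (by omega)]
        nlinarith
      · have : (A i + carryLo q A bit i) / q < B + 1 := by
          rw [Int.ediv_lt_iff_lt_mul (by omega)]
          nlinarith
        omega
    · simp

/-! ## Normalisation of the accumulator -/

/-- First pass: division with remainder. -/
def normFirst : Program :=
  .seq (.const 33 0) (forUp 30 4 31 (block [.load 34 10 30, .load 35 14 34, .add 35 35 33,
    .load 36 18 35, .store 15 30 36, .load 36 17 35, .load 37 11 34,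
    .ifPos 37 (.move 33 36) (.seq (.store 16 30 36) (.const 33 0))]))

/-- Segment `15` receives the residues. Segment `16` receives the quotient only at the tops of
chains, where it is not passed on as a carry; the second pass replaces it by the choice of the sign.
-/
theorem runs_normFirst {w : ℤ} (hq : 2 ≤ q) (R : Repr q L N e ord σ) {B : ℕ}
    (D : DivTable q (2 * B) σ) {A : ℕ → ℤ} {bit : ℕ → Prop}
    (hA : ∀ i < N, σ.mem 14 (ord i : ℤ) = A i) (hAB : ∀ i < N, |A i| ≤ B)
    (hbit : ∀ i < N, 0 < σ.mem 11 (ord i : ℤ) ↔ bit i) (hw : 2 * (B : ℤ) + N ≤ w) :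
    Runs w normFirst σ (13 * N + 4) (fun σ' => Frame 30 [15, 16] σ σ' ∧
      (∀ i < N, σ'.mem 15 (i : ℤ) = (A i + carryLo q A bit i) % q) ∧
      ∀ i < N, ¬ bit i → σ'.mem 16 (i : ℤ) = (A i + carryLo q A bit i) / q) := by
  have hT : 13 * N + 4 = 1 + (13 * N + 3) := by omega
  rw [hT]
  refine Runs.seq (R := fun σ' => Frame 30 [15, 16] σ σ' ∧ σ'.reg 33 = 0)
    (Runs.of_wp (by decide) ?_) ?_
  · simp [wp]; omega
  rintro σ₁ ⟨g1, g2⟩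
  refine (Runs.forUp (σ₀ := σ) (r := 30) (S := [15, 16]) (n := N) 10 (fun k σ' =>
    σ'.reg 33 = carryLo q A bit k ∧
    (∀ i < k, σ'.mem 15 (i : ℤ) = (A i + carryLo q A bit i) % q) ∧
    ∀ i < k, ¬ bit i → σ'.mem 16 (i : ℤ) = (A i + carryLo q A bit i) / q)
    (by decide) (by decide) (by decide) (by decide) (by decide) R.num R.one (by omega) g1
    (by simp [g2, carryLo]) (fun k σ v v' h => by simpa using h) ?_).mono
    (by omega) (fun σ' h => ⟨h.1, h.2.2⟩)
  rintro k hk σ' hF ⟨hI1, hI2, hI3⟩ hi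
  refine Runs.of_wp (by simp [block, cost]) ?_
  have m10 : σ'.mem 10 (k : ℤ) = ord k := by rw [hF.mem 10 (by decide), R.ordm k hk]
  have m14 : σ'.mem 14 (ord k : ℤ) = A k := by rw [hF.mem 14 (by decide), hA k hk]
  have m11 : 0 < σ'.mem 11 (ord k : ℤ) ↔ bit k := by rw [hF.mem 11 (by decide), hbit k hk]
  have hc := abs_carryLo_le (bit := bit) hq k fun i hi => hAB i (by omega)
  have hAk := hAB k hk
  have hsum : |A k + carryLo q A bit k| ≤ (2 * B : ℕ) := by
    rw [abs_le] at *; push_cast; constructor <;> linarith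
  have hD := D _ hsum
  rw [← hF.mem 17 (by decide), ← hF.mem 18 (by decide)] at hD
  simp [block, wp, hi, hF, m10, m14, hI1, hD.1, hD.2]
  refine ⟨by push_cast at hsum; omega, fun hpos => ?_, fun hneg => ⟨by omega, ?_⟩⟩
  · have hb := m11.mp hpos
    refine ⟨by simp [carryLo, hb], fun i hi => ?_, fun i hi hbi => hI3 i ?_ hbi⟩
    · split_ifs with h
      · rw [h]
      · exact hI2 i (by omega)
    · rcases hi.lt_or_eq with h | h
      · exact h
      · exact absurd (h ▸ hb) hbi
  · have hb : ¬ bit k := fun hc => by have := m11.mpr hc; omega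
    refine ⟨by simp [carryLo, hb], fun i hi => ?_, fun i hi hbi => ?_⟩
    · split_ifs with h
      · rw [h]
      · exact hI2 i (by omega)
    · split_ifs with h
      · rw [h]
      · exact hI3 i (by omega) hbi

/-- Second pass: the choice between the two representatives of a residue class, from the highest
exponent downwards. -/
def normSecond (q : ℕ) : Program :=
  -- This initial value is never read, since the highest node has no node above it in its chain.
  .seq (.const 33 1) (forUp 30 4 31 (block [.sub 34 4 30, .sub 34 34 3, .load 35 10 34,
    .load 36 11 35, .load 37 15 34,
    .ifPos 36 (.move 38 33) (.seq (.load 39 16 34) (.seq (.add 39 39 3)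
      (.ifPos 39 (.const 38 1) (.const 38 0)))),
    .store 16 34 38,
    -- The test whether the residue minus `q - 2` is positive singles out the residue `q - 1`.
    -- Register `33` afterwards tells whether the node below may have a positive digit.
    .ifPos 37 (.seq (.const 39 ((q : ℤ) - 2)) (.seq (.sub 39 37 39)
      (.ifPos 39 (.const 33 0) (.move 33 38)))) (.const 33 1)]))

open Classical in
theorem runs_normSecond {w : ℤ} (hq : 2 ≤ q) (R : Repr q L N e ord σ) {B : ℕ}
    {x κ : ℕ → ℤ} {bit : ℕ → Prop}
    (hbit : ∀ i < N, 0 < σ.mem 11 (ord i : ℤ) ↔ bit i) (hbitN : ∀ i, bit i → i + 1 < N)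
    (hx : ∀ i < N, σ.mem 15 (i : ℤ) = x i) (hκ : ∀ i < N, ¬ bit i → σ.mem 16 (i : ℤ) = κ i)
    (hx0 : ∀ i < N, 0 ≤ x i ∧ x i < q) (hκB : ∀ i < N, ¬ bit i → |κ i| ≤ B)
    (hw : 2 * (B : ℤ) + N + q + 2 ≤ w) :
    Runs w (normSecond q) σ (19 * N + 4) (fun σ' => Frame 30 [16] σ σ' ∧
      ∀ i < N, (σ'.mem 16 (i : ℤ) = 0 ∨ σ'.mem 16 (i : ℤ) = 1) ∧ (σ'.mem 16 (i : ℤ) = 1 ↔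
        if bit i then x (i + 1) = 0 ∨ x (i + 1) ≠ q - 1 ∧ σ'.mem 16 ((i + 1 : ℕ) : ℤ) = 1
        else 0 ≤ κ i)) := by
  have hq' : (2 : ℤ) ≤ q := by exact_mod_cast hq
  have hT : 19 * N + 4 = 1 + (19 * N + 3) := by omega
  rw [hT]
  refine Runs.seq (R := fun σ' => Frame 30 [16] σ σ' ∧ σ'.mem = σ.mem)
    (Runs.of_wp (by decide) ?_) ?_
  · simp [wp]; omega
  rintro σ₁ ⟨g1, g2⟩
  -- After `k` rounds the positions from `N - k` on carry their choices, the tops of chains below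
  -- still carry their quotients, and register `33` tells whether position `N - k` tolerates a
  -- positive digit below it.
  obtain ⟨Inv, hInv⟩ : ∃ Inv : ℕ → Store → Prop, ∀ k σ', Inv k σ' ↔
      ((0 < k → (σ'.reg 33 = 0 ∨ σ'.reg 33 = 1) ∧
        (σ'.reg 33 = 1 ↔ x (N - k) = 0 ∨ x (N - k) ≠ q - 1 ∧ σ'.mem 16 ((N - k : ℕ) : ℤ) = 1)) ∧
      (∀ i, i + k < N → ¬bit i → σ'.mem 16 (i : ℤ) = κ i) ∧
      ∀ i < N, N ≤ i + k → (σ'.mem 16 (i : ℤ) = 0 ∨ σ'.mem 16 (i : ℤ) = 1) ∧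
        (σ'.mem 16 (i : ℤ) = 1 ↔
          if bit i then x (i + 1) = 0 ∨ x (i + 1) ≠ q - 1 ∧ σ'.mem 16 ((i + 1 : ℕ) : ℤ) = 1
          else 0 ≤ κ i)) := ⟨_, fun _ _ => Iff.rfl⟩
  refine (Runs.forUp (σ₀ := σ) (r := 30) (S := [16]) (n := N) 16 Inv
    (by decide) (by decide) (by decide) (by decide) (by decide) R.num R.one (by omega) g1
    ((hInv _ _).mpr ⟨by simp, by simpa [g2] using hκ, fun i h1 h2 => by omega⟩)
    (fun k σ v v' h => by rw [hInv] at h ⊢; simpa using h) ?_).mono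
    (by omega) (fun σ' h => ⟨h.1, fun i hi => ((hInv _ _).mp h.2).2.2 i hi (by omega)⟩)
  rintro k hk σ' hF hI hi
  obtain ⟨hI1, hI2, hI3⟩ := (hInv _ _).mp hI
  refine Runs.of_wp (by simp [block, cost]) ?_
  obtain ⟨j, hj⟩ : ∃ j, j + (k + 1) = N := ⟨N - (k + 1), by omega⟩
  have hjN : N - (k + 1) = j := by omega
  have hidx : (N : ℤ) - k - 1 = (j : ℕ) := by omega
  have m3 : σ'.reg 3 = 1 := by rw [hF.reg 3 (by decide), R.one]
  have m4 : σ'.reg 4 = N := by rw [hF.reg 4 (by decide), R.num]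
  have m10 : σ'.mem 10 (j : ℤ) = ord j := by rw [hF.mem 10 (by decide), R.ordm j (by omega)]
  have m15 : σ'.mem 15 (j : ℤ) = x j := by rw [hF.mem 15 (by decide), hx j (by omega)]
  have m11 : 0 < σ'.mem 11 (ord j : ℤ) ↔ bit j := by rw [hF.mem 11 (by decide), hbit j (by omega)]
  have hxj := hx0 j (by omega)
  -- the new value of the cell `j`
  have key : ∀ (v u : ℤ) (τ : Store), (v = 0 ∨ v = 1) →
      (v = 1 ↔ if bit j then x (j + 1) = 0 ∨ x (j + 1) ≠ q - 1 ∧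
        σ'.mem 16 ((j + 1 : ℕ) : ℤ) = 1 else 0 ≤ κ j) →
      (u = 0 ∨ u = 1) → (u = 1 ↔ x j = 0 ∨ x j ≠ q - 1 ∧ v = 1) →
      τ.reg 33 = u → (∀ i : ℕ, τ.mem 16 (i : ℤ) = if i = j then v else σ'.mem 16 (i : ℤ)) →
      Inv (k + 1) τ := by
    intro v u τ hv1 hv2 hu1 hu2 ht1 ht2
    rw [hInv]
    refine ⟨fun _ => ?_, fun i hi hbi => ?_, fun i hi hik => ?_⟩
    · rw [hjN, ht1, ht2, if_pos rfl]; exact ⟨hu1, hu2⟩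
    · rw [ht2, if_neg (by omega)]; exact hI2 i (by omega) hbi
    · have e1 := ht2 i
      have e2 := ht2 (i + 1)
      by_cases hij : i = j
      · subst hij
        rw [if_pos rfl] at e1
        rw [if_neg (by omega)] at e2
        rw [e1, e2]
        exact ⟨hv1, hv2⟩
      · rw [if_neg hij] at e1
        rw [if_neg (by omega)] at e2
        rw [e1, e2]
        exact hI3 i hi (by omega)
  simp only [block, wp, Store.reg_setReg, Store.mem_setReg, Store.reg_setMem, hi, m3, m4, hidx, m10,
    m15, Nat.reduceEqDiff, reduceIte]
  refine ⟨by rw [abs_le]; omega, by rw [abs_le]; omega, fun hb => ?_, fun hb => ?_⟩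
  · have hbj := m11.mp hb
    have hj1 := hbitN j hbj
    have hk0 : 0 < k := by omega
    obtain ⟨p1, p2⟩ := hI1 hk0
    have hNk : N - k = j + 1 := by omega
    rw [hNk] at p2
    have hrel : σ'.reg 33 = 1 ↔ if bit j then x (j + 1) = 0 ∨ x (j + 1) ≠ q - 1 ∧
        σ'.mem 16 ((j + 1 : ℕ) : ℤ) = 1 else 0 ≤ κ j := by rw [if_pos hbj]; exact p2
    refine ⟨fun hx1 => ⟨by rw [abs_le]; omega, by rw [abs_le]; omega,
        fun h => ⟨by rw [abs_le]; omega, ?_⟩,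
      fun h => ?_⟩, fun hx1 => ⟨by rw [abs_le]; omega, ?_⟩⟩
    · refine ⟨by simp [hF],
        key (σ'.reg 33) 0 _ p1 hrel (by simp) ?_ (by simp) (by simp), by simp⟩
      constructor <;> intro h' <;> omega
    · refine ⟨by simp [hF],
        key (σ'.reg 33) (σ'.reg 33) _ p1 hrel p1 ?_ (by simp) (by simp),
        by simp⟩
      constructor <;> intro h' <;> omega
    · refine ⟨by simp [hF],
        key (σ'.reg 33) 1 _ p1 hrel (by simp) ?_ (by simp) (by simp),
        by simp⟩
      constructor <;> intro h' <;> omega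
  · have hbj : ¬ bit j := fun hc => hb (m11.mpr hc)
    have m16 : σ'.mem 16 (j : ℤ) = κ j := hI2 j (by omega) hbj
    have hκj := hκB j (by omega) hbj
    rw [abs_le] at hκj
    have hrel : ∀ v : ℤ, (v = 1 ↔ 0 ≤ κ j) → (v = 1 ↔ if bit j then x (j + 1) = 0 ∨
        x (j + 1) ≠ q - 1 ∧ σ'.mem 16 ((j + 1 : ℕ) : ℤ) = 1 else 0 ≤ κ j) := fun v hv => by
      rw [if_neg hbj]; exact hv
    simp only [m16]
    refine ⟨by rw [abs_le]; omega, fun hp => ⟨by rw [abs_le]; omega, ?_⟩,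
        fun hp => ⟨by rw [abs_le]; omega, ?_⟩⟩
    · refine ⟨fun hx1 => ⟨by rw [abs_le]; omega, by rw [abs_le]; omega,
        fun h => ⟨by rw [abs_le]; omega, ?_⟩, fun h => ?_⟩, fun hx1 => ⟨by rw [abs_le]; omega, ?_⟩⟩
      · refine ⟨by simp [hF],
        key 1 0 _ (by simp) (hrel _ (by omega)) (by simp) ?_ (by simp) (by simp), by simp⟩
        constructor <;> intro h' <;> omega
      · refine ⟨by simp [hF],
        key 1 1 _ (by simp) (hrel _ (by omega)) (by simp) ?_ (by simp) (by simp), by simp⟩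
        constructor <;> intro h' <;> omega
      · refine ⟨by simp [hF],
        key 1 1 _ (by simp) (hrel _ (by omega)) (by simp) ?_ (by simp) (by simp), by simp⟩
        constructor <;> intro h' <;> omega
    · refine ⟨fun hx1 => ⟨by rw [abs_le]; omega, by rw [abs_le]; omega,
        fun h => ⟨by rw [abs_le]; omega, ?_⟩, fun h => ?_⟩, fun hx1 => ⟨by rw [abs_le]; omega, ?_⟩⟩
      · refine ⟨by simp [hF],
        key 0 0 _ (by simp) (hrel _ (by omega)) (by simp) ?_ (by simp) (by simp), by simp⟩
        constructor <;> intro h' <;> omega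
      · refine ⟨by simp [hF],
        key 0 0 _ (by simp) (hrel _ (by omega)) (by simp) ?_ (by simp) (by simp), by simp⟩
        constructor <;> intro h' <;> omega
      · refine ⟨by simp [hF],
        key 0 1 _ (by simp) (hrel _ (by omega)) (by simp) ?_ (by simp) (by simp), by simp⟩
        constructor <;> intro h' <;> omega

/-- Third pass: the digits. -/
def normThird (q : ℕ) : Program :=
  -- Register `36` holds the residue plus carry `z`, and `z - (q - 1) > 0` means `z = q`. The
  -- outgoing carry in register `40` is set to `1` in advance and cleared in the two cases without
  -- carry.
  .seq (.const 33 0) (forUp 30 4 31 (block [.load 34 10 30, .load 35 11 34, .load 36 15 30,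
    .add 36 36 33, .load 37 16 30, .const 38 ((q : ℤ) - 1), .sub 39 36 38, .const 40 1,
    .ifPos 39 (.const 36 0) (.ifPos 36 (.ifPos 37 (.const 40 0)
      (.seq (.sub 36 36 38) (.sub 36 36 3))) (.seq (.const 36 0) (.const 40 0))),
    .store 14 34 36, .ifPos 35 (.move 33 40) (.const 33 0)]))

open Classical in
theorem runs_normThird {w : ℤ} (hq : 2 ≤ q) (R : Repr q L N e ord σ)
    {x : ℕ → ℤ} {bit pn : ℕ → Prop}
    (hbit : ∀ i < N, 0 < σ.mem 11 (ord i : ℤ) ↔ bit i)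
    (hx : ∀ i < N, σ.mem 15 (i : ℤ) = x i) (hpn : ∀ i < N, 0 < σ.mem 16 (i : ℤ) ↔ pn i)
    (hx0 : ∀ i < N, 0 ≤ x i ∧ x i < q) (hw : (N : ℤ) + 2 * q + 2 ≤ w) :
    Runs w (normThird q) σ (19 * N + 4) (fun σ' => Frame 30 [14] σ σ' ∧
      ∀ i < N, σ'.mem 14 (ord i : ℤ) = outDigit q (x i + carryHi q x pn bit i) (pn i)) := by
  have hq' : (2 : ℤ) ≤ q := by exact_mod_cast hq
  have hT : 19 * N + 4 = 1 + (19 * N + 3) := by omega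
  rw [hT]
  refine Runs.seq (R := fun σ' => Frame 30 [14] σ σ' ∧ σ'.reg 33 = 0)
    (Runs.of_wp (by decide) ?_) ?_
  · simp [wp]; omega
  rintro σ₁ ⟨g1, g2⟩
  obtain ⟨Inv, hInv⟩ : ∃ Inv : ℕ → Store → Prop, ∀ k σ', Inv k σ' ↔
      (σ'.reg 33 = carryHi q x pn bit k ∧
      ∀ i < k, σ'.mem 14 (ord i : ℤ) = outDigit q (x i + carryHi q x pn bit i) (pn i)) :=
    ⟨_, fun _ _ => Iff.rfl⟩
  refine (Runs.forUp (σ₀ := σ) (r := 30) (S := [14]) (n := N) 16 Inv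
    (by decide) (by decide) (by decide) (by decide) (by decide) R.num R.one (by omega) g1
    ((hInv _ _).mpr ⟨by simp [g2, carryHi], by simp⟩)
    (fun k σ v v' h => by rw [hInv] at h ⊢; simpa using h) ?_).mono
    (by omega) (fun σ' h => ⟨h.1, ((hInv _ _).mp h.2).2⟩)
  rintro k hk σ' hF hI hi
  obtain ⟨hI1, hI2⟩ := (hInv _ _).mp hI
  refine Runs.of_wp (by simp [block, cost]) ?_
  have m3 : σ'.reg 3 = 1 := by rw [hF.reg 3 (by decide), R.one]
  have m10 : σ'.mem 10 (k : ℤ) = ord k := by rw [hF.mem 10 (by decide), R.ordm k hk]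
  have m11 : 0 < σ'.mem 11 (ord k : ℤ) ↔ bit k := by rw [hF.mem 11 (by decide), hbit k hk]
  have m15 : σ'.mem 15 (k : ℤ) = x k := by rw [hF.mem 15 (by decide), hx k hk]
  have m16 : 0 < σ'.mem 16 (k : ℤ) ↔ pn k := by rw [hF.mem 16 (by decide), hpn k hk]
  have hxk := hx0 k hk
  have hd := carryHi_mem q x pn bit k
  have key : ∀ (τ : Store) (v : ℤ), v = outDigit q (x k + carryHi q x pn bit k) (pn k) →
      τ.reg 33 = carryHi q x pn bit (k + 1) →
      (∀ i : ℕ, τ.mem 14 (i : ℤ) = if i = ord k then v else σ'.mem 14 (i : ℤ)) →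
      Inv (k + 1) τ := by
    intro τ v hv h1 h2
    rw [hInv]
    refine ⟨h1, fun i hi => ?_⟩
    rw [h2]
    rcases Nat.lt_succ_iff_lt_or_eq.mp hi with h | h
    · rw [if_neg (fun hc => by have := R.ord_inj (by omega) hk hc; omega), hI2 i h]
    · rw [h, if_pos rfl, hv]
  simp only [block, wp, Store.reg_setReg, Store.mem_setReg, Store.reg_setMem, hi, m3, m10,
    m15, hI1, Nat.reduceEqDiff, reduceIte]
  have hout : carryHi q x pn bit (k + 1) =
      if bit k then outCarry q (x k + carryHi q x pn bit k) (pn k) else 0 := rfl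
  refine ⟨by rw [abs_le]; omega, by rw [abs_le]; omega, by rw [abs_le]; omega,
      by rw [abs_le]; omega,
    fun h1 => ⟨by rw [abs_le]; omega, ?_⟩, fun h1 => ⟨fun h2 => ⟨fun h3 => ⟨by rw [abs_le]; omega,
        ?_⟩,
      fun h3 => ⟨by rw [abs_le]; omega, by rw [abs_le]; omega, ?_⟩⟩,
      fun h2 => ⟨by rw [abs_le]; omega, by rw [abs_le]; omega, ?_⟩⟩⟩
  · have hz : x k + carryHi q x pn bit k = q := by omega
    refine ⟨fun hb => ⟨by simp [hF],
        key _ 0 ?_ ?_ (by simp), by simp⟩,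
      fun hb => ⟨by rw [abs_le]; omega, by simp [hF],
        key _ 0 ?_ ?_ (by simp), by simp⟩⟩
    · rw [hz]; simp [outDigit]
    · rw [hout, if_pos (m11.mp hb), hz]; simp [outCarry]
    · rw [hz]; simp [outDigit]
    · rw [hout, if_neg (mt m11.mpr hb)]; simp
  · have hz : x k + carryHi q x pn bit k ≠ q := by omega
    have hp := m16.mp h3
    refine ⟨fun hb => ⟨by simp [hF],
        key _ (x k + carryHi q x pn bit k) ?_ ?_ (by simp), by simp⟩,
      fun hb => ⟨by rw [abs_le]; omega, by simp [hF],
        key _ (x k + carryHi q x pn bit k) ?_ ?_ (by simp), by simp⟩⟩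
    · simp [outDigit, hz, h2, hp]
    · rw [hout, if_pos (m11.mp hb)]; simp [outCarry, hz, hp]
    · simp [outDigit, hz, h2, hp]
    · rw [hout, if_neg (mt m11.mpr hb)]; simp
  · have hz : x k + carryHi q x pn bit k ≠ q := by omega
    have hp := mt m16.mpr h3
    refine ⟨fun hb => ⟨by simp [hF],
        key _ (x k + carryHi q x pn bit k - (q - 1) - 1) ?_ ?_ (by simp), by simp⟩,
      fun hb => ⟨by rw [abs_le]; omega, by simp [hF],
        key _ (x k + carryHi q x pn bit k - (q - 1) - 1) ?_ ?_ (by simp), by simp⟩⟩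
    · rw [outDigit, if_neg hz, if_neg (by omega), if_neg hp]; ring
    · rw [hout, if_pos (m11.mp hb)]; simp [outCarry, hz, h2, hp]
    · rw [outDigit, if_neg hz, if_neg (by omega), if_neg hp]; ring
    · rw [hout, if_neg (mt m11.mpr hb)]; simp
  · have hz : x k + carryHi q x pn bit k ≠ q := by omega
    refine ⟨fun hb => ⟨by simp [hF],
        key _ 0 ?_ ?_ (by simp), by simp⟩,
      fun hb => ⟨by rw [abs_le]; omega, by simp [hF],
        key _ 0 ?_ ?_ (by simp), by simp⟩⟩
    · simp [outDigit, hz, not_lt.mp h2]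
    · rw [hout, if_pos (m11.mp hb)]; simp [outCarry, hz, not_lt.mp h2]
    · simp [outDigit, hz, not_lt.mp h2]
    · rw [hout, if_neg (mt m11.mpr hb)]; simp

end PowerCircuits

open scoped BigOperators
namespace PowerCircuits

variable {q L N : ℕ} {e ord : ℕ → ℕ} {σ : Store}

/-- Replace the accumulator by the compact digits of its value. -/
def normalise (q : ℕ) : Program := .seq normFirst (.seq (normSecond q) (normThird q))

/-- The value of a family of coefficients of the nodes. -/
def nodeSum (q N : ℕ) (e : ℕ → ℕ) (A : ℕ → ℤ) : ℤ :=
  ∑ a ∈ Finset.range N, A a * (q : ℤ) ^ e a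

theorem Repr.nodeSum_ord (R : Repr q L N e ord σ) (A : ℕ → ℤ) :
    ∑ i ∈ Finset.range N, A (ord i) * (q : ℤ) ^ e (ord i) = nodeSum q N e A := by
  unfold nodeSum
  refine Finset.sum_bij (fun i _ => ord i) ?_ ?_ ?_ ?_
  · intro i hi; simpa using R.ord_lt i (by simpa using hi)
  · intro i hi j hj h; exact R.ord_inj (by simpa using hi) (by simpa using hj) h
  · intro a ha
    obtain ⟨i, hi, rfl⟩ := R.surj a (by simpa using ha)
    exact ⟨i, by simpa using hi, rfl⟩
  · intros; rfl

/-- The hypothesis `hgap` is the arithmetical heart: the terms below any exponent without node are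
too small to produce a carry across it. The program itself never tests this; it holds because of the
room in the chains. -/
theorem runs_normalise {w : ℤ} (hq : 2 ≤ q) (R : Repr q L N e ord σ) {B : ℕ}
    (D : DivTable q (2 * B) σ) {A : ℕ → ℤ}
    (hA : ∀ a < N, σ.mem 14 (a : ℤ) = A a) (hAB : ∀ a < N, |A a| ≤ B)
    (hgap : ∀ p, (∀ a < N, e a ≠ p) → q * |psum q (spread (Finset.range N) e A) p| ≤ (q : ℤ) ^ p)
    (hw : 2 * (B : ℤ) + N + 2 * q + 2 ≤ w) :
    Runs w (normalise q) σ (51 * N + 12) (fun σ' => Frame 30 [14, 15, 16] σ σ' ∧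
      HasCd q (nodeSum q N e A) ∧
      (∀ m, cd q (nodeSum q N e A) m ≠ 0 → ∃ b < N, e b = m) ∧
      ∀ a < N, σ'.mem 14 (a : ℤ) = cd q (nodeSum q N e A) (e a)) := by
  classical
  have hq' : (2 : ℤ) ≤ q := by exact_mod_cast hq
  have hq0 : (q : ℤ) ≠ 0 := by omega
  set bit : ℕ → Prop := fun i => i + 1 < N ∧ e (ord (i + 1)) = e (ord i) + 1 with hbitdef
  set A' : ℕ → ℤ := fun i => A (ord i) with hA'
  have hbit : ∀ i < N, 0 < σ.mem 11 (ord i : ℤ) ↔ bit i := fun i hi => R.next_ord_iff hi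
  have hA'B : ∀ i < N, |A' i| ≤ B := fun i hi => hAB _ (R.ord_lt i hi)
  set x : ℕ → ℤ := fun i => (A' i + carryLo q A' bit i) % q with hx
  set κ : ℕ → ℤ := fun i => (A' i + carryLo q A' bit i) / q with hκ
  have hx0 : ∀ i < N, 0 ≤ x i ∧ x i < q := fun i hi =>
    ⟨Int.emod_nonneg _ hq0, Int.emod_lt_of_pos _ (by omega)⟩
  have hκB : ∀ i < N, ¬ bit i → |κ i| ≤ B := fun i hi _ => by
    have := abs_carryLo_le (A := A') (bit := fun _ => True) hq (B := B)
    have h1 := hA'B i hi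
    have h2 := abs_carryLo_le (bit := bit) hq (A := A') (B := B) i fun k hk => hA'B k (by omega)
    rw [abs_le] at *
    simp only [hκ]
    constructor
    · rw [Int.le_ediv_iff_mul_le (by omega)]
      nlinarith
    · have : (A' i + carryLo q A' bit i) / q < B + 1 := by
        rw [Int.ediv_lt_iff_lt_mul (by omega)]
        nlinarith
      omega
  have hT : 51 * N + 12 = (13 * N + 4) + ((19 * N + 4) + (19 * N + 4)) := by omega
  rw [hT]
  refine (runs_normFirst hq R D (A := A') (bit := bit) (fun i hi => hA _ (R.ord_lt i hi)) hA'B hbit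
    (by omega)).seq ?_
  rintro σ₁ ⟨F1, p1, p2⟩
  have R1 := R.frame F1 (by decide) (by decide)
  have hbit1 : ∀ i < N, 0 < σ₁.mem 11 (ord i : ℤ) ↔ bit i := by
    rw [F1.mem 11 (by decide)]; exact hbit
  refine (runs_normSecond hq R1 (B := B) (x := x) (κ := κ) (bit := bit) hbit1 (fun i h => h.1)
    p1 p2 hx0 hκB (by omega)).seq ?_
  rintro σ₂ ⟨F2, r1⟩
  have R2 := R1.frame F2 (by decide) (by decide)
  have hbit2 : ∀ i < N, 0 < σ₂.mem 11 (ord i : ℤ) ↔ bit i := by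
    rw [F2.mem 11 (by decide)]; exact hbit1
  set pn : ℕ → Prop := fun i => σ₂.mem 16 (i : ℤ) = 1 with hpn
  have hpn' : ∀ i < N, 0 < σ₂.mem 16 (i : ℤ) ↔ pn i := fun i hi => by
    have := (r1 i hi).1
    simp only [hpn]; omega
  refine (runs_normThird hq R2 (x := x) (bit := bit) (pn := pn) hbit2
    (by rw [F2.mem 15 (by decide)]; exact p1) hpn' hx0 (by omega)).mono le_rfl ?_
  rintro σ₃ ⟨F3, s1⟩
  have hspread := spread_reindex (e := e) (ord := ord) A R.ord_lt
    (fun i hi j hj h => R.ord_inj hi hj h) R.surj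
  have key := normalise_spec (q := q) (N := N) (A := A') (x := x) (e := fun i => e (ord i))
    (bit := bit) (pn := pn) hq R.mono (fun i hi => Iff.rfl) (fun i hi => rfl)
    (fun i hi => by
      have := (r1 i hi).2
      simp only [hpn]; convert this using 2)
    (fun i hi hbi => by
      -- The exponent just above the top of a chain belongs to no node, and the prefix of the sorted
      -- list up to this top consists of all terms below this exponent.
      have hp : ∀ a < N, e a ≠ e (ord i) + 1 := by
        intro a ha hc
        exact hbi ((R.next_ord_iff hi).mp ((R.next_pos_iff (R.ord_lt i hi)).mpr ⟨a, ha, hc⟩))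
      have h1 := hgap _ hp
      rw [← hspread, psum_spread] at h1
      have h2 : ∑ k ∈ Finset.range (i + 1), A' k * (q : ℤ) ^ e (ord k) =
          ∑ k ∈ Finset.range N, if e (ord k) < e (ord i) + 1 then A' k * (q : ℤ) ^ e (ord k)
            else 0 := by
        rw [← Finset.sum_filter]
        refine Finset.sum_congr ?_ fun _ _ => rfl
        ext k
        simp only [Finset.mem_range, Finset.mem_filter]
        constructor
        · intro hk
          refine ⟨by omega, ?_⟩
          rcases Nat.lt_succ_iff_lt_or_eq.mp hk with h | h
          · have := R.mono k i h hi; omega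
          · subst h; omega
        · rintro ⟨h1, h2⟩
          by_contra hc
          have := R.mono i k (by omega) h1; omega
      rw [h2]; exact h1)
  have hsum : ∑ k ∈ Finset.range N, A' k * (q : ℤ) ^ (fun i => e (ord i)) k = nodeSum q N e A :=
    R.nodeSum_ord A
  rw [hsum] at key
  obtain ⟨k1, k2, k3⟩ := key
  refine ⟨(F1.weaken le_rfl (by simp)).trans ((F2.weaken (b := 30) (S := [14, 15, 16]) le_rfl
    (by simp)).trans F3 le_rfl (by simp)) le_rfl (by simp), k1, ?_, ?_⟩
  · intro m hm
    obtain ⟨i, hi, h⟩ := k3 m hm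
    exact ⟨_, R.ord_lt i hi, h⟩
  · intro a ha
    obtain ⟨i, hi, rfl⟩ := R.surj a ha
    rw [s1 i hi, k2 i hi]

/-! ## Searching -/

/-- Search for the node whose exponent has the digits in the accumulator: register `33` tells
whether there is one, register `34` is this node, and register `30` is its position or the
position where it has to be inserted. -/
def findNode : Program :=
  .seq (block [.const 30 0, .move 31 4, .move 32 4])
  (.seq (.whilePos 32 (block [.sub 35 32 3, .load 36 10 35, .load 37 14 36, .sub 38 31 30,
      .ifPos 38 (block [.load 39 10 30, .load 40 13 39, .add 40 40 36, .load 41 12 40,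
        .sub 42 37 41, .ifPos 42 (.add 30 30 3) (block [.sub 43 31 3, .load 39 10 43,
          .load 40 13 39, .add 40 40 36, .load 41 12 40, .sub 42 41 37,
          .ifPos 42 (.move 31 43) (.move 32 35)])])
        (.move 32 35)]))
  (block [.sub 33 31 30, .ifPos 33 (.load 34 10 30) .skip]))

/-- Agreement need only be known at exponents of nodes, as both sequences vanish elsewhere. -/
theorem Repr.eq_of_agree (hq : 2 ≤ q) (R : Repr q L N e ord σ) {α β : ℕ → ℤ} {x y : ℤ}
    (hα : Compact q α) (hβ : Compact q β) (hx : HasVal q α x) (hy : HasVal q β y)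
    (sα : ∀ m, α m ≠ 0 → ∃ b < N, e b = m) (sβ : ∀ m, β m ≠ 0 → ∃ b < N, e b = m)
    {j : ℕ} (hj : j < N) (hag : ∀ r, j < r → r < N → α (e (ord r)) = β (e (ord r)))
    (h : α (e (ord j)) < β (e (ord j))) : x < y := by
  refine hα.lt_of_lex hq hβ hx hy (i := e (ord j)) (fun m hm => ?_) h
  by_cases hE : ∃ b < N, e b = m
  · obtain ⟨b, hb, rfl⟩ := hE
    obtain ⟨r, hr, rfl⟩ := R.surj b hb
    exact hag r (R.lt_of_e_lt hj hm) hr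
  · have h1 : α m = 0 := by by_contra hc; exact hE (sα m hc)
    have h2 : β m = 0 := by by_contra hc; exact hE (sβ m hc)
    rw [h1, h2]

/-- The candidates form an interval of the sorted list, consisting of the nodes whose digits agree
with those of `X` from position `j` on. Each round drops the first candidate, or drops the last one,
or lowers `j`. So `j` plus the length of the interval is a potential, and the search takes linear
time although whole rows of digits are compared. -/
theorem runs_findNode {w : ℤ} (hq : 2 ≤ q) (R : Repr q L N e ord σ) (hNL : N ≤ L) {X : ℤ}
    (hX : HasCd q X) (hsX : ∀ m, cd q X m ≠ 0 → ∃ b < N, e b = m)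
    (hacc : ∀ a < N, σ.mem 14 (a : ℤ) = cd q X (e a)) (hw : (L : ℤ) * L + N + 2 * q ≤ w) :
    Runs w findNode σ (40 * N + 8) (fun σ' => Frame 30 [] σ σ' ∧ ∃ lo : ℕ, σ'.reg 30 = lo ∧
      ((σ'.reg 33 = 1 ∧ lo < N ∧ σ'.reg 34 = ord lo ∧ (e (ord lo) : ℤ) = X) ∨
      (σ'.reg 33 = 0 ∧ lo ≤ N ∧ (∀ i < lo, (e (ord i) : ℤ) < X) ∧
        ∀ i, lo ≤ i → i < N → X < e (ord i)))) := by
  have hq' : (2 : ℤ) ≤ q := by exact_mod_cast hq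
  have hNw : (L : ℤ) * L + N + 2 * q ≤ w := hw
  have hLL : (0 : ℤ) ≤ (L : ℤ) * L := by positivity
  obtain ⟨Inv, hInv⟩ : ∃ Inv : Store → Prop, ∀ σ', Inv σ' ↔ (Frame 30 [] σ σ' ∧
      ∃ lo hi j : ℕ, σ'.reg 30 = lo ∧ σ'.reg 31 = hi ∧ σ'.reg 32 = j ∧ lo ≤ hi ∧ hi ≤ N ∧ j ≤ N ∧
      (∀ i < lo, (e (ord i) : ℤ) < X) ∧ (∀ i, hi ≤ i → i < N → X < e (ord i)) ∧
      ∀ i, lo ≤ i → i < hi → ∀ r, j ≤ r → r < N →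
        cd q (e (ord i)) (e (ord r)) = cd q X (e (ord r))) := ⟨_, fun _ => Iff.rfl⟩
  have hT : 40 * N + 8 ≥ 3 + (((19 + 1) * (2 * N) + 1) + 3) := by omega
  refine Runs.mono (Q := fun σ' => Frame 30 [] σ σ' ∧ ∃ lo : ℕ, σ'.reg 30 = lo ∧
      ((σ'.reg 33 = 1 ∧ lo < N ∧ σ'.reg 34 = ord lo ∧ (e (ord lo) : ℤ) = X) ∨
      (σ'.reg 33 = 0 ∧ lo ≤ N ∧ (∀ i < lo, (e (ord i) : ℤ) < X) ∧
        ∀ i, lo ≤ i → i < N → X < e (ord i)))) ?_ hT (fun _ h => h)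
  refine Runs.seq (R := fun σ' => Inv σ' ∧ σ'.reg 30 = 0 ∧ σ'.reg 31 = N ∧ σ'.reg 32 = N)
    (Runs.of_wp (by simp [block, cost]) ?_) ?_
  · simp only [block, wp, abs_zero]
    refine ⟨by omega, ?_, by simp, by simp [R.num], by simp [R.num]⟩
    rw [hInv]
    refine ⟨by simp, 0, N, N, by simp, by simp [R.num], by simp [R.num], by simp, le_rfl, le_rfl,
      ?_, ?_, ?_⟩ <;> intros <;> omega
  rintro σ₁ ⟨hI, h30, h31, h32⟩
  refine Runs.seq (R := fun σ' => Inv σ' ∧ ¬ 0 < σ'.reg 32) ?_ ?_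
  · have := Runs.whilePos (w := w) (x := 32) (σ := σ₁) (p := block [.sub 35 32 3, .load 36 10 35,
        .load 37 14 36, .sub 38 31 30,
      .ifPos 38 (block [.load 39 10 30, .load 40 13 39, .add 40 40 36, .load 41 12 40,
        .sub 42 37 41, .ifPos 42 (.add 30 30 3) (block [.sub 43 31 3, .load 39 10 43,
          .load 40 13 39, .add 40 40 36, .load 41 12 40, .sub 42 41 37,
          .ifPos 42 (.move 31 43) (.move 32 35)])])
        (.move 32 35)]) 19 Inv (fun σ => (σ.reg 32 + σ.reg 31 - σ.reg 30).toNat) hI ?_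
    · rw [h30, h31, h32] at this
      have hμ : ((N : ℤ) + N - 0).toNat = 2 * N := by omega
      rw [hμ] at this
      exact this
    · intro σ' hI' hpos
      obtain ⟨hF, lo, hi, j, g30, g31, g32, hlh, hhN, hjN, i1, i2, i3⟩ := (hInv σ').mp hI'
      have R' := R.frame hF (by decide) (by decide)
      obtain ⟨j, rfl⟩ : ∃ k, j = k + 1 := ⟨j - 1, by omega⟩
      have hjj : ((j + 1 : ℕ) : ℤ) - 1 = j := by push_cast; ring
      have m10 : σ'.mem 10 (j : ℤ) = ord j := R'.ordm j (by omega)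
      have m14 : σ'.mem 14 (ord j : ℤ) = cd q X (e (ord j)) := by
        rw [hF.mem 14 (by decide), hacc _ (R.ord_lt j (by omega))]
      have dig : ∀ i < N, σ'.mem 12 ((ord i : ℤ) * L + ord j) = cd q (e (ord i)) (e (ord j)) :=
        fun i hi => R'.rows _ (R.ord_lt i hi) _ (R.ord_lt j (by omega))
      have hadd : ∀ i < N, |(ord i : ℤ) * L + ord j| ≤ w := fun i hi => by
        have h1 := R.ord_lt i hi
        have h2 := R.ord_lt j (by omega)
        have h3 : (ord i : ℤ) * L ≤ L * L := mul_le_mul_of_nonneg_right (by omega) (by positivity)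
        rw [abs_le]; constructor
        · have : (0 : ℤ) ≤ (ord i : ℤ) * L := by positivity
          omega
        · omega
      have hXb := hX.1.lo (e (ord j))
      have hXb' := hX.1.hi (e (ord j))
      have hcdc : ∀ i < N, HasCd q (e (ord i)) := fun i hi => R.hasCd _ (R.ord_lt i hi)
      have hcds : ∀ i < N, ∀ m, cd q (e (ord i)) m ≠ 0 → ∃ b < N, e b = m :=
        fun i hi => R.supp _ (R.ord_lt i hi)
      have hless : ∀ i, lo ≤ i → i < hi → cd q (e (ord i)) (e (ord j)) < cd q X (e (ord j)) →
          (e (ord i) : ℤ) < X := fun i h1 h2 h3 =>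
        R.eq_of_agree hq (hcdc i (by omega)).1 hX.1 (hcdc i (by omega)).2 hX.2 (hcds i (by omega))
          hsX (by omega) (fun r hr hrN => i3 i h1 h2 r (by omega) hrN) h3
      have hgtr : ∀ i, lo ≤ i → i < hi → cd q X (e (ord j)) < cd q (e (ord i)) (e (ord j)) →
          X < (e (ord i) : ℤ) := fun i h1 h2 h3 =>
        R.eq_of_agree hq hX.1 (hcdc i (by omega)).1 hX.2 (hcdc i (by omega)).2 hsX
          (hcds i (by omega)) (by omega) (fun r hr hrN => (i3 i h1 h2 r (by omega) hrN).symm) h3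
      -- Within the interval all higher digits agree, so the digits at `j` increase weakly along the
      -- list. If the first and the last candidate have the digit of `X` at `j`, then so have all
      -- candidates.
      have hcmp : ∀ i k, lo ≤ i → i < k → k < hi →
          cd q (e (ord i)) (e (ord j)) ≤ cd q (e (ord k)) (e (ord j)) := by
        intro i k h1 h2 h3
        by_contra hc
        have := R.eq_of_agree hq (hcdc k (by omega)).1 (hcdc i (by omega)).1 (hcdc k (by omega)).2
          (hcdc i (by omega)).2 (hcds k (by omega)) (hcds i (by omega)) (j := j) (by omega)
          (fun r hr hrN => by
            rw [i3 i h1 (by omega) r (by omega) hrN, i3 k (by omega) h3 r (by omega) hrN])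
          (not_le.mp hc)
        have := R.mono i k h2 (by omega)
        omega
      refine Runs.of_wp (by simp [block, cost]) ?_
      simp only [block, wp, Store.reg_setReg, Store.mem_setReg, g30, g31, g32, R'.one, hjj, m10,
          m14,
        Nat.reduceEqDiff, reduceIte]
      refine ⟨by rw [abs_le]; omega, by rw [abs_le]; omega, fun hlt => ?_, fun hge => ?_⟩
      · have hlo : lo < hi := by omega
        have ml : σ'.mem 10 (lo : ℤ) = ord lo := R'.ordm lo (by omega)
        have mm : σ'.mem 13 (ord lo : ℤ) = (ord lo : ℤ) * L :=
          R'.mul _ (lt_of_lt_of_le (R.ord_lt lo (by omega)) hNL)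
        have hhi1 : (hi : ℤ) - 1 = (hi - 1 : ℕ) := by omega
        have mh : σ'.mem 10 ((hi - 1 : ℕ) : ℤ) = ord (hi - 1) := R'.ordm _ (by omega)
        have mm' : σ'.mem 13 (ord (hi - 1) : ℤ) = (ord (hi - 1) : ℤ) * L :=
          R'.mul _ (lt_of_lt_of_le (R.ord_lt _ (by omega)) hNL)
        have b1 := (hcdc lo (by omega)).1.lo (e (ord j))
        have b2 := (hcdc lo (by omega)).1.hi (e (ord j))
        have b3 := (hcdc (hi - 1) (by omega)).1.lo (e (ord j))
        have b4 := (hcdc (hi - 1) (by omega)).1.hi (e (ord j))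
        simp only [ml, mm, dig lo (by omega), hhi1, mh, mm', dig (hi - 1) (by omega)]
        refine ⟨hadd lo (by omega), by rw [abs_le]; omega, fun h1 => ⟨by rw [abs_le]; omega, ?_,
            ?_⟩,
          fun h1 => ⟨by rw [abs_le]; omega, hadd _ (by omega), by rw [abs_le]; omega,
            fun h2 => ⟨?_, ?_⟩, fun h2 => ⟨?_, ?_⟩⟩⟩
        · rw [hInv]
          refine ⟨by simp [hF], lo + 1, hi, j + 1, by simp, by simp [g31], by simp [g32],
            by omega, hhN, hjN, ?_, i2, fun i h1 h2 => i3 i (by omega) h2⟩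
          intro i hi'
          rcases Nat.lt_succ_iff_lt_or_eq.mp hi' with h | h
          · exact i1 i h
          · subst h; exact hless i le_rfl hlo (by omega)
        · simp; omega
        · rw [hInv]
          refine ⟨by simp [hF], lo, hi - 1, j + 1, by simp [g30], by simp, by simp [g32],
            by omega, by omega, hjN, i1, ?_, fun i h1 h2 => i3 i h1 (by omega)⟩
          intro i hi' hiN
          by_cases h : hi ≤ i
          · exact i2 i h hiN
          · have : i = hi - 1 := by omega
            subst this
            exact hgtr _ (by omega) (by omega) (by omega)
        · simp; omega
        · rw [hInv]
          refine ⟨by simp [hF], lo, hi, j, by simp [g30], by simp [g31], by simp,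
            hlh, hhN, by omega, i1, i2, ?_⟩
          intro i h3 h4 r hr hrN
          by_cases hrj : r = j
          · subst hrj
            have c1 : cd q (e (ord lo)) (e (ord r)) ≤ cd q (e (ord i)) (e (ord r)) := by
              rcases h3.eq_or_lt with h | h
              · rw [h]
              · exact hcmp lo i le_rfl h h4
            have c2 : cd q (e (ord i)) (e (ord r)) ≤ cd q (e (ord (hi - 1))) (e (ord r)) := by
              rcases (show i ≤ hi - 1 by omega).eq_or_lt with h | h
              · rw [h]
              · exact hcmp i _ h3 h (by omega)
            omega
          · exact i3 i h3 h4 r (by omega) hrN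
        · simp; omega
      · refine ⟨?_, ?_⟩
        · rw [hInv]
          refine ⟨by simp [hF], lo, hi, j, by simp [g30], by simp [g31], by simp,
            hlh, hhN, by omega, i1, i2, fun i h1 h2 => by omega⟩
        · simp; omega
  · rintro σ' ⟨hI', hneg⟩
    obtain ⟨hF, lo, hi, j, g30, g31, g32, hlh, hhN, hjN, i1, i2, i3⟩ := (hInv σ').mp hI'
    have R' := R.frame hF (by decide) (by decide)
    obtain rfl : j = 0 := by omega
    -- All digits have been compared, so every candidate that is left has the value `X`. As
    -- exponents are distinct, there is at most one.
    have heq : ∀ i, lo ≤ i → i < hi → (e (ord i) : ℤ) = X := by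
      intro i h1 h2
      have hc := R.hasCd _ (R.ord_lt i (by omega))
      have : cd q (e (ord i)) = cd q X := by
        funext m
        by_cases hE : ∃ b < N, e b = m
        · obtain ⟨b, hb, rfl⟩ := hE
          obtain ⟨r, hr, rfl⟩ := R.surj b hb
          exact i3 i h1 h2 r (Nat.zero_le _) hr
        · have h1 : cd q (e (ord i)) m = 0 := by
            by_contra hc; exact hE (R.supp _ (R.ord_lt i (by omega)) m hc)
          have h2 : cd q X m = 0 := by by_contra hc; exact hE (hsX m hc)
          rw [h1, h2]
      have h3 := hc.2
      rw [this] at h3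
      exact h3.eq hX.2
    have hle : hi ≤ lo + 1 := by
      by_contra hc
      have h1 := heq lo le_rfl (by omega)
      have h2 := heq (lo + 1) (by omega) (by omega)
      have := R.mono lo (lo + 1) (by omega) (by omega)
      omega
    refine Runs.of_wp (by simp [block, cost]) ?_
    simp only [block, wp, Store.reg_setReg, Store.mem_setReg, g30, g31, Nat.reduceEqDiff, reduceIte]
    refine ⟨by rw [abs_le]; omega, fun h1 => ⟨by simp [hF], lo, by simp, Or.inl ?_⟩,
      fun h1 => ⟨by simp [hF], lo, by simp, Or.inr ?_⟩⟩
    · have hlo : lo < hi := by omega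
      refine ⟨by omega, by omega, by simp [R'.ordm lo (by omega)], heq lo le_rfl hlo⟩
    · refine ⟨by omega, by omega, i1, fun i h2 h3 => i2 i (by omega) h3⟩

end PowerCircuits

/-! ### Values with small partial sums below gaps, and the insertion of nodes -/

open scoped BigOperators
namespace PowerCircuits

variable {q L N : ℕ} {e ord : ℕ → ℕ} {σ : Store}

/-- Like `Frame`, but the number of nodes in register `4` may change. -/
structure FrameN (b : ℕ) (S : List ℕ) (σ σ' : Store) : Prop where
  reg : ∀ r < b, r ≠ 4 → σ'.reg r = σ.reg r
  mem : ∀ s, s ∉ S → σ'.mem s = σ.mem s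

theorem Frame.frameN {b b' : ℕ} {S S' : List ℕ} {σ σ' : Store} (h : Frame b' S' σ σ')
    (hb : b ≤ b') (hS : S' ⊆ S) : FrameN b S σ σ' :=
  ⟨fun r hr _ => h.reg r (by omega), fun s hs => h.mem s fun hc => hs (hS hc)⟩

theorem FrameN.trans {b b' b'' : ℕ} {S S' S'' : List ℕ} {σ σ' σ'' : Store} (h : FrameN b' S' σ σ')
    (h' : FrameN b'' S'' σ' σ'') (hb : b ≤ b') (hS : S' ⊆ S) (hb' : b ≤ b'') (hS' : S'' ⊆ S) :
    FrameN b S σ σ'' :=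
  ⟨fun r hr h4 => (h'.reg r (by omega) h4).trans (h.reg r (by omega) h4),
    fun s hs => (h'.mem s fun hc => hs (hS' hc)).trans (h.mem s fun hc => hs (hS hc))⟩

theorem DivTable.frameN {B : ℕ} {σ' : Store} (D : DivTable q B σ) {b : ℕ} {S : List ℕ}
    (hF : FrameN b S σ σ') (hS : 17 ∉ S ∧ 18 ∉ S) : DivTable q B σ' := by
  unfold DivTable
  rw [hF.mem 17 hS.1, hF.mem 18 hS.2]
  exact D

/-- The partial sums of the compact power sum of `y` below exponents without node are small. -/
def Tame (q N : ℕ) (e : ℕ → ℕ) (b y : ℤ) : Prop :=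
  -- The power `q ^ (p - 2)` is what the slots guarantee. The tolerance `b` counts increments: it is
  -- `-1` between the processing of two nodes and grows to at most `2` while a node is being
  -- processed. Truncation in `p - 2` is harmless where this is combined with the presence of the
  -- exponents `0, …, 3`, because then `4 ≤ p`.
  ∀ p, (∀ a < N, e a ≠ p) → |psum q (cd q y) p| ≤ (q : ℤ) ^ (p - 2) + b

theorem Tame.mono {b b' y : ℤ} (h : Tame q N e b y) (hb : b ≤ b') : Tame q N e b' y :=
  fun p hp => (h p hp).trans (by linarith)

theorem four_le_gap {p : ℕ} (low : ∀ m < 4, ∃ a < N, e a = m) (hp : ∀ a < N, e a ≠ p) :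
    4 ≤ p := by
  by_contra hc
  obtain ⟨a, ha, hap⟩ := low p (by omega)
  exact hp a ha hap

/-- From `4 ≤ p` one has `q ^ (p - 2) ≥ 4`, hence `q ^ (p - 2) + 3 ≤ 2 * q ^ (p - 2) ≤ q ^ (p - 1)`.
The constant `3` is the greatest tolerance `2` plus one further increment, made in the search for a
neighbour. -/
theorem gap_bound (hq : 2 ≤ q) {p : ℕ} (hp : 4 ≤ p) {z : ℤ} (hz : |z| ≤ (q : ℤ) ^ (p - 2) + 3) :
    q * |z| ≤ (q : ℤ) ^ p := by
  have hq' : (2 : ℤ) ≤ q := by exact_mod_cast hq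
  obtain ⟨r, rfl⟩ : ∃ r, p = r + 2 + 2 := ⟨p - 4, by omega⟩
  have h1 : (4 : ℤ) ≤ (q : ℤ) ^ (r + 2) := by
    calc (4 : ℤ) = 2 ^ 2 := by norm_num
      _ ≤ (q : ℤ) ^ 2 := by gcongr
      _ ≤ (q : ℤ) ^ (r + 2) := pow_le_pow_right₀ (by omega) (by omega)
  have h2 : (q : ℤ) ^ (r + 2 + 2) = q * (q * (q : ℤ) ^ (r + 2)) := by rw [pow_add]; ring
  have h3 : r + 2 + 2 - 2 = r + 2 := by omega
  rw [h3] at hz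
  rw [h2]
  apply mul_le_mul_of_nonneg_left _ (by omega)
  nlinarith

theorem Repr.spread_cd (R : Repr q L N e ord σ) {y : ℤ}
    (hs : ∀ m, cd q y m ≠ 0 → ∃ b < N, e b = m) :
    spread (Finset.range N) e (fun a => cd q y (e a)) = cd q y := by
  funext m
  by_cases hE : ∃ b < N, e b = m
  · obtain ⟨b, hb, rfl⟩ := hE
    exact spread_apply _ (Finset.mem_range.mpr hb)
      fun c hc h => R.e_inj (Finset.mem_range.mp hc) hb h
  · rw [spread_eq_zero _ fun b hb h => hE ⟨b, Finset.mem_range.mp hb, h⟩]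
    by_contra hc
    exact hE (hs m fun h => hc h.symm)

/-- The coefficients after loading the digits of `y` and adding `inc`. -/
noncomputable def incCoeff (q : ℕ) (e : ℕ → ℕ) (y inc : ℤ) : ℕ → ℤ :=
  fun a => cd q y (e a) + if a = 0 then inc else 0

theorem Repr.spread_incCoeff (R : Repr q L N e ord σ) {y : ℤ} (inc : ℤ)
    (hs : ∀ m, cd q y m ≠ 0 → ∃ b < N, e b = m) {p : ℕ} (hp : 0 < p) :
    psum q (spread (Finset.range N) e (incCoeff q e y inc)) p = psum q (cd q y) p + inc := by
  conv_rhs => rw [← R.spread_cd hs]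
  rw [psum_spread, psum_spread]
  have : ∀ a ∈ Finset.range N,
      (if e a < p then incCoeff q e y inc a * (q : ℤ) ^ e a else 0) =
      (if e a < p then cd q y (e a) * (q : ℤ) ^ e a else 0) + if a = 0 then inc else 0 := by
    intro a ha
    by_cases h0 : a = 0
    · subst h0
      simp [incCoeff, R.zero, hp]
    · simp [incCoeff, h0]
  rw [Finset.sum_congr rfl this, Finset.sum_add_distrib]
  simp [R.pos]

theorem Repr.nodeSum_incCoeff (R : Repr q L N e ord σ) {y : ℤ} (inc : ℤ) (hy : HasCd q y)
    (hs : ∀ m, cd q y m ≠ 0 → ∃ b < N, e b = m) :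
    nodeSum q N e (incCoeff q e y inc) = y + inc := by
  have h1 : nodeSum q N e (fun a => cd q y (e a)) = y := by
    have h2 := hasVal_spread q (Finset.range N) e (fun a => cd q y (e a))
    rw [R.spread_cd hs] at h2
    exact h2.eq hy.2
  conv_rhs => rw [← h1]
  unfold nodeSum
  have : ∀ a ∈ Finset.range N, incCoeff q e y inc a * (q : ℤ) ^ e a =
      cd q y (e a) * (q : ℤ) ^ e a + if a = 0 then inc else 0 := by
    intro a ha
    by_cases h0 : a = 0
    · subst h0
      simp [incCoeff, R.zero]
    · simp [incCoeff, h0]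
  rw [Finset.sum_congr rfl this, Finset.sum_add_distrib]
  simp [R.pos]

theorem abs_incCoeff_le {y inc : ℤ} (hy : HasCd q y) (hinc : |inc| ≤ 1) (a : ℕ) :
    |incCoeff q e y inc a| ≤ q := by
  have h1 := hy.1.lo (e a)
  have h2 := hy.1.hi (e a)
  have h3 := abs_le.mp hinc
  unfold incCoeff
  rw [abs_le]
  split_ifs <;> constructor <;> omega

/-- The increment is made at the node `0`, whose exponent `0` lies below every gap. So it changes
each partial sum by at most `1`. -/
theorem Repr.gap_incCoeff (R : Repr q L N e ord σ) {y inc b : ℤ}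
    (low : ∀ m < 4, ∃ a < N, e a = m) (hinc : |inc| ≤ 1) (hb : Tame q N e b y)
    (hs : ∀ m, cd q y m ≠ 0 → ∃ b < N, e b = m) {p : ℕ} (hp : ∀ a < N, e a ≠ p) :
    |psum q (spread (Finset.range N) e (incCoeff q e y inc)) p| ≤ (q : ℤ) ^ (p - 2) + (b + 1) := by
  have h4 := four_le_gap low hp
  rw [R.spread_incCoeff inc hs (by omega)]
  have := hb p hp
  exact (abs_add_le _ _).trans (by linarith)

/-- Search for the node whose exponent is that of the row of the node in register `26` plus
register `27`. -/
def findInc (q : ℕ) : Program := .seq loadAcc (.seq (normalise q) findNode)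

/-- With `inc = 1` and `inc = -1` this finds the neighbours of a new node in its chain. The row need
not belong to a node that is already counted. -/
theorem runs_findInc {w : ℤ} (hq : 2 ≤ q) (R : Repr q L N e ord σ) {B : ℕ} (hNL : N ≤ L)
    (D : DivTable q (2 * B) σ) (hqB : q ≤ B) {y inc : ℤ} {id : ℕ}
    (low : ∀ m < 4, ∃ a < N, e a = m) (hid : id < L) (h26 : σ.reg 26 = id) (h27 : σ.reg 27 = inc)
    (hinc : |inc| ≤ 1) (hrow : ∀ a < N, σ.mem 12 ((id : ℤ) * L + a) = cd q y (e a))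
    (hy : HasCd q y) (hs : ∀ m, cd q y m ≠ 0 → ∃ b < N, e b = m) (hb : Tame q N e 2 y)
    (hw : (L : ℤ) * L + L + 2 * B + 2 * q + 2 ≤ w) :
    Runs w (findInc q) σ (97 * N + 28) (fun σ' => Frame 30 [14, 15, 16] σ σ' ∧
      ((σ'.reg 33 = 1 ∧ ∃ c < N, σ'.reg 34 = (c : ℕ) ∧ (e c : ℤ) = y + inc) ∨
      (σ'.reg 33 = 0 ∧ ∀ c < N, (e c : ℤ) ≠ y + inc))) := by
  have hLL : (0 : ℤ) ≤ (L : ℤ) * L := by positivity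
  have hidL : (id : ℤ) * L + N ≤ L * L := by
    have : ((id : ℤ) + 1) * L ≤ L * L := mul_le_mul_of_nonneg_right (by omega) (by positivity)
    have h2 : (N : ℤ) ≤ L := by exact_mod_cast hNL
    nlinarith
  have hA := abs_incCoeff_le (e := e) hy hinc
  have hT : 97 * N + 28 = (6 * N + 8) + ((51 * N + 12) + (40 * N + 8)) := by omega
  rw [hT]
  refine (runs_loadAcc R.num R.one R.pos h26 (R.mul id hid) hrow (by omega) ?_).seq ?_
  · have := hA 0
    simp only [incCoeff, if_true] at this
    rw [h27]
    omega
  rintro σ₁ ⟨F1, p1⟩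
  have R1 := R.frame F1 (by decide) (by decide)
  rw [h27] at p1
  refine (runs_normalise hq R1 (D.frame F1 (by decide)) (A := incCoeff q e y inc) p1
    (fun a _ => (hA a).trans (by exact_mod_cast hqB)) (fun p hp => ?_) (by omega)).seq ?_
  · exact gap_bound hq (four_le_gap low hp) ((R.gap_incCoeff low hinc hb hs hp).trans (by norm_num))
  rintro σ₂ ⟨F2, p2, p3, p4⟩
  rw [R.nodeSum_incCoeff inc hy hs] at p2 p3 p4
  have R2 := R1.frame F2 (by decide) (by decide)
  refine (runs_findNode hq R2 hNL p2 p3 p4 (by omega)).mono le_rfl ?_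
  rintro σ₃ ⟨F3, lo, -, h3⟩
  refine ⟨(F1.weaken le_rfl (by simp)).trans (F2.trans F3 le_rfl (by simp)) le_rfl (by simp), ?_⟩
  rcases h3 with ⟨g1, g2, g3, g4⟩ | ⟨g1, g2, g3, g4⟩
  · exact Or.inl ⟨g1, ord lo, R.ord_lt lo g2, g3, g4⟩
  · refine Or.inr ⟨g1, fun c hc h => ?_⟩
    obtain ⟨i, hi, rfl⟩ := R.surj c hc
    by_cases hlo : i < lo
    · have := g3 i hlo; omega
    · have := g4 i (by omega) hi; omega

/-! ## Inserting a node -/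

theorem addr_inj {L a b c d : ℕ} (hb : b < L) (hd : d < L)
    (h : (a : ℤ) * L + b = (c : ℤ) * L + d) : a = c ∧ b = d := by
  have h' : a * L + b = c * L + d := by exact_mod_cast h
  have hL : 0 < L := by omega
  have h1 : (a * L + b) / L = a := by
    rw [mul_comm, Nat.mul_add_div hL, Nat.div_eq_of_lt hb, add_zero]
  have h2 : (c * L + d) / L = c := by
    rw [mul_comm, Nat.mul_add_div hL, Nat.div_eq_of_lt hd, add_zero]
  have h3 : a = c := by rw [← h1, ← h2, h']
  subst h3
  exact ⟨rfl, by omega⟩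

/-- Store the accumulator in the row of the node `N`. -/
def storeRow : Program :=
  .seq (.load 22 13 4) (forUp 30 4 31 (block [.add 33 22 30, .load 34 14 30, .store 12 33 34]))

theorem runs_storeRow {w : ℤ} (R : Repr q L N e ord σ) (hNL : N < L) {f : ℕ → ℤ}
    (hacc : ∀ a < N, σ.mem 14 (a : ℤ) = f a) (hw : (L : ℤ) * L + L ≤ w) :
    Runs w storeRow σ (6 * N + 4) (fun σ' => Frame 22 [12] σ σ' ∧
      (∀ b < N, σ'.mem 12 ((N : ℤ) * L + b) = f b) ∧
      ∀ a < L, ∀ b < L, ¬ (a = N ∧ b < N) →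
        σ'.mem 12 ((a : ℤ) * L + b) = σ.mem 12 ((a : ℤ) * L + b)) := by
  have hLL : (0 : ℤ) ≤ (L : ℤ) * L := by positivity
  have hidL : ((N : ℤ) + 1) * L ≤ L * L := mul_le_mul_of_nonneg_right (by omega) (by positivity)
  have hN0 : (0 : ℤ) ≤ (N : ℤ) * L := by positivity
  have hT : 6 * N + 4 = 1 + (6 * N + 3) := by omega
  rw [hT]
  refine Runs.seq (R := fun σ' => Frame 22 [12] σ σ' ∧ σ'.reg 22 = (N : ℤ) * L ∧ σ'.mem = σ.mem)
    (Runs.of_wp (by decide) ?_) ?_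
  · simp [wp, R.num, R.mul N hNL]
  rintro σ₁ ⟨g1, g2, g3⟩
  refine (Runs.forUp (σ₀ := σ) (r := 22) (S := [12]) (n := N) 3 (fun k σ' =>
    σ'.reg 22 = (N : ℤ) * L ∧ (∀ b < k, σ'.mem 12 ((N : ℤ) * L + b) = f b) ∧
      ∀ a < L, ∀ b < L, ¬ (a = N ∧ b < N) →
        σ'.mem 12 ((a : ℤ) * L + b) = σ.mem 12 ((a : ℤ) * L + b))
    (by decide) (by decide) (by decide) (by decide) (by decide) R.num R.one (by omega) g1
    ⟨g2, by simp, by simp [g3]⟩ (fun k σ v v' h => by simpa using h) ?_).mono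
    (by omega) (fun σ' h => ⟨h.1, h.2.2⟩)
  rintro k hk σ' hF ⟨hI1, hI2, hI3⟩ hi
  refine Runs.of_wp (by simp [block, cost]) ?_
  have m14 : σ'.mem 14 (k : ℤ) = f k := by rw [hF.mem 14 (by decide), hacc k hk]
  simp [block, wp, hi, hF, hI1, m14]
  refine ⟨by rw [abs_le]; constructor <;> nlinarith, fun b hb => ?_, fun a ha b hb hab => ?_⟩
  · split_ifs with h
    · rw [h]
    · exact hI2 b (by omega)
  · rw [if_neg, hI3 a ha b hb (fun h => absurd (hab h.1) (by omega))]
    intro h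
    obtain ⟨h1, h2⟩ := addr_inj hb (by omega) h
    exact absurd (hab h1) (by omega)

/-- Shift the part of the sorted list from the position in register `21` on. -/
def shiftOrd : Program :=
  .seq (block [.move 30 4, .sub 31 30 21]) (.whilePos 31 (block [.sub 32 30 3, .load 33 10 32,
    .store 10 30 33, .move 30 32, .sub 31 30 21]))

theorem runs_shiftOrd {w : ℤ} (R : Repr q L N e ord σ) {pos : ℕ} (h21 : σ.reg 21 = pos)
    (hpos : pos ≤ N) (hw : (N : ℤ) ≤ w) :
    Runs w shiftOrd σ (6 * N + 3) (fun σ' => Frame 30 [10] σ σ' ∧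
      (∀ i < pos, σ'.mem 10 (i : ℤ) = ord i) ∧
      ∀ i, pos ≤ i → i < N → σ'.mem 10 ((i + 1 : ℕ) : ℤ) = ord i) := by
  have hT : 6 * N + 3 = 2 + ((5 + 1) * N + 1) := by omega
  rw [hT]
  obtain ⟨Inv, hInv⟩ : ∃ Inv : Store → Prop, ∀ σ', Inv σ' ↔ (Frame 30 [10] σ σ' ∧
      ∃ j : ℕ, pos ≤ j ∧ j ≤ N ∧ σ'.reg 30 = j ∧ σ'.reg 31 = (j : ℤ) - pos ∧
      (∀ i < j, σ'.mem 10 (i : ℤ) = ord i) ∧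
      ∀ i, j ≤ i → i < N → σ'.mem 10 ((i + 1 : ℕ) : ℤ) = ord i) := ⟨_, fun _ => Iff.rfl⟩
  refine Runs.seq (R := fun σ' => Inv σ' ∧ σ'.reg 31 ≤ N) (Runs.of_wp (by decide) ?_) ?_
  · simp only [block, wp, Store.reg_setReg, Nat.reduceEqDiff, reduceIte, R.num, h21]
    refine ⟨by rw [abs_le]; omega, ?_, by omega⟩
    rw [hInv]
    exact ⟨by simp, N, hpos, le_rfl, by simp, by simp, R.ordm, fun i h1 h2 => by omega⟩
  rintro σ₁ ⟨hI, h31⟩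
  refine (Runs.whilePos 5 Inv (fun σ => (σ.reg 31).toNat) hI ?_).mono ?_ ?_
  · intro σ' hI' hp
    obtain ⟨hF, j, h1, h2, h3, h4, h5, h6⟩ := (hInv σ').mp hI'
    obtain ⟨j, rfl⟩ : ∃ k, j = k + 1 := ⟨j - 1, by omega⟩
    have m3 : σ'.reg 3 = 1 := by rw [hF.reg 3 (by decide), R.one]
    have m21 : σ'.reg 21 = pos := by rw [hF.reg 21 (by decide), h21]
    have hjj : ((j + 1 : ℕ) : ℤ) - 1 = j := by push_cast; ring
    refine Runs.of_wp (by decide) ?_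
    simp only [block, wp, Store.reg_setReg, Store.mem_setReg, Store.reg_setMem, Nat.reduceEqDiff,
        reduceIte, h3, m3, hjj,
      h5 j (by omega), m21]
    refine ⟨by rw [abs_le]; omega, by rw [abs_le]; omega, ?_, by omega⟩
    rw [hInv]
    refine ⟨by simp [hF], j, by omega, by omega, by simp, by simp, fun i hi => ?_,
        fun i hi hiN => ?_⟩
    · simp only [Store.mem_setReg, Store.mem_setMem, true_and, Nat.cast_inj]
      rw [if_neg (by omega), h5 i (by omega)]
    · simp only [Store.mem_setReg, Store.mem_setMem, true_and, Nat.cast_inj]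
      split_ifs with h
      · have : i = j := by omega
        rw [this]
      · exact h6 i (by omega) hiN
  · have : (σ₁.reg 31).toNat ≤ N := by omega
    have := Nat.mul_le_mul_left (5 + 1) this
    omega
  · rintro σ' ⟨hI', hn⟩
    obtain ⟨hF, j, h1, h2, h3, h4, h5, h6⟩ := (hInv σ').mp hI'
    obtain rfl : j = pos := by omega
    exact ⟨hF, h5, h6⟩

/-- Insert the node whose exponent has the digits in the accumulator at the position in register
`30` of the sorted list. -/
def insertNode (q : ℕ) : Program :=
  .seq (.move 21 30) (.seq storeRow (.seq (block [.move 26 4, .const 27 1]) (.seq (findInc q)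
    (.seq (block [.ifPos 33 (.move 23 34) (.const 23 0), .const 27 (-1)]) (.seq (findInc q)
    (.seq (block [.move 24 33, .move 25 34]) (.seq shiftOrd
    (block [.store 10 21 4, .store 11 4 23, .ifPos 24 (.store 11 25 4) .skip, .move 20 4,
      .add 4 4 3]))))))))

theorem Repr.insert {σ' : Store} (R : Repr q L N e ord σ) (hNL : N < L) {k pos : ℕ}
    (hk : HasCd q k) (hs : ∀ m, cd q k m ≠ 0 → ∃ b < N, e b = m) (hpos : pos ≤ N)
    (hlt : ∀ i < pos, e (ord i) < k) (hgt : ∀ i, pos ≤ i → i < N → k < e (ord i))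
    (h3 : σ'.reg 3 = 1) (h4 : σ'.reg 4 = N + 1)
    (ho1 : ∀ i < pos, σ'.mem 10 (i : ℤ) = ord i) (ho2 : σ'.mem 10 (pos : ℤ) = N)
    (ho3 : ∀ i, pos ≤ i → i < N → σ'.mem 10 ((i + 1 : ℕ) : ℤ) = ord i)
    (hn1 : ∀ b < N, e b = k + 1 → σ'.mem 11 (N : ℤ) = b)
    (hn2 : (∀ b < N, e b ≠ k + 1) → σ'.mem 11 (N : ℤ) = 0)
    (hn3 : ∀ a < N, e a + 1 = k → σ'.mem 11 (a : ℤ) = N)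
    (hn4 : ∀ a < N, e a + 1 ≠ k → σ'.mem 11 (a : ℤ) = σ.mem 11 (a : ℤ))
    (hr1 : ∀ b < N, σ'.mem 12 ((N : ℤ) * L + b) = cd q k (e b))
    (hr2 : ∀ a < L, ∀ b < L, ¬ (a = N ∧ b < N) →
        σ'.mem 12 ((a : ℤ) * L + b) = σ.mem 12 ((a : ℤ) * L + b))
    (h13 : σ'.mem 13 = σ.mem 13) :
    Repr q L (N + 1) (fun a => if a = N then k else e a)
      (fun i => if i < pos then ord i else if i = pos then N else ord (i - 1)) σ' := by
  have hkE : ∀ b < N, e b ≠ k := by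
    intro b hb h
    obtain ⟨i, hi, rfl⟩ := R.surj b hb
    by_cases hip : i < pos
    · have := hlt i hip; omega
    · have := hgt i (by omega) hi; omega
  have hN0 := R.pos
  have e_lt : ∀ b < N, (if b = N then k else e b) = e b := fun b hb => if_neg (by omega)
  have e_ord : ∀ i < N, (if ord i = N then k else e (ord i)) = e (ord i) :=
    fun i hi => e_lt _ (R.ord_lt i hi)
  refine ⟨by omega, ?_, ?_, ?_, ?_, ?_, ?_, h3, by rw [h4]; push_cast; rfl, ?_, ?_, ?_, ?_, ?_, ?_⟩
  · intro i hi
    split_ifs with h1 h2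
    · have := R.ord_lt i (by omega); omega
    · omega
    · have := R.ord_lt (i - 1) (by omega); omega
  · intro i j hij hj
    have hv : ∀ i < N + 1, (if (if i < pos then ord i else if i = pos then N else ord (i - 1)) = N
        then k else e (if i < pos then ord i else if i = pos then N else ord (i - 1))) =
        if i < pos then e (ord i) else if i = pos then k else e (ord (i - 1)) := by
      intro i hi
      by_cases h1 : i < pos
      · simp only [h1, if_true]; exact e_ord i (by omega)
      · by_cases h2 : i = pos
        · simp [h2]
        · simp only [h1, h2, if_false]; exact e_ord _ (by omega)
    rw [hv i (by omega), hv j hj]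
    split_ifs with h1 h2 h3 h4 h5
    · exact R.mono i j hij (by omega)
    · exact hlt i h1
    · exact (hlt i h1).trans (hgt (j - 1) (by omega) (by omega))
    · omega
    · omega
    · exact hgt _ (by omega) (by omega)
    · omega
    · omega
    · exact R.mono _ _ (by omega) (by omega)
  · intro a ha
    by_cases haN : a = N
    · exact ⟨pos, by omega, by simp [haN]⟩
    · obtain ⟨i, hi, rfl⟩ := R.surj a (by omega)
      by_cases hip : i < pos
      · exact ⟨i, by omega, by simp [hip]⟩
      · refine ⟨i + 1, by omega, ?_⟩
        rw [if_neg (by omega), if_neg (by omega), Nat.add_sub_cancel]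
  · rw [e_lt 0 hN0, R.zero]
  · intro a ha
    by_cases haN : a = N
    · simpa [haN] using hk
    · rw [e_lt a (by omega)]; exact R.hasCd a (by omega)
  · intro a ha m hm
    by_cases haN : a = N
    · simp only [haN, if_true] at hm
      obtain ⟨b, hb, rfl⟩ := hs m hm
      exact ⟨b, by omega, e_lt b hb⟩
    · rw [e_lt a (by omega)] at hm
      obtain ⟨b, hb, rfl⟩ := R.supp a (by omega) m hm
      exact ⟨b, by omega, e_lt b hb⟩
  · intro i hi
    split_ifs with h1 h2
    · exact ho1 i h1
    · rw [h2, ho2]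
    · have := ho3 (i - 1) (by omega) (by omega)
      rwa [Nat.sub_add_cancel (by omega)] at this
  · intro a ha b hb hab
    by_cases haN : a = N <;> by_cases hbN : b = N
    · simp [haN, hbN] at hab
    · subst haN
      rw [e_lt b (by omega), if_pos rfl] at hab
      exact hn1 b (by omega) hab
    · subst hbN
      rw [e_lt a (by omega), if_pos rfl] at hab
      exact hn3 a (by omega) hab.symm
    · rw [e_lt a (by omega), e_lt b (by omega)] at hab
      rw [hn4 a (by omega) (fun h => hkE b (by omega) (by omega)),
          R.next a (by omega) b (by omega) hab]
  · intro a ha hno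
    by_cases haN : a = N
    · subst haN
      refine hn2 fun b hb => ?_
      have := hno b (by omega)
      rwa [e_lt b hb, if_pos rfl] at this
    · have h1 := hno N (by omega)
      rw [if_pos rfl, e_lt a (by omega)] at h1
      rw [hn4 a (by omega) (fun h => h1 h.symm)]
      refine R.no_next a (by omega) fun b hb => ?_
      have := hno b (by omega)
      rwa [e_lt b hb, e_lt a (by omega)] at this
  · intro a ha b hb
    -- No digit sequence in use is non-zero at `k`, because their supports consist of exponents of
    -- old nodes. So the new column vanishes, also in the row of the new node itself.
    have hcol : ∀ y : ℤ, (∀ m, cd q y m ≠ 0 → ∃ b < N, e b = m) → cd q y k = 0 := by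
      intro y hy
      by_contra hc
      obtain ⟨b, hb, h⟩ := hy k hc
      exact hkE b hb h
    by_cases hbN : b = N
    · subst hbN
      rw [hr2 a (by omega) b (by omega) (by omega), R.rows_zero a (by omega) b (by omega) le_rfl,
        if_pos rfl]
      by_cases haN : a = b
      · rw [if_pos haN, hcol _ hs]
      · rw [if_neg haN, hcol _ (R.supp a (by omega))]
    · rw [e_lt b (by omega)]
      by_cases haN : a = N
      · subst haN
        rw [if_pos rfl, hr1 b (by omega)]
      · rw [if_neg haN, hr2 a (by omega) b (by omega) (by omega), R.rows a (by omega) b (by omega)]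
  · intro a ha b hb hNb
    rw [hr2 a ha b hb (by omega), R.rows_zero a ha b hb (by omega)]
  · rw [h13]; exact R.mul

/-- Row `N` does not belong to a counted node, and the requirement of vanishing concerns only its
columns from `N` on, which are not written. -/
theorem Repr.frame_row {σ' : Store} (R : Repr q L N e ord σ) (hNL : N < L)
    (hF : Frame 22 [12] σ σ') (hr2 : ∀ a < L, ∀ b < L, ¬ (a = N ∧ b < N) →
        σ'.mem 12 ((a : ℤ) * L + b) = σ.mem 12 ((a : ℤ) * L + b)) : Repr q L N e ord σ' where
  pos := R.pos
  ord_lt := R.ord_lt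
  mono := R.mono
  surj := R.surj
  zero := R.zero
  hasCd := R.hasCd
  supp := R.supp
  one := by rw [hF.reg 3 (by omega), R.one]
  num := by rw [hF.reg 4 (by omega), R.num]
  ordm := by rw [hF.mem 10 (by decide)]; exact R.ordm
  next := by rw [hF.mem 11 (by decide)]; exact R.next
  no_next := by rw [hF.mem 11 (by decide)]; exact R.no_next
  rows := fun a ha b hb => by rw [hr2 a (by omega) b (by omega) (by omega), R.rows a ha b hb]
  rows_zero := fun a ha b hb h => by rw [hr2 a ha b hb (by omega), R.rows_zero a ha b hb h]
  mul := by rw [hF.mem 13 (by decide)]; exact R.mul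

end PowerCircuits

open scoped BigOperators
namespace PowerCircuits

variable {q L N : ℕ} {e ord : ℕ → ℕ} {σ : Store}

theorem runs_insertNode {w : ℤ} (hq : 2 ≤ q) (R : Repr q L N e ord σ) {B : ℕ} (hNL : N < L)
    (D : DivTable q (2 * B) σ) (hqB : q ≤ B) (low : ∀ m < 4, ∃ a < N, e a = m) {k pos : ℕ}
    (hk : HasCd q k) (hs : ∀ m, cd q k m ≠ 0 → ∃ b < N, e b = m) (hb : Tame q N e 2 k)
    (hacc : ∀ a < N, σ.mem 14 (a : ℤ) = cd q k (e a)) (h30 : σ.reg 30 = pos) (hpos : pos ≤ N)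
    (hlt : ∀ i < pos, e (ord i) < k) (hgt : ∀ i, pos ≤ i → i < N → k < e (ord i))
    (hw : (L : ℤ) * L + L + 2 * B + 2 * q + 2 ≤ w) :
    Runs w (insertNode q) σ (206 * N + 77) (fun σ' =>
      FrameN 20 [10, 11, 12, 14, 15, 16] σ σ' ∧ σ'.reg 20 = N ∧
      Repr q L (N + 1) (fun a => if a = N then k else e a)
        (fun i => if i < pos then ord i else if i = pos then N else ord (i - 1)) σ') := by
  have hLL : (0 : ℤ) ≤ (L : ℤ) * L := by positivity
  have hkE : ∀ b < N, e b ≠ k := by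
    intro b hb h
    obtain ⟨i, hi, rfl⟩ := R.surj b hb
    by_cases hip : i < pos
    · have := hlt i hip; omega
    · have := hgt i (by omega) hi; omega
  have hT : 206 * N + 77 = 1 + ((6 * N + 4) + (2 + ((97 * N + 28) + (3 + ((97 * N + 28) +
      (2 + ((6 * N + 3) + 6))))))) := by omega
  rw [hT]
  refine Runs.seq (R := fun σ' => Frame 20 [] σ σ' ∧ σ'.reg 21 = pos)
    (Runs.of_wp (by decide) (by simp [wp, h30])) ?_
  rintro σ₁ ⟨F1, p1⟩
  have R1 := R.frame F1 (by decide) (by decide)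
  -- The row is stored before the number of nodes is raised, so that the searches for the two
  -- neighbours can read it while they still work with the old nodes.
  refine (runs_storeRow R1 hNL (f := fun a => cd q k (e a))
    (by rw [F1.mem 14 (by decide)]; exact hacc) (by omega)).seq ?_
  rintro σ₂ ⟨F2, p2, p3⟩
  have R2 := R1.frame_row hNL F2 p3
  refine Runs.seq (R := fun σ' => Frame 22 [] σ₂ σ' ∧ σ'.reg 26 = N ∧ σ'.reg 27 = 1)
    (Runs.of_wp (by decide) ?_) ?_
  · simp [block, wp, R2.num]; omega
  rintro σ₃ ⟨F3, p4, p5⟩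
  have R3 := R2.frame F3 (by decide) (by decide)
  have D3 := ((D.frame F1 (by decide)).frame F2 (by decide)).frame F3 (by decide)
  have row3 : ∀ a < N, σ₃.mem 12 ((N : ℤ) * L + a) = cd q k (e a) := by
    rw [F3.mem 12 (by decide)]; exact p2
  refine (runs_findInc hq R3 hNL.le D3 hqB (y := k) (inc := 1) (id := N) low hNL p4 p5 (by simp)
    row3 hk hs hb hw).seq ?_
  rintro σ₄ ⟨F4, p6⟩
  have R4 := R3.frame F4 (by decide) (by decide)
  refine Runs.seq (R := fun σ' => Frame 22 [] σ₄ σ' ∧ σ'.reg 26 = N ∧ σ'.reg 27 = -1 ∧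
    (∀ b < N, e b = k + 1 → σ'.reg 23 = b) ∧ ((∀ b < N, e b ≠ k + 1) → σ'.reg 23 = 0))
    (Runs.of_wp (by decide) ?_) ?_
  · have h26 : σ₄.reg 26 = N := by rw [F4.reg 26 (by decide), p4]
    simp only [block, wp]
    rcases p6 with ⟨g1, c, hc, g2, g3⟩ | ⟨g1, g2⟩
    · have g3' : e c = k + 1 := by exact_mod_cast g3
      refine ⟨fun _ => ⟨by rw [abs_le]; omega, by simp, by simp [h26], by simp, ?_, ?_⟩,
        fun h => by omega⟩
      · intro b hb hbe
        simp only [Store.reg_setReg, Nat.reduceEqDiff, reduceIte, g2]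
        rw [R.e_inj hb hc (by omega)]
      · intro h; exact absurd g3' (h c hc)
    · refine ⟨fun h => by omega, fun _ => ⟨by rw [abs_le]; omega, by rw [abs_le]; omega, by simp,
        by simp [h26], by simp, ?_, by simp⟩⟩
      intro b hb hbe
      exact absurd (by rw [hbe]; push_cast; rfl) (g2 b hb)
  rintro σ₅ ⟨F5, p7, p8, p9, p10⟩
  have R5 := R4.frame F5 (by decide) (by decide)
  have D5 := (D3.frame F4 (by decide)).frame F5 (by decide)
  refine (runs_findInc hq R5 hNL.le D5 hqB (y := k) (inc := -1) (id := N) low hNL p7 p8 (by simp)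
    (by rw [F5.mem 12 (by decide), F4.mem 12 (by decide)]; exact row3) hk hs hb hw).seq ?_
  rintro σ₆ ⟨F6, p11⟩
  have R6 := R5.frame F6 (by decide) (by decide)
  refine Runs.seq (R := fun σ' => Frame 22 [] σ₆ σ' ∧ σ'.reg 23 = σ₅.reg 23 ∧
    ((σ'.reg 24 = 1 ∧ ∃ c < N, σ'.reg 25 = (c : ℕ) ∧ e c + 1 = k) ∨
      (σ'.reg 24 = 0 ∧ ∀ c < N, e c + 1 ≠ k))) (Runs.of_wp (by decide) ?_) ?_
  · simp only [block, wp]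
    refine ⟨by simp, by simp [F6.reg 23 (by decide)], ?_⟩
    rcases p11 with ⟨g1, c, hc, g2, g3⟩ | ⟨g1, g2⟩
    · exact Or.inl ⟨by simp [g1], c, hc, by simp [g2], by omega⟩
    · exact Or.inr ⟨by simp [g1], fun c hc h => g2 c hc (by omega)⟩
  rintro σ₇ ⟨F7, p12, p13⟩
  have R7 := R6.frame F7 (by decide) (by decide)
  have h21 : σ₇.reg 21 = pos := by
    rw [F7.reg 21 (by decide), F6.reg 21 (by decide), F5.reg 21 (by decide), F4.reg 21 (by decide),
      F3.reg 21 (by decide), F2.reg 21 (by decide), p1]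
  refine (runs_shiftOrd R7 h21 hpos (by omega)).seq ?_
  rintro σ₈ ⟨F8, p14, p15⟩
  have R8 : σ₈.reg 3 = 1 ∧ σ₈.reg 4 = N := by
    rw [F8.reg 3 (by decide), F8.reg 4 (by decide)]; exact ⟨R7.one, R7.num⟩
  have h21' : σ₈.reg 21 = pos := by rw [F8.reg 21 (by decide), h21]
  have h23 : σ₈.reg 23 = σ₅.reg 23 := by rw [F8.reg 23 (by decide), p12]
  have h24 := F8.reg 24 (by decide)
  have h25 := F8.reg 25 (by decide)
  have W : ∀ {b : ℕ} {S : List ℕ} {τ τ' : Store}, Frame b S τ τ' → 20 ≤ b →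
      S ⊆ [10, 11, 12, 14, 15, 16] → FrameN 20 [10, 11, 12, 14, 15, 16] τ τ' :=
    fun h hb hS => h.frameN hb hS
  have T : ∀ {τ τ' τ'' : Store}, FrameN 20 [10, 11, 12, 14, 15, 16] τ τ' →
      FrameN 20 [10, 11, 12, 14, 15, 16] τ' τ'' → FrameN 20 [10, 11, 12, 14, 15, 16] τ τ'' :=
    fun h h' => h.trans h' le_rfl (by simp) le_rfl (by simp)
  have F78 : FrameN 20 [10, 11, 12, 14, 15, 16] σ σ₈ :=
    T (T (T (T (T (T (T (W F1 (by decide) (by simp)) (W F2 (by decide) (by simp)))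
      (W F3 (by decide) (by simp))) (W F4 (by decide) (by simp))) (W F5 (by decide) (by simp)))
      (W F6 (by decide) (by simp))) (W F7 (by decide) (by simp))) (W F8 (by decide) (by simp))
  have m11 : σ₈.mem 11 = σ.mem 11 := by
    rw [F8.mem 11 (by decide), F7.mem 11 (by decide), F6.mem 11 (by decide), F5.mem 11 (by decide),
      F4.mem 11 (by decide), F3.mem 11 (by decide), F2.mem 11 (by decide), F1.mem 11 (by decide)]
  have m12 : σ₈.mem 12 = σ₂.mem 12 := by
    rw [F8.mem 12 (by decide), F7.mem 12 (by decide), F6.mem 12 (by decide), F5.mem 12 (by decide),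
      F4.mem 12 (by decide), F3.mem 12 (by decide)]
  have m13 : σ₈.mem 13 = σ.mem 13 := F78.mem 13 (by decide)
  -- The two branches differ only in the pointer from a predecessor with exponent `k - 1`;
  -- everything else is collected here once.
  have mcore : ∀ σ' : Store, FrameN 20 [10, 11, 12, 14, 15, 16] σ₈ σ' →
      σ'.reg 3 = 1 → σ'.reg 4 = N + 1 →
      (∀ i : ℕ, σ'.mem 10 (i : ℤ) = if i = pos then (N : ℤ) else σ₈.mem 10 (i : ℤ)) →
      σ'.mem 12 = σ₈.mem 12 → σ'.mem 13 = σ₈.mem 13 →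
      σ'.mem 11 (N : ℤ) = σ₅.reg 23 →
      (∀ a < N, e a + 1 = k → σ'.mem 11 (a : ℤ) = N) →
      (∀ a < N, e a + 1 ≠ k → σ'.mem 11 (a : ℤ) = σ.mem 11 (a : ℤ)) →
      FrameN 20 [10, 11, 12, 14, 15, 16] σ σ' ∧ True ∧
      Repr q L (N + 1) (fun a => if a = N then k else e a)
        (fun i => if i < pos then ord i else if i = pos then N else ord (i - 1)) σ' := by
    intro σ' G h3 h4 h10 h12 h13 h11 hn3 hn4
    refine ⟨F78.trans G le_rfl (by simp) le_rfl (by simp), trivial, ?_⟩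
    refine R.insert hNL hk hs hpos hlt hgt h3 h4 ?_ ?_ ?_ ?_ ?_ hn3 hn4 ?_ ?_ (by rw [h13, m13])
    · intro i hi
      rw [h10, if_neg (by omega), p14 i hi]
    · rw [h10, if_pos rfl]
    · intro i hi hiN
      rw [h10, if_neg (by omega), p15 i hi hiN]
    · intro b hb h; rw [h11, p9 b hb h]
    · intro h; rw [h11, p10 h]
    · rw [h12, m12]; exact p2
    · intro a ha b hb hab
      rw [h12, m12, p3 a ha b hb hab, F1.mem 12 (by decide)]
  refine Runs.of_wp (by decide) ?_
  simp only [block, wp, Store.reg_setReg, Store.reg_setMem, R8.1, R8.2, h21', h23, h24, h25,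
    Nat.reduceEqDiff, reduceIte]
  refine ⟨fun h1 => ⟨by rw [abs_le]; omega, ?_⟩, fun h1 => ⟨by rw [abs_le]; omega, ?_⟩⟩
  · rcases p13 with ⟨g1, c, hc, g2, g3⟩ | ⟨g1, g2⟩
    swap
    · omega
    refine mcore _ ⟨fun r hr h4 => ?_, fun s hs => ?_⟩ ?_ ?_ (fun i => ?_) ?_ ?_ ?_ ?_ ?_
    · simp only [Store.reg_setReg, Store.reg_setMem]
      rw [if_neg h4, if_neg (by omega)]
    · simp only [List.mem_cons, not_or] at hs
      simp only [Store.mem_setReg]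
      rw [Store.mem_setMem_of_ne _ _ _ _ hs.2.1, Store.mem_setMem_of_ne _ _ _ _ hs.2.1,
        Store.mem_setMem_of_ne _ _ _ _ hs.1]
    · simp [R8.1]
    · simp
    · simp [Store.mem_setMem]
    · simp
    · simp
    · simp only [Store.mem_setReg, Store.mem_setMem, g2, true_and, Nat.cast_inj]
      rw [if_neg (by omega), if_pos trivial]
    · intro a ha h
      simp only [Store.mem_setReg, Store.mem_setMem, g2, true_and, Nat.cast_inj]
      rw [if_pos (R.e_inj ha hc (by omega))]
    · intro a ha h
      simp only [Store.mem_setReg, Store.mem_setMem, g2, true_and, Nat.cast_inj]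
      rw [if_neg (fun hac => h (by rw [hac]; exact g3)), if_neg (by omega), if_neg (by simp), m11]
  · rcases p13 with ⟨g1, c, hc, g2, g3⟩ | ⟨g1, g2⟩
    · omega
    refine mcore _ ⟨fun r hr h4 => ?_, fun s hs => ?_⟩ ?_ ?_ (fun i => ?_) ?_ ?_ ?_ ?_ ?_
    · simp only [Store.reg_setReg, Store.reg_setMem]
      rw [if_neg h4, if_neg (by omega)]
    · simp only [List.mem_cons, not_or] at hs
      simp only [Store.mem_setReg]
      rw [Store.mem_setMem_of_ne _ _ _ _ hs.2.1, Store.mem_setMem_of_ne _ _ _ _ hs.1]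
    · simp [R8.1]
    · simp
    · simp [Store.mem_setMem]
    · simp
    · simp
    · simp [Store.mem_setMem]
    · intro a ha h; exact absurd h (g2 a ha)
    · intro a ha h
      simp only [Store.mem_setReg, Store.mem_setMem, true_and, Nat.cast_inj]
      rw [if_neg (by omega), if_neg (by simp), m11]

/-- Normalise the accumulator and find or create the node whose exponent is its value; register
`20` is this node. -/
def ensure (q : ℕ) : Program :=
  .seq (normalise q) (.seq findNode (.ifPos 33 (.move 20 34) (insertNode q)))

/-- The nodes `e', N'` arise from the nodes `e, N` by adding the exponent `k`. -/
structure Extends (N N' : ℕ) (e e' : ℕ → ℕ) (k : ℕ) : Prop where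
  le : N ≤ N'
  le' : N' ≤ N + 1
  old : ∀ a < N, e' a = e a
  new : ∀ a, N ≤ a → a < N' → e' a = k
  mem : ∃ r < N', e' r = k

theorem Extends.not_mem {N' k : ℕ} {e' : ℕ → ℕ} (h : Extends N N' e e' k) {p : ℕ}
    (hp : ∀ a < N', e' a ≠ p) : ∀ a < N, e a ≠ p := fun a ha => by
  rw [← h.old a ha]; exact hp a (by have := h.le; omega)

theorem Extends.mem_old {N' k : ℕ} {e' : ℕ → ℕ} (h : Extends N N' e e' k) {p : ℕ}
    (hp : ∃ a < N, e a = p) : ∃ a < N', e' a = p := by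
  obtain ⟨a, ha, rfl⟩ := hp
  exact ⟨a, by have := h.le; omega, h.old a ha⟩

theorem Extends.tame {N' k : ℕ} {e' : ℕ → ℕ} (h : Extends N N' e e' k) {b y : ℤ}
    (hy : Tame q N e b y) : Tame q N' e' b y := fun p hp => hy p (h.not_mem hp)

theorem runs_ensure {w : ℤ} (hq : 2 ≤ q) (R : Repr q L N e ord σ) {B : ℕ} (hNL : N < L)
    (D : DivTable q (2 * B) σ) (hqB : q ≤ B) (low : ∀ m < 4, ∃ a < N, e a = m) {k : ℕ} {b : ℤ}
    {A : ℕ → ℤ} (hA : ∀ a < N, σ.mem 14 (a : ℤ) = A a) (hAB : ∀ a < N, |A a| ≤ B)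
    (hk : nodeSum q N e A = k) (hb : b ≤ 2)
    (hgap : ∀ p, (∀ a < N, e a ≠ p) →
      |psum q (spread (Finset.range N) e A) p| ≤ (q : ℤ) ^ (p - 2) + b)
    (htame : ∀ a < N, Tame q N e b (e a))
    (hw : (L : ℤ) * L + L + 2 * B + 2 * q + 2 ≤ w) :
    Runs w (ensure q) σ (297 * N + 98) (fun σ' => FrameN 20 [10, 11, 12, 14, 15, 16] σ σ' ∧
      ∃ N' e' ord', Repr q L N' e' ord' σ' ∧ Extends N N' e e' k ∧
        (∃ r < N', σ'.reg 20 = (r : ℕ) ∧ e' r = k) ∧ ∀ a < N', Tame q N' e' b (e' a)) := by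
  have hLL : (0 : ℤ) ≤ (L : ℤ) * L := by positivity
  have hT : 297 * N + 98 = (51 * N + 12) + ((40 * N + 8) + ((206 * N + 77) + 1)) := by omega
  have hgap' : ∀ p, (∀ a < N, e a ≠ p) →
      q * |psum q (spread (Finset.range N) e A) p| ≤ (q : ℤ) ^ p := fun p hp =>
    gap_bound hq (four_le_gap low hp) ((hgap p hp).trans (by linarith))
  rw [hT]
  refine (runs_normalise hq R D hA hAB hgap' (by omega)).seq ?_
  rintro σ₁ ⟨F1, p1, p2, p3⟩
  rw [hk] at p1 p2 p3
  have R1 := R.frame F1 (by decide) (by decide)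
  -- Below a gap the compact digits have the same partial sum as the coefficients before
  -- normalisation, by `Compact.psum_eq_of_gap`. Thus the bound for the coefficients becomes a bound
  -- for the new exponent.
  have htk : Tame q N e b k := by
    intro p hp
    have hcdp : cd q k p = 0 := by
      by_contra hc
      obtain ⟨a, ha, h⟩ := p2 p hc
      exact hp a ha h
    have hv := hasVal_spread q (Finset.range N) e A
    rw [show ∑ a ∈ Finset.range N, A a * (q : ℤ) ^ e a = k from hk] at hv
    rw [p1.1.psum_eq_of_gap hq p1.2 hv hcdp
      (spread_eq_zero _ fun a ha => hp a (Finset.mem_range.mp ha)) (hgap' p hp)]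
    exact hgap p hp
  refine (runs_findNode hq R1 hNL.le p1 p2 p3 (by omega)).seq ?_
  rintro σ₂ ⟨F2, lo, q1, q2⟩
  have R2 := R1.frame F2 (by decide) (by decide)
  have F12 : FrameN 20 [10, 11, 12, 14, 15, 16] σ σ₂ :=
    (F1.frameN (b := 20) (S := [10, 11, 12, 14, 15, 16]) (by simp) (by simp)).trans
      (F2.frameN (b := 20) (S := []) (by simp) (by simp))
      le_rfl (by simp) (by simp) (by simp)
  rcases q2 with ⟨g1, g2, g3, g4⟩ | ⟨g1, g2, g3, g4⟩
  · have g4' : e (ord lo) = k := by exact_mod_cast g4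
    refine Runs.ifPos (fun _ => (Runs.of_wp (T := 1) (by decide) ?_).mono (by omega) fun _ h => h)
      (fun h => by omega)
    have F20 : Frame 20 [] σ₂ (σ₂.setReg 20 (σ₂.reg 34)) := by simp
    refine ⟨F12.trans (F20.frameN (b := 20) (S := []) le_rfl (by simp)) le_rfl (by simp) le_rfl
      (by simp), N, e, ord, R2.frame F20 (by decide) (by decide), ?_, ?_, htame⟩
    · exact ⟨le_rfl, by omega, fun _ _ => rfl, fun a h1 h2 => by omega, _, R.ord_lt lo g2, g4'⟩
    · exact ⟨ord lo, R.ord_lt lo g2, by simp [g3], g4'⟩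
  · refine Runs.ifPos (fun h => by omega) (fun _ => ?_)
    refine (runs_insertNode hq R2 hNL ((D.frame F1 (by decide)).frame F2 (by decide)) hqB low p1 p2
      (htk.mono hb) (by rw [F2.mem 14 (by decide)]; exact p3) q1 g2
      (fun i hi => by exact_mod_cast g3 i hi) (fun i h1 h2 => by exact_mod_cast g4 i h1 h2)
      hw).mono le_rfl ?_
    rintro σ₃ ⟨F3, h20, R3⟩
    have hext : Extends N (N + 1) e (fun a => if a = N then k else e a) k :=
      ⟨by omega, le_rfl, fun a ha => if_neg (by omega), fun a h1 h2 => if_pos (by omega),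
        N, by omega, if_pos rfl⟩
    refine ⟨F12.trans F3 le_rfl (by simp) le_rfl (by simp), N + 1, _, _, R3, hext,
      ⟨N, by omega, h20, if_pos rfl⟩, ?_⟩
    intro a ha
    by_cases haN : a = N
    · rw [if_pos haN]; exact hext.tame htk
    · rw [if_neg haN]; exact hext.tame (htame a (by omega))

end PowerCircuits

/-! ### Extension of a chain at its top -/

open scoped BigOperators
namespace PowerCircuits

variable {q L N : ℕ} {e ord : ℕ → ℕ} {σ : Store}

/-- Move to the top of the chain of the node in register `10`; the result is in register `21`. -/
def climb : Program :=
  .seq (block [.move 21 10, .load 22 11 21]) (.whilePos 22 (block [.move 21 22, .load 22 11 21]))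

theorem runs_climb {w : ℤ} (R : Repr q L N e ord σ) {id : ℕ} (hid : id < N)
    (h10 : σ.reg 10 = id) :
    Runs w climb σ (3 * N + 3) (fun σ' => Frame 20 [] σ σ' ∧ ∃ a < N, σ'.reg 21 = (a : ℕ) ∧
      e id ≤ e a ∧ (∀ j, e id ≤ j → j ≤ e a → ∃ c < N, e c = j) ∧ ∀ c < N, e c ≠ e a + 1) := by
  have hT : 3 * N + 3 = 2 + (3 * N + 1) := by omega
  rw [hT]
  obtain ⟨Inv, hInv⟩ : ∃ Inv : Store → Prop, ∀ σ', Inv σ' ↔ (Frame 20 [] σ σ' ∧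
      ∃ a < N, σ'.reg 21 = (a : ℕ) ∧ σ'.reg 22 = σ.mem 11 (a : ℤ) ∧
      e id ≤ e a ∧ (∀ j, e id ≤ j → j ≤ e a → ∃ c < N, e c = j)) := ⟨_, fun _ => Iff.rfl⟩
  refine Runs.seq (R := Inv) (Runs.of_wp (by decide) ?_) ?_
  · simp only [block, wp, hInv]
    refine ⟨by simp, id, hid, by simp [h10], by simp [h10], le_rfl, fun j h1 h2 => ?_⟩
    exact ⟨id, hid, by omega⟩
  intro σ₁ h₁
  -- The number of nodes with larger exponent than the current one decreases strictly along the
  -- chain.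
  let μ : Store → ℕ := fun σ' =>
    ((Finset.range N).filter fun a => e (σ'.reg 21).toNat < e a).card
  have hμ : μ σ₁ ≤ N := (Finset.card_filter_le _ _).trans (by simp)
  refine (Runs.whilePos (σ := σ₁) 2 Inv μ h₁ ?_).mono ?_ ?_
  · intro σ₂ h₂ hpos
    obtain ⟨F, a, ha, h21, h22, hle, hch⟩ := (hInv _).mp h₂
    rw [h22] at hpos
    obtain ⟨c, hc, hce⟩ := (R.next_pos_iff ha).mp hpos
    have hn := R.next a ha c hc hce
    refine Runs.of_wp (by decide) ?_
    simp only [block, wp, hInv]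
    refine ⟨⟨by simpa using F, c, hc, by simp [h22, hn], ?_, by omega, ?_⟩, ?_⟩
    · simp only [Store.reg_setReg, Store.mem_setReg, F.mem 11 (by decide)]
      simp [h22, hn]
    · intro j h1 h2
      by_cases hj : j ≤ e a
      · exact hch j h1 hj
      · exact ⟨c, hc, by omega⟩
    · refine Finset.card_lt_card ?_
      simp only [Store.reg_setReg, Nat.reduceEqDiff, reduceIte, h22, hn, Int.toNat_natCast, h21]
      rw [Finset.ssubset_iff_of_subset]
      · exact ⟨c, by simp [hc, hce], by simp⟩
      · intro x hx
        rw [Finset.mem_filter] at hx ⊢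
        exact ⟨hx.1, by omega⟩
  · nlinarith
  · rintro σ₂ ⟨h₂, hpos⟩
    obtain ⟨F, a, ha, h21, h22, hle, hch⟩ := (hInv _).mp h₂
    rw [h22, R.next_pos_iff ha] at hpos
    push Not at hpos
    exact ⟨F, a, ha, h21, hle, hch, hpos⟩

/-- Add a node on top of the chain of the node in register `10`. -/
def extend (q : ℕ) : Program :=
  .seq climb (.seq (block [.move 26 21, .const 27 1]) (.seq loadAcc (ensure q)))

/-- The exponent of the new node is that of the top plus `1`, so the tolerance for partial sums
rises from `b` to `b + 1`. The intermediate exponents of the chain are reported because the capacity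
argument needs to know that the chain has no gap. -/
theorem runs_extend {w : ℤ} (hq : 2 ≤ q) (R : Repr q L N e ord σ) {B : ℕ} (hNL : N < L)
    (D : DivTable q (2 * B) σ) (hqB : q ≤ B) (low : ∀ m < 4, ∃ a < N, e a = m) {b : ℤ}
    {id : ℕ} (hid : id < N) (h10 : σ.reg 10 = id) (hb : b ≤ 1)
    (htame : ∀ a < N, Tame q N e b (e a))
    (hw : (L : ℤ) * L + L + 2 * B + 2 * q + 2 ≤ w) :
    Runs w (extend q) σ (306 * N + 111) (fun σ' => FrameN 20 [10, 11, 12, 14, 15, 16] σ σ' ∧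
      ∃ N' e' ord', Repr q L N' e' ord' σ' ∧ ∃ a < N, Extends N N' e e' (e a + 1) ∧
        e id ≤ e a ∧ (∀ j, e id ≤ j → j ≤ e a → ∃ c < N, e c = j) ∧ (∀ c < N, e c ≠ e a + 1) ∧
        ∀ a < N', Tame q N' e' (b + 1) (e' a)) := by
  have hLL : (0 : ℤ) ≤ (L : ℤ) * L := by positivity
  have hT : 306 * N + 111 = (3 * N + 3) + (2 + ((6 * N + 8) + (297 * N + 98))) := by omega
  rw [hT]
  refine (runs_climb R hid h10).seq ?_
  rintro σ₁ ⟨F1, a, ha, p1, p2, p3, p4⟩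
  have R1 := R.frame F1 (by decide) (by decide)
  refine Runs.seq (R := fun σ' => Frame 20 [] σ₁ σ' ∧ σ'.reg 26 = a ∧ σ'.reg 27 = 1)
    (Runs.of_wp (by decide) ?_) ?_
  · simp [block, wp, p1]; omega
  rintro σ₂ ⟨F2, p5, p6⟩
  have R2 := R1.frame F2 (by decide) (by decide)
  have haL : (a : ℤ) * L + N ≤ L * L := by
    have : ((a : ℤ) + 1) * L ≤ L * L := mul_le_mul_of_nonneg_right (by omega) (by positivity)
    linarith
  have habs := abs_le.mp (abs_incCoeff_le (e := e) (R.hasCd a ha) (inc := 1) (by simp) 0)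
  simp only [incCoeff, if_true, R.zero] at habs
  refine (runs_loadAcc (row := fun c => cd q (e a) (e c)) R2.num R2.one R2.pos p5
    (R2.mul a (by omega)) (fun c hc => R2.rows a ha c hc) (by linarith)
    (by rw [p6, R.zero, abs_le]; omega)).seq ?_
  rintro σ₃ ⟨F3, p7⟩
  have R3 := R2.frame F3 (by decide) (by decide)
  rw [p6] at p7
  have hsum := R.nodeSum_incCoeff 1 (R.hasCd a ha) (R.supp a ha)
  refine (runs_ensure hq R3 hNL (((D.frame F1 (by decide)).frame F2 (by decide)).frame F3
    (by decide)) hqB low (A := incCoeff q e (e a) 1) p7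
    (fun c _ => (abs_incCoeff_le (R.hasCd a ha) (by simp) c).trans (by exact_mod_cast hqB))
    (k := e a + 1) (b := b + 1) (by rw [hsum]; push_cast; rfl) (by omega)
    (fun p hp => R.gap_incCoeff low (by simp) (htame a ha) (R.supp a ha) hp)
    (fun c hc => (htame c hc).mono (by omega)) hw).mono le_rfl ?_
  rintro σ₄ ⟨F4, N', e', ord', R4, hE, -, ht⟩
  have F12 : FrameN 20 [14] σ σ₂ := (F1.frameN (b := 20) (S := [14]) le_rfl (by simp)).trans
    (F2.frameN (b := 20) (S := [14]) le_rfl (by simp)) le_rfl (by simp) le_rfl (by simp)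
  have F13 : FrameN 20 [14] σ σ₃ := F12.trans
    (F3.frameN (b := 20) (S := [14]) (by simp) (by simp)) le_rfl (by simp) le_rfl (by simp)
  exact ⟨F13.trans F4 le_rfl (by simp) le_rfl (by simp), N', e', ord', R4, a, ha, hE, p2, p3, p4,
      ht⟩

end PowerCircuits

open scoped BigOperators
namespace PowerCircuits

variable {q L N : ℕ} {e ord : ℕ → ℕ} {σ : Store}

/-! ## The capacity of the chains -/

/-- The exponents of the nodes. -/
def exps (N : ℕ) (e : ℕ → ℕ) : Finset ℕ := (Finset.range N).image e

theorem mem_exps {p : ℕ} : p ∈ exps N e ↔ ∃ a < N, e a = p := by simp [exps]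

theorem Extends.exps_eq {N' k : ℕ} {e' : ℕ → ℕ} (h : Extends N N' e e' k) :
    exps N' e' = insert k (exps N e) := by
  ext p
  rw [Finset.mem_insert, mem_exps, mem_exps]
  constructor
  · rintro ⟨a, ha, rfl⟩
    by_cases haN : a < N
    · exact Or.inr ⟨a, haN, (h.old a haN).symm⟩
    · exact Or.inl (h.new a (by omega) ha)
  · rintro (rfl | hp)
    · exact h.mem
    · exact h.mem_old hp

/-- The exponents followed by two further exponents. -/
def slots (E : Finset ℕ) : Finset ℕ := E.filter fun j => j + 1 ∈ E ∧ j + 2 ∈ E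

theorem mem_slots {E : Finset ℕ} {j : ℕ} : j ∈ slots E ↔ j ∈ E ∧ j + 1 ∈ E ∧ j + 2 ∈ E := by
  simp [slots]

theorem slots_mono {E E' : Finset ℕ} (h : E ⊆ E') : slots E ⊆ slots E' := fun j hj => by
  rw [mem_slots] at *
  exact ⟨h hj.1, h hj.2.1, h hj.2.2⟩

/-- The sum of the powers below `q ^ p`, where the exponents are those of `S`. -/
def weight (q : ℕ) (S : Finset ℕ) (k : ℕ → ℕ) (p : ℕ) : ℤ :=
  ∑ v ∈ S, if k v < p then (q : ℤ) ^ k v else 0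

/-- The chains in `E` have room for all sums of the nodes in `S`. -/
def Capacity (q : ℕ) (E S : Finset ℕ) (k : ℕ → ℕ) (ρ : ℤ) : Prop :=
  -- The left side is the largest possible value, below `p`, of a marking supported on `S`, plus a
  -- slack `ρ` for remainders. Only exponents without node matter, since only there a carry could
  -- get lost.
  ∀ p, p ∉ E → ((q : ℤ) - 1) * weight q S k p + ρ ≤ ((q : ℤ) - 1) * weight q (slots E) id p

/-- If `j` is a slot below `p`, then `j + 1` and `j + 2` are exponents and hence different from `p`,
so that `j < p - 2`. The rest is the geometric sum. -/
theorem weight_slots_lt (hq : 2 ≤ q) {E : Finset ℕ} {p : ℕ} (hp : p ∉ E) :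
    ((q : ℤ) - 1) * weight q (slots E) id p ≤ (q : ℤ) ^ (p - 2) - 1 := by
  have hq' : (2 : ℤ) ≤ q := by exact_mod_cast hq
  have h1 : weight q (slots E) id p ≤ ∑ j ∈ Finset.range (p - 2), (q : ℤ) ^ j := by
    unfold weight
    rw [← Finset.sum_filter]
    refine Finset.sum_le_sum_of_subset_of_nonneg (fun j hj => ?_) fun j _ _ => by positivity
    rw [Finset.mem_filter, mem_slots] at hj
    obtain ⟨⟨h0, h1, h2⟩, h3⟩ := hj
    simp only [id] at h3
    rw [Finset.mem_range]
    have h4 : j + 1 ≠ p := fun h => hp (h ▸ h1)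
    have h5 : j + 2 ≠ p := fun h => hp (h ▸ h2)
    omega
  have h2 := mul_geom_sum (q : ℤ) (p - 2)
  rw [← h2]
  exact mul_le_mul_of_nonneg_left h1 (by omega)

theorem abs_sum_le_weight {S : Finset ℕ} {k : ℕ → ℕ} {c : ℕ → ℤ} (hq : 2 ≤ q)
    (hc : ∀ v ∈ S, |c v| ≤ q - 1) (p : ℕ) :
    |psum q (spread S k c) p| ≤ ((q : ℤ) - 1) * weight q S k p := by
  rw [psum_spread, weight, Finset.mul_sum]
  refine (Finset.abs_sum_le_sum_abs _ _).trans (Finset.sum_le_sum fun v hv => ?_)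
  split_ifs
  · rw [abs_mul, abs_of_nonneg (by positivity : (0 : ℤ) ≤ (q : ℤ) ^ k v)]
    exact mul_le_mul_of_nonneg_right (hc v hv) (by positivity)
  · simp

/-- `x` is a sum of the powers with exponents in `S`, up to a remainder of at most `ρ`. -/
def Spans (q : ℕ) (S : Finset ℕ) (k : ℕ → ℕ) (ρ : ℤ) (x : ℕ) : Prop :=
  ∃ (c : ℕ → ℤ) (r : ℤ), (∀ v ∈ S, |c v| ≤ q - 1) ∧ 0 ≤ r ∧ r ≤ ρ ∧
    (x : ℤ) = ∑ v ∈ S, c v * (q : ℤ) ^ k v + r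

theorem Spans.succ {S : Finset ℕ} {k : ℕ → ℕ} {ρ : ℤ} {x : ℕ} (h : Spans q S k ρ x) :
    Spans q S k (ρ + 1) (x + 1) := by
  obtain ⟨c, r, h1, h2, h3, h4⟩ := h
  exact ⟨c, r + 1, h1, by omega, by omega, by push_cast; linarith⟩

theorem Spans.mono {S S' : Finset ℕ} {k : ℕ → ℕ} {ρ ρ' : ℤ} {x : ℕ} (h : Spans q S k ρ x)
    (hq : 2 ≤ q) (hS : S ⊆ S') (hρ : ρ ≤ ρ') : Spans q S' k ρ' x := by
  obtain ⟨c, r, h1, h2, h3, h4⟩ := h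
  have hq' : (2 : ℤ) ≤ q := by exact_mod_cast hq
  refine ⟨fun v => if v ∈ S then c v else 0, r, fun v _ => ?_, h2, h3.trans hρ, ?_⟩
  · beta_reduce
    split_ifs with hv
    · exact h1 v hv
    · simp; omega
  · rw [h4]
    congr 1
    rw [← Finset.sum_subset hS]
    · exact Finset.sum_congr rfl fun v hv => by simp only [if_pos hv]
    · intro v _ hv; simp only [if_neg hv, zero_mul]

/-- The increments spoil the tolerance when it is followed from node to node. Here the exponent is
instead written directly as a marking of the given nodes plus a remainder, and the slack in
`Capacity` absorbs the remainder. This restores the tolerance `-1`. -/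
theorem Spans.tame {S : Finset ℕ} {k : ℕ → ℕ} {ρ : ℤ} (hq : 2 ≤ q)
    (low : ∀ m < 4, ∃ a < N, e a = m) (hk : ∀ v ∈ S, ∃ a < N, e a = k v)
    (hcap : Capacity q (exps N e) S k ρ) {x : ℕ} (hx : Spans q S k ρ x) (hcd : HasCd q x)
    (hs : ∀ m, cd q x m ≠ 0 → ∃ a < N, e a = m) : Tame q N e (-1) x := by
  obtain ⟨c, r, h1, h2, h3, h4⟩ := hx
  intro p hp
  have h4p := four_le_gap low hp
  have hpE : p ∉ exps N e := fun h => by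
    obtain ⟨a, ha, h⟩ := mem_exps.mp h; exact hp a ha h
  have hcdp : cd q x p = 0 := by
    by_contra hc
    obtain ⟨a, ha, h⟩ := hs p hc
    exact hp a ha h
  -- The remainder is put at exponent `0`, which lies below every gap. The coefficients of `β` need
  -- not be digits; only value and partial sums count.
  let β : ℕ → ℤ := fun m => spread S k c m + if m = 0 then r else 0
  have hpsum : ∀ p, 0 < p → psum q β p = psum q (spread S k c) p + r := by
    intro p hp
    simp only [psum, β, add_mul, Finset.sum_add_distrib, ite_mul, zero_mul]
    simp [hp]
  have hβ : HasVal q β x := by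
    obtain ⟨B, hB1, hB2, hB3⟩ := (hasVal_spread q S k c).exists_psum 1
    refine ⟨B, fun i hi => ?_, ?_⟩
    · simp only [β]; rw [hB2 i hi, if_neg (by omega), add_zero]
    · rw [hpsum B (by omega), hB3, h4]
  have hb : |psum q β p| ≤ (q : ℤ) ^ (p - 2) + -1 := by
    rw [hpsum p (by omega)]
    have g1 := abs_sum_le_weight (k := k) hq h1 p
    have g2 := hcap p hpE
    have g3 := weight_slots_lt hq hpE
    have g4 := abs_add_le (psum q (spread S k c) p) r
    rw [abs_of_nonneg h2] at g4
    linarith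
  rw [hcd.1.psum_eq_of_gap hq hcd.2 hβ hcdp ?_ (gap_bound hq h4p (hb.trans (by omega)))]
  · exact hb
  · simp only [β]
    rw [spread_eq_zero, if_neg (by omega), add_zero]
    intro v hv h
    obtain ⟨a, ha, h'⟩ := hk v hv
    exact hp a ha (h'.trans h)

theorem Capacity.gap {S : Finset ℕ} {k : ℕ → ℕ} {ρ : ℤ} (hq : 2 ≤ q) {E : Finset ℕ}
    (hcap : Capacity q E S k ρ) (hρ : 0 ≤ ρ) {c : ℕ → ℤ} (hc : ∀ v ∈ S, |c v| ≤ q - 1)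
    {p : ℕ} (hp : p ∉ E) : |psum q (spread S k c) p| ≤ (q : ℤ) ^ (p - 2) + -1 := by
  have g1 := abs_sum_le_weight (k := k) hq hc p
  have g2 := hcap p hp
  have g3 := weight_slots_lt hq hp
  linarith

theorem weight_insert {S : Finset ℕ} {k : ℕ → ℕ} {u : ℕ} (hu : u ∉ S) (p : ℕ) :
    weight q (insert u S) k p = (if k u < p then (q : ℤ) ^ k u else 0) + weight q S k p :=
  Finset.sum_insert hu

theorem weight_mono {S S' : Finset ℕ} {k : ℕ → ℕ} (h : S ⊆ S') (p : ℕ) :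
    weight q S k p ≤ weight q S' k p :=
  Finset.sum_le_sum_of_subset_of_nonneg h fun v _ _ => by split_ifs <;> positivity

/-- The chains still have enough room after the insertion of the exponent of a new node, if the
chain of this exponent is extended twice and the chain of `0` once. -/
theorem Capacity.step (hq : 2 ≤ q) {E S : Finset ℕ} {k : ℕ → ℕ} {ρ : ℤ} {u b b' c : ℕ}
    (hcap : Capacity q E S k ρ) (hu : u ∉ S) (low : ∀ m < 4, m ∈ E)
    (hb : k u ≤ b) (hbE : ∀ j, k u ≤ j → j ≤ b → j ∈ insert (k u) E) (hb1 : b + 1 ∉ insert (k u) E)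
    (hb' : k u ≤ b') (hbE' : ∀ j, k u ≤ j → j ≤ b' → j ∈ insert (b + 1) (insert (k u) E))
    (hb1' : b' + 1 ∉ insert (b + 1) (insert (k u) E))
    (hcE : ∀ j ≤ c, j ∈ insert (b' + 1) (insert (b + 1) (insert (k u) E)))
    (hc1 : c + 1 ∉ insert (b' + 1) (insert (b + 1) (insert (k u) E))) :
    Capacity q (insert (c + 1) (insert (b' + 1) (insert (b + 1) (insert (k u) E))))
      (insert u S) k (ρ + 3) := by
  have hq' : (2 : ℤ) ≤ q := by exact_mod_cast hq
  set E1 := insert (k u) E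
  set E2 := insert (b + 1) E1
  set E3 := insert (b' + 1) E2
  have s1 : E ⊆ E1 := Finset.subset_insert _ _
  have s2 : E1 ⊆ E2 := Finset.subset_insert _ _
  have s3 : E2 ⊆ E3 := Finset.subset_insert _ _
  have s4 : E3 ⊆ insert (c + 1) E3 := Finset.subset_insert _ _
  have hc3 : 3 ≤ c := by
    by_contra h
    exact hc1 (s3 (s2 (s1 (low (c + 1) (by omega)))))
  have hbb : b < b' := by
    by_contra h
    rcases Nat.lt_or_ge b' b with h1 | h1
    · exact hb1' (s2 (hbE (b' + 1) (by omega) (by omega)))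
    · have : b' = b := by omega
      exact hb1' (this ▸ Finset.mem_insert_self _ _)
  have hslot : b ∈ slots E3 := by
    rw [mem_slots]
    refine ⟨s3 (s2 (hbE b hb le_rfl)), s3 (Finset.mem_insert_self _ _), ?_⟩
    rcases Nat.lt_or_ge (b + 1) b' with h | h
    · exact s3 (hbE' (b + 2) (by omega) (by omega))
    · have : b' = b + 1 := by omega
      rw [show b + 2 = b' + 1 by omega]
      exact Finset.mem_insert_self _ _
  -- Before the extensions `b` was the top of its chain, so `b` is a slot that did not count before.
  have hslot' : b ∉ slots E := fun h => hb1 (s1 (mem_slots.mp h).2.1)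
  have cslot : c - 1 ∈ slots (insert (c + 1) E3) := by
    rw [mem_slots]
    refine ⟨s4 (hcE _ (by omega)), s4 (hcE _ (by omega)), ?_⟩
    rw [show c - 1 + 2 = c + 1 by omega]
    exact Finset.mem_insert_self _ _
  have cslot' : c - 1 ∉ slots E3 := fun h => hc1 (by
    have := (mem_slots.mp h).2.2; rwa [show c - 1 + 2 = c + 1 by omega] at this)
  intro p hp
  have hpE : p ∉ E := fun h => hp (s4 (s3 (s2 (s1 h))))
  have hcp : c - 1 < p := by
    by_contra h
    exact hp (s4 (hcE p (by omega)))
  have h0 := hcap p hpE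
  have hsub : insert (c - 1) (insert b (slots E)) ⊆ slots (insert (c + 1) E3) := by
    intro j hj
    simp only [Finset.mem_insert] at hj
    rcases hj with rfl | rfl | hj
    · exact cslot
    · exact slots_mono s4 hslot
    · exact slots_mono (s1.trans (s2.trans (s3.trans s4))) hj
  have hcb : c - 1 ∉ insert b (slots E) := by
    intro h
    rcases Finset.mem_insert.mp h with h | h
    · exact cslot' (h ▸ hslot)
    · exact cslot' (slots_mono (s1.trans (s2.trans s3)) h)
  have h1 := weight_mono (q := q) (k := id) hsub p
  rw [weight_insert hcb, weight_insert hslot'] at h1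
  simp only [id, hcp, if_true] at h1
  rw [weight_insert hu]
  -- The new slot `c - 1` in the chain of `0` contributes at least `4`, because this chain contains
  -- `0, …, 3`. This covers the growth of the slack by `3`.
  have h2 : (4 : ℤ) ≤ (q : ℤ) ^ (c - 1) := by
    calc (4 : ℤ) = 2 ^ 2 := by norm_num
      _ ≤ (q : ℤ) ^ 2 := by gcongr
      _ ≤ (q : ℤ) ^ (c - 1) := pow_le_pow_right₀ (by omega) (by omega)
  -- The new slot `b` pays for the new node `u`, as `k u ≤ b`. No gap `p` can separate the two,
  -- because the chain between them is complete.
  have h3 : (if k u < p then (q : ℤ) ^ k u else 0) ≤ if b < p then (q : ℤ) ^ b else 0 := by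
    split_ifs with g1 g2 g2
    · exact pow_le_pow_right₀ (by omega) hb
    · exact absurd (s4 (s3 (s2 (hbE p (by omega) (by omega))))) hp
    · positivity
    · rfl
  nlinarith

/-- The slots `0` and `1` weigh `1 + q`, while the single processed node weighs `1`. The difference
`(q - 1) * q` is at least `2`. -/
theorem Capacity.base (hq : 2 ≤ q) {E : Finset ℕ} (hE : ∀ m < 4, m ∈ E) {u : ℕ} {k : ℕ → ℕ}
    (hk : k u = 0) : Capacity q E {u} k 2 := by
  have hq' : (2 : ℤ) ≤ q := by exact_mod_cast hq
  intro p hp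
  have h4 : 4 ≤ p := by
    by_contra h
    exact hp (hE p (by omega))
  have hsub : ({0, 1} : Finset ℕ) ⊆ slots E := by
    intro j hj
    simp only [Finset.mem_insert, Finset.mem_singleton] at hj
    rw [mem_slots]
    exact ⟨hE _ (by omega), hE _ (by omega), hE _ (by omega)⟩
  have h1 := weight_mono (q := q) (k := id) hsub p
  have h2 : weight q {0, 1} id p = 1 + q := by
    simp [weight, show 0 < p by omega, show 1 < p by omega]
  have h3 : weight q {u} k p = 1 := by simp [weight, hk, show 0 < p by omega]
  rw [h3]
  rw [h2] at h1
  nlinarith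

end PowerCircuits

open scoped BigOperators
namespace PowerCircuits

variable {q L N : ℕ} {e ord : ℕ → ℕ} {σ : Store}

/-! ## Tables -/

/-- The multiples of register `5`. -/
def mulTable : Program :=
  .seq (.const 32 0) (forUp 30 5 31 (block [.store 13 30 32, .add 32 32 5]))

theorem runs_mulTable {w : ℤ} (h3 : σ.reg 3 = 1) (h5 : σ.reg 5 = L)
    (hw : (L : ℤ) * L + L ≤ w) :
    Runs w mulTable σ (5 * L + 4) (fun σ' => Frame 30 [13] σ σ' ∧
      ∀ a < L, σ'.mem 13 (a : ℤ) = (a : ℤ) * L) := by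
  have hLL : (0 : ℤ) ≤ (L : ℤ) * L := by positivity
  have hT : 5 * L + 4 = 1 + (5 * L + 3) := by omega
  rw [hT]
  refine Runs.seq (R := fun σ' => Frame 30 [13] σ σ' ∧ σ'.reg 32 = 0)
    (Runs.of_wp (by decide) (by simp [wp]; omega)) ?_
  rintro σ₁ ⟨F1, p1⟩
  refine (Runs.forUp (σ₀ := σ) (r := 30) (S := [13]) (n := L) 2 (fun k σ' =>
    σ'.reg 32 = (k : ℤ) * L ∧ ∀ a < k, σ'.mem 13 (a : ℤ) = (a : ℤ) * L)
    (by decide) (by decide) (by decide) (by decide) (by decide) h5 h3 (by omega) F1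
    (by simp [p1]) (fun k σ v v' h => by simpa using h) ?_).mono le_rfl (fun σ' h => ⟨h.1, h.2.2⟩)
  rintro k hk σ' hF ⟨hI1, hI2⟩ hi
  refine Runs.of_wp (by decide) ?_
  have h5' : σ'.reg 5 = L := by rw [hF.reg 5 (by decide), h5]
  have hkL : ((k : ℤ) + 1) * L ≤ L * L := mul_le_mul_of_nonneg_right (by omega) (by positivity)
  have hk0 : (0 : ℤ) ≤ (k : ℤ) * L := by positivity
  simp [block, wp, hi, hF, hI1, h5']
  refine ⟨by rw [abs_le]; constructor <;> linarith, by ring, fun a ha => ?_⟩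
  split_ifs with h
  · rw [h]
  · exact hI2 a (by omega)

/-- The quotients and remainders of the numbers of absolute value at most `2qn`. -/
def divTable (q : ℕ) : Program :=
  -- The product `2 * q * n` is formed by adding `n` repeatedly. The table is then filled from `-2 *
  -- q * n` upwards, adjusting quotient and remainder by one at each entry.
  .seq (block [.const 8 (2 * q), .const 32 0]) (.seq (forUp 30 8 31 (.add 32 32 0))
  (.seq (block [.move 6 32, .add 7 6 6, .add 7 7 3, .const 33 0, .sub 32 33 6, .sub 33 33 0,
    .sub 33 33 0, .const 34 0, .const 35 q])
  (forUp 30 7 31 (block [.store 17 32 33, .store 18 32 34, .add 32 32 3, .add 34 34 3,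
    .sub 36 35 34, .ifPos 36 .skip (block [.const 34 0, .add 33 33 3])]))))

theorem ediv_emod_add_one (hq : 0 < q) (a : ℤ) :
    (0 < (q : ℤ) - (a % q + 1) → (a + 1) / q = a / q ∧ (a + 1) % q = a % q + 1) ∧
    (¬ 0 < (q : ℤ) - (a % q + 1) → (a + 1) / q = a / q + 1 ∧ (a + 1) % q = 0) := by
  have hq' : (0 : ℤ) < q := by exact_mod_cast hq
  have h1 := Int.emod_nonneg a hq'.ne'
  have h2 := Int.emod_lt_of_pos a hq'
  have h3 := Int.emod_add_mul_ediv a q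
  constructor
  · intro h
    exact (Int.ediv_emod_unique hq').mpr ⟨by linarith, by omega, by omega⟩
  · intro h
    have : a % q + 1 = q := by omega
    exact (Int.ediv_emod_unique hq').mpr ⟨by linarith, by omega, by omega⟩

theorem runs_divTable {w : ℤ} (hq : 2 ≤ q) {n : ℕ} (h0 : σ.reg 0 = n) (h3 : σ.reg 3 = 1)
    (hw : 4 * (q : ℤ) * n + 2 * q + 2 * n + 4 ≤ w) :
    Runs w (divTable q) σ (44 * q * n + 8 * q + 30) (fun σ' => Frame 6 [17, 18] σ σ' ∧
      DivTable q (2 * (q * n)) σ') := by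
  have hq' : (2 : ℤ) ≤ q := by exact_mod_cast hq
  have hqn : (0 : ℤ) ≤ (q : ℤ) * n := by positivity
  have hT : 44 * q * n + 8 * q + 30 = 2 + ((4 * (2 * q) + 3) + (9 + (11 *
      (4 * q * n + 1) + 5))) := by
    ring
  rw [hT]
  refine Runs.seq (R := fun σ' => Frame 6 [17, 18] σ σ' ∧ σ'.reg 8 = (2 * q : ℕ) ∧ σ'.reg 32 = 0)
    (Runs.of_wp (by simp [block, cost]) ?_) ?_
  · simp [block, wp]
    constructor <;> linarith
  rintro σ₁ ⟨F1, p1, p2⟩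
  have g0 : σ₁.reg 0 = n := by rw [F1.reg 0 (by decide), h0]
  have g3 : σ₁.reg 3 = 1 := by rw [F1.reg 3 (by decide), h3]
  refine (Runs.forUp (σ₀ := σ₁) (r := 30) (S := []) (n := 2 * q) 1 (fun k σ' =>
    σ'.reg 32 = (k : ℤ) * n)
    (by decide) (by decide) (by decide) (by decide) (by decide) p1 g3 (by push_cast; linarith)
    (by simp) (by simp [p2]) (fun k σ v v' h => by simpa using h) ?_).seq ?_
  · rintro k hk σ' hF hI hi
    refine Runs.of_wp (by decide) ?_
    have : ((k : ℤ) + 1) * n ≤ (2 * q) * n :=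
      mul_le_mul_of_nonneg_right (by omega) (by positivity)
    have h2 : (0 : ℤ) ≤ (k : ℤ) * n := by positivity
    simp [wp, hi, hF, hI, hF.reg 0, g0]
    refine ⟨by rw [abs_le]; constructor <;> linarith, by ring⟩
  rintro σ₂ ⟨F2, p3⟩
  have f0 : σ₂.reg 0 = n := by rw [F2.reg 0 (by decide), g0]
  have f3 : σ₂.reg 3 = 1 := by rw [F2.reg 3 (by decide), g3]
  have p3' : σ₂.reg 32 = 2 * (q * n) := by rw [p3]; push_cast; ring
  -- The lowest argument is a multiple of `q`, so its quotient and remainder are known without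
  -- division.
  have e0 : (-(2 * (q * n) : ℤ)) / q = -2 * n ∧ (-(2 * (q * n) : ℤ)) % q = 0 :=
    (Int.ediv_emod_unique (by omega)).mpr ⟨by ring, by omega, by omega⟩
  refine Runs.seq (R := fun σ' => Frame 6 [17, 18] σ σ' ∧ σ'.reg 7 = (4 * q * n + 1 : ℕ) ∧
    σ'.reg 32 = -(2 * (q * n)) ∧ σ'.reg 33 = -2 * n ∧ σ'.reg 34 = 0 ∧ σ'.reg 35 = q)
    (Runs.of_wp (by simp [block, cost]) ?_) ?_
  · simp only [block, wp, Store.reg_setReg, Nat.reduceEqDiff, reduceIte, p3', f0, f3]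
    refine ⟨by rw [abs_le]; constructor <;> linarith, by rw [abs_le]; constructor <;> linarith,
      by rw [abs_zero]; linarith, by rw [abs_le]; constructor <;> linarith,
      by rw [abs_le]; constructor <;> linarith, by rw [abs_le]; constructor <;> linarith,
      by rw [abs_zero]; linarith, by rw [abs_le]; constructor <;> linarith, ?_, ?_, ?_, ?_, ?_, ?_⟩
    · simpa using F1.trans F2 (by decide) (by simp)
    · push_cast; ring
    · ring
    · ring
    · trivial
    · trivial
  rintro σ₃ ⟨F3, p4, p5, p6, p7, p8⟩
  have k3 : σ₃.reg 3 = 1 := by rw [F3.reg 3 (by decide), h3]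
  refine (Runs.forUp (σ₀ := σ₃) (r := 30) (S := [17, 18]) (n := 4 * q * n + 1) 8 (fun k σ' =>
    σ'.reg 32 = -(2 * (q * n)) + (k : ℤ) ∧ σ'.reg 33 = (-(2 * (q * n)) + (k : ℤ)) / q ∧
    σ'.reg 34 = (-(2 * (q * n)) + (k : ℤ)) % q ∧ σ'.reg 35 = q ∧
    ∀ j < k, σ'.mem 17 (-(2 * (q * n)) + (j : ℤ)) = (-(2 * (q * n)) + (j : ℤ)) / q ∧
      σ'.mem 18 (-(2 * (q * n)) + (j : ℤ)) = (-(2 * (q * n)) + (j : ℤ)) % q)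
    (by decide) (by decide) (by decide) (by decide) (by decide) p4 k3 (by push_cast; linarith)
    (by simp) ?_ (fun k σ v v' h => by simpa using h) ?_).mono (by omega) ?_
  · simp only [Nat.cast_zero, add_zero, p5, p6, p7, p8, e0.1, e0.2]
    simp
  · rintro k hk σ' hF ⟨i1, i2, i3, i4, i5⟩ hi
    refine Runs.of_wp (by decide) ?_
    have h3' : σ'.reg 3 = 1 := by rw [hF.reg 3 (by decide), k3]
    set a : ℤ := -(2 * (q * n)) + (k : ℤ) with ha
    have hk' : (k : ℤ) < 4 * q * n + 1 := by exact_mod_cast hk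
    have ha1 : |a| ≤ 2 * (q * n) := by rw [abs_le]; constructor <;> linarith
    have ha2 := Int.abs_ediv_le_abs a q
    have h1 := Int.emod_nonneg a (b := (q : ℤ)) (by omega)
    have h2 := Int.emod_lt_of_pos a (b := (q : ℤ)) (by omega)
    obtain ⟨s1, s2⟩ := ediv_emod_add_one (q := q) (by omega) a
    have ha3 := abs_le.mp ha1
    have ha4 := abs_le.mp (ha2.trans ha1)
    have hk1 : -(2 * (q * n : ℤ)) + ((k + 1 : ℕ) : ℤ) = a + 1 := by rw [ha]; push_cast; ring
    have hmem : ∀ (τ : Store), τ.mem = ((σ'.setMem 17 a (a / q)).setMem 18 a (a % q)).mem →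
        ∀ j < k + 1, τ.mem 17 (-(2 * (q * n)) + (j : ℤ)) = (-(2 * (q * n)) + (j : ℤ)) / q ∧
          τ.mem 18 (-(2 * (q * n)) + (j : ℤ)) = (-(2 * (q * n)) + (j : ℤ)) % q := by
      intro τ hτ j hj
      rw [hτ]
      by_cases hjk : j = k
      · subst hjk; simp [← ha]
      · have hne : -(2 * (q * n : ℤ)) + (j : ℤ) ≠ a := by rw [ha]; omega
        simpa [hne] using i5 j (by omega)
    simp only [block, wp, Store.reg_setReg, Store.reg_setMem, Store.mem_setReg, Nat.reduceEqDiff,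
      reduceIte, i1, i2, i3, i4, h3', hi, hk1]
    refine ⟨by rw [abs_le]; constructor <;> linarith, by rw [abs_le]; constructor <;> linarith,
      by rw [abs_le]; constructor <;> linarith, fun hc => ?_, fun hc => ?_⟩
    · obtain ⟨s1, s1'⟩ := s1 hc
      rw [s1, s1']
      exact ⟨by simpa using hF, ⟨trivial, rfl, rfl, trivial, hmem _ rfl⟩, trivial⟩
    · obtain ⟨s2, s2'⟩ := s2 hc
      rw [s2, s2']
      refine ⟨by rw [abs_zero]; linarith, by rw [abs_le]; constructor <;> linarith,
        by simpa using hF, ⟨trivial, rfl, rfl, trivial, hmem _ rfl⟩, trivial⟩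
  · rintro σ₄ ⟨F4, -, -, -, -, p9⟩
    refine ⟨F3.trans F4 (by decide) (by simp), fun a ha => ?_⟩
    push_cast at ha
    have ha' := abs_le.mp ha
    have hcast : ((a + 2 * (q * n)).toNat : ℤ) = a + 2 * (q * n) := Int.toNat_of_nonneg
        (by linarith)
    have := p9 (a + 2 * (q * n)).toNat (by zify; rw [hcast]; linarith)
    rw [hcast, show -(2 * (q * n : ℤ)) + (a + 2 * (q * n)) = a by ring] at this
    exact this

/-! ## The first nodes -/

theorem hasCd_of_psum (hq : 2 ≤ q) {x : ℤ} (a b c : ℤ) (hα : Compact q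
    (fun i => if i = 0 then a else if i = 1 then b else if i = 2 then c else 0))
    (hx : a + b * q + c * q ^ 2 = x) : HasCd q x :=
  hα.hasCd hq ⟨3, fun i hi => by
    beta_reduce
    rw [if_neg (by omega), if_neg (by omega), if_neg (by omega)], by
    simp [psum, Finset.sum_range_succ, ← hx]⟩

theorem hasCd_digit (hq : 2 ≤ q) {x : ℤ} (h0 : -(q : ℤ) < x) (h1 : x < q) : HasCd q x := by
  refine hasCd_of_psum hq x 0 0 ⟨?_, ?_, ?_, ?_⟩ (by ring) <;> intro i <;>
    rcases i with _ | _ | _ | i <;> simp <;> omega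

/-- Below `q` a single digit suffices. The remaining cases are `2 = q` and `3 = -1 + q ^ 2` for `q =
2`, and `3 = q` for `q = 3`. -/
theorem hasCd_of_lt_four (hq : 2 ≤ q) {x : ℕ} (hx : x < 4) : HasCd q x := by
  by_cases h : x < q
  · exact hasCd_digit hq (by omega) (by omega)
  · have : q = 2 ∨ q = 3 := by omega
    rcases this with rfl | rfl
    · have : x = 2 ∨ x = 3 := by omega
      rcases this with rfl | rfl
      · refine hasCd_of_psum le_rfl 0 1 0 ⟨?_, ?_, ?_, ?_⟩ (by norm_num) <;> intro i <;>
          rcases i with _ | _ | _ | i <;> simp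
      · refine hasCd_of_psum le_rfl (-1) 0 1 ⟨?_, ?_, ?_, ?_⟩ (by norm_num) <;> intro i <;>
          rcases i with _ | _ | _ | i <;> simp
    · have : x = 3 := by omega
      subst this
      refine hasCd_of_psum hq 0 1 0 ⟨?_, ?_, ?_, ?_⟩ (by norm_num) <;> intro i <;>
        rcases i with _ | _ | _ | i <;> simp

/-- Initialise the node `x < 4` with the exponent `x`. -/
noncomputable def initNode (q x : ℕ) : Program := block [.const 33 x, .load 34 13 33,
  .store 10 33 33, .const 35 (if x = 3 then 0 else x + 1), .store 11 33 35,
  -- These digits depend only on `q` and are therefore constants of the program.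
  .const 35 (cd q x 0), .store 12 34 35, .add 34 34 3,
  .const 35 (cd q x 1), .store 12 34 35, .add 34 34 3,
  .const 35 (cd q x 2), .store 12 34 35, .add 34 34 3,
  .const 35 (cd q x 3), .store 12 34 35]

theorem runs_initNode {w : ℤ} (hq : 2 ≤ q) {x : ℕ} (hx : x < 4) (h3 : σ.reg 3 = 1)
    (hm : σ.mem 13 (x : ℤ) = (x : ℤ) * L) (hw : 3 * (L : ℤ) + 4 + q ≤ w) :
    Runs w (initNode q x) σ 16 (fun σ' => Frame 30 [10, 11, 12] σ σ' ∧
      (∀ a : ℕ, σ'.mem 10 (a : ℤ) = if a = x then (x : ℤ) else σ.mem 10 (a : ℤ)) ∧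
      (∀ a : ℕ, σ'.mem 11 (a : ℤ) = if a = x then (if x = 3 then 0 else (x : ℤ) + 1)
        else σ.mem 11 (a : ℤ)) ∧
      (∀ b < 4, σ'.mem 12 ((x : ℤ) * L + (b : ℕ)) = cd q x b) ∧
      ∀ p : ℤ, (∀ b < 4, p ≠ (x : ℤ) * L + (b : ℕ)) → σ'.mem 12 p = σ.mem 12 p) := by
  have hcd : ∀ i, |cd q x i| ≤ w := fun i => by
    have h1 := (hasCd_of_lt_four hq hx).1.lo i
    have h2 := (hasCd_of_lt_four hq hx).1.hi i
    rw [abs_le]; constructor <;> linarith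
  have hxL : (x : ℤ) * L ≤ 3 * L := mul_le_mul_of_nonneg_right (by omega) (by positivity)
  have hxL0 : (0 : ℤ) ≤ (x : ℤ) * L := by positivity
  refine Runs.of_wp (by simp [initNode, block, cost]) ?_
  simp only [initNode, block, wp, Store.reg_setReg, Store.reg_setMem, Store.mem_setReg,
    Nat.reduceEqDiff, reduceIte, h3, hm, hcd, true_and]
  refine ⟨by rw [abs_le]; omega, by split_ifs <;> rw [abs_le] <;> omega, by rw [abs_le]; omega,
    by rw [abs_le]; omega, by rw [abs_le]; omega, by simp, fun a => ?_, fun a => ?_, ?_, ?_⟩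
  · simp [Store.mem_setMem]
  · simp [Store.mem_setMem]
  · intro b hb
    interval_cases b <;> simp [Store.mem_setMem] <;> intros <;> omega
  · intro p hp
    have g0 := hp 0 (by omega)
    have g1 := hp 1 (by omega)
    have g2 := hp 2 (by omega)
    have g3 := hp 3 (by omega)
    simp only [Nat.cast_zero, Nat.cast_one, Nat.cast_ofNat, add_zero] at g0 g1 g2 g3
    simp [Store.mem_setMem]
    rw [if_neg (by omega), if_neg (by omega), if_neg (by omega), if_neg g0]

/-- Initialise the nodes with the exponents `0, 1, 2, 3`. -/
noncomputable def initNodes (q : ℕ) : Program :=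
  .seq (initNode q 0) (.seq (initNode q 1) (.seq (initNode q 2) (.seq (initNode q 3) (.const 4 4))))

/-- The first `x` nodes have been initialised. -/
structure InitState (q L x : ℕ) (σ₀ σ : Store) : Prop where
  frame : Frame 30 [10, 11, 12] σ₀ σ
  ordm : ∀ i < x, σ.mem 10 (i : ℤ) = (i : ℕ)
  next : ∀ i < x, σ.mem 11 (i : ℤ) = if i = 3 then 0 else (i : ℤ) + 1
  rows : ∀ a < x, ∀ b < 4, σ.mem 12 ((a : ℤ) * L + (b : ℕ)) = cd q a b
  zero : ∀ a < L, ∀ b < L, 4 ≤ b → σ.mem 12 ((a : ℤ) * L + (b : ℕ)) = 0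

theorem InitState.succ {w : ℤ} (hq : 2 ≤ q) (hL : 4 ≤ L) {σ₀ : Store} {x : ℕ} (hx : x < 4)
    (h3 : σ₀.reg 3 = 1) (hm : ∀ a < L, σ₀.mem 13 (a : ℤ) = (a : ℤ) * L)
    (hw : 3 * (L : ℤ) + 4 + q ≤ w) (h : InitState q L x σ₀ σ) :
    Runs w (initNode q x) σ 16 (InitState q L (x + 1) σ₀) := by
  refine (runs_initNode hq hx (by rw [h.frame.reg 3 (by decide), h3])
    (by rw [h.frame.mem 13 (by decide), hm x (by omega)]) hw).mono le_rfl ?_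
  rintro σ' ⟨F, p1, p2, p3, p4⟩
  have hne : ∀ a < L, ∀ b < L, (a ≠ x ∨ 4 ≤ b) → ∀ c < 4,
      (a : ℤ) * L + (b : ℕ) ≠ (x : ℤ) * L + (c : ℕ) := by
    intro a ha b hb hab c hc h
    have := addr_inj hb (by omega : c < L) h
    omega
  refine ⟨h.frame.trans F le_rfl (by simp), fun i hi => ?_, fun i hi => ?_, fun a ha b hb => ?_,
    fun a ha b hb h4 => ?_⟩
  · rw [p1]
    split_ifs with h'
    · rw [h']
    · exact h.ordm i (by omega)
  · rw [p2]
    by_cases h' : i = x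
    · subst h'; simp
    · rw [if_neg h', h.next i (by omega)]
  · by_cases h' : a = x
    · subst h'; exact p3 b hb
    · rw [p4 _ (hne a (by omega) b (by omega) (Or.inl h')), h.rows a (by omega) b hb]
  · rw [p4 _ (hne a ha b hb (Or.inr h4)), h.zero a ha b hb h4]

theorem runs_initNodes {w : ℤ} (hq : 2 ≤ q) (hL : 4 ≤ L) (h3 : σ.reg 3 = 1)
    (hm : ∀ a < L, σ.mem 13 (a : ℤ) = (a : ℤ) * L) (h12 : ∀ p, σ.mem 12 p = 0)
    (hw : 3 * (L : ℤ) + 4 + q ≤ w) :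
    Runs w (initNodes q) σ 65 (fun σ' => FrameN 30 [10, 11, 12] σ σ' ∧
      Repr q L 4 (fun a => a) (fun a => a) σ') := by
  have h0 : InitState q L 0 σ σ := ⟨by simp, by simp, by simp, by simp, fun _ _ _ _ _ => h12 _⟩
  refine (h0.succ hq hL (by omega) h3 hm hw).seq (T₂ := 49) fun σ₁ h1 => ?_
  refine (h1.succ hq hL (by omega) h3 hm hw).seq (T₂ := 33) fun σ₂ h2 => ?_
  refine (h2.succ hq hL (by omega) h3 hm hw).seq (T₂ := 17) fun σ₃ h3' => ?_
  refine (h3'.succ hq hL (by omega) h3 hm hw).seq (T₂ := 1) fun σ₄ h4 => ?_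
  refine Runs.of_wp (by decide) ?_
  simp only [wp]
  refine ⟨by rw [abs_le]; omega, ⟨fun r hr hr4 => ?_, fun s hs => h4.frame.mem s hs⟩, ?_⟩
  · simp [hr4, h4.frame.reg r hr]
  · refine ⟨by omega, fun i hi => hi, fun i k h1 h2 => h1, fun a ha => ⟨a, ha, rfl⟩, rfl,
      fun a ha => hasCd_of_lt_four hq ha, fun a ha m hm => ?_, ?_, by simp, h4.ordm, ?_, ?_,
          h4.rows,
      h4.zero, ?_⟩
    · have hc := hasCd_of_lt_four hq ha
      -- A non-zero digit of `a < 4` sits at an exponent below `a`, which is again one of the first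
      -- four nodes.
      exact ⟨m, (hc.1.lt_of_ne_zero hq hc.2 hm).trans ha, rfl⟩
    · simp [h4.frame.reg 3, h3]
    · intro a ha b hb h
      rw [Store.mem_setReg, h4.next a ha, if_neg (by omega)]
      omega
    · intro a ha h
      rw [Store.mem_setReg, h4.next a ha, if_pos]
      by_contra h'
      exact h (a + 1) (by omega) rfl
    · rw [Store.mem_setReg, h4.frame.mem 13 (by decide)]; exact hm

end PowerCircuits

open scoped BigOperators
namespace PowerCircuits

variable {q L N n : ℕ} {e ord : ℕ → ℕ} {σ : Store}

/-! ## The given circuit -/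

/-- The edge labels `dm` of a power circuit with nodes `0, …, n - 1` and exponents `k`. -/
structure Input (q n : ℕ) (dm : ℕ → ℕ → ℤ) (k : ℕ → ℕ) : Prop where
  abs : ∀ u < n, ∀ v < n, |dm u v| ≤ q - 1
  val : ∀ u < n, (k u : ℤ) = ∑ v ∈ Finset.range n, dm u v * (q : ℤ) ^ k v
  -- Acyclicity in the form needed for scheduling: as long as some node is unprocessed, there is one
  -- with all its successors processed.
  min : ∀ S ⊂ Finset.range n, ∃ u < n, u ∉ S ∧ ∀ v < n, dm u v ≠ 0 → v ∈ S

/-- The number of successors of `u` outside `S`. -/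
def openSucc (n : ℕ) (dm : ℕ → ℕ → ℤ) (S : Finset ℕ) (u : ℕ) : ℕ :=
  ((Finset.range n).filter fun v => dm u v ≠ 0 ∧ v ∉ S).card

theorem openSucc_eq_zero {dm : ℕ → ℕ → ℤ} {S : Finset ℕ} {u : ℕ} :
    openSucc n dm S u = 0 ↔ ∀ v < n, dm u v ≠ 0 → v ∈ S := by
  simp only [openSucc, Finset.card_eq_zero, Finset.filter_eq_empty_iff, Finset.mem_range]
  constructor
  · intro h v hv hd
    by_contra hc
    exact h hv ⟨hd, hc⟩
  · rintro h v hv ⟨hd, hc⟩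
    exact hc (h v hv hd)

theorem openSucc_insert {dm : ℕ → ℕ → ℤ} {S : Finset ℕ} {u s : ℕ} (hs : s < n) (hsS : s ∉ S) :
    (openSucc n dm (insert s S) u : ℤ) = openSucc n dm S u - if dm u s ≠ 0 then 1 else 0 := by
  have h : (Finset.range n).filter (fun v => dm u v ≠ 0 ∧ v ∉ insert s S) =
      ((Finset.range n).filter fun v => dm u v ≠ 0 ∧ v ∉ S).erase s := by
    ext v
    simp only [Finset.mem_filter, Finset.mem_erase, Finset.mem_insert, not_or]
    tauto
  unfold openSucc
  rw [h]
  split_ifs with hd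
  · have hmem : s ∈ (Finset.range n).filter fun v => dm u v ≠ 0 ∧ v ∉ S := by simp [hs, hd, hsS]
    have := Finset.card_erase_add_one hmem
    omega
  · rw [Finset.erase_eq_of_notMem (by simp [hd]), sub_zero]

/-- Count the successors of all nodes. -/
def countSucc : Program :=
  .seq (.const 52 0) (forUp 30 0 31 (.seq (.const 53 0) (.seq (forUp 50 0 51 (block [.load 54 0 52,
    .add 52 52 3, .const 55 0, .sub 55 55 54,
    .ifPos 54 (.add 53 53 3) (.ifPos 55 (.add 53 53 3) .skip)])) (.store 20 30 53))))

theorem runs_countSucc {w : ℤ} {dm : ℕ → ℕ → ℤ} (h0 : σ.reg 0 = n) (h3 : σ.reg 3 = 1)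
    (hd : ∀ u < n, ∀ v < n, σ.mem 0 ((u : ℤ) * n + v) = dm u v)
    (hdq : ∀ u < n, ∀ v < n, |dm u v| ≤ q - 1) (hw : (n : ℤ) * n + n + q ≤ w) :
    Runs w countSucc σ (10 * (n * n) + 8 * n + 4) (fun σ' => Frame 30 [20] σ σ' ∧
      ∀ u < n, σ'.mem 20 (u : ℤ) = openSucc n dm ∅ u) := by
  have hnn : (0 : ℤ) ≤ (n : ℤ) * n := by positivity
  have hT : 10 * (n * n) + 8 * n + 4 = 1 + ((10 * n + 5 + 3) * n + 3) := by ring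
  rw [hT]
  refine Runs.seq (R := fun σ' => Frame 30 [20] σ σ' ∧ σ'.reg 52 = 0)
    (Runs.of_wp (by decide) (by simp [wp]; omega)) ?_
  rintro σ₁ ⟨F1, p1⟩
  refine (Runs.forUp (σ₀ := σ) (r := 30) (S := [20]) (n := n) (10 * n + 5) (fun k σ' =>
    σ'.reg 52 = (k : ℤ) * n ∧ ∀ u < k, σ'.mem 20 (u : ℤ) = openSucc n dm ∅ u)
    (by decide) (by decide) (by decide) (by decide) (by decide) h0 h3 (by omega) F1
    (by simp [p1]) (fun k σ v v' h => by simpa using h) ?_).mono le_rfl (fun σ' h => ⟨h.1, h.2.2⟩)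
  rintro k hk σ₂ F2 ⟨p2, p3⟩ p4
  have hkn : ((k : ℤ) + 1) * n ≤ n * n := mul_le_mul_of_nonneg_right (by omega) (by positivity)
  have hk0 : (0 : ℤ) ≤ (k : ℤ) * n := by positivity
  have hT : 10 * n + 5 = 1 + ((7 + 3) * n + 3 + 1) := by ring
  rw [hT]
  refine Runs.seq (R := fun σ' => Frame 53 [] σ₂ σ' ∧ σ'.reg 53 = 0)
    (Runs.of_wp (by decide) (by simp [wp]; omega)) ?_
  rintro σ₃ ⟨F3, p5⟩
  have g0 : σ₃.reg 0 = n := by rw [F3.reg 0 (by decide), F2.reg 0 (by decide), h0]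
  have g3 : σ₃.reg 3 = 1 := by rw [F3.reg 3 (by decide), F2.reg 3 (by decide), h3]
  refine (Runs.forUp (σ₀ := σ₃) (r := 50) (S := []) (n := n) 7 (fun j σ' =>
    σ'.reg 52 = (k : ℤ) * n + j ∧ σ'.reg 53 = openSucc j dm ∅ k)
    (by decide) (by decide) (by decide) (by decide) (by decide) g0 g3 (by omega) (by simp)
    ⟨by rw [F3.reg 52 (by decide), p2]; simp, by simp [openSucc, p5]⟩
    (fun k σ v v' h => by simpa using h) ?_).seq ?_
  · rintro j hj σ₄ F4 ⟨p6, p7⟩ p8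
    refine Runs.of_wp (by decide) ?_
    have m0 : σ₄.mem 0 ((k : ℤ) * n + j) = dm k j := by
      rw [F4.mem 0 (by decide), F3.mem 0 (by decide), F2.mem 0 (by decide), hd k hk j hj]
    have k3 : σ₄.reg 3 = 1 := by rw [F4.reg 3 (by decide), g3]
    have hq := abs_le.mp (hdq k hk j hj)
    have hc : openSucc j dm ∅ k ≤ j := (Finset.card_filter_le _ _).trans (by simp)
    have hc' : (openSucc (j + 1) dm ∅ k : ℤ) = openSucc j dm ∅ k + if dm k j ≠ 0 then 1 else 0 := by
      unfold openSucc
      rw [Finset.range_add_one, Finset.filter_insert]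
      split_ifs with h1 h2 h2
      · rw [Finset.card_insert_of_notMem (by simp)]; push_cast; rfl
      · exact absurd h1.1 h2
      · exact absurd ⟨h2, by simp⟩ h1
      · simp
    simp only [block, wp, Store.reg_setReg, Nat.reduceEqDiff, reduceIte, p6, p7,
      p8, m0, k3, hc']
    refine ⟨by rw [abs_le]; constructor <;> linarith, by rw [abs_zero]; linarith,
      by rw [abs_le]; constructor <;> linarith,
      fun h => ⟨by rw [abs_le]; constructor <;> linarith, by simpa using F4,
        ⟨by push_cast; ring, ?_⟩, trivial⟩,
      fun h => ⟨fun h' => ⟨by rw [abs_le]; constructor <;> linarith, by simpa using F4,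
        ⟨by push_cast; ring, ?_⟩, trivial⟩, fun h' => ⟨by simpa using F4,
        ⟨by push_cast; ring, ?_⟩, trivial⟩⟩⟩
    · rw [if_pos (by omega)]
    · rw [if_pos (by omega)]
    · rw [if_neg (by omega), add_zero]
  · rintro σ₄ ⟨F4, p6, p7⟩
    refine Runs.of_wp (by decide) ?_
    have F24 : Frame 30 [20] σ σ₄ := (F2.trans F3 (by decide) (by simp)).trans F4 (by decide)
        (by simp)
    have p8 : σ₄.reg 30 = k := by rw [F4.reg 30 (by decide), F3.reg 30 (by decide), p4]
    simp only [wp, p8, p7, Store.reg_setMem, p6]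
    refine ⟨by simpa using F24, ⟨by push_cast; ring, fun u hu => ?_⟩, trivial⟩
    rw [Store.mem_setMem]
    split_ifs with h
    · have : u = k := by exact_mod_cast h.2
      rw [this]
    · rw [F4.mem 20 (by decide), F3.mem 20 (by decide)]
      exact p3 u (by have : u ≠ k := fun hc => h ⟨rfl, by rw [hc]⟩
                     omega)

/-- Search for a node with counter `0`. -/
def scan : Program :=
  .seq (.const 35 0) (.seq (forUp 30 0 31 (block [.load 32 20 30, .add 33 32 3,
    .ifPos 32 .skip (.ifPos 33 (block [.move 34 30, .move 36 35]) .skip), .add 35 35 0]))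
    (block [.move 9 34, .move 12 36]))

/-- The position `s * n` of the row is accumulated along the scan, since it cannot be computed by a
multiplication. Processed nodes have negative counters and are passed over. -/
theorem runs_scan {w : ℤ} {c : ℕ → ℤ} (h0 : σ.reg 0 = n) (h3 : σ.reg 3 = 1)
    (hc : ∀ u < n, σ.mem 20 (u : ℤ) = c u) (hcn : ∀ u < n, -1 ≤ c u ∧ c u ≤ n)
    (hex : ∃ u < n, c u = 0) (hw : (n : ℤ) * n + n + 1 ≤ w) :
    Runs w scan σ (10 * n + 6) (fun σ' => Frame 9 [] σ σ' ∧
      ∃ s < n, c s = 0 ∧ σ'.reg 9 = (s : ℕ) ∧ σ'.reg 12 = (s : ℤ) * n) := by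
  have hnn : (0 : ℤ) ≤ (n : ℤ) * n := by positivity
  have hT : 10 * n + 6 = 1 + ((7 + 3) * n + 3 + 2) := by ring
  rw [hT]
  refine Runs.seq (R := fun σ' => Frame 30 [] σ σ' ∧ σ'.reg 35 = 0)
    (Runs.of_wp (by decide) (by simp [wp]; omega)) ?_
  rintro σ₁ ⟨F1, p1⟩
  refine (Runs.forUp (σ₀ := σ) (r := 30) (S := []) (n := n) 7 (fun k σ' =>
    σ'.reg 35 = (k : ℤ) * n ∧ ((∃ s < k, c s = 0) →
      ∃ s < k, c s = 0 ∧ σ'.reg 34 = (s : ℕ) ∧ σ'.reg 36 = (s : ℤ) * n))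
    (by decide) (by decide) (by decide) (by decide) (by decide) h0 h3 (by omega) F1
    (by simp [p1]) (fun k σ v v' h => by simpa using h) ?_).seq ?_
  · rintro k hk σ₂ F2 ⟨p2, p3⟩ p4
    have hkn : ((k : ℤ) + 1) * n ≤ n * n := mul_le_mul_of_nonneg_right (by omega) (by positivity)
    have hk0 : (0 : ℤ) ≤ (k : ℤ) * n := by positivity
    have m20 : σ₂.mem 20 (k : ℤ) = c k := by rw [F2.mem 20 (by decide), hc k hk]
    have k3 : σ₂.reg 3 = 1 := by rw [F2.reg 3 (by decide), h3]
    have k0 : σ₂.reg 0 = n := by rw [F2.reg 0 (by decide), h0]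
    obtain ⟨c1, c2⟩ := hcn k hk
    refine Runs.of_wp (by decide) ?_
    simp only [block, wp, Store.reg_setReg, Nat.reduceEqDiff, reduceIte, p2,
      p4, m20, k3, k0]
    have hno : c k ≠ 0 → (∃ s < k + 1, c s = 0) →
        ∃ s < k + 1, c s = 0 ∧ σ₂.reg 34 = (s : ℕ) ∧ σ₂.reg 36 = (s : ℤ) * n := by
      rintro hck ⟨s, hs, hcs⟩
      have hsk : s ≠ k := fun h => hck (h ▸ hcs)
      obtain ⟨s', h1, h2⟩ := p3 ⟨s, by omega, hcs⟩
      exact ⟨s', by omega, h2⟩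
    have hb : |(k : ℤ) * n + n| ≤ w := by rw [abs_le]; constructor <;> linarith
    refine ⟨by rw [abs_le]; constructor <;> linarith, fun h => ⟨hb, by simpa using F2,
      ⟨by push_cast; ring, hno (by omega)⟩, trivial⟩, fun h => ⟨fun h' => ⟨hb, by simpa using F2,
      ⟨by push_cast; ring, fun _ => ⟨k, by omega, by omega, rfl, rfl⟩⟩, trivial⟩, fun h' => ⟨hb,
      by simpa using F2, ⟨by push_cast; ring, hno (by omega)⟩, trivial⟩⟩⟩
  · rintro σ₂ ⟨F2, -, p2⟩
    obtain ⟨s, hs, hcs, h34, h36⟩ := p2 hex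
    refine Runs.of_wp (by decide) ?_
    simp only [block, wp, Store.reg_setReg, Nat.reduceEqDiff, reduceIte, h34, h36]
    exact ⟨by simpa using F2.weaken (by decide) (by simp), s, hs, hcs, rfl, rfl⟩

/-- Mark the node in register `9` as processed, and decrease the counters of its predecessors. -/
def decrement : Program :=
  .seq (block [.const 33 (-1), .store 20 9 33, .move 35 9])
  (forUp 30 0 31 (block [.load 32 0 35, .const 34 0, .sub 34 34 32, .load 36 20 30, .sub 37 36 3,
    .ifPos 32 (.store 20 30 37) (.ifPos 34 (.store 20 30 37) .skip), .add 35 35 0]))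

theorem runs_decrement {w : ℤ} {dm : ℕ → ℕ → ℤ} {c : ℕ → ℤ} {s : ℕ} (h0 : σ.reg 0 = n)
    (h3 : σ.reg 3 = 1) (h9 : σ.reg 9 = s) (hs : s < n)
    (hd : ∀ u < n, ∀ v < n, σ.mem 0 ((u : ℤ) * n + v) = dm u v)
    (hdq : ∀ u < n, ∀ v < n, |dm u v| ≤ q - 1)
    (hc : ∀ u < n, σ.mem 20 (u : ℤ) = c u) (hcn : ∀ u < n, -1 ≤ c u ∧ c u ≤ n)
    (hw : (n : ℤ) * n + 2 * n + q + 2 ≤ w) :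
    Runs w decrement σ (12 * n + 6) (fun σ' => Frame 30 [20] σ σ' ∧
      ∀ u < n, σ'.mem 20 (u : ℤ) = (if u = s then -1 else c u) - if dm u s ≠ 0 then 1 else 0) := by
  have hnn : (0 : ℤ) ≤ (n : ℤ) * n := by positivity
  have hT : 12 * n + 6 = 3 + ((9 + 3) * n + 3) := by ring
  rw [hT]
  refine Runs.seq (R := fun σ' => Frame 30 [20] σ σ' ∧ σ'.reg 35 = s ∧
    ∀ u < n, σ'.mem 20 (u : ℤ) = if u = s then -1 else c u)
    (Runs.of_wp (by decide) ?_) ?_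
  · simp only [block, wp, Store.reg_setReg, Store.mem_setReg, Store.reg_setMem, Nat.reduceEqDiff,
      reduceIte, h9]
    refine ⟨by rw [abs_le]; omega, by simp, trivial, fun u hu => ?_⟩
    rw [Store.mem_setMem]
    simp only [Store.mem_setReg, hc u hu, true_and, Nat.cast_inj]
  rintro σ₁ ⟨F1, p1, q1⟩
  refine (Runs.forUp (σ₀ := σ) (r := 30) (S := [20]) (n := n) 9 (fun k σ' =>
    σ'.reg 35 = (k : ℤ) * n + s ∧ (∀ u < n, σ'.mem 20 (u : ℤ) =
      (if u = s then -1 else c u) - if u < k ∧ dm u s ≠ 0 then 1 else 0))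
    (by decide) (by decide) (by decide) (by decide) (by decide) h0 h3 (by omega) F1
    ⟨by simp [p1], by simpa using q1⟩ (fun k σ v v' h => by simpa using h) ?_).mono le_rfl ?_
  · rintro k hk σ₂ F2 ⟨p2, p3⟩ p4
    have hkn : ((k : ℤ) + 1) * n ≤ n * n := mul_le_mul_of_nonneg_right (by omega) (by positivity)
    have hk0 : (0 : ℤ) ≤ (k : ℤ) * n := by positivity
    have m20 := p3 k hk
    rw [if_neg (by omega : ¬ (k < k ∧ dm k s ≠ 0)), sub_zero] at m20
    have m0 : σ₂.mem 0 ((k : ℤ) * n + s) = dm k s := by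
      rw [F2.mem 0 (by decide), hd k hk s hs]
    have k3 : σ₂.reg 3 = 1 := by rw [F2.reg 3 (by decide), h3]
    have k0 : σ₂.reg 0 = n := by rw [F2.reg 0 (by decide), h0]
    have hq := abs_le.mp (hdq k hk s hs)
    have hck : -1 ≤ (if k = s then -1 else c k) ∧ (if k = s then -1 else c k) ≤ n := by
      have := hcn k hk
      split_ifs <;> omega
    have hb : |(k : ℤ) * n + s + n| ≤ w := by rw [abs_le]; constructor <;> linarith
    refine Runs.of_wp (by decide) ?_
    simp only [block, wp, Store.reg_setReg, Store.mem_setReg, Store.reg_setMem, Nat.reduceEqDiff,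
      reduceIte, p2, p4, m20, m0, k3, k0]
    have hyes : ∀ τ : Store, τ.mem 20 = (σ₂.setMem 20 k ((if k = s then -1 else c k) - 1)).mem 20 →
        dm k s ≠ 0 → ∀ u < n, τ.mem 20 (u : ℤ) =
        (if u = s then -1 else c u) - if u < k + 1 ∧ dm u s ≠ 0 then 1 else 0 := by
      intro τ hτ hd u hu
      rw [hτ, Store.mem_setMem]
      by_cases huk : u = k
      · subst huk; simp [hd]
      · rw [if_neg (by simpa using huk), p3 u hu]
        simp only [show u < k + 1 ↔ u < k by omega]
    refine ⟨by rw [abs_le]; constructor <;> linarith, by rw [abs_le]; constructor <;> linarith,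
      by rw [abs_le]; constructor <;> linarith, fun h => ⟨hb, by simpa using F2,
        ⟨by push_cast; ring, hyes _ rfl (by omega)⟩, trivial⟩, fun h => ⟨fun h' => ⟨hb,
        by simpa using F2, ⟨by push_cast; ring, hyes _ rfl (by omega)⟩, trivial⟩,
        fun h' => ⟨hb, by simpa using F2, ⟨by push_cast; ring, fun u hu => ?_⟩, trivial⟩⟩⟩
    rw [p3 u hu]
    by_cases huk : u = k
    · subst huk; simp [show dm u s = 0 by omega]
    · simp only [show u < k + 1 ↔ u < k by omega]
  · rintro σ₂ ⟨F2, -, p2⟩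
    refine ⟨F2, fun u hu => ?_⟩
    rw [p2 u hu]
    simp only [hu, true_and]

end PowerCircuits

open scoped BigOperators
namespace PowerCircuits

variable {q L N n : ℕ} {e ord : ℕ → ℕ} {σ : Store}

/-! ## Processing a node -/

/-- The nodes in `S` have been processed; `π` maps them to the new nodes. -/
structure Progress (q L n t : ℕ) (k : ℕ → ℕ) (S : Finset ℕ) (N : ℕ) (e ord π : ℕ → ℕ)
    (σ : Store) : Prop where
  repr : Repr q L N e ord σ
  low : ∀ m < 4, ∃ a < N, e a = m
  size : N ≤ 4 * t
  -- This is required of unprocessed nodes too. Their image is irrelevant, as they enter only with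
  -- coefficient `0`.
  lt : ∀ v < n, π v < N
  mem : ∀ v < n, σ.mem 19 (v : ℤ) = π v
  eq : ∀ v ∈ S, e (π v) = k v
  -- The slack is `2` after the first node, from the exponents `1, 2, 3 = 1 + r` with `r ≤ 2`, and
  -- grows by `3` with each node because of the three extensions.
  cap : Capacity q (exps N e) S k (3 * t - 1)
  spans : ∀ a < N, Spans q S k (3 * t - 1) (e a)

theorem Progress.tame {t : ℕ} {k π : ℕ → ℕ} {S : Finset ℕ} (hq : 2 ≤ q)
    (P : Progress q L n t k S N e ord π σ) (hS : S ⊆ Finset.range n) :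
    ∀ a < N, Tame q N e (-1) (e a) := fun a ha =>
  (P.spans a ha).tame hq P.low (fun v hv => ⟨π v, P.lt v (Finset.mem_range.mp (hS hv)), P.eq v hv⟩)
    P.cap (P.repr.hasCd a ha) (P.repr.supp a ha)

/-- Collecting the digits of all given nodes with the same image does not change the power sum. -/
theorem spread_fiber {f : ℕ → ℤ} {π : ℕ → ℕ} (hπ : ∀ v < n, π v < N) :
    spread (Finset.range N) e (fun a => ∑ v ∈ Finset.range n, if π v = a then f v else 0) =
      spread (Finset.range n) (fun v => e (π v)) f := by
  funext m
  simp only [spread]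
  calc _ = ∑ a ∈ Finset.range N, ∑ v ∈ Finset.range n,
        if π v = a then (if e (π v) = m then f v else 0) else 0 := by
        refine Finset.sum_congr rfl fun a _ => ?_
        split_ifs with h
        · refine Finset.sum_congr rfl fun v _ => ?_
          split_ifs with h1 h2
          · rfl
          · exact absurd (h1 ▸ h) h2
          · rfl
        · refine (Finset.sum_eq_zero fun v _ => ?_).symm
          split_ifs with h1 h2
          · exact absurd (h1 ▸ h2) h
          · rfl
          · rfl
    _ = _ := by
        rw [Finset.sum_comm]
        refine Finset.sum_congr rfl fun v hv => ?_
        rw [Finset.sum_ite_eq, if_pos (Finset.mem_range.mpr (hπ v (Finset.mem_range.mp hv)))]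

theorem nodeSum_fiber {f : ℕ → ℤ} {π : ℕ → ℕ} (hπ : ∀ v < n, π v < N) :
    nodeSum q N e (fun a => ∑ v ∈ Finset.range n, if π v = a then f v else 0) =
      ∑ v ∈ Finset.range n, f v * (q : ℤ) ^ e (π v) := by
  have h := hasVal_spread q (Finset.range N) e
    (fun a => ∑ v ∈ Finset.range n, if π v = a then f v else 0)
  rw [spread_fiber hπ] at h
  exact h.eq (hasVal_spread q _ _ f)

theorem abs_fiber_le {f : ℕ → ℤ} {π : ℕ → ℕ} (hf : ∀ v < n, |f v| ≤ q - 1) (a : ℕ) :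
    |∑ v ∈ Finset.range n, if π v = a then f v else 0| ≤ ((q * n : ℕ) : ℤ) := by
  refine (Finset.abs_sum_le_sum_abs _ _).trans ?_
  refine (Finset.sum_le_card_nsmul _ _ (q : ℤ) fun v hv => ?_).trans (by simp [mul_comm])
  have := hf v (Finset.mem_range.mp hv)
  split_ifs
  · linarith
  · simp

/-- The prefix sums of a marking of the processed nodes are small. -/
theorem Progress.gap {t : ℕ} {k π : ℕ → ℕ} {S : Finset ℕ} (hq : 2 ≤ q) (ht : 0 < t)
    (P : Progress q L n t k S N e ord π σ) (hS : S ⊆ Finset.range n) {f : ℕ → ℤ}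
    (hf : ∀ v < n, |f v| ≤ q - 1) (h0 : ∀ v < n, f v ≠ 0 → v ∈ S) {p : ℕ}
    (hp : ∀ a < N, e a ≠ p) : |psum q (spread (Finset.range N) e
      (fun a => ∑ v ∈ Finset.range n, if π v = a then f v else 0)) p| ≤ (q : ℤ) ^ (p - 2) + -1 := by
  have h1 : spread (Finset.range n) (fun v => e (π v)) f = spread S k f := by
    funext m
    simp only [spread]
    rw [← Finset.sum_subset hS]
    · exact Finset.sum_congr rfl fun v hv => by simp only [P.eq v hv]
    · intro v hv hvS
      have : f v = 0 := by
        by_contra hc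
        exact hvS (h0 v (Finset.mem_range.mp hv) hc)
      rw [this, ite_self]
  rw [spread_fiber P.lt, h1]
  refine P.cap.gap hq (by omega) (fun v hv => hf v (Finset.mem_range.mp (hS hv))) fun h => ?_
  obtain ⟨a, ha, h⟩ := mem_exps.mp h
  exact hp a ha h

theorem Input.val_of_closed {dm : ℕ → ℕ → ℤ} {k π : ℕ → ℕ} (I : Input q n dm k) {S : Finset ℕ}
    {s : ℕ} (hs : s < n) (hπ : ∀ v ∈ S, e (π v) = k v) (h0 : ∀ v < n, dm s v ≠ 0 → v ∈ S) :
    ∑ v ∈ Finset.range n, dm s v * (q : ℤ) ^ e (π v) = k s := by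
  rw [I.val s hs]
  refine Finset.sum_congr rfl fun v hv => ?_
  by_cases h : dm s v = 0
  · rw [h, zero_mul, zero_mul]
  · rw [hπ v (h0 v (Finset.mem_range.mp hv) h)]

/-- Process the node in register `9`; register `12` contains the position of its row. -/
def process (q : ℕ) : Program :=
  .seq clearAcc (.seq (addMarking 0) (.seq (ensure q) (.seq (block [.store 19 9 20, .move 10 20])
    (.seq (extend q) (.seq (extend q) (.seq (.const 10 0) (extend q)))))))

/-- One call of `ensure` and three of `extend` create at most four nodes. Meanwhile the tolerance
rises from `-1` to `2`. It does not enter the next round: the new `Progress` contains only capacity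
and spanning, from which `Progress.tame` recovers `-1`. -/
theorem runs_process {w : ℤ} (hq : 2 ≤ q) {dm : ℕ → ℕ → ℤ} {k π : ℕ → ℕ} (I : Input q n dm k)
    {t s : ℕ} {S : Finset ℕ} (ht : 0 < t) (P : Progress q L n t k S N e ord π σ)
    (hS : S ⊆ Finset.range n) (hs : s < n) (hsS : s ∉ S) (hsucc : ∀ v < n, dm s v ≠ 0 → v ∈ S)
    (h0 : σ.reg 0 = n) (h9 : σ.reg 9 = s) (h12 : σ.reg 12 = (s : ℤ) * n)
    (hd : ∀ u < n, ∀ v < n, σ.mem 0 ((u : ℤ) * n + v) = dm u v)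
    (D : DivTable q (2 * (q * n)) σ) (hL : 4 * t + 4 ≤ L) (hnL : n ≤ L)
    (hw : (L : ℤ) * L + L + 2 * (q * n : ℕ) + 2 * q + 2 ≤ w) :
    Runs w (process q) σ (1300 * L) (fun σ' =>
      FrameN 10 [10, 11, 12, 14, 15, 16, 19] σ σ' ∧ ∃ N' e' ord' π',
        Progress q L n (t + 1) k (insert s S) N' e' ord' π' σ') := by
  have hLL : (0 : ℤ) ≤ (L : ℤ) * L := by positivity
  have hn0 : 0 < n := by omega
  have hqn : (q : ℤ) ≤ ((q * n : ℕ) : ℤ) := by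
    push_cast; nlinarith [(by exact_mod_cast hn0 : (1 : ℤ) ≤ n)]
  have hsize := P.size
  have hqB : q ≤ q * n := by exact_mod_cast hqn
  have hsn : (s : ℤ) * n + n ≤ L * L := by
    have h1 : ((s : ℤ) + 1) * n ≤ L * L :=
      mul_le_mul (by omega) (by omega) (by positivity) (by positivity)
    linarith
  have hf : ∀ v < n, |dm s v| ≤ q - 1 := I.abs s hs
  have ten : ∀ {b : ℕ} {S : List ℕ} {τ τ' : Store}, FrameN b S τ τ' → 10 ≤ b →
      S ⊆ [10, 11, 12, 14, 15, 16, 19] → FrameN 10 [10, 11, 12, 14, 15, 16, 19] τ τ' :=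
    fun h hb hS => ⟨fun r hr h4 => h.reg r (by omega) h4, fun s hs => h.mem s fun hc => hs (hS hc)⟩
  have T : ∀ {τ τ' τ'' : Store}, FrameN 10 [10, 11, 12, 14, 15, 16, 19] τ τ' →
      FrameN 10 [10, 11, 12, 14, 15, 16, 19] τ' τ'' →
      FrameN 10 [10, 11, 12, 14, 15, 16, 19] τ τ'' :=
    fun h h' => h.trans h' le_rfl (by simp) le_rfl (by simp)
  have R0 := P.repr
  -- The number of nodes is at most `N`, `N + 1`, `N + 2` and `N + 3` before the four calls.
  refine Runs.mono (T := (5 * N + 3) + ((9 * n + 4) + ((297 * N + 98) + (2 + ((306 *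
      (N + 1) + 111) +
    ((306 * (N + 2) + 111) + (1 + (306 * (N + 3) + 111)))))))) ?_ (by omega) (fun _ h => h)
  refine (runs_clearAcc R0.num R0.one (by linarith)).seq ?_
  rintro σ₁ ⟨F1, c1⟩
  have R1 := R0.frame F1 (by decide) (by decide)
  refine (runs_addMarking (s := 0) (K := q) (base := s * n) (π := π) (f := dm s) (N := N)
      (by decide)
    (by rw [F1.reg 0 (by decide), h0]) R1.one (by rw [F1.reg 12 (by decide), h12]; push_cast; rfl)
    (by rw [F1.mem 19 (by decide)]; exact P.mem) ?_ (fun v hv => (hf v hv).trans (by omega)) P.lt c1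
    (by push_cast at hw ⊢; nlinarith)).seq ?_
  · intro v hv
    rw [F1.mem 0 (by decide), ← hd s hs v hv]; push_cast; rfl
  rintro σ₂ ⟨F2, c2⟩
  have R2 := R1.frame F2 (by decide) (by decide)
  have D2 := (D.frame F1 (by decide)).frame F2 (by decide)
  refine (runs_ensure hq R2 (by omega) D2 hqB P.low c2 (fun a _ => abs_fiber_le hf a) (k := k s)
    (by rw [nodeSum_fiber P.lt, I.val_of_closed hs P.eq hsucc]) (b := -1) (by omega)
    (fun p hp => P.gap hq ht hS hf hsucc hp) (P.tame hq hS) hw).seq ?_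
  rintro σ₃ ⟨F3, N1, e1, ord1, R3, X1, ⟨r, hr, h20, hrk⟩, tame1⟩
  have low1 : ∀ m < 4, ∃ a < N1, e1 a = m := fun m hm => X1.mem_old (P.low m hm)
  have hN1 : N1 ≤ N + 1 := X1.le'
  have F13 := T (T (ten (F1.frameN (S := [14]) le_rfl (by simp)) (by decide) (by simp))
    (ten (F2.frameN (S := [14]) le_rfl (by simp)) (by decide) (by simp)))
    (ten F3 (by decide) (by simp))
  have m19 : σ₃.mem 19 = σ.mem 19 := by
    rw [F3.mem 19 (by decide), F2.mem 19 (by decide), F1.mem 19 (by decide)]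
  refine Runs.seq (R := fun σ' => Frame 10 [19] σ₃ σ' ∧ σ'.reg 10 = r ∧
    ∀ v : ℕ, σ'.mem 19 (v : ℤ) = if v = s then (r : ℤ) else σ.mem 19 (v : ℤ))
    (Runs.of_wp (by decide) ?_) ?_
  · have h9' : σ₃.reg 9 = s := by rw [F13.reg 9 (by decide) (by decide), h9]
    simp only [block, wp, h9', Store.reg_setMem, h20]
    refine ⟨by simp, by simp, fun v => ?_⟩
    simp [m19]
  rintro σ₄ ⟨F4, h10, c4⟩
  have R4 := R3.frame F4 (by decide) (by decide)
  have F14 := T F13 (ten (F4.frameN (S := [19]) le_rfl (by simp)) (by decide) (by simp))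
  refine ((runs_extend hq R4 (by omega) (D.frameN F14 (by decide)) hqB low1 hr h10 (by omega) tame1
    hw).mono (T' := 306 * (N + 1) + 111) (by omega) fun _ h => h).seq ?_
  rintro σ₅ ⟨F5, N2, e2, ord2, R5, a2, ha2, X2, le2, ch2, top2, tame2⟩
  have low2 : ∀ m < 4, ∃ a < N2, e2 a = m := fun m hm => X2.mem_old (low1 m hm)
  have hN2 : N2 ≤ N1 + 1 := X2.le'
  have F15 := T F14 (ten F5 (by decide) (by simp))
  refine ((runs_extend hq R5 (by omega) (D.frameN F15 (by decide)) hqB low2 (id := r)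
    (lt_of_lt_of_le hr X2.le) (by rw [F5.reg 10 (by decide) (by decide), h10]) (by omega) tame2
    hw).mono (T' := 306 * (N + 2) + 111) (by omega) fun _ h => h).seq ?_
  rintro σ₆ ⟨F6, N3, e3, ord3, R6, a3, ha3, X3, le3, ch3, top3, tame3⟩
  have low3 : ∀ m < 4, ∃ a < N3, e3 a = m := fun m hm => X3.mem_old (low2 m hm)
  have hN3 : N3 ≤ N2 + 1 := X3.le'
  have F16 := T F15 (ten F6 (by decide) (by simp))
  refine Runs.seq (R := fun σ' => Frame 10 [] σ₆ σ' ∧ σ'.reg 10 = (0 : ℕ))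
    (Runs.of_wp (by decide) (by simp [wp]; omega)) ?_
  rintro σ₇ ⟨F7, h10'⟩
  have R7 := R6.frame F7 (by decide) (by decide)
  have F17 := T F16 (ten (F7.frameN (S := []) le_rfl (by simp)) (by decide) (by simp))
  refine (runs_extend hq R7 (by omega) (D.frameN F17 (by decide)) hqB low3 R7.pos h10'
      (by omega) tame3
    hw).mono (by omega) ?_
  rintro σ₈ ⟨F8, N4, e4, ord4, R8, a4, ha4, X4, le4, ch4, top4, tame4⟩
  have hN4 : N4 ≤ N3 + 1 := X4.le'
  have le1 := X1.le
  have le2' := X2.le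
  have le3' := X3.le
  have le4' := X4.le
  rw [X2.old r hr] at le3 ch3
  rw [hrk] at le2 ch2 le3 ch3
  rw [R6.zero] at ch4
  have old : ∀ a < N1, e4 a = e1 a := fun a ha => by
    rw [X4.old a (by omega), X3.old a (by omega), X2.old a ha]
  refine ⟨T F17 (ten F8 (by decide) (by simp)), N4, e4, ord4, fun v => if v = s then r else π v,
    R8, fun m hm => X4.mem_old (low3 m hm), by omega, fun v hv => ?_, fun v hv => ?_,
        fun v hv => ?_,
    ?_, ?_⟩
  · split_ifs
    · omega
    · have := P.lt v hv; omega
  · rw [F8.mem 19 (by decide), F7.mem 19 (by decide), F6.mem 19 (by decide),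
        F5.mem 19 (by decide), c4]
    split_ifs
    · rfl
    · exact P.mem v hv
  · split_ifs with h
    · rw [old r hr, hrk, h]
    · have hv' := (Finset.mem_insert.mp hv).resolve_left h
      have := P.lt v (Finset.mem_range.mp (hS hv'))
      rw [old _ (by omega), X1.old _ this, P.eq v hv']
  · have hcap := P.cap.step (u := s) (b := e1 a2) (b' := e2 a3) (c := e3 a4) hq hsS
      (fun m hm => mem_exps.mpr (P.low m hm)) le2
    rw [← X1.exps_eq, ← X2.exps_eq, ← X3.exps_eq, ← X4.exps_eq] at hcap
    have key := hcap (fun j h1 h2 => mem_exps.mpr (ch2 j h1 h2))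
      (fun h => by obtain ⟨a, ha, h⟩ := mem_exps.mp h; exact top2 a ha h) le3
      (fun j h1 h2 => mem_exps.mpr (ch3 j h1 h2))
      (fun h => by obtain ⟨a, ha, h⟩ := mem_exps.mp h; exact top3 a ha h)
      (fun j h2 => mem_exps.mpr (ch4 j (Nat.zero_le _) h2))
      (fun h => by obtain ⟨a, ha, h⟩ := mem_exps.mp h; exact top4 a ha h)
    convert key using 1
    push_cast; ring
  · have sub : S ⊆ insert s S := Finset.subset_insert _ _
    have sp1 : ∀ a < N1, Spans q (insert s S) k (3 * t - 1) (e1 a) := by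
      intro a ha
      by_cases haN : a < N
      · rw [X1.old a haN]; exact (P.spans a haN).mono hq sub le_rfl
      · rw [X1.new a (by omega) ha]
        -- The exponent of the processed node is the value of its successor marking, with remainder
        -- `0`; each of the following extensions adds `1` to the remainder.
        refine Spans.mono ⟨dm s, 0, fun v hv => hf v (Finset.mem_range.mp (hS hv)), le_rfl,
            by omega,
          ?_⟩ hq sub le_rfl
        rw [I.val s hs, add_zero]
        refine (Finset.sum_subset hS fun v hv hvS => ?_).symm
        have : dm s v = 0 := by
          by_contra hc
          exact hvS (hsucc v (Finset.mem_range.mp hv) hc)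
        rw [this, zero_mul]
    have sp2 : ∀ a < N2, Spans q (insert s S) k (3 * t - 1 + 1) (e2 a) := by
      intro a ha
      by_cases haN : a < N1
      · rw [X2.old a haN]; exact (sp1 a haN).mono hq subset_rfl (by omega)
      · rw [X2.new a (by omega) ha]; exact (sp1 a2 ha2).succ
    have sp3 : ∀ a < N3, Spans q (insert s S) k (3 * t - 1 + 1 + 1) (e3 a) := by
      intro a ha
      by_cases haN : a < N2
      · rw [X3.old a haN]; exact (sp2 a haN).mono hq subset_rfl (by omega)
      · rw [X3.new a (by omega) ha]; exact (sp2 a3 ha3).succ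
    intro a ha
    push_cast
    rw [show 3 * ((t : ℤ) + 1) - 1 = 3 * t - 1 + 1 + 1 + 1 by ring]
    by_cases haN : a < N3
    · rw [X4.old a haN]; exact (sp3 a haN).mono hq subset_rfl (by omega)
    · rw [X4.new a (by omega) ha]; exact (sp3 a4 ha4).succ

end PowerCircuits

/-! ### Processing all nodes in topological order -/

open scoped BigOperators
namespace PowerCircuits

variable {q L N n : ℕ} {e ord : ℕ → ℕ} {σ : Store}

theorem Progress.frame {t : ℕ} {k π : ℕ → ℕ} {S : Finset ℕ} {σ' : Store}
    (P : Progress q L n t k S N e ord π σ) {b : ℕ} {T : List ℕ} (hF : Frame b T σ σ') (hb : 5 ≤ b)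
    (hT : 10 ∉ T ∧ 11 ∉ T ∧ 12 ∉ T ∧ 13 ∉ T) (h19 : 19 ∉ T) :
    Progress q L n t k S N e ord π σ' where
  repr := P.repr.frame hF hb hT
  low := P.low
  size := P.size
  lt := P.lt
  mem := by rw [hF.mem 19 h19]; exact P.mem
  eq := P.eq
  cap := P.cap
  spans := P.spans

theorem Input.exp_eq_zero {dm : ℕ → ℕ → ℤ} {k : ℕ → ℕ} (I : Input q n dm k) {s : ℕ} (hs : s < n)
    (h : ∀ v < n, dm s v = 0) : k s = 0 := by
  have := I.val s hs
  rw [Finset.sum_eq_zero fun v hv => by rw [h v (Finset.mem_range.mp hv), zero_mul]] at this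
  exact_mod_cast this

/-- The first node in topological order has no successors, hence exponent `0`, and is represented by
the node `0`. Together with the exponents `1, 2, 3` this uses exactly the four nodes that are
allowed. -/
theorem progress_one (hq : 2 ≤ q) {k : ℕ → ℕ} {s : ℕ} (hk : k s = 0)
    (R : Repr q L 4 (fun a => a) (fun a => a) σ) (h19 : ∀ v < n, σ.mem 19 (v : ℤ) = 0) :
    Progress q L n 1 k {s} 4 (fun a => a) (fun a => a) (fun _ => 0) σ where
  repr := R
  low := fun m hm => ⟨m, hm, rfl⟩
  size := le_rfl
  lt := fun _ _ => by omega
  mem := fun v hv => by rw [h19 v hv]; rfl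
  eq := fun v hv => by rw [Finset.mem_singleton.mp hv, hk]
  cap := Capacity.base hq (fun m hm => mem_exps.mpr ⟨m, hm, rfl⟩) hk
  spans := fun a ha => by
    have hq' : (2 : ℤ) ≤ q := by exact_mod_cast hq
    -- For `a > 0` the value `1` of the processed node is used once, leaving `a - 1 ≤ 2`. Without it
    -- the remainder for `a = 3` would exceed the slack.
    refine ⟨fun _ => if a = 0 then 0 else 1, if a = 0 then 0 else (a : ℤ) - 1, fun v _ => ?_, ?_,
        ?_, ?_⟩
    · beta_reduce
      split_ifs <;> simp <;> omega
    · split_ifs <;> omega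
    · split_ifs <;> omega
    · simp only [Finset.sum_singleton, hk, pow_zero, mul_one]
      split_ifs with h
      · simp [h]
      · omega

/-- Process all nodes in topological order. -/
def processAll (q : ℕ) : Program :=
  forUp 6 0 7 (.seq scan (.seq (.ifPos 6 (process q) (block [.const 16 0,
      .store 19 9 16])) decrement))

/-- The state after processing `t` nodes. -/
structure LoopState (q L n t : ℕ) (dm : ℕ → ℕ → ℤ) (k : ℕ → ℕ) (S : Finset ℕ) (σ : Store) :
    Prop where
  sub : S ⊆ Finset.range n
  card : S.card = t
  closed : ∀ u ∈ S, ∀ v < n, dm u v ≠ 0 → v ∈ S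
  count : ∀ u < n, σ.mem 20 (u : ℤ) = if u ∈ S then -1 else (openSucc n dm S u : ℤ)
  start : t = 0 → Repr q L 4 (fun a => a) (fun a => a) σ ∧ ∀ v < n, σ.mem 19 (v : ℤ) = 0
  progress : 0 < t → ∃ N e ord π, Progress q L n t k S N e ord π σ

theorem LoopState.frame {t : ℕ} {dm : ℕ → ℕ → ℤ} {k : ℕ → ℕ} {S : Finset ℕ} {σ' : Store}
    (P : LoopState q L n t dm k S σ) {b : ℕ} (hF : Frame b [] σ σ') (hb : 5 ≤ b) :
    LoopState q L n t dm k S σ' where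
  sub := P.sub
  card := P.card
  closed := P.closed
  count := by rw [hF.mem 20 (by simp)]; exact P.count
  start := fun h => by
    rw [hF.mem 19 (by simp)]
    exact ⟨(P.start h).1.frame hF hb (by simp), (P.start h).2⟩
  progress := fun h => by
    obtain ⟨N, e, ord, π, h⟩ := P.progress h
    exact ⟨N, e, ord, π, h.frame hF hb (by simp) (by simp)⟩

theorem count_bounds {dm : ℕ → ℕ → ℤ} {S : Finset ℕ}
    (u : ℕ) : -1 ≤ (if u ∈ S then -1 else (openSucc n dm S u : ℤ)) ∧
      (if u ∈ S then -1 else (openSucc n dm S u : ℤ)) ≤ n := by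
  have : openSucc n dm S u ≤ n := (Finset.card_filter_le _ _).trans (by simp)
  split_ifs <;> omega

theorem runs_processAll {w : ℤ} (hq : 2 ≤ q) {dm : ℕ → ℕ → ℤ} {k : ℕ → ℕ} (I : Input q n dm k)
    (hL : L = 4 * n) (h0 : σ.reg 0 = n) (h3 : σ.reg 3 = 1)
    (hd : ∀ u < n, ∀ v < n, σ.mem 0 ((u : ℤ) * n + v) = dm u v)
    (D : DivTable q (2 * (q * n)) σ) (h20 : LoopState q L n 0 dm k ∅ σ)
    (hw : (L : ℤ) * L + L + 2 * (q * n : ℕ) + 2 * q + 2 ≤ w) :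
    Runs w (processAll q) σ ((1400 * L + 20) * n + 3) (fun σ' =>
      Frame 4 [10, 11, 12, 14, 15, 16, 19, 20] σ σ' ∧ ∃ S, LoopState q L n n dm k S σ') := by
  have hnn : (0 : ℤ) ≤ (n : ℤ) * n := by positivity
  have hLL : (L : ℤ) * L = 16 * (n * n) := by rw [hL]; push_cast; ring
  have hL' : (L : ℤ) = 4 * n := by rw [hL]; push_cast; rfl
  have hqn : (0 : ℤ) ≤ ((q * n : ℕ) : ℤ) := by positivity
  refine (Runs.forUp (σ₀ := σ) (r := 4) (S := [10, 11, 12, 14, 15, 16, 19, 20]) (n := n)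
    (1400 * L + 17) (fun t σ' => ∃ S, LoopState q L n t dm k S σ')
    (by decide) (by decide) (by decide) (by decide) (by decide) h0 h3 (by linarith) (by simp)
    ⟨∅, h20⟩ (fun k σ v v' ⟨S, h⟩ => ⟨S, h.frame (b := 6) (by simp) (by decide)⟩) ?_).mono
    le_rfl fun _ h => h
  rintro t ht σ₁ F1 ⟨S, P1⟩ p1
  -- Fewer than `n` nodes are processed, so a node with counter `0` exists.
  have hex : ∃ u < n, (if u ∈ S then -1 else (openSucc n dm S u : ℤ)) = 0 := by
    obtain ⟨u, hu, huS, h⟩ := I.min S (Finset.ssubset_iff_subset_ne.mpr ⟨P1.sub, fun h => by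
      have := P1.card; rw [h, Finset.card_range] at this; omega⟩)
    exact ⟨u, hu, by rw [if_neg huS, openSucc_eq_zero.mpr h]; rfl⟩
  have hT : 1400 * L + 17 = (10 * n + 6) + (1300 * L + 2 + 1 + (100 * L - 10 * n + 8)) := by omega
  rw [hT]
  refine (runs_scan (by rw [F1.reg 0 (by decide), h0]) (by rw [F1.reg 3 (by decide), h3]) P1.count
    (fun u _ => count_bounds u) hex (by linarith)).seq ?_
  rintro σ₂ ⟨F2, s, hs, hcs, h9, h12⟩
  have hsS : s ∉ S := fun h => by rw [if_pos h] at hcs; omega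
  rw [if_neg hsS] at hcs
  have hsucc := openSucc_eq_zero.mp (by exact_mod_cast hcs : openSucc n dm S s = 0)
  have F02 : Frame 4 [10, 11, 12, 14, 15, 16, 19, 20] σ σ₂ := F1.trans F2 (by decide) (by simp)
  have P2 := P1.frame F2 (by decide)
  have hd2 : ∀ u < n, ∀ v < n, σ₂.mem 0 ((u : ℤ) * n + v) = dm u v := by
    rw [F02.mem 0 (by decide)]; exact hd
  have hclosed : ∀ u ∈ insert s S, ∀ v < n, dm u v ≠ 0 → v ∈ insert s S := by
    intro u hu v hv h
    rcases Finset.mem_insert.mp hu with rfl | hu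
    · exact Finset.mem_insert_of_mem (hsucc v hv h)
    · exact Finset.mem_insert_of_mem (P1.closed u hu v hv h)
  have h62 : σ₂.reg 6 = t := by rw [F2.reg 6 (by decide), p1]
  refine Runs.seq (R := fun σ' => FrameN 10 [10, 11, 12, 14, 15, 16, 19] σ₂ σ' ∧
    ∃ N e ord π, Progress q L n (t + 1) k (insert s S) N e ord π σ') ?_ ?_
  · refine Runs.ifPos (fun h => ?_) (fun h => ?_)
    · have ht0 : 0 < t := by rw [h62] at h; exact_mod_cast h
      obtain ⟨N, e, ord, π, P⟩ := P2.progress ht0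
      exact (runs_process hq I ht0 P P2.sub hs hsS hsucc (by rw [F02.reg 0 (by decide),
          h0]) h9 h12 hd2
        (D.frame F02 (by decide)) (by omega) (by omega) hw).mono (by omega) fun _ h => h
    · have ht0 : t = 0 := by rw [h62] at h; omega
      subst ht0
      have hS : S = ∅ := Finset.card_eq_zero.mp P1.card
      subst hS
      obtain ⟨R, m19⟩ := P2.start rfl
      refine Runs.of_wp (T := 1300 * L + 2) (by simp [block, cost]) ?_
      simp only [block, wp, Store.reg_setReg, Nat.reduceEqDiff, reduceIte, h9]
      have FF : Frame 10 [19] σ₂ ((σ₂.setReg 16 0).setMem 19 s 0) := by simp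
      refine ⟨by rw [abs_zero]; linarith, FF.frameN le_rfl (by simp), 4, _, _, _,
        progress_one hq (I.exp_eq_zero hs fun v hv => ?_) (R.frame FF (by decide) (by decide))
        fun v hv => ?_⟩
      · by_contra hc
        simpa using hsucc v hv hc
      · rw [Store.mem_setMem, Store.mem_setReg, m19 v hv, ite_self]
  rintro σ₃ ⟨F3, N, e, ord, π, P3⟩
  have F03 : Frame 4 [10, 11, 12, 14, 15, 16, 19, 20] σ σ₃ :=
    ⟨fun r hr => by rw [F3.reg r (by omega) (by omega), F02.reg r hr], fun s hs => by
      rw [F3.mem s fun h => hs (by revert h; simp; omega), F02.mem s hs]⟩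
  refine (runs_decrement (c := fun u => if u ∈ S then -1 else (openSucc n dm S u : ℤ))
    (by rw [F03.reg 0 (by decide), h0]) P3.repr.one
    (by rw [F3.reg 9 (by decide) (by decide), h9]) hs
    (by rw [F03.mem 0 (by decide)]; exact hd) I.abs (by rw [F3.mem 20 (by decide)]; exact P2.count)
    (fun u _ => count_bounds u) (by linarith)).mono (by omega) ?_
  rintro σ₄ ⟨F4, c4⟩
  refine ⟨F03.trans F4 (by decide) (by simp), ⟨insert s S, ?_, ?_, hclosed, ?_, by omega,
    fun _ => ⟨N, e, ord, π, P3.frame F4 (by decide) (by decide) (by decide)⟩⟩, ?_⟩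
  · exact Finset.insert_subset (Finset.mem_range.mpr hs) P1.sub
  · rw [Finset.card_insert_of_notMem hsS, P1.card]
  · intro u hu
    rw [c4 u hu]
    by_cases hus : u = s
    · subst hus
      have : dm u u = 0 := by
        by_contra hc
        exact hsS (hsucc u hu hc)
      simp [this]
    · rw [if_neg hus]
      by_cases huS : u ∈ S
      · have : dm u s = 0 := by
          by_contra hc
          exact hsS (P1.closed u huS s hs hc)
        simp [huS, this]
      · rw [if_neg huS, if_neg (show u ∉ insert s S by simp [hus, huS]), openSucc_insert hs hsS]
  · rw [F4.reg 6 (by decide), F3.reg 6 (by decide) (by decide), h62]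

/-- Preparations before the first node is processed. -/
noncomputable def setup (q : ℕ) : Program :=
  .seq (block [.const 3 1, .add 5 0 0, .add 5 5 5]) (.seq mulTable (.seq (divTable q)
    (.seq (initNodes q) countSucc)))

theorem runs_setup {w : ℤ} (hq : 2 ≤ q) {dm : ℕ → ℕ → ℤ} {k : ℕ → ℕ} (I : Input q n dm k)
    (hn : 0 < n) (hL : L = 4 * n) (h0 : σ.reg 0 = n)
    (hd : ∀ u < n, ∀ v < n, σ.mem 0 ((u : ℤ) * n + v) = dm u v)
    (h12 : ∀ p, σ.mem 12 p = 0) (h19 : ∀ p, σ.mem 19 p = 0)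
    (hw : (L : ℤ) * L + L + 4 * (q * n : ℕ) + 2 * q + 2 * n + 4 ≤ w) :
    Runs w (setup q) σ (10 * (n * n) + 28 * n + 44 * q * n + 8 * q + 110) (fun σ' =>
      Frame 3 [10, 11, 12, 13, 17, 18, 20] σ σ' ∧ σ'.reg 3 = 1 ∧ DivTable q (2 * (q * n)) σ' ∧
      LoopState q L n 0 dm k ∅ σ') := by
  have hLL : (L : ℤ) * L = 16 * (n * n) := by rw [hL]; push_cast; ring
  have hnn : (0 : ℤ) ≤ (n : ℤ) * n := by positivity
  have hL' : (L : ℤ) = 4 * n := by rw [hL]; push_cast; rfl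
  have hqn : (0 : ℤ) ≤ ((q * n : ℕ) : ℤ) := by positivity
  have hT : 10 * (n * n) + 28 * n + 44 * q * n + 8 * q + 110 = 3 + ((5 * L + 4) +
      ((44 * q * n + 8 * q + 30) + (65 + (10 * (n * n) + 8 * n + 8)))) := by rw [hL]; ring
  rw [hT]
  refine Runs.seq (R := fun σ' => Frame 3 [] σ σ' ∧ σ'.reg 3 = 1 ∧ σ'.reg 5 = L)
    (Runs.of_wp (by decide) ?_) ?_
  · simp only [block, wp, Store.reg_setReg, Nat.reduceEqDiff, reduceIte, h0]
    refine ⟨by rw [abs_le]; omega, by rw [abs_le]; omega, by rw [abs_le]; omega, by simp, trivial,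
        ?_⟩
    omega
  rintro σ₁ ⟨F1, p1, p2⟩
  refine (runs_mulTable p1 p2 (by linarith)).seq ?_
  rintro σ₂ ⟨F2, p3⟩
  have g0 : σ₂.reg 0 = n := by rw [F2.reg 0 (by decide), F1.reg 0 (by decide), h0]
  have g3 : σ₂.reg 3 = 1 := by rw [F2.reg 3 (by decide), p1]
  refine (runs_divTable hq g0 g3 (by push_cast at hw; linarith)).seq ?_
  rintro σ₃ ⟨F3, D3⟩
  have k3 : σ₃.reg 3 = 1 := by rw [F3.reg 3 (by decide), g3]
  refine (runs_initNodes (L := L) hq (by omega) k3 (by rw [F3.mem 13 (by decide)]; exact p3)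
    (fun p => by rw [F3.mem 12 (by decide), F2.mem 12 (by decide), F1.mem 12 (by decide), h12])
    (by have : (n : ℤ) ≤ n * n := by exact_mod_cast Nat.le_mul_self n
        linarith)).seq ?_
  rintro σ₄ ⟨F4, R4⟩
  have F04 : Frame 3 [10, 11, 12, 13, 17, 18, 20] σ σ₄ := by
    have h1 : Frame 3 [10, 11, 12, 13, 17, 18, 20] σ σ₁ := F1.weaken le_rfl (by simp)
    have h := (h1.trans F2 (by decide) (by simp)).trans F3 (by decide) (by simp)
    exact ⟨fun r hr => by rw [F4.reg r (by omega) (by omega), h.reg r hr], fun s hs => by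
      rw [F4.mem s fun hc => hs (by revert hc; simp; omega), h.mem s hs]⟩
  refine (runs_countSucc (dm := dm) (q := q) (by rw [F04.reg 0 (by decide), h0]) R4.one
    (by rw [F04.mem 0 (by decide)]; exact hd) I.abs (by linarith)).mono (by omega) ?_
  rintro σ₅ ⟨F5, p5⟩
  refine ⟨F04.trans F5 (by decide) (by simp), by rw [F5.reg 3 (by decide), R4.one],
    (D3.frameN F4 (by decide)).frame F5 (by decide), by simp, rfl, by simp, by simpa using p5,
    fun _ => ⟨R4.frame F5 (by decide) (by decide), fun v _ => ?_⟩, by simp⟩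
  rw [F5.mem 19 (by decide), F04.mem 19 (by decide), h19]

end PowerCircuits

open scoped BigOperators
namespace PowerCircuits

variable {q L N n m : ℕ} {e ord : ℕ → ℕ} {σ : Store}

/-! ## The list of compact markings -/

/-- Append the accumulator, in the order of the exponents, to the list in segment `21`. -/
def appendAcc : Program :=
  .seq (.move 34 20) (.seq (forUp 30 4 31 (block [.load 32 10 30, .load 33 14 32, .store 21 34 33,
    .add 34 34 3])) (.move 20 34))

theorem runs_appendAcc {w : ℤ} (R : Repr q L N e ord σ) {f : ℕ → ℤ} {base : ℕ}
    (hf : ∀ a < N, σ.mem 14 (a : ℤ) = f a) (h20 : σ.reg 20 = base) (hw : (base : ℤ) + N ≤ w) :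
    Runs w appendAcc σ (7 * N + 5) (fun σ' => Frame 20 [21] σ σ' ∧ σ'.reg 20 = (base + N : ℕ) ∧
      (∀ j < N, σ'.mem 21 ((base : ℤ) + (j : ℕ)) = f (ord j)) ∧
      ∀ p < base, σ'.mem 21 (p : ℤ) = σ.mem 21 (p : ℤ)) := by
  have hT : 7 * N + 5 = 1 + (((4 + 3) * N + 3) + 1) := by ring
  rw [hT]
  refine Runs.seq (R := fun σ' => Frame 30 [] σ σ' ∧ σ'.reg 34 = base)
    (Runs.of_wp (by decide) (by simp [wp, h20])) ?_
  rintro σ₁ ⟨F1, p1⟩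
  refine (Runs.forUp (σ₀ := σ) (r := 30) (S := [21]) (n := N) 4 (fun k σ' =>
    σ'.reg 34 = (base : ℤ) + k ∧ (∀ j < k, σ'.mem 21 ((base : ℤ) + (j : ℕ)) = f (ord j)) ∧
      ∀ p < base, σ'.mem 21 (p : ℤ) = σ.mem 21 (p : ℤ))
    (by decide) (by decide) (by decide) (by decide) (by decide) R.num R.one (by linarith)
    (F1.weaken le_rfl (by simp)) ⟨by simp [p1], by simp, fun p _ => by rw [F1.mem 21 (by decide)]⟩
    (fun k σ v v' h => by simpa using h) ?_).seq ?_
  · rintro k hk σ₂ F2 ⟨i1, i2, i3⟩ i4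
    refine Runs.of_wp (by decide) ?_
    have m10 : σ₂.mem 10 (k : ℤ) = ord k := by rw [F2.mem 10 (by decide), R.ordm k hk]
    have m14 : σ₂.mem 14 (ord k : ℤ) = f (ord k) := by
      rw [F2.mem 14 (by decide), hf _ (R.ord_lt k hk)]
    have k3 : σ₂.reg 3 = 1 := by rw [F2.reg 3 (by decide), R.one]
    simp only [block, wp, Store.reg_setReg, Store.mem_setReg, Store.reg_setMem, Nat.reduceEqDiff,
      reduceIte, i1, i4, m10, m14, k3]
    refine ⟨by rw [abs_le]; omega, by simpa using F2, ⟨by push_cast; ring, fun j hj => ?_,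
      fun p hp => ?_⟩, trivial⟩
    · rw [Store.mem_setMem]
      by_cases hjk : j = k
      · rw [if_pos ⟨rfl, by rw [hjk]⟩, hjk]
      · rw [if_neg (by omega)]
        exact i2 j (by omega)
    · rw [Store.mem_setMem, if_neg (by omega)]
      exact i3 p hp
  · rintro σ₂ ⟨F2, i1, i2, i3⟩
    refine Runs.of_wp (by decide) ?_
    simp only [wp, i1]
    exact ⟨by simpa using F2.weaken (by decide) (by simp), by simp, i2, i3⟩

/-- Write the successor markings and the given markings, as compact markings. -/
def writeMarkings (q : ℕ) : Program :=
  .seq (.const 20 0) (.seq (forUp 6 4 7 (.seq (block [.load 26 10 6, .const 27 0])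
    (.seq loadAcc appendAcc)))
  (.seq (.const 12 0) (.seq (forUp 6 1 7 (.seq clearAcc (.seq (addMarking 1)
    (.seq (normalise q) (.seq appendAcc (.add 12 12 0)))))) (.add 5 4 1))))

/-- The nodes with exponents `E 0 < ⋯ < E (N - 1)` and the values `X s` of compact markings. -/
structure Family (q N T : ℕ) (E : ℕ → ℕ) (X : ℕ → ℤ) : Prop where
  mono : ∀ i k, i < k → k < N → E i < E k
  hasCd : ∀ s < T, HasCd q (X s)
  supp : ∀ s < T, ∀ p, cd q (X s) p ≠ 0 → ∃ i < N, E i = p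
  -- The tolerance `-1` gives a strict inequality at top nodes, which `Family.mark_eq_zero_of_isTop`
  -- needs.
  tame : ∀ s < T, ∀ p, (∀ i < N, E i ≠ p) → |psum q (cd q (X s)) p| ≤ (q : ℤ) ^ (p - 2) + -1
  le : N ≤ T
  node : ∀ s < N, X s = E s

/-- The storage contains the lists of nodes and of compact markings. -/
structure Written (q N T : ℕ) (E : ℕ → ℕ) (X : ℕ → ℤ) (σ : Store) : Prop where
  one : σ.reg 3 = 1
  num : σ.reg 4 = N
  total : σ.reg 5 = T
  bit : ∀ i < N, 0 < σ.mem 11 (σ.mem 10 (i : ℤ)) ↔ i + 1 < N ∧ E (i + 1) = E i + 1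
  digit : ∀ s < T, ∀ j < N, σ.mem 21 ((s : ℤ) * N + (j : ℕ)) = cd q (X s) (E j)

/-- The values of the list of markings. -/
def listVal (q n N : ℕ) (mk : ℕ → ℕ → ℤ) (k : ℕ → ℕ) (E : ℕ → ℕ) (s : ℕ) : ℤ :=
  if s < N then E s else ∑ v ∈ Finset.range n, mk (s - N) v * (q : ℤ) ^ k v

/-- The bounds for the markings come from the capacity, with `S` the set of all nodes. Existence of
compact digits is a hypothesis of the last part because it is only delivered by the run of the
normalisation. -/
theorem Progress.family_listVal {k π : ℕ → ℕ} {mk : ℕ → ℕ → ℤ} (hq : 2 ≤ q) (hn : 0 < n)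
    (P : Progress q L n n k (Finset.range n) N e ord π σ)
    (hmq : ∀ u < m, ∀ v < n, |mk u v| ≤ q - 1) :
    (∀ u < m, ∀ p, (∀ a < N, e a ≠ p) → q * |psum q (spread (Finset.range N) e
      (fun a => ∑ v ∈ Finset.range n, if π v = a then mk u v else 0)) p| ≤ (q : ℤ) ^ p) ∧
    (∀ u, nodeSum q N e (fun a => ∑ v ∈ Finset.range n, if π v = a then mk u v else 0) =
      ∑ v ∈ Finset.range n, mk u v * (q : ℤ) ^ k v) ∧
    ((∀ u < m, HasCd q (∑ v ∈ Finset.range n, mk u v * (q : ℤ) ^ k v) ∧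
      ∀ p, cd q (∑ v ∈ Finset.range n, mk u v * (q : ℤ) ^ k v) p ≠ 0 → ∃ b < N, e b = p) →
      Family q N (N + m) (fun i => e (ord i)) (listVal q n N mk k (fun i => e (ord i)))) := by
  have R := P.repr
  have htame := P.tame hq subset_rfl
  have hgap : ∀ u < m, ∀ p, (∀ a < N, e a ≠ p) → |psum q (spread (Finset.range N) e
      (fun a => ∑ v ∈ Finset.range n, if π v = a then mk u v else 0)) p| ≤ (q : ℤ) ^ (p - 2) + -1 :=
    fun u hu p hp => P.gap hq hn subset_rfl (hmq u hu) (fun v hv _ => Finset.mem_range.mpr hv) hp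
  have hgap' : ∀ u < m, ∀ p, (∀ a < N, e a ≠ p) → q * |psum q (spread (Finset.range N) e
      (fun a => ∑ v ∈ Finset.range n, if π v = a then mk u v else 0)) p| ≤ (q : ℤ) ^ p :=
    fun u hu p hp => gap_bound hq (four_le_gap P.low hp) ((hgap u hu p hp).trans (by linarith))
  have hval : ∀ u, nodeSum q N e (fun a => ∑ v ∈ Finset.range n, if π v = a then mk u v else 0) =
      ∑ v ∈ Finset.range n, mk u v * (q : ℤ) ^ k v := by
    intro u
    rw [nodeSum_fiber P.lt]
    exact Finset.sum_congr rfl fun v hv => by rw [P.eq v hv]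
  refine ⟨hgap', hval, ?_⟩
  intro hcd
  have tr : ∀ {p}, (∃ b < N, e b = p) → ∃ i < N, e (ord i) = p := by
    rintro p ⟨b, hb, rfl⟩
    obtain ⟨i, hi, rfl⟩ := R.surj b hb
    exact ⟨i, hi, rfl⟩
  have tr' : ∀ {p}, (∀ i < N, e (ord i) ≠ p) → ∀ a < N, e a ≠ p := by
    intro p h a ha hap
    obtain ⟨i, hi, h'⟩ := tr ⟨a, ha, hap⟩
    exact h i hi h'
  refine ⟨R.mono, fun s hs => ?_, fun s hs p hp => ?_, fun s hs p hp => ?_, by omega,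
    fun s hs => if_pos hs⟩
  · unfold listVal
    split_ifs with h
    · exact R.hasCd _ (R.ord_lt s h)
    · exact (hcd _ (by omega)).1
  · unfold listVal at hp
    split_ifs at hp with h
    · exact tr (R.supp _ (R.ord_lt s h) p hp)
    · exact tr ((hcd _ (by omega)).2 p hp)
  · unfold listVal
    split_ifs with h
    · exact htame _ (R.ord_lt s h) p (tr' hp)
    · have hu : s - N < m := by omega
      obtain ⟨c1, c2⟩ := hcd _ hu
      have hsp := hasVal_spread q (Finset.range N) e
        (fun a => ∑ v ∈ Finset.range n, if π v = a then mk (s - N) v else 0)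
      have hv := hval (s - N)
      unfold nodeSum at hv
      rw [hv] at hsp
      rw [c1.1.psum_eq_of_gap hq c1.2 hsp ?_
        (spread_eq_zero _ fun a ha => tr' hp a (Finset.mem_range.mp ha)) (hgap' _ hu p (tr' hp))]
      · exact hgap _ hu p (tr' hp)
      · by_contra hc
        obtain ⟨a, ha, h⟩ := c2 p hc
        exact tr' hp a ha h

-- The rows of the nodes are compact already and are only reordered by increasing exponent; the
-- given markings have to be normalised. Each of the `N + m` rows takes time linear in `N + n`.
set_option maxHeartbeats 800000 in
theorem runs_writeMarkings {w : ℤ} (hq : 2 ≤ q) {k π : ℕ → ℕ} {mk : ℕ → ℕ → ℤ} (hn : 0 < n)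
    (P : Progress q L n n k (Finset.range n) N e ord π σ) (hL : L = 4 * n)
    (h0 : σ.reg 0 = n) (h1 : σ.reg 1 = m)
    (hm : ∀ u < m, ∀ v < n, σ.mem 1 ((u : ℤ) * n + v) = mk u v)
    (hmq : ∀ u < m, ∀ v < n, |mk u v| ≤ q - 1) (D : DivTable q (2 * (q * n)) σ)
    (hw : (L : ℤ) * L + L + 2 * (q * n : ℕ) + 2 * q + 2 + L * m + m ≤ w) :
    Runs w (writeMarkings q) σ (13 * (N * N) + 19 * N + m * (63 * N + 9 * n + 28) + 9) (fun σ' =>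
      Frame 5 [14, 15, 16, 21] σ σ' ∧ Family q N (N + m) (fun i => e (ord i))
        (listVal q n N mk k (fun i => e (ord i))) ∧
      Written q N (N + m) (fun i => e (ord i)) (listVal q n N mk k (fun i => e (ord i))) σ') := by
  have hLL : (0 : ℤ) ≤ (L : ℤ) * L := by positivity
  have hLm : (0 : ℤ) ≤ (L : ℤ) * m := by positivity
  have hqn : (q : ℤ) ≤ ((q * n : ℕ) : ℤ) := by
    push_cast; nlinarith [(by exact_mod_cast hn : (1 : ℤ) ≤ n)]
  have hNL : N ≤ L := by rw [hL]; exact P.size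
  have hNL' : (N : ℤ) ≤ L := by exact_mod_cast hNL
  have hnL : (n : ℤ) ≤ L := by omega
  have R := P.repr
  obtain ⟨hgap', hval, hfam⟩ := P.family_listVal (m := m) hq hn hmq
  have hT : 13 * (N * N) + 19 * N + m * (63 * N + 9 * n + 28) + 9 = 1 +
      (((13 * N + 15 + 3) * N + 3) +
      (1 + ((((5 * N + 3) + ((9 * n + 4) + ((51 * N + 12) + ((7 * N + 5) + 1))) + 3) * m + 3) +
        (1 + N)))) := by ring
  rw [hT]
  refine Runs.seq (R := fun σ' => Frame 5 [14, 15, 16, 21] σ σ' ∧ σ'.reg 20 = 0)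
    (Runs.of_wp (by decide) (by simp [wp]; linarith)) ?_
  rintro σ₁ ⟨F1, p1⟩
  refine (Runs.forUp (σ₀ := σ) (r := 5) (S := [14, 15, 16, 21]) (n := N) (13 * N + 15) (fun s σ' =>
    σ'.reg 20 = (s * N : ℕ) ∧ ∀ u < s, ∀ j < N, σ'.mem 21 ((u : ℤ) * N + (j : ℕ)) =
      cd q (e (ord u)) (e (ord j)))
    (by decide) (by decide) (by decide) (by decide) (by decide) R.num R.one (by linarith)
    F1 ⟨by simp [p1], by simp⟩ (fun k σ v v' h => by simpa using h) ?_).seq ?_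
  · rintro s hs σ₂ F2 ⟨i1, i2⟩ i3
    have R2 := R.frame F2 (by decide) (by decide)
    have hsL := R.ord_lt s hs
    have hoL : (ord s : ℤ) * L + L ≤ L * L := by
      have : ((ord s : ℤ) + 1) * L ≤ L * L := mul_le_mul_of_nonneg_right (by omega) (by positivity)
      linarith
    have hsN : (s : ℤ) * N + N ≤ L * L := by
      have : ((s : ℤ) + 1) * N ≤ L * L := mul_le_mul (by omega) hNL' (by positivity) (by positivity)
      linarith
    have hT : 13 * N + 15 = 2 + ((6 * N + 8) + (7 * N + 5)) := by ring
    rw [hT]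
    refine Runs.seq (R := fun σ' => Frame 20 [] σ₂ σ' ∧ σ'.reg 26 = ord s ∧ σ'.reg 27 = 0 ∧
      σ'.reg 20 = (s * N : ℕ)) (Runs.of_wp (by decide) ?_) ?_
    · simp [block, wp, i3, R2.ordm s hs, i1]; linarith
    rintro σ₃ ⟨F3, q1, q2, q3⟩
    have R3 := R2.frame F3 (by decide) (by decide)
    have hb := abs_le.mp (abs_incCoeff_le (e := e) (R.hasCd _ hsL) (inc := 0) (by simp) 0)
    simp only [incCoeff, ite_self, add_zero] at hb
    refine (runs_loadAcc R3.num R3.one R3.pos q1 (R3.mul _ (by omega)) (R3.rows _ hsL)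
      (by linarith) (by rw [q2, add_zero, abs_le]; constructor <;> linarith)).seq ?_
    rintro σ₄ ⟨F4, q4⟩
    simp only [q2, ite_self, add_zero] at q4
    have R4 := R3.frame F4 (by decide) (by decide)
    refine (runs_appendAcc R4 (base := s * N) q4 (by rw [F4.reg 20 (by decide), q3])
      (by push_cast; linarith)).mono le_rfl ?_
    rintro σ₅ ⟨F5, q5, q6, q7⟩
    refine ⟨((F2.trans F3 (by decide) (by simp)).trans F4 (by decide) (by simp)).trans F5
        (by decide)
      (by simp), ⟨by rw [q5]; push_cast; ring, fun u hu j hj => ?_⟩, ?_⟩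
    · by_cases hus : u = s
      · subst hus; rw [← q6 j hj]; push_cast; rfl
      · have h1 : u * N + j < s * N := by
          have : (u + 1) * N ≤ s * N := Nat.mul_le_mul_right _ (by omega)
          linarith
        have h2 := q7 _ h1
        push_cast at h2
        rw [h2, F4.mem 21 (by decide), F3.mem 21 (by decide)]
        exact i2 u (by omega) j hj
    · rw [F5.reg 6 (by decide), F4.reg 6 (by decide), F3.reg 6 (by decide), i3]
  rintro σ₂ ⟨F2, i1, i2⟩
  refine Runs.seq (R := fun σ' => Frame 5 [14, 15, 16, 21] σ σ' ∧ σ'.reg 12 = 0 ∧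
    σ'.reg 20 = (N * N : ℕ) ∧ σ'.mem = σ₂.mem) (Runs.of_wp (by decide) ?_) ?_
  · simp [wp, F2, i1]; linarith
  rintro σ₃ ⟨F3, j1, j2, j3⟩
  refine (Runs.forUp (σ₀ := σ) (r := 5) (S := [14, 15, 16, 21]) (n := m)
    ((5 * N + 3) + ((9 * n + 4) + ((51 * N + 12) + ((7 * N + 5) + 1)))) (fun s σ' =>
    σ'.reg 12 = (s * n : ℕ) ∧ σ'.reg 20 = ((N + s) * N : ℕ) ∧
    (∀ u < s, HasCd q (∑ v ∈ Finset.range n, mk u v * (q : ℤ) ^ k v) ∧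
      ∀ p, cd q (∑ v ∈ Finset.range n, mk u v * (q : ℤ) ^ k v) p ≠ 0 → ∃ b < N, e b = p) ∧
    ∀ u < N + s, ∀ j < N, σ'.mem 21 ((u : ℤ) * N + (j : ℕ)) =
      cd q (listVal q n N mk k (fun i => e (ord i)) u) (e (ord j)))
    (by decide) (by decide) (by decide) (by decide) (by decide) h1 R.one (by linarith)
    F3 ⟨by simp [j1], by simp [j2], by simp, fun u hu j hj => ?_⟩
    (fun k σ v v' h => by simpa using h) ?_).seq ?_
  · rw [j3, i2 u hu j hj, listVal, if_pos (by omega)]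
  · rintro s hs σ₄ F4 ⟨k1, k2, k3, k4⟩ k5
    have R4 := R.frame F4 (by decide) (by decide)
    have hsn : (s : ℤ) * n + n ≤ L * m := by
      have : ((s : ℤ) + 1) * n ≤ m * L := mul_le_mul (by omega) hnL (by positivity) (by positivity)
      linarith
    have hsN : ((N : ℤ) + s) * N + N ≤ L * L + L * m := by
      have h1 : ((s : ℤ) + 1) * N ≤ m * L := mul_le_mul (by omega) hNL' (by positivity)
          (by positivity)
      have h2 : (N : ℤ) * N ≤ L * L := mul_le_mul hNL' hNL' (by positivity) (by positivity)
      linarith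
    refine (runs_clearAcc R4.num R4.one (by linarith)).seq ?_
    rintro σ₅ ⟨F5, l1⟩
    have R5 := R4.frame F5 (by decide) (by decide)
    have F05 : Frame 5 [14, 15, 16, 21] σ σ₅ := F4.trans F5 (by decide) (by simp)
    refine (runs_addMarking (s := 1) (K := q) (base := s * n) (π := π) (f := mk s) (N := N)
      (by decide) (by rw [F05.reg 0 (by decide), h0]) R5.one (by rw [F5.reg 12 (by decide), k1])
      (by rw [F05.mem 19 (by decide)]; exact P.mem) ?_
      (fun v hv => (hmq s hs v hv).trans (by omega)) P.lt l1
      (by push_cast at hw ⊢; nlinarith)).seq ?_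
    · intro v hv
      rw [F05.mem 1 (by decide), ← hm s hs v hv]; push_cast; rfl
    rintro σ₆ ⟨F6, l2⟩
    have R6 := R5.frame F6 (by decide) (by decide)
    refine (runs_normalise hq R6 (((D.frame F4 (by decide)).frame F5 (by decide)).frame F6
      (by decide)) l2 (fun a _ => abs_fiber_le (hmq s hs) a) (hgap' s hs) (by linarith)).seq ?_
    rintro σ₇ ⟨F7, l3, l4, l5⟩
    rw [hval] at l3 l4 l5
    have R7 := R6.frame F7 (by decide) (by decide)
    refine (runs_appendAcc R7 (base := (N + s) * N) l5 (by rw [F7.reg 20 (by decide),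
      F6.reg 20 (by decide), F5.reg 20 (by decide), k2]) (by push_cast; linarith)).seq ?_
    rintro σ₈ ⟨F8, l6, l7, l8⟩
    refine Runs.of_wp (by decide) ?_
    have F08 : Frame 5 [14, 15, 16, 21] σ σ₈ :=
      ((F05.trans F6 (by decide) (by simp)).trans F7 (by decide) (by simp)).trans F8 (by decide)
        (by simp)
    have h12 : σ₈.reg 12 = (s * n : ℕ) := by
      rw [F8.reg 12 (by decide), F7.reg 12 (by decide), F6.reg 12 (by decide),
          F5.reg 12 (by decide),
        k1]
    have h0' : σ₈.reg 0 = n := by rw [F08.reg 0 (by decide), h0]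
    have h6 : σ₈.reg 6 = s := by
      rw [F8.reg 6 (by decide), F7.reg 6 (by decide), F6.reg 6 (by decide), F5.reg 6 (by decide),
          k5]
    simp only [wp, Store.reg_setReg, Store.mem_setReg, Nat.reduceEqDiff, reduceIte, h12, h0', l6,
        h6]
    refine ⟨by push_cast; rw [abs_le]; constructor <;> nlinarith, by simpa using F08,
      ⟨by push_cast; ring, by push_cast; ring, fun u hu => ?_, fun u hu j hj => ?_⟩, trivial⟩
    · by_cases hus : u = s
      · subst hus; exact ⟨l3, l4⟩
      · exact k3 u (by omega)
    · by_cases hus : u = N + s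
      · subst hus
        have := l7 j hj
        push_cast at this ⊢
        rw [this, listVal, if_neg (by omega), Nat.add_sub_cancel_left]
      · have h1 : u * N + j < (N + s) * N := by
          have : (u + 1) * N ≤ (N + s) * N := Nat.mul_le_mul_right _ (by omega)
          linarith
        have h2 := l8 _ h1
        push_cast at h2
        rw [h2, F7.mem 21 (by decide), F6.mem 21 (by decide), F5.mem 21 (by decide)]
        exact k4 u (by omega) j hj
  · rintro σ₄ ⟨F4, k1, k2, k3, k4⟩
    have R4 := R.frame F4 (by decide) (by decide)
    refine Runs.of_wp (T := 1 + N) (by simp [cost]) ?_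
    have h1' : σ₄.reg 1 = m := by rw [F4.reg 1 (by decide), h1]
    simp only [wp, R4.num, h1']
    refine ⟨by rw [abs_le]; constructor <;> linarith, by simpa using F4, hfam k3, ?_, ?_, ?_, ?_,
        ?_⟩
    · simp [R4.one]
    · simp [R4.num]
    · simp
    · intro i hi
      rw [Store.mem_setReg, R4.ordm i hi]
      exact R4.next_ord_iff hi
    · exact k4

end PowerCircuits

open scoped BigOperators
namespace PowerCircuits

/-! ## Digital trees -/

/-- The nodes of level `j` and string `s` exist after the insertion of `ℓ` levels and of the first
`k` strings on the next level. -/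
def Present (T ℓ k j s : ℕ) : Prop := s < T ∧ (j ≤ ℓ ∨ j = ℓ + 1 ∧ s < k)

/-- A partially built digital tree for the strings `dig · s`, `s < T`. Its nodes are numbered level
by level; the nodes of level `j` are those from `start j` on. The node of level `j` on the path of
the string `s` is `nd j s`, and `C t a` is the child of `t` with label `a`, or `0`. -/
structure Trie (T : ℕ) (dig : ℕ → ℕ → ℤ) (ℓ k : ℕ) (start : ℕ → ℕ) (nd : ℕ → ℕ → ℕ)
    (C : ℕ → ℤ → ℕ) : Prop where
  root : ∀ s, nd 0 s = 0
  start_zero : start 0 = 0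
  start_one : start 1 = 1
  mono : Monotone start
  stable : ∀ j, ℓ + 2 ≤ j → start j = start (ℓ + 2)
  -- Besides the root there is at most one node for each string on each level.
  size_le : start (ℓ + 2) ≤ 1 + ℓ * T + k
  bounds : ∀ j s, Present T ℓ k j s → start j ≤ nd j s ∧ nd j s < start (j + 1)
  surj : ∀ j t, start (j + 1) ≤ t → t < start (j + 2) →
    ∃ s, Present T ℓ k (j + 1) s ∧ nd (j + 1) s = t
  edge : ∀ j s, Present T ℓ k (j + 1) s → C (nd j s) (dig j s) = nd (j + 1) s
  -- Strings that share a node share its parent and the label of the edge, so a node determines the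
  -- word that leads to it.
  inj : ∀ j s s', Present T ℓ k (j + 1) s → Present T ℓ k (j + 1) s' →
    nd (j + 1) s = nd (j + 1) s' → nd j s = nd j s' ∧ dig j s = dig j s'
  -- The number `0` stands for a missing child, which is unambiguous since the root is nobody's
  -- child.
  exists_edge : ∀ t a, C t a ≠ 0 → ∃ j s, Present T ℓ k (j + 1) s ∧ nd j s = t ∧ dig j s = a

variable {T ℓ k : ℕ} {dig : ℕ → ℕ → ℤ} {start : ℕ → ℕ} {nd : ℕ → ℕ → ℕ} {C : ℕ → ℤ → ℕ}

theorem Present.pred {j s : ℕ} (h : Present T ℓ k (j + 1) s) : Present T ℓ k j s :=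
  ⟨h.1, by rcases h.2 with h | h <;> left <;> omega⟩

/-- The levels occupy disjoint intervals of numbers, so the number of a node determines its level.
-/
theorem Trie.level_eq (h : Trie T dig ℓ k start nd C) {j j' s s' : ℕ} (hs : Present T ℓ k j s)
    (hs' : Present T ℓ k j' s') (he : nd j s = nd j' s') : j = j' := by
  obtain ⟨h1, h2⟩ := h.bounds j s hs
  obtain ⟨h3, h4⟩ := h.bounds j' s' hs'
  rcases lt_trichotomy j j' with hj | hj | hj
  · have := h.mono (show j + 1 ≤ j' from hj); omega
  · exact hj
  · have := h.mono (show j' + 1 ≤ j from hj); omega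

theorem Trie.init (T : ℕ) (dig : ℕ → ℕ → ℤ) :
    Trie T dig 0 0 (fun j => if j = 0 then 0 else 1) (fun _ _ => 0) (fun _ _ => 0) where
  root := by simp
  start_zero := by simp
  start_one := by simp
  mono := by
    intro i j hij
    beta_reduce
    split_ifs <;> omega
  stable j hj := by simp; omega
  size_le := by simp
  bounds j s h := by
    have : j = 0 := by rcases h.2 with h | h <;> omega
    simp [this]
  surj j t h1 h2 := by simp at h1 h2; omega
  edge := by simp
  inj j s s' h := by rcases h.2 with h | h <;> omega
  exists_edge := by simp

theorem Trie.next_level (h : Trie T dig ℓ T start nd C) : Trie T dig (ℓ + 1) 0 start nd C := by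
  have hp : ∀ j s, Present T (ℓ + 1) 0 j s ↔ Present T ℓ T j s := by
    intro j s
    unfold Present
    constructor <;> rintro ⟨h1, h2⟩ <;> refine ⟨h1, ?_⟩ <;> omega
  exact {
    root := h.root
    start_zero := h.start_zero
    start_one := h.start_one
    mono := h.mono
    stable := fun j hj => by rw [h.stable j (by omega), h.stable (ℓ + 1 + 2) (by omega)]
    size_le := by
      rw [h.stable (ℓ + 1 + 2) (by omega)]
      have := h.size_le
      linarith
    bounds := fun j s hs => h.bounds j s ((hp j s).mp hs)
    surj := fun j t h1 h2 => by
      obtain ⟨s, hs, he⟩ := h.surj j t h1 h2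
      exact ⟨s, (hp _ _).mpr hs, he⟩
    edge := fun j s hs => h.edge j s ((hp _ _).mp hs)
    inj := fun j s s' hs hs' => h.inj j s s' ((hp _ _).mp hs) ((hp _ _).mp hs')
    exists_edge := fun t a ha => by
      obtain ⟨j, s, hs, he⟩ := h.exists_edge t a ha
      exact ⟨j, s, (hp _ _).mpr hs, he⟩ }

theorem present_succ {j s : ℕ} : Present T ℓ (k + 1) j s ↔
    Present T ℓ k j s ∨ (j = ℓ + 1 ∧ s = k ∧ s < T) := by
  unfold Present
  constructor
  · rintro ⟨h1, h2⟩
    by_cases h3 : j = ℓ + 1 ∧ s = k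
    · exact Or.inr ⟨h3.1, h3.2, h1⟩
    · exact Or.inl ⟨h1, by omega⟩
  · rintro (⟨h1, h2⟩ | ⟨h1, h2, h3⟩)
    · exact ⟨h1, by omega⟩
    · exact ⟨h3, by omega⟩

theorem Present.ne {j s : ℕ} (h : Present T ℓ k j s) : ¬ (j = ℓ + 1 ∧ s = k) := by
  rintro ⟨rfl, rfl⟩
  rcases h.2 with h | h <;> omega

theorem Trie.edge_pos (h : Trie T dig ℓ k start nd C) {j s : ℕ} (hs : Present T ℓ k (j + 1) s) :
    0 < nd (j + 1) s := by
  have h1 := (h.bounds _ s hs).1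
  have h2 := h.mono (show 1 ≤ j + 1 by omega)
  rw [h.start_one] at h2
  omega

/-- The child exists already. -/
theorem Trie.step_old (h : Trie T dig ℓ k start nd C) (hk : k < T)
    (hC : C (nd ℓ k) (dig ℓ k) ≠ 0) : Trie T dig ℓ (k + 1) start
      (fun j s => if j = ℓ + 1 ∧ s = k then C (nd ℓ k) (dig ℓ k) else nd j s) C := by
  -- The existing child was reached by an earlier string `r`, and the new string inherits its
  -- properties from `r`. The levels agree because the parent lies on only one level.
  obtain ⟨j₀, r, hr, hr1, hr2⟩ := h.exists_edge _ _ hC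
  have hpk : Present T ℓ k ℓ k := ⟨hk, Or.inl le_rfl⟩
  obtain rfl : j₀ = ℓ := h.level_eq hr.pred hpk hr1
  have hnew : C (nd j₀ k) (dig j₀ k) = nd (j₀ + 1) r := by rw [← hr1, ← hr2, h.edge j₀ r hr]
  rw [hnew]
  have hlow : ∀ j s, ¬ (j = j₀ + 1 ∧ s = k) →
      (if j = j₀ + 1 ∧ s = k then nd (j₀ + 1) r else nd j s) = nd j s := fun j s hn => if_neg hn
  have hpred : ∀ j s, Present T j₀ (k + 1) (j + 1) s → ¬ (j = j₀ + 1 ∧ s = k) := by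
    rintro j s ⟨-, hc⟩; omega
  refine ⟨fun s => by rw [if_neg (by omega), h.root], h.start_zero, h.start_one, h.mono, h.stable,
    by have := h.size_le; omega, fun j s hs => ?_, fun j t h1 h2 => ?_, fun j s hs => ?_,
    fun j s s' hs hs' he => ?_, fun t a ha => ?_⟩
  · split_ifs with hc
    · rw [hc.1]; exact h.bounds _ r hr
    · exact h.bounds j s ((present_succ.mp hs).resolve_right fun hc' => hc ⟨hc'.1, hc'.2.1⟩)
  · obtain ⟨s, hs, he⟩ := h.surj j t h1 h2
    exact ⟨s, present_succ.mpr (Or.inl hs), by rw [hlow _ _ hs.ne, he]⟩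
  · rw [hlow j s (hpred j s hs)]
    split_ifs with hc
    · obtain ⟨rfl, rfl⟩ : j = j₀ ∧ s = k := by omega
      exact hnew
    · exact h.edge j s ((present_succ.mp hs).resolve_right fun hc' => hc ⟨hc'.1, hc'.2.1⟩)
  · beta_reduce at he ⊢
    rw [hlow j s (hpred j s hs), hlow j s' (hpred j s' hs')]
    split_ifs at he with hc hc' hc'
    · rw [hc.2, hc'.2]; exact ⟨rfl, rfl⟩
    · obtain ⟨rfl, rfl⟩ : j = j₀ ∧ s = k := by omega
      have := h.inj j r s' hr
        ((present_succ.mp hs').resolve_right fun hc'' => hc' ⟨hc''.1, hc''.2.1⟩) he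
      rw [← hr1, ← hr2]; exact this
    · obtain ⟨rfl, rfl⟩ : j = j₀ ∧ s' = k := by omega
      have := h.inj j s r
        ((present_succ.mp hs).resolve_right fun hc'' => hc ⟨hc''.1, hc''.2.1⟩) hr he
      rw [← hr1, ← hr2]; exact this
    · exact h.inj j s s'
        ((present_succ.mp hs).resolve_right fun hc'' => hc ⟨hc''.1, hc''.2.1⟩)
        ((present_succ.mp hs').resolve_right fun hc'' => hc' ⟨hc''.1, hc''.2.1⟩) he
  · obtain ⟨j, s, hs, h1, h2⟩ := h.exists_edge t a ha
    have hs' := present_succ.mpr (Or.inl hs)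
    exact ⟨j, s, hs', by rw [hlow j s (hpred j s hs'), h1], h2⟩

/-- The child has to be created. -/
theorem Trie.step_new (h : Trie T dig ℓ k start nd C) (hk : k < T)
    (hC : C (nd ℓ k) (dig ℓ k) = 0) : Trie T dig ℓ (k + 1)
      (fun j => if ℓ + 2 ≤ j then start (ℓ + 2) + 1 else start j)
      (fun j s => if j = ℓ + 1 ∧ s = k then start (ℓ + 2) else nd j s)
      (fun t a => if t = nd ℓ k ∧ a = dig ℓ k then start (ℓ + 2) else C t a) := by
  have hpk : Present T ℓ k ℓ k := ⟨hk, Or.inl le_rfl⟩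
  have hlow : ∀ j s, ¬ (j = ℓ + 1 ∧ s = k) →
      (if j = ℓ + 1 ∧ s = k then start (ℓ + 2) else nd j s) = nd j s := fun j s hn => if_neg hn
  have hpred : ∀ j s, Present T ℓ (k + 1) (j + 1) s → ¬ (j = ℓ + 1 ∧ s = k) := by
    rintro j s ⟨-, hc⟩; omega
  have hold : ∀ {j s}, Present T ℓ (k + 1) j s → ¬ (j = ℓ + 1 ∧ s = k) → Present T ℓ k j s :=
    fun hs hc => (present_succ.mp hs).resolve_right fun hc' => hc ⟨hc'.1, hc'.2.1⟩
  have hlt : ∀ j s, Present T ℓ k (j + 1) s → nd (j + 1) s < start (ℓ + 2) := by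
    intro j s hs
    refine (h.bounds _ s hs).2.trans_le (h.mono ?_)
    rcases hs.2 with hc | hc <;> omega
  have hs1 : 1 ≤ start (ℓ + 2) := by
    rw [← h.start_one]; exact h.mono (by omega)
  -- An existing edge cannot be overwritten: its entry in the table is positive, whereas the new
  -- entry was `0`.
  have hne : ∀ j s, Present T ℓ k (j + 1) s → ¬ (nd j s = nd ℓ k ∧ dig j s = dig ℓ k) := by
    rintro j s hs ⟨h1, h2⟩
    have h3 := h.edge j s hs
    rw [h1, h2, hC] at h3
    have := h.edge_pos hs
    omega
  refine ⟨fun s => by rw [if_neg (by omega), h.root], ?_, ?_, ?_, ?_, ?_, fun j s hs => ?_,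
    fun j t h1 h2 => ?_, fun j s hs => ?_, fun j s s' hs hs' he => ?_, fun t a ha => ?_⟩
  · rw [if_neg (by omega), h.start_zero]
  · rw [if_neg (by omega), h.start_one]
  · intro i j hij
    beta_reduce
    have h1 := h.mono hij
    split_ifs with h2 h3 h3
    · rfl
    · omega
    · have := h.mono (show i ≤ ℓ + 2 by omega); omega
    · exact h1
  · intro j hj
    rw [if_pos hj, if_pos le_rfl]
  · rw [if_pos le_rfl]
    have := h.size_le
    omega
  · by_cases hc : j = ℓ + 1 ∧ s = k
    · rw [if_pos hc, if_neg (by omega), if_pos (by omega)]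
      exact ⟨by rw [hc.1]; exact h.mono (by omega), by omega⟩
    · have hb := h.bounds j s (hold hs hc)
      have hj : j ≤ ℓ + 1 := by rcases hs.2 with hc | hc <;> omega
      rw [if_neg hc, if_neg (by omega)]
      refine ⟨hb.1, ?_⟩
      split_ifs with h1
      · have : j + 1 = ℓ + 2 := by omega
        rw [this] at hb; omega
      · exact hb.2
  · beta_reduce at h1 h2 ⊢
    by_cases hj : ℓ + 2 ≤ j + 1
    · rw [if_pos hj] at h1
      rw [if_pos (by omega)] at h2
      omega
    rw [if_neg hj] at h1
    by_cases hj' : ℓ + 2 ≤ j + 2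
    · obtain rfl : j = ℓ := by omega
      rw [if_pos le_rfl] at h2
      by_cases ht : t = start (j + 2)
      · exact ⟨k, present_succ.mpr (Or.inr ⟨rfl, rfl, hk⟩), by rw [if_pos ⟨rfl, rfl⟩, ht]⟩
      · obtain ⟨s, hs, he⟩ := h.surj j t h1 (by omega)
        exact ⟨s, present_succ.mpr (Or.inl hs), by rw [hlow _ _ hs.ne, he]⟩
    · rw [if_neg hj'] at h2
      obtain ⟨s, hs, he⟩ := h.surj j t h1 h2
      exact ⟨s, present_succ.mpr (Or.inl hs), by rw [hlow _ _ hs.ne, he]⟩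
  · rw [hlow j s (hpred j s hs)]
    by_cases hc : j + 1 = ℓ + 1 ∧ s = k
    · obtain ⟨rfl, rfl⟩ : j = ℓ ∧ s = k := by omega
      rw [if_pos ⟨rfl, rfl⟩, if_pos ⟨rfl, rfl⟩]
    · rw [if_neg (hne j s (hold hs hc)), if_neg hc]
      exact h.edge j s (hold hs hc)
  · beta_reduce at he ⊢
    rw [hlow j s (hpred j s hs), hlow j s' (hpred j s' hs')]
    split_ifs at he with hc hc' hc'
    · rw [hc.2, hc'.2]; exact ⟨rfl, rfl⟩
    · have := hlt j s' (hold hs' hc'); omega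
    · have := hlt j s (hold hs hc); omega
    · exact h.inj j s s' (hold hs hc) (hold hs' hc') he
  · beta_reduce at ha ⊢
    by_cases hc : t = nd ℓ k ∧ a = dig ℓ k
    · refine ⟨ℓ, k, present_succ.mpr (Or.inr ⟨rfl, rfl, hk⟩), ?_, hc.2.symm⟩
      rw [hlow ℓ k (by omega), hc.1]
    · rw [if_neg hc] at ha
      obtain ⟨j, s, hs, h1, h2⟩ := h.exists_edge t a ha
      have hs' := present_succ.mpr (Or.inl hs)
      exact ⟨j, s, hs', by rw [hlow j s (hpred j s hs'), h1], h2⟩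

end PowerCircuits

/-! ### The program for the digital tree -/

open scoped BigOperators
namespace PowerCircuits

variable {q N T ℓ k : ℕ} {dig : ℕ → ℕ → ℤ} {start : ℕ → ℕ} {nd : ℕ → ℕ → ℕ} {C : ℕ → ℤ → ℕ}
  {σ : Store}

/-- Insert the next digit of the string in register `30`. -/
def trieStep (q : ℕ) : Program := block [.load 32 22 30, .load 34 21 33, .add 33 33 4,
    .load 35 23 32,
  .add 35 35 34, .const 36 (q - 1), .add 35 35 36, .load 37 24 35,
  .ifPos 37 (.store 22 30 37) (block [.store 24 35 40, .store 23 40 41, .store 22 30 40,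
    .add 40 40 3, .const 36 (2 * q - 1), .add 41 41 36])]

/-- Build the digital tree of the strings in segment `21`. -/
def buildTrie (q : ℕ) : Program :=
  -- Register `42` starts with the last column. Words are read from the leaf to the root, so the
  -- edges at the root carry the digits at the greatest exponent. Registers `40` and `41` hold the
  -- next free number and the position of its entries in the table of children.
  .seq (block [.const 40 1, .const 41 (2 * q - 1), .const 43 1, .store 5 43 40, .const 43 2,
      .sub 42 4 3])
  (forUp 6 4 7 (.seq (.move 33 42) (.seq (forUp 30 5 31 (trieStep q))
    (block [.store 5 43 40, .add 43 43 3, .sub 42 42 3]))))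

/-- The storage contains a partially built digital tree. -/
structure TrieMem (q N T ℓ k : ℕ) (start : ℕ → ℕ) (nd : ℕ → ℕ → ℕ) (C : ℕ → ℤ → ℕ) (σ : Store) :
    Prop where
  cur : ∀ s < T, σ.mem 22 (s : ℤ) = nd (if s < k then ℓ + 1 else ℓ) s
  base : ∀ t < start (ℓ + 2), σ.mem 23 (t : ℤ) = (t : ℤ) * (2 * q - 1)
  child : ∀ (t : ℕ) (a : ℤ), |a| ≤ q - 1 →
    σ.mem 24 ((t : ℤ) * (2 * q - 1) + (a + q - 1)) = C t a
  size : σ.reg 40 = start (ℓ + 2)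
  addr : σ.reg 41 = (start (ℓ + 2) : ℤ) * (2 * q - 1)
  col : σ.reg 42 = (N : ℤ) - 1 - ℓ
  lev : σ.reg 43 = (ℓ : ℤ) + 2
  starts : ∀ j ≤ ℓ + 1, σ.mem 5 (j : ℤ) = start j

theorem TrieMem.congr {σ' : Store} (h : TrieMem q N T ℓ k start nd C σ) (hm : σ'.mem = σ.mem)
    (hr : ∀ r, 40 ≤ r → r < 44 → σ'.reg r = σ.reg r) : TrieMem q N T ℓ k start nd C σ' where
  cur := by rw [hm]; exact h.cur
  base := by rw [hm]; exact h.base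
  child := by rw [hm]; exact h.child
  size := by rw [hr 40 (by omega) (by omega)]; exact h.size
  addr := by rw [hr 41 (by omega) (by omega)]; exact h.addr
  col := by rw [hr 42 (by omega) (by omega)]; exact h.col
  lev := by rw [hr 43 (by omega) (by omega)]; exact h.lev
  starts := by rw [hm]; exact h.starts

theorem digit_addr_inj (hq : 2 ≤ q) {t t' : ℕ} {a a' : ℤ} (ha : |a| ≤ q - 1) (ha' : |a'| ≤ q - 1)
    (h : (t : ℤ) * (2 * q - 1) + (a + q - 1) = (t' : ℤ) * (2 * q - 1) + (a' + q - 1)) :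
    t = t' ∧ a = a' := by
  rw [abs_le] at ha ha'
  have e1 : (((a + q - 1).toNat : ℕ) : ℤ) = a + q - 1 := Int.toNat_of_nonneg (by omega)
  have e2 : (((a' + q - 1).toNat : ℕ) : ℤ) = a' + q - 1 := Int.toNat_of_nonneg (by omega)
  have e3 : ((2 * q - 1 : ℕ) : ℤ) = 2 * q - 1 := by omega
  rw [← e1, ← e2, ← e3] at h
  have := addr_inj (by omega) (by omega) h
  omega

/-- The child is looked up in a table with `2 * q - 1` entries per node, which takes constant time.
The tree has at most `1 + N * T` nodes, and this bounds all addresses. -/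
theorem runs_trieStep {w : ℤ} (hq : 2 ≤ q) (h : Trie T dig ℓ k start nd C)
    (hM : TrieMem q N T ℓ k start nd C σ) (hk : k < T) (hℓ : ℓ < N) (h3 : σ.reg 3 = 1)
    (h4 : σ.reg 4 = N) (h30 : σ.reg 30 = k) (h33 : σ.reg 33 = (k : ℤ) * N + ((N : ℤ) - 1 - ℓ))
    (hdig : σ.mem 21 ((k : ℤ) * N + ((N : ℤ) - 1 - ℓ)) = dig ℓ k) (hd : |dig ℓ k| ≤ q - 1)
    (hw : ((N : ℤ) * T + 3) * (2 * q) + N * T + N ≤ w) :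
    Runs w (trieStep q) σ 15 (fun σ' => Frame 30 [22, 23, 24] σ σ' ∧
      (∃ start' nd' C', Trie T dig ℓ (k + 1) start' nd' C' ∧
        TrieMem q N T ℓ (k + 1) start' nd' C' σ' ∧ σ'.reg 33 = ((k + 1 : ℕ) : ℤ) * N +
            ((N : ℤ) - 1 - ℓ)) ∧
      σ'.reg 30 = k) := by
  have hq' : (2 : ℤ) ≤ q := by exact_mod_cast hq
  have hNT : (0 : ℤ) ≤ (N : ℤ) * T := by positivity
  have hsize : (start (ℓ + 2) : ℤ) ≤ 1 + N * T := by
    have h1 := h.size_le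
    have h2 : (ℓ + 1) * T ≤ N * T := Nat.mul_le_mul_right _ hℓ
    have : start (ℓ + 2) ≤ 1 + N * T := by linarith
    exact_mod_cast this
  have hp : Present T ℓ k ℓ k := ⟨hk, Or.inl le_rfl⟩
  have hb := h.bounds ℓ k hp
  have hndlt : nd ℓ k < start (ℓ + 2) := hb.2.trans_le (h.mono (by omega))
  have hkN : (k : ℤ) * N + N ≤ N * T := by
    have : ((k : ℤ) + 1) * N ≤ T * N := mul_le_mul_of_nonneg_right (by omega) (by positivity)
    linarith
  have hkN0 : (0 : ℤ) ≤ (k : ℤ) * N := by positivity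
  have hnd : (nd ℓ k : ℤ) * (2 * q - 1) + (2 * q - 1) ≤ (N * T + 3) * (2 * q) := by
    have h1 : ((nd ℓ k : ℤ) + 1) * (2 * q - 1) ≤ (1 + N * T) * (2 * q - 1) :=
      mul_le_mul_of_nonneg_right (by omega) (by omega)
    nlinarith
  have hnd0 : (0 : ℤ) ≤ (nd ℓ k : ℤ) * (2 * q - 1) := mul_nonneg (by positivity) (by omega)
  have hst : (start (ℓ + 2) : ℤ) * (2 * q - 1) + (2 * q - 1) ≤ (N * T + 3) * (2 * q) := by
    have h1 : ((start (ℓ + 2) : ℤ) + 1) * (2 * q - 1) ≤ (1 + N * T + 1) * (2 * q - 1) :=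
      mul_le_mul_of_nonneg_right (by omega) (by omega)
    nlinarith
  have hst0 : (0 : ℤ) ≤ (start (ℓ + 2) : ℤ) * (2 * q - 1) := mul_nonneg (by positivity) (by omega)
  have hqw : 6 * (q : ℤ) ≤ w := by nlinarith
  have hNw : (N : ℤ) * T + N ≤ w := by nlinarith
  have hd' := abs_le.mp hd
  have m22 : σ.mem 22 (k : ℤ) = nd ℓ k := by rw [hM.cur k hk, if_neg (by omega)]
  have m23 := hM.base _ hndlt
  have m24 := hM.child (nd ℓ k) _ hd
  have e35 : (nd ℓ k : ℤ) * (2 * q - 1) + dig ℓ k + (q - 1) =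
      (nd ℓ k : ℤ) * (2 * q - 1) + (dig ℓ k + q - 1) := by ring
  refine Runs.of_wp (by simp [trieStep, block, cost]) ?_
  simp only [trieStep, block, wp, Store.reg_setReg, Store.mem_setReg, Store.reg_setMem,
    Nat.reduceEqDiff, reduceIte, h3, h4, h30, h33, hdig, m22, m23, e35, m24, hM.size, hM.addr]
  refine ⟨by rw [abs_le]; constructor <;> linarith, by rw [abs_le]; constructor <;> linarith,
    by rw [abs_le]; constructor <;> linarith, by rw [abs_le]; constructor <;> linarith,
    fun hc => ⟨by simp, ⟨start, _, C, h.step_old hk (by omega), ?_, by push_cast; ring⟩, trivial⟩,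
    fun hc => ⟨by rw [abs_le]; constructor <;> linarith, by rw [abs_le]; constructor <;> linarith,
      by rw [abs_le]; constructor <;> linarith,
      by simp, ⟨_, _, _, h.step_new hk (by omega), ?_, by push_cast; ring⟩, trivial⟩⟩
  · refine ⟨fun s hs => ?_, ?_, ?_, by simp [hM.size], by simp [hM.addr], by simp [hM.col],
      by simp [hM.lev], ?_⟩
    · rw [Store.mem_setMem]
      by_cases hsk : s = k
      · subst hsk; simp
      · rw [if_neg (by omega), if_neg (by omega)]
        simp only [Store.mem_setReg, hM.cur s hs, show s < k + 1 ↔ s < k by omega]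
    · simpa using hM.base
    · simpa using hM.child
    · simpa using hM.starts
  · have s2 : (if ℓ + 2 ≤ ℓ + 2 then start (ℓ + 2) + 1 else start (ℓ + 2)) = start (ℓ + 2) + 1 :=
      if_pos le_rfl
    refine ⟨fun s hs => ?_, fun t ht => ?_, fun t a ha => ?_, ?_, ?_, by simp [hM.col],
      by simp [hM.lev], fun j hj => ?_⟩
    · simp only [Store.mem_setReg, Store.mem_setMem, Nat.reduceEqDiff, false_and, if_false,
          true_and]
      by_cases hsk : s = k
      · subst hsk; simp
      · rw [if_neg (by omega), if_neg (by omega), hM.cur s hs]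
        simp only [show s < k + 1 ↔ s < k by omega]
    · rw [s2] at ht
      simp only [Store.mem_setReg, Store.mem_setMem, Nat.reduceEqDiff, false_and, if_false,
          true_and]
      split_ifs with hc'
      · rw [hc']
      · exact hM.base t (by omega)
    · simp only [Store.mem_setReg, Store.mem_setMem, Nat.reduceEqDiff, false_and, if_false,
          true_and]
      by_cases hta : t = nd ℓ k ∧ a = dig ℓ k
      · rw [if_pos hta, hta.1, hta.2, if_pos rfl]
      · rw [if_neg hta, if_neg fun hc' => hta (digit_addr_inj hq ha hd hc'), hM.child t a ha]
    · rw [s2]; simp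
    · rw [s2]; simp; ring
    · simp only [Store.mem_setReg, Store.mem_setMem, Nat.reduceEqDiff, false_and, if_false]
      rw [if_neg (by omega), hM.starts j hj]

/-- All strings are advanced by one level before the next level begins. Therefore the nodes are
numbered level by level, and no sorting of the strings is needed. -/
theorem runs_buildTrie {w : ℤ} (hq : 2 ≤ q) (h3 : σ.reg 3 = 1) (h4 : σ.reg 4 = N) (h5 : σ.reg 5 = T)
    (hdig : ∀ ℓ < N, ∀ s < T, σ.mem 21 ((s : ℤ) * N + ((N : ℤ) - 1 - ℓ)) = dig ℓ s ∧
      |dig ℓ s| ≤ q - 1)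
    (m5 : ∀ p, σ.mem 5 p = 0) (m22 : ∀ p, σ.mem 22 p = 0) (m23 : ∀ p, σ.mem 23 p = 0)
    (m24 : ∀ p, σ.mem 24 p = 0) (hw : ((N : ℤ) * T + 3) * (2 * q) + N * T + N + T ≤ w) :
    Runs w (buildTrie q) σ ((18 * T + 10) * N + 9) (fun σ' => Frame 6 [5, 22, 23, 24] σ σ' ∧
      ∃ start nd C, Trie T dig N 0 start nd C ∧ TrieMem q N T N 0 start nd C σ') := by
  have hq' : (2 : ℤ) ≤ q := by exact_mod_cast hq
  have hNT : (0 : ℤ) ≤ (N : ℤ) * T := by positivity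
  have hqw : 6 * (q : ℤ) + N + T ≤ w := by nlinarith
  have hT : (18 * T + 10) * N + 9 = 6 + ((18 * T + 7 + 3) * N + 3) := by ring
  rw [hT]
  obtain ⟨Inv, hInv⟩ : ∃ Inv : ℕ → Store → Prop, ∀ ℓ σ', Inv ℓ σ' ↔ (∃ start nd C,
      Trie T dig ℓ 0 start nd C ∧ TrieMem q N T ℓ 0 start nd C σ') := ⟨_, fun _ _ => Iff.rfl⟩
  refine Runs.seq (R := fun σ' => Frame 6 [5, 22, 23, 24] σ σ' ∧ Inv 0 σ')
    (Runs.of_wp (by simp [block, cost]) ?_) ?_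
  · simp only [block, wp, Store.reg_setReg, Store.reg_setMem,
      Nat.reduceEqDiff, reduceIte, h3, h4, hInv]
    refine ⟨by rw [abs_le]; constructor <;> linarith, by rw [abs_le]; constructor <;> linarith,
      by rw [abs_le]; constructor <;> linarith, by rw [abs_le]; constructor <;> linarith,
      by rw [abs_le]; constructor <;> linarith, by simp, _, _, _, Trie.init T dig, ?_⟩
    refine ⟨by simp [m22], fun t ht => ?_, by simp [m24], by simp, by simp, by simp, by simp,
      fun j hj => ?_⟩
    · have : t = 0 := by simp at ht; exact ht
      subst this; simp [m23]
    · simp only [Store.mem_setReg, Store.mem_setMem, true_and, m5]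
      rcases j with _ | _ | j <;> simp
      omega
  rintro σ₁ ⟨F1, hI1⟩
  refine (Runs.forUp (σ₀ := σ) (r := 6) (S := [5, 22, 23, 24]) (n := N) (18 * T + 7) Inv
    (by decide) (by decide) (by decide) (by decide) (by decide) h4 h3 (by linarith)
    F1 hI1 ?_ ?_).mono le_rfl (fun σ' h => ⟨h.1, (hInv _ _).mp h.2⟩)
  · intro k σ v v' h
    obtain ⟨start, nd, C, t1, t2⟩ := (hInv _ _).mp h
    refine (hInv _ _).mpr ⟨start, nd, C, t1, t2.congr rfl fun r h1 h2 => ?_⟩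
    simp only [Store.reg_setReg]
    rw [if_neg (by omega), if_neg (by omega)]
  · intro ℓ hℓ σ₂ F2 hI2 h6
    obtain ⟨start, nd, C, t1, t2⟩ := (hInv _ _).mp hI2
    have hT : 18 * T + 7 = 1 + (((15 + 3) * T + 3) + 3) := by ring
    rw [hT]
    refine Runs.seq (R := fun σ' => Frame 30 [] σ₂ σ' ∧ TrieMem q N T ℓ 0 start nd C σ' ∧
      σ'.reg 33 = ((0 : ℕ) : ℤ) * N + ((N : ℤ) - 1 - ℓ)) (Runs.of_wp (by decide) ?_) ?_
    · simp only [wp]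
      refine ⟨by simp, t2.congr rfl fun r h1 h2 => ?_, by simp [t2.col]⟩
      simp only [Store.reg_setReg]
      rw [if_neg (by omega)]
    rintro σ₃ ⟨F3, t3, p3⟩
    have F13 : Frame 6 [5, 22, 23, 24] σ σ₃ := F2.trans F3 (by decide) (by simp)
    obtain ⟨J, hJ⟩ : ∃ J : ℕ → Store → Prop, ∀ k σ', J k σ' ↔ (∃ start nd C,
      Trie T dig ℓ k start nd C ∧ TrieMem q N T ℓ k start nd C σ' ∧
        σ'.reg 33 = ((k : ℕ) : ℤ) * N + ((N : ℤ) - 1 - ℓ)) := ⟨_, fun _ _ => Iff.rfl⟩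
    refine (Runs.forUp (σ₀ := σ₃) (r := 30) (S := [22, 23, 24]) (n := T) 15 J
      (by decide) (by decide) (by decide) (by decide) (by decide) (by rw [F13.reg 5 (by decide),
          h5])
      (by rw [F13.reg 3 (by decide), h3]) (by linarith) (by simp)
      ((hJ _ _).mpr ⟨start, nd, C, t1, t3, p3⟩) ?_ ?_).seq ?_
    · intro k σ v v' h
      obtain ⟨start, nd, C, t1, t2, t3⟩ := (hJ _ _).mp h
      refine (hJ _ _).mpr ⟨start, nd, C, t1, t2.congr rfl fun r h1 h2 => ?_, by simpa using t3⟩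
      simp only [Store.reg_setReg]
      rw [if_neg (by omega), if_neg (by omega)]
    · intro k hk σ₄ F4 hJ4 h30
      obtain ⟨start', nd', C', u1, u2, u3⟩ := (hJ _ _).mp hJ4
      have F14 : Frame 6 [5, 22, 23, 24] σ σ₄ := F13.trans F4 (by decide) (by simp)
      refine (runs_trieStep hq u1 u2 hk hℓ (by rw [F14.reg 3 (by decide), h3])
        (by rw [F14.reg 4 (by decide), h4]) h30 u3
        (by rw [F14.mem 21 (by decide)]; exact (hdig ℓ hℓ k hk).1) (hdig ℓ hℓ k hk).2
        (by linarith)).mono le_rfl ?_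
      rintro σ₅ ⟨F5, g1, g2⟩
      exact ⟨F4.trans F5 le_rfl (by simp), (hJ _ _).mpr g1, g2⟩
    · rintro σ₄ ⟨F4, hJ4⟩
      obtain ⟨start', nd', C', u1, u2, u3⟩ := (hJ _ _).mp hJ4
      have F14 : Frame 6 [5, 22, 23, 24] σ σ₄ := F13.trans F4 (by decide) (by simp)
      have k3 : σ₄.reg 3 = 1 := by rw [F14.reg 3 (by decide), h3]
      have u1' := u1.next_level
      have hst : start' (ℓ + 1 + 2) = start' (ℓ + 2) := u1.stable _ (by omega)
      refine Runs.of_wp (by decide) ?_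
      simp only [block, wp, Store.reg_setReg, Store.reg_setMem, Nat.reduceEqDiff, reduceIte, k3,
        u2.size, u2.col, u2.lev, hInv]
      refine ⟨by rw [abs_le]; constructor <;> linarith, by rw [abs_le]; constructor <;> linarith,
        by simpa using F14, ⟨start', nd', C', u1', ?_⟩, ?_⟩
      · refine ⟨fun s hs => ?_, fun t ht => ?_, fun t a ha => ?_, ?_, ?_, ?_, ?_, fun j hj => ?_⟩
        · simp only [Store.mem_setReg, Store.mem_setMem, Nat.reduceEqDiff, false_and, if_false]
          rw [u2.cur s hs, if_pos hs]; simp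
        · rw [hst] at ht
          simpa using u2.base t ht
        · simpa using u2.child t a ha
        · rw [hst]; simp [u2.size]
        · rw [hst]; simp [u2.addr]
        · simp; ring
        · simp; ring
        · simp only [Store.mem_setReg, Store.mem_setMem, true_and]
          split_ifs with hc
          · have : j = ℓ + 2 := by omega
            rw [this]
          · exact u2.starts j (by omega)
      · rw [F4.reg 6 (by decide), F3.reg 6 (by decide), h6]

end PowerCircuits

open scoped BigOperators
namespace PowerCircuits

variable {q N T n m : ℕ} {E : ℕ → ℕ} {X : ℕ → ℤ} {start : ℕ → ℕ} {nd : ℕ → ℕ → ℕ}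
  {C : ℕ → ℤ → ℕ} {σ : Store}

/-! ## The output -/

/-- The product of the registers `4` and `x`. -/
def mulLoop (x : ℕ) : Program := .seq (.const 32 0) (forUp 30 4 31 (.add 32 32 x))

theorem runs_mulLoop {w : ℤ} {x A : ℕ} (hx : x < 30) (h3 : σ.reg 3 = 1) (h4 : σ.reg 4 = N)
    (hA : σ.reg x = A) (hw : (N : ℤ) * A + N ≤ w) :
    Runs w (mulLoop x) σ (4 * N + 4) (fun σ' => Frame 30 [] σ σ' ∧ σ'.reg 32 = (N * A : ℕ)) := by
  have hNA : (0 : ℤ) ≤ (N : ℤ) * A := by positivity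
  have hT : 4 * N + 4 = 1 + ((1 + 3) * N + 3) := by ring
  rw [hT]
  refine Runs.seq (R := fun σ' => Frame 30 [] σ σ' ∧ σ'.reg 32 = 0)
    (Runs.of_wp (by decide) (by simp [wp]; omega)) ?_
  rintro σ₁ ⟨F1, p1⟩
  refine (Runs.forUp (σ₀ := σ) (r := 30) (S := []) (n := N) 1 (fun k σ' => σ'.reg 32 = (k * A : ℕ))
    (by decide) (by decide) (by decide) (by decide) (by decide) h4 h3 (by linarith) F1
    (by simp [p1]) (fun k σ v v' h => by simpa using h) ?_).mono le_rfl (fun σ' h => h)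
  rintro k hk σ₂ F2 i1 i2
  have hx' : σ₂.reg x = A := by rw [F2.reg x hx, hA]
  have hkA : ((k : ℤ) + 1) * A ≤ N * A := mul_le_mul_of_nonneg_right (by omega) (by positivity)
  have hkA0 : (0 : ℤ) ≤ (k : ℤ) * A := by positivity
  refine Runs.of_wp (by simp [cost]) ?_
  simp [wp, i1, i2, hx', F2]
  refine ⟨by rw [abs_le]; constructor <;> linarith, by ring⟩

/-- Copy the nodes and the bits. -/
def writeNodes : Program := forUp 30 4 31 (block [.store 2 30 30, .load 32 10 30, .load 33 11 32,
  .ifPos 33 (.const 34 1) (.const 34 0), .store 3 30 34])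

theorem runs_writeNodes {w : ℤ} (W : Written q N T E X σ) (hw : (N : ℤ) + 1 ≤ w) :
    Runs w writeNodes σ (9 * N + 3) (fun σ' => Frame 30 [2, 3] σ σ' ∧
      (∀ i < N, σ'.mem 2 (i : ℤ) = (i : ℕ)) ∧
      ∀ i < N, (i + 1 < N ∧ E (i + 1) = E i + 1 → σ'.mem 3 (i : ℤ) = 1) ∧
        (¬ (i + 1 < N ∧ E (i + 1) = E i + 1) → σ'.mem 3 (i : ℤ) = 0)) := by
  refine Runs.forUp (σ₀ := σ) (r := 30) (S := [2, 3]) (n := N) 6 (fun k σ' =>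
    (∀ i < k, σ'.mem 2 (i : ℤ) = (i : ℕ)) ∧
      ∀ i < k, (i + 1 < N ∧ E (i + 1) = E i + 1 → σ'.mem 3 (i : ℤ) = 1) ∧
        (¬ (i + 1 < N ∧ E (i + 1) = E i + 1) → σ'.mem 3 (i : ℤ) = 0))
    (by decide) (by decide) (by decide) (by decide) (by decide) W.num W.one (by linarith)
    (by simp) (by simp) (fun k σ v v' h => by simpa using h) ?_
  rintro k hk σ₂ F2 ⟨i1, i2⟩ i3
  have hbit := W.bit k hk
  refine Runs.of_wp (by decide) ?_
  simp only [block, wp, Store.reg_setReg, Store.mem_setReg, Store.reg_setMem, Nat.reduceEqDiff,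
    reduceIte, i3]
  have e1 : ((σ₂.setMem 2 (k : ℤ) (k : ℤ)).mem 11 ((σ₂.setMem 2 (k : ℤ) (k : ℤ)).mem 10 (k : ℤ))) =
      σ.mem 11 (σ.mem 10 (k : ℤ)) := by
    simp [F2.mem 10, F2.mem 11]
  rw [e1, hbit]
  refine ⟨fun h => ⟨by rw [abs_le]; omega, by simpa using F2, ⟨fun i hi => ?_, fun i hi => ?_⟩,
    trivial⟩, fun h => ⟨by rw [abs_le]; omega, by simpa using F2, ⟨fun i hi => ?_, fun i hi => ?_⟩,
    trivial⟩⟩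
  · by_cases hik : i = k
    · subst hik; simp
    · simp [hik, i1 i (by omega)]
  · by_cases hik : i = k
    · subst hik; simp [h]
    · simpa [hik] using i2 i (by omega)
  · by_cases hik : i = k
    · subst hik; simp
    · simp [hik, i1 i (by omega)]
  · by_cases hik : i = k
    · subst hik; simp [h]
    · simpa [hik] using i2 i (by omega)

/-- Copy the compact markings. -/
def copyMarkings : Program := forUp 30 17 31 (block [.load 32 21 30, .store 0 30 32, .sub 33 30 16,
  .store 1 33 32])

/-- Every entry is written twice, to the matrix of edges and, shifted by `A = N * N`, to the list of
markings. The superfluous entries lie beyond the matrix, respectively at negative addresses. -/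
theorem runs_copyMarkings {w : ℤ} {A B : ℕ} (h3 : σ.reg 3 = 1) (h16 : σ.reg 16 = A)
    (h17 : σ.reg 17 = B) (hw : (A : ℤ) + B ≤ w) :
    Runs w copyMarkings σ (7 * B + 3) (fun σ' => Frame 30 [0, 1] σ σ' ∧
      (∀ p < B, σ'.mem 0 (p : ℤ) = σ.mem 21 (p : ℤ)) ∧
      ∀ p < B, σ'.mem 1 ((p : ℤ) - A) = σ.mem 21 (p : ℤ)) := by
  refine Runs.forUp (σ₀ := σ) (r := 30) (S := [0, 1]) (n := B) 4 (fun k σ' =>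
    (∀ p < k, σ'.mem 0 (p : ℤ) = σ.mem 21 (p : ℤ)) ∧
      ∀ p < k, σ'.mem 1 ((p : ℤ) - A) = σ.mem 21 (p : ℤ))
    (by decide) (by decide) (by decide) (by decide) (by decide) h17 h3 (by linarith)
    (by simp) (by simp) (fun k σ v v' h => by simpa using h) ?_
  rintro k hk σ₂ F2 ⟨i1, i2⟩ i3
  refine Runs.of_wp (by decide) ?_
  have h16' : σ₂.reg 16 = A := by rw [F2.reg 16 (by decide), h16]
  have m21 := F2.mem 21 (by decide)
  simp only [block, wp, Store.reg_setReg, Store.reg_setMem, Nat.reduceEqDiff,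
    reduceIte, i3, h16', m21]
  refine ⟨by rw [abs_le]; omega, by simpa using F2, ⟨fun p hp => ?_, fun p hp => ?_⟩, trivial⟩
  · by_cases hpk : p = k
    · subst hpk; simp
    · simp [hpk, i1 p (by omega)]
  · by_cases hpk : p = k
    · subst hpk; simp
    · simp [hpk, i2 p (by omega)]

/-- Copy the children of the tree. -/
def writeChildren : Program := forUp 30 9 31 (block [.load 32 24 30,
  .ifPos 32 .skip (.const 32 (-1)), .store 4 30 32])

theorem runs_writeChildren {w : ℤ} {A : ℕ} (h3 : σ.reg 3 = 1) (h9 : σ.reg 9 = A)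
    (hw : (A : ℤ) + 1 ≤ w) :
    Runs w writeChildren σ (7 * A + 3) (fun σ' => Frame 30 [4] σ σ' ∧
      ∀ p < A, (0 < σ.mem 24 (p : ℤ) → σ'.mem 4 (p : ℤ) = σ.mem 24 (p : ℤ)) ∧
        (¬ 0 < σ.mem 24 (p : ℤ) → σ'.mem 4 (p : ℤ) = -1)) := by
  refine Runs.forUp (σ₀ := σ) (r := 30) (S := [4]) (n := A) 4 (fun k σ' =>
      ∀ p < k, (0 < σ.mem 24 (p : ℤ) → σ'.mem 4 (p : ℤ) = σ.mem 24 (p : ℤ)) ∧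
        (¬ 0 < σ.mem 24 (p : ℤ) → σ'.mem 4 (p : ℤ) = -1))
    (by decide) (by decide) (by decide) (by decide) (by decide) h9 h3 (by linarith)
    (by simp) (by simp) (fun k σ v v' h => by simpa using h) ?_
  rintro k hk σ₂ F2 i1 i2
  refine Runs.of_wp (by decide) ?_
  have m24 := F2.mem 24 (by decide)
  simp only [block, wp, Store.reg_setReg, Nat.reduceEqDiff, reduceIte, i2, m24]
  refine ⟨fun h => ⟨by simpa using F2, fun p hp => ?_, by simpa using i2⟩,
    fun h => ⟨by rw [abs_le]; omega, by simpa using F2, fun p hp => ?_, by simpa using i2⟩⟩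
  · by_cases hpk : p = k
    · subst hpk; simp [h]
    · simpa [hpk] using i1 p (by omega)
  · by_cases hpk : p = k
    · subst hpk; simp [h]
    · simpa [hpk] using i1 p (by omega)

/-- List the nodes of the tree. -/
def writeLevels : Program := forUp 30 8 31 (.store 6 30 30)

/-- As the numbering follows the levels, the concatenation of the lists of levels is the identity.
-/
theorem runs_writeLevels {w : ℤ} {A : ℕ} (h3 : σ.reg 3 = 1) (h8 : σ.reg 8 = A)
    (hw : (A : ℤ) ≤ w) :
    Runs w writeLevels σ (4 * A + 3) (fun σ' => Frame 30 [6] σ σ' ∧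
      ∀ p < A, σ'.mem 6 (p : ℤ) = (p : ℕ)) := by
  refine Runs.forUp (σ₀ := σ) (r := 30) (S := [6]) (n := A) 1 (fun k σ' =>
      ∀ p < k, σ'.mem 6 (p : ℤ) = (p : ℕ))
    (by decide) (by decide) (by decide) (by decide) (by decide) h8 h3 (by linarith)
    (by simp) (by simp) (fun k σ v v' h => by simpa using h) ?_
  rintro k hk σ₂ F2 i1 i2
  refine Runs.of_wp (by decide) ?_
  simp only [wp, i2]
  refine ⟨by simpa using F2, fun p hp => ?_, by simpa using i2⟩
  by_cases hpk : p = k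
  · subst hpk; simp
  · simpa [hpk] using i1 p (by omega)

/-- Write the output. -/
def writeOutput : Program :=
  .seq (block [.move 8 40, .move 9 41]) (.seq (mulLoop 4) (.seq (.move 16 32) (.seq (mulLoop 5)
    (.seq (.move 17 32) (.seq writeNodes (.seq copyMarkings (.seq writeChildren (.seq writeLevels
      (block [.move 0 4, .move 1 8, .const 2 0])))))))))

/-- The storage contains the output. -/
structure Output (q N T : ℕ) (E : ℕ → ℕ) (X : ℕ → ℤ) (start : ℕ → ℕ) (C : ℕ → ℤ → ℕ) (σ : Store) :
    Prop where
  nodeCount : σ.reg 0 = N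
  treeSize : σ.reg 1 = start (N + 2)
  treeRoot : σ.reg 2 = 0
  edges : ∀ i < N, ∀ j < N, σ.mem 0 ((i : ℤ) * N + (j : ℕ)) = cd q (X i) (E j)
  markings : ∀ s, N + s < T → ∀ j < N, σ.mem 1 ((s : ℤ) * N + (j : ℕ)) = cd q (X (N + s)) (E j)
  nodes : ∀ i < N, σ.mem 2 (i : ℤ) = (i : ℕ)
  bits : ∀ i < N, (i + 1 < N ∧ E (i + 1) = E i + 1 → σ.mem 3 (i : ℤ) = 1) ∧
    (¬ (i + 1 < N ∧ E (i + 1) = E i + 1) → σ.mem 3 (i : ℤ) = 0)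
  children : ∀ t < start (N + 2), ∀ a : ℤ, |a| ≤ q - 1 →
    σ.mem 4 ((t : ℤ) * (2 * q - 1) + (a + q - 1)) = if C t a = 0 then -1 else (C t a : ℤ)
  starts : ∀ j ≤ N + 1, σ.mem 5 (j : ℤ) = start j
  levels : ∀ i < start (N + 2), σ.mem 6 (i : ℤ) = (i : ℕ)

theorem runs_writeOutput {w : ℤ} (hq : 2 ≤ q) (W : Written q N T E X σ) (hNT : N ≤ T)
    (hM : TrieMem q N T N 0 start nd C σ) (hs : start (N + 2) ≤ 1 + N * T)
    (hw : ((N : ℤ) * T + 3) * (2 * q) + 2 * (N * T) + N + T + 1 ≤ w) :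
    Runs w writeOutput σ (7 * (N * T) + 17 * N + (1 + N * T) * (14 * q) + 50)
      (Output q N T E X start C) := by
  have hq' : (2 : ℤ) ≤ q := by exact_mod_cast hq
  have hNT0 : (0 : ℤ) ≤ (N : ℤ) * T := by positivity
  have hNN : (N : ℤ) * N ≤ N * T := mul_le_mul_of_nonneg_left (by omega) (by positivity)
  have hqw : 2 * ((N : ℤ) * T) + N + T + 6 * q ≤ w := by nlinarith
  have hq1 : ((2 * q - 1 : ℕ) : ℤ) = 2 * q - 1 := by omega
  have hst : start (N + 2) * (2 * q - 1) ≤ (1 + N * T) * (2 * q - 1) := Nat.mul_le_mul_right _ hs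
  have hst' : (1 + N * T) * (2 * q - 1) + (1 + N * T) = (1 + N * T) * (2 * q) := by
    rw [← Nat.mul_succ]; congr 1; omega
  have hst'' : ((start (N + 2) * (2 * q - 1) : ℕ) : ℤ) + 1 ≤ w := by
    have h1 : ((start (N + 2) * (2 * q - 1) : ℕ) : ℤ) ≤ ((1 + N * T) * (2 * q) : ℕ) := by
      exact_mod_cast (by omega : start (N + 2) * (2 * q - 1) ≤ (1 + N * T) * (2 * q))
    push_cast at h1 ⊢
    nlinarith
  refine Runs.mono (T := 2 + ((4 * N + 4) + (1 + ((4 * N + 4) + (1 + ((9 * N + 3) +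
    ((7 * (N * T) + 3) + ((7 * (start (N + 2) * (2 * q - 1)) + 3) +
      ((4 * start (N + 2) + 3) + 3))))))))) ?_ ?_ (fun _ h => h)
  swap
  · have : (1 + N * T) * (14 * q) = 7 * ((1 + N * T) * (2 * q)) := by ring
    omega
  refine Runs.seq (R := fun σ' => Frame 8 [] σ σ' ∧ σ'.reg 8 = start (N + 2) ∧
    σ'.reg 9 = (start (N + 2) * (2 * q - 1) : ℕ)) (Runs.of_wp (by decide) ?_) ?_
  · simp [block, wp, hM.size, hM.addr, hq1]
  rintro σ₁ ⟨F1, p8, p9⟩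
  have a3 : σ₁.reg 3 = 1 := by rw [F1.reg 3 (by decide), W.one]
  have a4 : σ₁.reg 4 = N := by rw [F1.reg 4 (by decide), W.num]
  have a5 : σ₁.reg 5 = T := by rw [F1.reg 5 (by decide), W.total]
  refine (runs_mulLoop (x := 4) (by decide) a3 a4 a4 (by linarith)).seq ?_
  rintro σ₂ ⟨F2, b1⟩
  refine Runs.seq (R := fun σ' => Frame 16 [] σ₁ σ' ∧ σ'.reg 16 = (N * N : ℕ))
    (Runs.of_wp (by decide) (by simp [wp, b1]; exact F2.weaken (by decide) (by simp))) ?_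
  rintro σ₃ ⟨F3, b2⟩
  refine (runs_mulLoop (x := 5) (A := T) (N := N) (by decide) (by rw [F3.reg 3 (by decide), a3])
    (by rw [F3.reg 4 (by decide), a4]) (by rw [F3.reg 5 (by decide), a5]) (by linarith)).seq ?_
  rintro σ₄ ⟨F4, b3⟩
  refine Runs.seq (R := fun σ' => Frame 8 [] σ σ' ∧ Frame 17 [] σ₃ σ' ∧ σ'.reg 17 = (N * T : ℕ))
    (Runs.of_wp (by decide) ?_) ?_
  · simp only [wp, b3]
    exact ⟨by simpa using ((F1.trans F3 (by decide) (by simp)).trans F4 (by decide) (by simp)),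
      by simpa using F4.weaken (by decide) (by simp), by simp⟩
  rintro σ₅ ⟨F5, F35, b4⟩
  have c16 : σ₅.reg 16 = (N * N : ℕ) := by rw [F35.reg 16 (by decide), b2]
  have c8 : σ₅.reg 8 = start (N + 2) := by rw [F35.reg 8 (by decide), F3.reg 8 (by decide), p8]
  have c9 : σ₅.reg 9 = (start (N + 2) * (2 * q - 1) : ℕ) := by
    rw [F35.reg 9 (by decide), F3.reg 9 (by decide), p9]
  have W5 : Written q N T E X σ₅ := by
    refine ⟨by rw [F5.reg 3 (by decide), W.one], by rw [F5.reg 4 (by decide), W.num],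
      by rw [F5.reg 5 (by decide), W.total], ?_, ?_⟩
    · rw [F5.mem 10 (by decide), F5.mem 11 (by decide)]; exact W.bit
    · rw [F5.mem 21 (by decide)]; exact W.digit
  refine (runs_writeNodes W5 (by linarith)).seq ?_
  rintro σ₆ ⟨F6, d1, d2⟩
  have e3 : σ₆.reg 3 = 1 := by rw [F6.reg 3 (by decide), W5.one]
  refine (runs_copyMarkings (A := N * N) (B := N * T) e3 (by rw [F6.reg 16 (by decide), c16])
    (by rw [F6.reg 17 (by decide), b4]) (by push_cast; linarith)).seq ?_
  rintro σ₇ ⟨F7, d3, d4⟩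
  have f3 : σ₇.reg 3 = 1 := by rw [F7.reg 3 (by decide), e3]
  refine (runs_writeChildren (A := start (N + 2) * (2 * q - 1)) f3
    (by rw [F7.reg 9 (by decide), F6.reg 9 (by decide), c9]) hst'').seq ?_
  rintro σ₈ ⟨F8, d5⟩
  refine (runs_writeLevels (A := start (N + 2)) (by rw [F8.reg 3 (by decide), f3])
    (by rw [F8.reg 8 (by decide), F7.reg 8 (by decide), F6.reg 8 (by decide), c8])
    (by have : (start (N + 2) : ℤ) ≤ 1 + N * T := by exact_mod_cast hs
        linarith)).seq ?_
  rintro σ₉ ⟨F9, d6⟩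
  have F59 : Frame 30 [0, 1, 2, 3, 4, 6] σ₅ σ₉ := by
    have h6 : Frame 30 [0, 1, 2, 3, 4, 6] σ₅ σ₆ := F6.weaken le_rfl (by simp)
    exact ((h6.trans F7 le_rfl (by simp)).trans F8 le_rfl (by simp)).trans F9 le_rfl (by simp)
  have m24 : σ₇.mem 24 = σ.mem 24 := by
    rw [F7.mem 24 (by decide), F6.mem 24 (by decide), F5.mem 24 (by decide)]
  have m21 : σ₆.mem 21 = σ.mem 21 := by rw [F6.mem 21 (by decide), F5.mem 21 (by decide)]
  rw [m21] at d3 d4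
  refine Runs.of_wp (by decide) ?_
  simp only [block, wp]
  refine ⟨by rw [abs_zero]; linarith, ?_, ?_, ?_, fun i hi j hj => ?_, fun s hs j hj => ?_, ?_, ?_,
    fun t ht a ha => ?_, ?_, ?_⟩
  · simp [F59.reg 4, W5.num]
  · simp [F59.reg 8, c8]
  · simp
  · simp only [Store.mem_setReg]
    rw [F9.mem 0 (by decide), F8.mem 0 (by decide)]
    have h1 : i * N + j < N * T := by
      have : (i + 1) * N ≤ T * N := Nat.mul_le_mul_right _ (by omega)
      linarith
    have h2 := d3 _ h1
    push_cast at h2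
    rw [h2, W.digit i (by omega) j hj]
  · simp only [Store.mem_setReg]
    rw [F9.mem 1 (by decide), F8.mem 1 (by decide)]
    have h1 : (N + s) * N + j < N * T := by
      have : (N + s + 1) * N ≤ T * N := Nat.mul_le_mul_right _ (by omega)
      linarith
    have h2 := d4 _ h1
    push_cast at h2
    rw [show ((N : ℤ) + s) * N + j - N * N = s * N + j by ring] at h2
    have h3 := W.digit (N + s) hs j hj
    push_cast at h3
    rw [h2, h3]
  · simp only [Store.mem_setReg]
    rw [F9.mem 2 (by decide), F8.mem 2 (by decide), F7.mem 2 (by decide)]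
    exact d1
  · simp only [Store.mem_setReg]
    rw [F9.mem 3 (by decide), F8.mem 3 (by decide), F7.mem 3 (by decide)]
    exact d2
  · simp only [Store.mem_setReg]
    rw [F9.mem 4 (by decide)]
    have ha' := abs_le.mp ha
    have h0 : (((a + q - 1).toNat : ℕ) : ℤ) = a + q - 1 := Int.toNat_of_nonneg (by omega)
    have h1 : t * (2 * q - 1) + (a + q - 1).toNat < start (N + 2) * (2 * q - 1) := by
      have : (t + 1) * (2 * q - 1) ≤ start (N + 2) * (2 * q - 1) := Nat.mul_le_mul_right _ ht
      have h3 : (a + q - 1).toNat < 2 * q - 1 := by omega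
      linarith
    have h2 := d5 _ h1
    push_cast only [Nat.cast_add, Nat.cast_mul] at h2
    rw [h0, hq1, m24, hM.child t a ha] at h2
    split_ifs with hc
    · exact h2.2 (by omega)
    · exact h2.1 (by omega)
  · simp only [Store.mem_setReg]
    rw [F59.mem 5 (by decide), F5.mem 5 (by decide)]
    exact hM.starts
  · simp only [Store.mem_setReg]
    exact d6

end PowerCircuits

open scoped BigOperators
namespace PowerCircuits

variable {q N T n m : ℕ} {E : ℕ → ℕ} {X : ℕ → ℤ} {start : ℕ → ℕ} {nd : ℕ → ℕ → ℕ}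
  {C : ℕ → ℤ → ℕ} {σ : Store}

/-! ## The complete program -/

/-- The program that constructs a treed circuit. -/
noncomputable def makeTree (q : ℕ) : Program :=
  .seq (.ifPos 0 (.seq (setup q) (.seq (processAll q) (writeMarkings q)))
    (block [.const 3 1, .const 4 0, .move 5 1])) (.seq (buildTrie q) writeOutput)

/-- For an empty circuit all markings are empty and have value `0`. -/
theorem family_zero (hq : 2 ≤ q) (mk : ℕ → ℕ → ℤ) (k E : ℕ → ℕ) :
    Family q 0 m E (listVal q 0 0 mk k E) := by
  have h0 : ∀ s, listVal q 0 0 mk k E s = 0 := by simp [listVal]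
  have hcd := (compact_zero hq).cd_eq hq (hasVal_zero q)
  have hh := (compact_zero hq).hasCd hq (hasVal_zero q)
  refine ⟨by omega, fun s _ => by rw [h0]; exact hh, fun s _ p hp => ?_, fun s _ p _ => ?_,
      by omega,
    by omega⟩
  · rw [h0, hcd] at hp
    exact absurd rfl hp
  · rw [h0, hcd]
    have : (1 : ℤ) ≤ (q : ℤ) ^ (p - 2) := one_le_pow₀ (by exact_mod_cast (by omega : 1 ≤ q))
    simp only [psum, Pi.zero_apply, zero_mul, Finset.sum_const_zero, abs_zero]
    linarith

/-- The digits in the order of the levels of the tree. -/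
noncomputable def levelDigit (q N : ℕ) (E : ℕ → ℕ) (X : ℕ → ℤ) (ℓ s : ℕ) : ℤ :=
  cd q (X s) (E (N - 1 - ℓ))

/-- With at most `4 * n` nodes and `4 * n + m` rows, every phase takes `O(n ^ 2 + n * m + 1)` steps,
where the constant is linear in `q`. The word size has to cover the addresses in the table of
children, about `2 * q` for each of the at most `1 + N * (N + m)` nodes of the tree. -/
theorem runs_makeTree {w : ℤ} (hq : 2 ≤ q) {dm mk : ℕ → ℕ → ℤ} {k : ℕ → ℕ} (I : Input q n dm k)
    (h0 : σ.reg 0 = n) (h1 : σ.reg 1 = m)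
    (hd : ∀ u < n, ∀ v < n, σ.mem 0 ((u : ℤ) * n + v) = dm u v)
    (hm : ∀ u < m, ∀ v < n, σ.mem 1 ((u : ℤ) * n + v) = mk u v)
    (hmq : ∀ u < m, ∀ v < n, |mk u v| ≤ q - 1) (hz : ∀ s, 2 ≤ s → ∀ p, σ.mem s p = 0)
    (hw : 100 * (q : ℤ) * ((n : ℤ) + m + 1) ^ 2 ≤ w) :
    Runs w (makeTree q) σ (10000 * q * (n ^ 2 + n * m + 1)) (fun σ' =>
      ∃ N E start nd C, N ≤ 4 * n ∧ Family q N (N + m) E (listVal q n N mk k E) ∧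
        Trie (N + m) (levelDigit q N E (listVal q n N mk k E)) N 0 start nd C ∧
        Output q N (N + m) E (listVal q n N mk k E) start C σ') := by
  have hq' : (2 : ℤ) ≤ q := by exact_mod_cast hq
  have hnn : (0 : ℤ) ≤ (n : ℤ) * n := by positivity
  have hnm : (0 : ℤ) ≤ (n : ℤ) * m := by positivity
  have hmm : (0 : ℤ) ≤ (m : ℤ) * m := by positivity
  have hbig : 100 * (q : ℤ) * (n * n + 2 * (n * m) + 2 * n + 2 * m + 1) ≤ w := by
    refine le_trans ?_ hw
    have : ((n : ℤ) + m + 1) ^ 2 = n * n + 2 * (n * m) + 2 * n + 2 * m + 1 + m * m := by ring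
    rw [this]
    exact mul_le_mul_of_nonneg_left (by linarith) (by positivity)
  have q1 : ∀ x : ℤ, 0 ≤ x → 2 * x ≤ q * x := fun x hx => mul_le_mul_of_nonneg_right hq' hx
  have b1 := q1 _ hnn
  have b2 := q1 _ hnm
  have b3 := q1 (n : ℤ) (by positivity)
  have b4 := q1 (m : ℤ) (by positivity)
  have hphase : Runs w (.ifPos 0 (.seq (setup q) (.seq (processAll q) (writeMarkings q)))
      (block [.const 3 1, .const 4 0, .move 5 1])) σ (7000 * q * (n ^ 2 + n * m + 1))
      (fun σ' => (∀ s ∈ [5, 22, 23, 24], σ'.mem s = σ.mem s) ∧ ∃ N E, N ≤ 4 * n ∧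
        Family q N (N + m) E (listVal q n N mk k E) ∧
        Written q N (N + m) E (listVal q n N mk k E) σ') := by
    -- An empty circuit has no first node to start from; the other branch of the program sets `N =
    -- 0` and `T = m` directly.
    rcases Nat.eq_zero_or_pos n with rfl | hn
    · have hT : 4 ≤ 7000 * q * (0 ^ 2 + 0 * m + 1) := by omega
      refine Runs.mono (T := 3 + 1) (Runs.ifPos (fun h => by simp [h0] at h) fun _ => ?_) hT
        (fun _ h => h)
      refine Runs.of_wp (by decide) ?_
      simp only [block, wp, Store.reg_setReg, Nat.reduceEqDiff, reduceIte, h1]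
      refine ⟨by rw [abs_le]; constructor <;> linarith, by rw [abs_zero]; linarith, by simp, 0,
        fun _ => 0, le_rfl, ?_, ?_⟩
      · rw [Nat.zero_add]; exact family_zero hq mk k _
      · refine ⟨by simp, by simp, by simp, by simp, by simp⟩
    · have hn1 : (n : ℤ) ≤ n * n := by exact_mod_cast Nat.le_mul_self n
      have hm1 : (m : ℤ) ≤ n * m := by exact_mod_cast Nat.le_mul_of_pos_left m hn
      have hnN : n ≤ n * n := Nat.le_mul_self n
      have hmN : m ≤ n * m := Nat.le_mul_of_pos_left m hn
      refine Runs.mono (T := ((10 * (n * n) + 28 * n + 44 * q * n + 8 * q + 110) +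
        (((1400 * (4 * n) + 20) * n + 3) + (13 * ((4 * n) * (4 * n)) + 19 * (4 * n) +
          m * (63 * (4 * n) + 9 * n + 28) + 9))) + 1) (Runs.ifPos (fun _ => ?_)
        (fun h => absurd (by rw [h0]; exact_mod_cast hn) h)) ?_ (fun _ h => h)
      · refine (runs_setup hq I hn (L := 4 * n) rfl h0 hd (hz 12 (by omega)) (hz 19 (by omega))
          (by push_cast; linarith)).seq ?_
        rintro σ₁ ⟨F1, p1, D1, S1⟩
        refine (runs_processAll hq I rfl (by rw [F1.reg 0 (by decide), h0]) p1
          (by rw [F1.mem 0 (by decide)]; exact hd) D1 S1 (by push_cast; linarith)).seq ?_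
        rintro σ₂ ⟨F2, S, S2⟩
        have hS : S = Finset.range n := Finset.eq_of_subset_of_card_le S2.sub (by
          rw [S2.card, Finset.card_range])
        obtain ⟨N, e, ord, π, P⟩ := S2.progress hn
        rw [hS] at P
        have hN := P.size
        refine (runs_writeMarkings hq hn P rfl (by rw [F2.reg 0 (by decide), F1.reg 0 (by decide),
            h0])
          (by rw [F2.reg 1 (by decide), F1.reg 1 (by decide), h1])
          (by rw [F2.mem 1 (by decide), F1.mem 1 (by decide)]; exact hm) hmq
          (D1.frame F2 (by decide)) (by push_cast; linarith)).mono ?_ ?_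
        · gcongr
        · rintro σ₃ ⟨F3, hF, hW⟩
          refine ⟨fun s hs => ?_, N, _, hN, hF, hW⟩
          have : s = 5 ∨ s = 22 ∨ s = 23 ∨ s = 24 := by simpa using hs
          rw [F3.mem s (by simp; omega), F2.mem s (by simp; omega), F1.mem s (by simp; omega)]
      · have e1 : 7000 * q * (n ^ 2 + n * m + 1) =
            7000 * (q * (n * n)) + 7000 * (q * (n * m)) + 7000 * q := by ring
        have e2 : 2 * (n * n) ≤ q * (n * n) := Nat.mul_le_mul_right _ hq
        have e3 : 2 * (n * m) ≤ q * (n * m) := Nat.mul_le_mul_right _ hq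
        have e4 : q * n ≤ q * (n * n) := Nat.mul_le_mul_left _ hnN
        rw [e1]
        nlinarith
  refine Runs.mono (T := 7000 * q * (n ^ 2 + n * m + 1) + (((18 * (4 * n + m) + 10) * (4 * n) + 9) +
    (7 * ((4 * n) * (4 * n + m)) + 17 * (4 * n) + (1 + (4 * n) * (4 * n + m)) *
        (14 * q) + 50))) ?_ ?_
    (fun _ h => h)
  · refine hphase.seq ?_
    rintro σ₁ ⟨hz1, N, E, hN, hF, W⟩
    have hNT : (N : ℤ) * (N + m) ≤ 16 * (n * n) + 4 * (n * m) := by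
      have h1 : N * (N + m) ≤ (4 * n) * (4 * n + m) := Nat.mul_le_mul hN (by omega)
      have h2 : (N : ℤ) * (N + m) ≤ (4 * n) * (4 * n + m) := by exact_mod_cast h1
      linarith
    have hNT0 : (0 : ℤ) ≤ (N : ℤ) * (N + m) := by positivity
    have hN' : (N : ℤ) ≤ 4 * n := by exact_mod_cast hN
    have hprod : ((N : ℤ) * (N + m) + 3) * (2 * q) ≤ (16 * (n * n) + 4 * (n * m) + 3) * (2 * q) :=
      mul_le_mul_of_nonneg_right (by linarith) (by omega)
    have hzero : ∀ s ∈ [5, 22, 23, 24], ∀ p, σ₁.mem s p = 0 := fun s hs p => by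
      rw [hz1 s hs]
      have : s = 5 ∨ s = 22 ∨ s = 23 ∨ s = 24 := by simpa using hs
      exact hz s (by omega) p
    refine Runs.mono (T := ((18 * (N + m) + 10) * N + 9) + (7 * (N * (N + m)) + 17 * N +
      (1 + N * (N + m)) * (14 * q) + 50)) ?_ ?_ (fun _ h => h)
    · refine (runs_buildTrie hq W.one W.num W.total (dig := levelDigit q N E (listVal q n N mk k E))
        (fun ℓ hℓ s hs => ⟨?_, ?_⟩) (hzero 5 (by simp)) (hzero 22 (by simp)) (hzero 23 (by simp))
        (hzero 24 (by simp)) ?_).seq ?_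
      · have := W.digit s hs (N - 1 - ℓ) (by omega)
        rw [levelDigit, ← this, show ((N - 1 - ℓ : ℕ) : ℤ) = N - 1 - ℓ by omega]
      · have h1 := (hF.hasCd s hs).1.lo (E (N - 1 - ℓ))
        have h2 := (hF.hasCd s hs).1.hi (E (N - 1 - ℓ))
        rw [levelDigit, abs_le]; constructor <;> omega
      · push_cast; linarith
      rintro σ₂ ⟨F2, start, nd, C, hTrie, hM⟩
      have W2 : Written q N (N + m) E (listVal q n N mk k E) σ₂ := by
        refine ⟨by rw [F2.reg 3 (by decide), W.one], by rw [F2.reg 4 (by decide), W.num],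
          by rw [F2.reg 5 (by decide), W.total], ?_, ?_⟩
        · rw [F2.mem 10 (by decide), F2.mem 11 (by decide)]; exact W.bit
        · rw [F2.mem 21 (by decide)]; exact W.digit
      refine (runs_writeOutput hq W2 hF.le hM (by simpa using hTrie.size_le) ?_).mono le_rfl ?_
      · push_cast; linarith
      · intro σ₃ hO
        exact ⟨N, E, start, nd, C, hN, hF, hTrie, hO⟩
    · gcongr
  · have e1 : 10000 * q * (n ^ 2 + n * m + 1) = 7000 * q * (n ^ 2 + n * m + 1) +
        (3000 * (q * (n * n)) + 3000 * (q * (n * m)) + 3000 * q) := by ring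
    have e2 : 2 * (n * n) ≤ q * (n * n) := Nat.mul_le_mul_right _ hq
    have e3 : 2 * (n * m) ≤ q * (n * m) := Nat.mul_le_mul_right _ hq
    have hnN : n ≤ n * n := Nat.le_mul_self n
    rw [e1]
    nlinarith

end PowerCircuits

open scoped BigOperators
namespace PowerCircuits

variable {q N T : ℕ} {E : ℕ → ℕ} {X : ℕ → ℤ}

/-! ## The circuit of a family of compact markings -/

/-- A node of `q` times the value could be appended to the maximal chain. -/
theorem LabelledDag.IsTop.ne {Γ : Type} [Fintype Γ] {G : LabelledDag q Γ} {v : Γ} (h : G.IsTop v)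
    (u : Γ) : (q : ℝ) * G.nodeVal v ≠ G.nodeVal u := by
  obtain ⟨l, ⟨-, hl, hmax⟩, hv⟩ := h
  intro hu
  have := hmax (l ++ [u]) (List.isChain_append.mpr ⟨hl, List.isChain_singleton _,
      fun x hx y hy => by
    rw [hv, Option.mem_some_iff] at hx
    simp only [List.head?_cons, Option.mem_some_iff] at hy
    rw [← hx, ← hy, hu]⟩) (List.prefix_append _ _)
  simp at this

theorem Family.lt_iff (F : Family q N T E X) (i j : Fin N) : E i < E j ↔ i < j := by
  constructor
  · intro h
    by_contra hc
    rcases (not_lt.mp hc).eq_or_lt with h1 | h1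
    · rw [h1] at h; exact lt_irrefl _ h
    · exact absurd (F.mono j i h1 i.2) (by omega)
  · exact fun h => F.mono i j h j.2

theorem Family.injective (F : Family q N T E X) : Function.Injective (fun i : Fin N => E i) := by
  intro i j h
  rcases lt_trichotomy i j with h1 | h1 | h1
  · exact absurd h ((F.lt_iff i j).mpr h1).ne
  · exact h1
  · exact absurd h ((F.lt_iff j i).mpr h1).ne'

theorem Family.digit_mem (F : Family q N T E X) {s : ℕ} (hs : s < T) (p : ℕ) :
    cd q (X s) p ∈ Finset.Icc (1 - (q : ℤ)) ((q : ℤ) - 1) := by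
  have h1 := (F.hasCd s hs).1.lo p
  have h2 := (F.hasCd s hs).1.hi p
  rw [Finset.mem_Icc]
  omega

/-- The compact markings of the family. -/
noncomputable def Family.mark (F : Family q N T E X) (s : Fin T) : Marking q (Fin N) :=
  fun j => ⟨cd q (X s) (E j), F.digit_mem s.2 _⟩

theorem Family.spread_eq (F : Family q N T E X) (s : Fin T) :
    spread Finset.univ (fun j : Fin N => E j) (fun j => cd q (X s) (E j)) = cd q (X s) := by
  funext p
  by_cases h : ∃ i < N, E i = p
  · obtain ⟨i, hi, rfl⟩ := h
    exact spread_apply (e := fun j : Fin N => E j) _ (Finset.mem_univ (⟨i, hi⟩ : Fin N))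
      fun b _ hb => F.injective hb
  · rw [spread_eq_zero (e := fun j : Fin N => E j) _ fun b _ hb => h ⟨b, b.2, hb⟩]
    by_contra hc
    exact h (F.supp s s.2 p (Ne.symm hc))

theorem Family.sum_digits (F : Family q N T E X) (s : Fin T) :
    ∑ j : Fin N, cd q (X s) (E j) * (q : ℤ) ^ E j = X s := by
  have h := hasVal_spread q Finset.univ (fun j : Fin N => E j) (fun j => cd q (X s) (E j))
  rw [F.spread_eq s] at h
  exact h.eq (F.hasCd s s.2).2

/-- The digits of `E i` sit at exponents below `E i`. So edges lead from later to earlier nodes of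
the sorted list. -/
theorem Family.lt_of_ne_zero (hq : 2 ≤ q) (F : Family q N T E X) {i j : Fin N}
    (h : cd q (X i) (E j) ≠ 0) : j < i := by
  have h1 := F.hasCd i (i.2.trans_le F.le)
  rw [F.node i i.2] at h1 h
  exact (F.lt_iff j i).mp (h1.1.lt_of_ne_zero hq h1.2 h)

/-- The circuit with nodes of values `q ^ E i`. -/
noncomputable def Family.dag (hq : 2 ≤ q) (F : Family q N T E X) : LabelledDag q (Fin N) where
  δ i := F.mark (i.castLE F.le)
  acyclic u hu := by
    have : ∀ v, Relation.TransGen (fun x y => (F.mark (x.castLE F.le) y : ℤ) ≠ 0) u v → v < u := by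
      intro v hv
      induction hv with
      | single h => exact F.lt_of_ne_zero hq h
      | tail _ h ih => exact (F.lt_of_ne_zero hq h).trans ih
    exact lt_irrefl u (this u hu)

/-- By induction along the sorted list, the successor marking evaluates to the power sum with the
digits of `E i`, whose value is `E i` itself. -/
theorem Family.nodeVal_dag (hq : 2 ≤ q) (F : Family q N T E X) (i : Fin N) :
    (F.dag hq).nodeVal i = (q : ℝ) ^ E i := by
  induction i using WellFoundedLT.induction with
  | ind i ih =>
    rw [LabelledDag.nodeVal_eq]
    have h : (F.dag hq).markVal ((F.dag hq).succ i) = (E i : ℕ) := by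
      have h1 := F.sum_digits (i.castLE F.le)
      have h2 : X (i.castLE F.le : Fin T) = E i := F.node i i.2
      rw [h2] at h1
      rw [← Int.cast_natCast (E i), ← h1]
      push_cast
      refine Finset.sum_congr rfl fun j _ => ?_
      by_cases h0 : cd q (X i) (E j) = 0
      · have : ((F.dag hq).succ i j : ℤ) = 0 := h0
        rw [this, ← h2, Fin.val_castLE, h0]
        simp
      · rw [ih j (F.lt_of_ne_zero hq h0), ← h2]
        rfl
    rw [h, Real.rpow_natCast]

theorem Family.markVal_mark (hq : 2 ≤ q) (F : Family q N T E X) (s : Fin T) :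
    (F.dag hq).markVal (F.mark s) = X s := by
  rw [← F.sum_digits s]
  push_cast
  exact Finset.sum_congr rfl fun j _ => by rw [F.nodeVal_dag hq]; rfl

theorem one_lt_cast_of_two_le (hq : 2 ≤ q) : (1 : ℝ) < q := by exact_mod_cast hq

theorem Family.isCompactPowerSum_mark (hq : 2 ≤ q) (F : Family q N T E X) (s : Fin T) :
    IsCompactPowerSum q ((F.dag hq).powerSum (F.mark s)) := by
  have : (F.dag hq).powerSum (F.mark s) = cd q (X s) := by
    rw [← F.spread_eq s]
    funext p
    refine Finset.sum_congr rfl fun j _ => ?_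
    refine if_congr ?_ rfl rfl
    rw [F.nodeVal_dag hq, pow_right_inj₀ (by linarith [one_lt_cast_of_two_le hq])
      (one_lt_cast_of_two_le hq).ne']
  rw [this]
  exact (F.hasCd s s.2).1.isCompactPowerSum hq (F.hasCd s s.2).2.finite

/-- Above a top node there is a gap `p = E v + 1`. The partial sum below it is at most `q ^ (E v -
1) - 1`, too small for a non-zero compact digit at `E v`. -/
theorem Family.mark_eq_zero_of_isTop (hq : 2 ≤ q) (F : Family q N T E X) (s : Fin T) {v : Fin N}
    (hv : (F.dag hq).IsTop v) : (F.mark s v : ℤ) = 0 := by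
  have hq' : (2 : ℤ) ≤ q := by exact_mod_cast hq
  have hb := F.tame s s.2 (E v + 1) fun i hi h => by
    apply hv.ne ⟨i, hi⟩
    rw [F.nodeVal_dag hq, F.nodeVal_dag hq, h, pow_succ']
  refine (F.hasCd s s.2).1.eq_zero_of_small hq ?_
  rcases Nat.eq_zero_or_pos (E v) with h0 | h0
  -- For `E v = 0` the gap is `p = 1`, and truncated subtraction makes the bound `q ^ 0 - 1 = 0`.
  · rw [h0] at hb ⊢
    simp only [zero_add, Nat.reduceSub, pow_zero] at hb ⊢
    have := abs_nonneg (psum q (cd q (X s)) 1)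
    have h1 : |psum q (cd q (X s)) 1| = 0 := by omega
    rw [h1]; simp
  · obtain ⟨p, hp⟩ := Nat.exists_eq_succ_of_ne_zero h0.ne'
    rw [hp] at hb ⊢
    simp only [Nat.succ_eq_add_one, Nat.reduceSubDiff] at hb ⊢
    rw [pow_succ (q : ℤ) p, mul_comm ((q : ℤ) ^ p)]
    exact mul_lt_mul_of_pos_left (by linarith) (by linarith)

/-- The reduced circuit of the family. -/
noncomputable def Family.reduced (hq : 2 ≤ q) (F : Family q N T E X) :
    ReducedCircuit q (Fin N) where
  toLabelledDag := F.dag hq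
  proper i := ⟨E i, F.nodeVal_dag hq i⟩
  nodes := List.finRange N
  bits := List.ofFn fun i : Fin (N - 1) => decide (E (i + 1) = E i + 1)
  nodeVal_ne i j hij h := by
    rw [F.nodeVal_dag hq, F.nodeVal_dag hq, pow_right_inj₀ (by linarith [one_lt_cast_of_two_le hq])
      (one_lt_cast_of_two_le hq).ne'] at h
    exact hij (F.injective h)
  mem_nodes := List.mem_finRange
  sorted := (List.pairwise_lt_finRange N).imp fun {i j} h => by
    rw [F.nodeVal_dag hq, F.nodeVal_dag hq, pow_lt_pow_iff_right₀ (one_lt_cast_of_two_le hq)]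
    exact (F.lt_iff i j).mpr h
  bits_length := by simp
  bits_iff i h := by
    rw [List.length_finRange] at h
    rw [F.nodeVal_dag hq, F.nodeVal_dag hq, ← pow_succ',
      pow_right_inj₀ (by linarith [one_lt_cast_of_two_le hq]) (one_lt_cast_of_two_le hq).ne']
    rw [List.getElem?_eq_getElem (by simp; omega)]
    simp [eq_comm]

end PowerCircuits

open scoped BigOperators
namespace PowerCircuits

variable {q N T : ℕ} {dig : ℕ → ℕ → ℤ} {start : ℕ → ℕ} {nd : ℕ → ℕ → ℕ} {C : ℕ → ℤ → ℕ}
  {D : ℕ → Fin T → Digit q}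

/-! ## The tree of strings of digits -/

/-- The last `ℓ` digits of a string, from the bottom of the tree to the root. -/
def word (D : ℕ → Fin T → Digit q) : ℕ → Fin T → List (Digit q)
  | 0, _ => []
  | ℓ + 1, s => D ℓ s :: word D ℓ s

theorem length_word (D : ℕ → Fin T → Digit q) (ℓ : ℕ) (s : Fin T) : (word D ℓ s).length = ℓ := by
  induction ℓ with
  | zero => rfl
  | succ ℓ ih => simp [word, ih]

theorem word_eq_map_finRange (D : ℕ → Fin T → Digit q) (ℓ : ℕ) (s : Fin T) :
    word D ℓ s = (List.finRange ℓ).map fun i : Fin ℓ => D (ℓ - 1 - i) s := by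
  induction ℓ with
  | zero => rfl
  | succ ℓ ih =>
    rw [List.finRange_succ, List.map_cons, List.map_map, word, ih]
    simp only [List.cons.injEq, Fin.val_zero, Nat.sub_zero, Nat.add_sub_cancel, true_and]
    refine List.map_congr_left fun i _ => ?_
    simp only [Function.comp, Fin.val_succ]
    congr 1
    omega

theorem present_of_le {j : ℕ} (hj : j ≤ N) (s : Fin T) : Present T N 0 j s := ⟨s.2, Or.inl hj⟩

theorem Present.le {j s : ℕ} (h : Present T N 0 j s) : j ≤ N := by
  rcases h.2 with h | h <;> omega

theorem Trie.start_le (h : Trie T dig N 0 start nd C) (j : ℕ) : start j ≤ start (N + 2) := by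
  rcases le_total j (N + 2) with hj | hj
  · exact h.mono hj
  · exact (h.stable j hj).le

theorem Trie.nd_lt (h : Trie T dig N 0 start nd C) {j s : ℕ} (hs : Present T N 0 j s) :
    nd j s < start (N + 2) := (h.bounds j s hs).2.trans_le (h.start_le _)

theorem Trie.child_lt (h : Trie T dig N 0 start nd C) {t : ℕ} {a : ℤ} (hC : C t a ≠ 0) :
    C t a < start (N + 2) := by
  obtain ⟨j, s, hs, rfl, rfl⟩ := h.exists_edge t a hC
  rw [h.edge j s hs]
  exact h.nd_lt hs

theorem Trie.exists_nd (h : Trie T dig N 0 start nd C) (J : ℕ) {t : ℕ} (ht : t < start (J + 1)) :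
    t = 0 ∨ ∃ j s, Present T N 0 (j + 1) s ∧ nd (j + 1) s = t := by
  induction J with
  | zero => rw [h.start_one] at ht; omega
  | succ J ih =>
    by_cases hc : t < start (J + 1)
    · exact ih hc
    · exact Or.inr ⟨J, h.surj J t (not_lt.mp hc) ht⟩

theorem Trie.word_eq (h : Trie T dig N 0 start nd C) (hD : ∀ ℓ (s : Fin T), dig ℓ s = D ℓ s) {j : ℕ}
    (hj : j ≤ N) {s s' : Fin T} (he : nd j s = nd j s') : word D j s = word D j s' := by
  induction j with
  | zero => rfl
  | succ j ih =>
    obtain ⟨h1, h2⟩ := h.inj j s s' (present_of_le hj s) (present_of_le hj s') he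
    rw [hD, hD] at h2
    rw [word, word, ih (by omega) h1, Subtype.ext h2]

/-- The tree given by the table of children. -/
def Trie.data (q : ℕ) (h : Trie T dig N 0 start nd C) : TreeData q where
  size := start (N + 2)
  root := ⟨0, by have := h.start_le 1; rw [h.start_one] at this; omega⟩
  child t a := if hC : C t a = 0 then none else some ⟨C t a, h.child_lt hC⟩

theorem Trie.child_eq_some (h : Trie T dig N 0 start nd C) {t c : Fin (h.data q).size}
    {a : Digit q} : (h.data q).child t a = some c ↔ C t a ≠ 0 ∧ C t a = c := by
  by_cases hC : C t a = 0
  · have : (h.data q).child t a = none := dif_pos hC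
    simp [this, hC]
  · have : (h.data q).child t a = some ⟨C t a, h.child_lt hC⟩ := dif_neg hC
    rw [this]
    exact ⟨fun he => ⟨hC, congrArg Fin.val (Option.some.inj he)⟩,
      fun he => congrArg some (Fin.ext he.2)⟩

theorem Trie.child_nd (h : Trie T dig N 0 start nd C) (hD : ∀ ℓ (s : Fin T),
    dig ℓ s = D ℓ s) {j : ℕ}
    {s : Fin T} {t c : Fin (h.data q).size} (hj : j + 1 ≤ N) (ht : nd j s = t)
    (hc : nd (j + 1) s = c) : (h.data q).child t (D j s) = some c := by
  have hs := present_of_le hj s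
  have he := h.edge j s hs
  rw [hD, ht, hc] at he
  rw [h.child_eq_some, he, ← hc]
  exact ⟨(h.edge_pos hs).ne', rfl⟩

theorem Trie.exists_of_child (h : Trie T dig N 0 start nd C) (hD : ∀ ℓ (s : Fin T), dig ℓ s = D ℓ s)
    {t c : Fin (h.data q).size} {a : Digit q} (hc : (h.data q).child t a = some c) :
    ∃ (j : ℕ) (s : Fin T), j + 1 ≤ N ∧ nd j s = t ∧ nd (j + 1) s = c ∧ D j s = a := by
  obtain ⟨h1, h2⟩ := h.child_eq_some.mp hc
  obtain ⟨j, s, hs, h3, h4⟩ := h.exists_edge _ _ h1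
  refine ⟨j, ⟨s, hs.1⟩, hs.le, h3, ?_, ?_⟩
  · rw [← h2, ← h3, ← h4, h.edge j s hs]
  · have := hD j ⟨s, hs.1⟩
    exact Subtype.ext (this.symm.trans h4)

theorem Trie.path_word (h : Trie T dig N 0 start nd C) (hD : ∀ ℓ (s : Fin T),
    dig ℓ s = D ℓ s) {j : ℕ}
    (hj : j ≤ N) (s : Fin T) :
    (h.data q).Path (word D j s) ⟨nd j s, h.nd_lt (present_of_le hj s)⟩ := by
  induction j with
  | zero =>
    have : (⟨nd 0 s, h.nd_lt (present_of_le hj s)⟩ : Fin (h.data q).size) = (h.data q).root :=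
      Fin.ext (h.root s)
    rw [this]
    exact .root
  | succ j ih => exact .step _ _ _ _ (ih (by omega)) (h.child_nd hD hj rfl rfl)

/-- The induction runs over the path. Different strings may pass through the same node, so at each
step one passes to a string that realises the last edge and uses that both strings have the same
word up to this node. -/
theorem Trie.eq_word_of_path (h : Trie T dig N 0 start nd C) (hD : ∀ ℓ (s : Fin T), dig ℓ s = D ℓ s)
    {w : List (Digit q)} {t : Fin (h.data q).size} (hw : (h.data q).Path w t) :
    ∀ (j : ℕ) (s : Fin T), j ≤ N → nd j s = t → w = word D j s := by
  induction hw with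
  | root =>
    intro j s hj he
    have : j = 0 := h.level_eq (present_of_le hj s) (present_of_le (Nat.zero_le N) s)
      (he.trans (h.root s).symm)
    rw [this]; rfl
  | step w t a c _ hc ih =>
    intro j' s' hj' he'
    obtain ⟨j, s, hj, h1, h2, rfl⟩ := h.exists_of_child hD hc
    obtain rfl : j' = j + 1 :=
      h.level_eq (present_of_le hj' s') (present_of_le hj s) (he'.trans h2.symm)
    rw [h.word_eq hD hj' (he'.trans h2.symm), word, ← ih j s (by omega) h1]

theorem Trie.path_cases (h : Trie T dig N 0 start nd C) (hD : ∀ ℓ (s : Fin T), dig ℓ s = D ℓ s)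
    {w : List (Digit q)} {t : Fin (h.data q).size} (hw : (h.data q).Path w t) :
    w = [] ∧ (t : ℕ) = 0 ∨ ∃ (j : ℕ) (s : Fin T), j + 1 ≤ N ∧ nd (j + 1) s = t ∧
      w = word D (j + 1) s := by
  have hw' := hw
  cases hw with
  | root => exact Or.inl ⟨rfl, rfl⟩
  | step w t a c _ hc =>
    obtain ⟨j, s, hj, h1, h2, rfl⟩ := h.exists_of_child hD hc
    exact Or.inr ⟨j, s, hj, h2, h.eq_word_of_path hD hw' _ s hj h2⟩

/-- The digital tree with its lists of levels. -/
def Trie.tree (h : Trie T dig N 0 start nd C) (hD : ∀ ℓ (s : Fin T),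
    dig ℓ s = D ℓ s) : DigitTree q where
  toTreeData := h.data q
  root_ne_child t a hc := by
    obtain ⟨h1, h2⟩ := h.child_eq_some.mp hc
    exact h1 h2
  parent_unique t a t' a' c hc hc' := by
    obtain ⟨j, s, hj, h1, h2, h3⟩ := h.exists_of_child hD hc
    obtain ⟨j', s', hj', h1', h2', h3'⟩ := h.exists_of_child hD hc'
    have hs := present_of_le hj s
    have hs' := present_of_le hj' s'
    obtain rfl : j = j' := by
      have := h.level_eq hs hs' (h2.trans h2'.symm)
      omega
    obtain ⟨h4, h5⟩ := h.inj j s s' hs hs' (h2.trans h2'.symm)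
    rw [hD, hD] at h5
    exact ⟨Fin.ext (by rw [← h1, ← h1', h4]), by rw [← h3, ← h3', Subtype.ext h5]⟩
  reachable t := by
    rcases h.exists_nd (N + 1) t.2 with h0 | ⟨j, s, hs, he⟩
    · obtain rfl : t = (h.data q).root := Fin.ext h0
      exact ⟨[], .root⟩
    · obtain rfl : t = ⟨nd (j + 1) s, h.nd_lt hs⟩ := Fin.ext he.symm
      exact ⟨_, h.path_word hD hs.le ⟨s, hs.1⟩⟩
  level k := List.ofFn fun i : Fin (start (k + 1) - start k) =>
    ⟨start k + i, by
      have := i.2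
      have := h.start_le (k + 1)
      change start k + i < start (N + 2)
      omega⟩
  level_nodup k := List.nodup_ofFn.mpr fun i j hij => by
    simp only [Fin.mk.injEq] at hij
    exact Fin.ext (by omega)
  mem_level k t := by
    rw [List.mem_ofFn]
    constructor
    · rintro ⟨i, rfl⟩
      have hi := i.2
      cases k with
      | zero =>
        have h0 := h.start_zero
        have h1 := h.start_one
        have hi' : (i : ℕ) < start 1 - start 0 := hi
        refine ⟨[], ?_, rfl⟩
        convert TreeData.Path.root
        change start 0 + (i : ℕ) = 0
        omega
      | succ j =>
        obtain ⟨s, hs, he⟩ := h.surj j (start (j + 1) + i) (by omega)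
          (by have : start (j + 1 + 1) = start (j + 2) := rfl; omega)
        refine ⟨word D (j + 1) ⟨s, hs.1⟩, ?_, length_word _ _ _⟩
        convert h.path_word hD hs.le ⟨s, hs.1⟩
        exact Fin.ext he.symm
    · rintro ⟨w, hw, rfl⟩
      obtain ⟨h1, h2⟩ : start w.length ≤ t ∧ t < start (w.length + 1) := by
        rcases h.path_cases hD hw with ⟨rfl, h0⟩ | ⟨j, s, hj, he, rfl⟩
        · simp [h0, h.start_zero, h.start_one]
        · rw [length_word, ← he]
          exact h.bounds _ s (present_of_le hj s)
      exact ⟨⟨t - start w.length, by omega⟩, Fin.ext (by simp; omega)⟩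

theorem Trie.exists_leaf (h : Trie T dig N 0 start nd C) (hD : ∀ ℓ (s : Fin T), dig ℓ s = D ℓ s)
    (s : Fin T) : ∃ t, (h.tree hD).IsLeaf t ∧ (h.tree hD).Path (word D N s) t := by
  refine ⟨_, fun a => ?_, h.path_word hD le_rfl s⟩
  by_contra hc
  obtain ⟨c, hc⟩ := Option.ne_none_iff_exists'.mp hc
  obtain ⟨j, s', hj, h1, -, -⟩ := h.exists_of_child hD hc
  have := h.level_eq (present_of_le (by omega) s') (present_of_le le_rfl s) h1
  omega

/-- A node above level `N` on the path of a string has a child, so it is not a leaf. The root needs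
a string to conclude this; `N ≤ T` provides one unless `N = 0`, in which case the root itself is a
leaf with the empty word. -/
theorem Trie.leaf_cases (h : Trie T dig N 0 start nd C) (hD : ∀ ℓ (s : Fin T), dig ℓ s = D ℓ s)
    (hN : N ≤ T) {w : List (Digit q)} {t : Fin (h.data q).size} (ht : (h.tree hD).IsLeaf t)
    (hw : (h.tree hD).Path w t) : N = 0 ∧ w = [] ∨ ∃ s, w = word D N s := by
  have key : ∀ (j : ℕ) (s : Fin T), j ≤ N → nd j s = t → w = word D j s →
      ∃ s, w = word D N s := by
    intro j s hj he hws
    rcases hj.eq_or_lt with rfl | hj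
    · exact ⟨s, hws⟩
    · have := h.child_nd (q := q) (t := t) (c := ⟨_, h.nd_lt (present_of_le hj s)⟩) hD hj he rfl
      exact absurd (ht (D j s)) (by change (h.data q).child t (D j s) ≠ none; rw [this]; simp)
  rcases h.path_cases hD hw with ⟨h1, h2⟩ | ⟨j, s, hj, he, h1⟩
  · rcases Nat.eq_zero_or_pos N with h0 | h0
    · exact Or.inl ⟨h0, h1⟩
    · exact Or.inr (key 0 ⟨0, by omega⟩ (Nat.zero_le _) ((h.root _).trans h2.symm) h1)
  · exact Or.inr (key (j + 1) s hj he h1)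

end PowerCircuits

open scoped BigOperators
namespace PowerCircuits

variable {q n m N T : ℕ} {E : ℕ → ℕ} {X : ℕ → ℤ} {start : ℕ → ℕ} {nd : ℕ → ℕ → ℕ}
  {C : ℕ → ℤ → ℕ} {σ : Store}

/-! ## The treed circuit of a family of compact markings -/

/-- The digits of the family in the order of the levels of the tree. -/
noncomputable def Family.strings (F : Family q N T E X) (ℓ : ℕ) (s : Fin T) : Digit q :=
  ⟨levelDigit q N E X ℓ s, F.digit_mem s.2 _⟩

theorem Family.word_strings (F : Family q N T E X) (s : Fin T) :
    word F.strings N s = (List.finRange N).map (F.mark s) := by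
  rw [word_eq_map_finRange]
  refine List.map_congr_left fun i _ => Subtype.ext ?_
  simp only [strings, mark, levelDigit]
  congr 2
  omega

/-- The digital tree of the family. -/
noncomputable def Family.tree (F : Family q N T E X)
    (h : Trie T (levelDigit q N E X) N 0 start nd C) : DigitTree q :=
  h.tree (D := F.strings) fun _ _ => rfl

theorem Family.isLeafMarking_mark (F : Family q N T E X)
    (h : Trie T (levelDigit q N E X) N 0 start nd C) (s : Fin T) :
    IsLeafMarking (List.finRange N) (F.tree h).toTreeData (F.mark s) := by
  obtain ⟨t, ht, hp⟩ := h.exists_leaf (D := F.strings) (fun _ _ => rfl) s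
  rw [F.word_strings] at hp
  exact ⟨t, ht, hp⟩

theorem Family.eq_mark_of_isLeafMarking (F : Family q N T E X)
    (h : Trie T (levelDigit q N E X) N 0 start nd C) {M : Marking q (Fin N)}
    (hM : IsLeafMarking (List.finRange N) (F.tree h).toTreeData M) :
    N = 0 ∨ ∃ s, M = F.mark s := by
  obtain ⟨t, ht, hp⟩ := hM
  rcases h.leaf_cases (D := F.strings) (fun _ _ => rfl) F.le ht hp with ⟨h0, -⟩ | ⟨s, hs⟩
  · exact Or.inl h0
  · rw [F.word_strings, List.map_inj_left] at hs
    exact Or.inr ⟨s, funext fun i => hs i (List.mem_finRange i)⟩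

/-- The treed circuit of the family. -/
noncomputable def Family.treed (hq : 2 ≤ q) (F : Family q N T E X)
    (h : Trie T (levelDigit q N E X) N 0 start nd C) {𝓜 : Set (Marking q (Fin N))}
    (h𝓜 : ∀ M ∈ 𝓜, ∃ s, M = F.mark s) : TreedCircuit q (Fin N) 𝓜 where
  toReducedCircuit := F.reduced hq
  tree := F.tree h
  leaf_depth t w ht hw := by
    rw [Fintype.card_fin]
    rcases h.leaf_cases (D := F.strings) (fun _ _ => rfl) F.le ht hw with ⟨rfl, rfl⟩ | ⟨s, rfl⟩
    · rfl
    · exact length_word _ _ _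
  leaf_compact M hM := by
    -- For `N = 0` the root represents the empty marking even if the family has no members, so this
    -- case is treated separately.
    rcases F.eq_mark_of_isLeafMarking h hM with rfl | ⟨s, rfl⟩
    · have h0 : (F.reduced hq).powerSum M = 0 := by
        funext k
        simp [LabelledDag.powerSum]
      rw [h0]
      exact (compact_zero hq).isCompactPowerSum hq (hasVal_zero q).finite
    · exact F.isCompactPowerSum_mark hq s
  succ_compact u := F.isLeafMarking_mark h (u.castLE F.le)
  unmarked_top M hM v hMv hv := by
    obtain ⟨s, rfl⟩ : ∃ s, M = F.mark s := by
      rcases hM with hM | hM | ⟨u, rfl⟩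
      · exact h𝓜 M hM
      · rcases F.eq_mark_of_isLeafMarking h hM with rfl | hs
        · exact v.elim0
        · exact hs
      · exact ⟨u.castLE F.le, rfl⟩
    exact hMv (F.mark_eq_zero_of_isTop hq s hv)

theorem Output.holdsOutput (hq : 2 ≤ q) {F : Family q N (N + m) E X}
    {h : Trie (N + m) (levelDigit q N E X) N 0 start nd C}
    (O : Output q N (N + m) E X start C σ)
    (h𝓜 : ∀ M ∈ Set.range fun k : Fin m => F.mark (k.natAdd N), ∃ s, M = F.mark s) :
    HoldsOutput σ (F.treed hq h h𝓜) (fun k => F.mark (k.natAdd N)) where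
  size := O.nodeCount
  edges i j := O.edges i i.2 j j.2
  markings k i := O.markings k (by omega) i i.2
  nodes i hi := by
    have hi' : i < N := by
      have h0 : i < (List.finRange N).length := hi
      rwa [List.length_finRange] at h0
    have : (F.treed hq h h𝓜).nodes[i] = ⟨i, hi'⟩ := List.getElem_finRange _
    rw [this, O.nodes i hi']
  bits i hi := by
    have hi' : i < N - 1 := by
      have h0 : i < (List.ofFn fun i : Fin (N - 1) => decide (E (i + 1) = E i + 1)).length := hi
      rwa [List.length_ofFn] at h0
    have : (F.treed hq h h𝓜).bits[i] = decide (E (i + 1) = E i + 1) := List.getElem_ofFn _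
    obtain ⟨h1, h2⟩ := O.bits i (by omega)
    rw [this]
    split_ifs with hb
    · exact h1 ⟨by omega, by simpa using hb⟩
    · exact h2 fun hc => hb (by simpa using hc.2)
  treeSize := O.treeSize
  treeRoot := O.treeRoot
  children t a := by
    have ha := Finset.mem_Icc.mp a.2
    rw [O.children t t.2 a (by rw [abs_le]; omega)]
    by_cases hC : C t a = 0
    · have : (F.treed hq h h𝓜).tree.child t a = none := dif_pos hC
      rw [this, if_pos hC]; rfl
    · have : (F.treed hq h h𝓜).tree.child t a = some ⟨C t a, h.child_lt hC⟩ := dif_neg hC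
      rw [this, if_neg hC]; rfl
  levelStart k hk := by
    have : ((F.treed hq h h𝓜).tree.level k).length = start (k + 1) - start k := List.length_ofFn
    have h1 := O.starts (k + 1) (by omega)
    rw [Nat.cast_add, Nat.cast_one] at h1
    rw [this, h1, O.starts k (by omega)]
    have := h.mono (Nat.le_add_right k 1)
    omega
  levels k hk i hi := by
    have hl : ((F.treed hq h h𝓜).tree.level k).length = start (k + 1) - start k := List.length_ofFn
    have : (((F.treed hq h h𝓜).tree.level k)[i] : ℕ) = start k + i :=
      congrArg Fin.val (List.getElem_ofFn _)
    rw [this, O.starts k (by omega), ← Nat.cast_add, O.levels]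
    have := h.start_le (k + 1)
    omega

/-! ## The input -/

theorem Digit.abs_le (a : Digit q) : |(a : ℤ)| ≤ q - 1 := by
  have := Finset.mem_Icc.mp a.2
  rw [_root_.abs_le]
  omega

/-- A matrix of digits, extended by zero. -/
def extendZero {a b : ℕ} (f : Fin a → Fin b → Digit q) (u v : ℕ) : ℤ :=
  if h : u < a ∧ v < b then f ⟨u, h.1⟩ ⟨v, h.2⟩ else 0

theorem extendZero_apply {a b : ℕ} (f : Fin a → Fin b → Digit q) (u : Fin a) (v : Fin b) :
    extendZero f u v = f u v := dif_pos ⟨u.2, v.2⟩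

theorem sum_addr_eq_extendZero {a : ℕ} (f : Fin a → Fin n → Digit q) {u v : ℕ} (hu : u < a)
    (hv : v < n) : (∑ i : Fin a, ∑ j : Fin n, if (u : ℤ) * n + v = (i : ℤ) * n + j then
      (f i j : ℤ) else 0) = extendZero f u v := by
  rw [Finset.sum_eq_single ⟨u, hu⟩, Finset.sum_eq_single ⟨v, hv⟩]
  · simpa using (extendZero_apply f ⟨u, hu⟩ ⟨v, hv⟩).symm
  · intro j _ hj
    refine if_neg fun he => hj (Fin.ext ?_)
    exact (addr_inj hv j.2 he).2.symm
  · simp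
  · intro i _ hi
    refine Finset.sum_eq_zero fun j _ => if_neg fun he => hi (Fin.ext ?_)
    exact (addr_inj hv j.2 he).1.symm
  · simp

/-- The exponents of the values of the nodes. -/
noncomputable def PowerCircuit.exponent (P : PowerCircuit q (Fin n)) (u : ℕ) : ℕ :=
  if h : u < n then (P.proper ⟨u, h⟩).choose else 0

theorem PowerCircuit.nodeVal_eq_pow (P : PowerCircuit q (Fin n)) (u : Fin n) :
    P.nodeVal u = (q : ℝ) ^ P.exponent u := by
  rw [exponent, dif_pos u.2]
  exact (P.proper u).choose_spec

theorem PowerCircuit.markVal_eq {a : ℕ} (P : PowerCircuit q (Fin n))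
    (f : Fin a → Marking q (Fin n)) (u : Fin a) :
    P.markVal (f u) =
      ((∑ v ∈ Finset.range n, extendZero f u v * (q : ℤ) ^ P.exponent v : ℤ) : ℝ) := by
  rw [Finset.sum_range]
  push_cast
  exact Finset.sum_congr rfl fun v _ => by rw [P.nodeVal_eq_pow, extendZero_apply]

/-- The values are real powers, so the equation between exponents comes from the injectivity of `x ↦
q ^ x`. A node outside `S` that is minimal for the well-founded edge relation has all its successors
in `S`. -/
theorem PowerCircuit.input (hq : 2 ≤ q) (P : PowerCircuit q (Fin n)) :
    Input q n (extendZero P.δ) P.exponent where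
  abs u hu v hv := by
    rw [extendZero_apply P.δ ⟨u, hu⟩ ⟨v, hv⟩]
    exact Digit.abs_le _
  val u hu := by
    have h1 := P.nodeVal_eq_pow ⟨u, hu⟩
    have hq1 := one_lt_cast_of_two_le hq
    rw [P.nodeVal_eq, ← Real.rpow_natCast,
      Real.rpow_right_inj (by linarith) hq1.ne'] at h1
    have h2 := P.markVal_eq P.δ ⟨u, hu⟩
    exact_mod_cast h1.symm.trans h2
  min S hS := by
    obtain ⟨u, hu, huS⟩ := Finset.exists_of_ssubset hS
    have hu' := Finset.mem_range.mp hu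
    obtain ⟨w, hw, hmin⟩ := P.wellFounded_edge.has_min {x : Fin n | (x : ℕ) ∉ S} ⟨⟨u, hu'⟩, huS⟩
    refine ⟨w, w.2, hw, fun v hv hd => ?_⟩
    by_contra hvS
    rw [extendZero_apply P.δ w ⟨v, hv⟩] at hd
    exact hmin ⟨v, hv⟩ hvS hd

end PowerCircuits

theorem mainTheorem2 (q : ℕ) (hq : 2 ≤ q) :
    ∃ (MakeTree : PowerCircuits.Program) (C d : ℕ),
      ∀ (n m : ℕ) (P : PowerCircuits.PowerCircuit q (Fin n))
        (M : Fin m → PowerCircuits.Marking q (Fin n)),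
        ∃ (n' : ℕ) (M' : Fin m → PowerCircuits.Marking q (Fin n'))
          (P' : PowerCircuits.TreedCircuit q (Fin n') (Set.range M'))
          (t : ℕ) (σ : PowerCircuits.Store),
          PowerCircuits.Exec ((C : ℤ) * ((n : ℤ) + m + 1) ^ d) MakeTree
            (PowerCircuits.inputStore P.toLabelledDag M) t σ ∧
          PowerCircuits.HoldsOutput σ P' M' ∧
          (∀ k, P'.IsCompact (M' k)) ∧
          (∀ k, P'.markVal (M' k) = P.markVal (M k)) ∧
          n' ≤ 4 * n ∧
          t ≤ C * (n ^ 2 + n * m + 1) := by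
  -- The number of steps dictates the constant; the bound `100 * q * (n + m + 1) ^ 2` for the
  -- integers is then satisfied as well, with exponent `2`.
  refine ⟨PowerCircuits.makeTree q, 10000 * q, 2, fun n m P M => ?_⟩
  obtain ⟨t, σ, hexec, ht, N, E, start, nd, C, hN, F, hT, O⟩ :=
    PowerCircuits.runs_makeTree (w := ((10000 * q : ℕ) : ℤ) * ((n : ℤ) + m + 1) ^ 2)
      (σ := PowerCircuits.inputStore P.toLabelledDag M) (mk := PowerCircuits.extendZero M) hq (P.input hq) rfl rfl
      (fun u hu v hv => PowerCircuits.sum_addr_eq_extendZero P.δ hu hv)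
      (fun u hu v hv => PowerCircuits.sum_addr_eq_extendZero M hu hv)
      (fun u hu v hv => by
        rw [PowerCircuits.extendZero_apply M ⟨u, hu⟩ ⟨v, hv⟩]
        exact PowerCircuits.Digit.abs_le _)
      (fun s hs p => by
        simp only [PowerCircuits.inputStore]
        rw [if_neg (by omega), if_neg (by omega)])
      (by
        push_cast
        have : (0 : ℤ) ≤ q * ((n : ℤ) + m + 1) ^ 2 := by positivity
        nlinarith)
  have h𝓜 : ∀ M' ∈ Set.range fun k : Fin m => F.mark (k.natAdd N), ∃ s, M' = F.mark s := by
    rintro _ ⟨k, rfl⟩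
    exact ⟨_, rfl⟩
  refine ⟨N, _, F.treed hq hT h𝓜, t, σ, hexec, O.holdsOutput hq h𝓜,
    fun k => F.isLeafMarking_mark hT _, fun k => ?_, hN, ht⟩
  refine (F.markVal_mark hq _).trans ?_
  rw [P.markVal_eq M k]
  simp [PowerCircuits.listVal]
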